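/- Let $\mathbb{F}_q$ be a finite field with $q$ elements and let $\mathcal{M}$ be the set of monic polynomials in $\mathbb{F}_q[T]$. Write $|A| = q^{\deg A}$ for $A \neq 0$, let $P$ always denote a prime (a monic irreducible polynomial), and let $\Lambda(A) = \log|P|$ if $A = P^m$ with $m \geq 1$, and $\Lambda(A) = 0$ otherwise. For $R \in \mathcal{M}$ let $\phi^*(R)$ be the number of primitive Dirichlet characters modulo $R$, and let $\sum^*_{\chi \bmod R}$ be the sum over them. For a primitive character $\chi$ modulo $R \neq 1$ let $L(s,\chi)$ be the analytic continuation to $\mathbb{C}$ of $\sum_{A \in \mathcal{M}} \chi(A)|A|^{-s}$ (it is the finite sum over $\deg A < \deg R$), and for integers $X \geq 1$ let $$P_X(s,\chi) = \exp\Big( \sum_{A \in \mathcal{M},\ \deg A \leq X} \frac{\chi(A)\Lambda(A)}{|A|^s \log|A|} \Big)$$ (the term $A=1$ being $0$). For each $X \geq 1$ let $u = u_X$ be a non-negative $C^\infty$ function on $\mathbb{R}$ with support in $[e, e^{1+q^{-X}}]$ and $\int_0^\infty u(x)\,dx = 1$. Put $E_1(y) = \int_0^\infty \frac{e^{-(y+t)}}{y+t}\,dt$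 and $U(z) = \int_0^\infty u(x) E_1(z \log x)\,dx$ for $y, z \neq 0$ with argument different from $\pi$, and let $$Z_X(s,\chi) = \exp\Big( -\sum_{\rho} U\big( (s-\rho)(\log q) X \big) \Big),$$ where $\rho$ runs over all zeros of $L(\cdot,\chi)$ in $\mathbb{C}$, counted with multiplicity; at the points $s$ with $s = \rho$ or $\arg(s-\rho) = \pi$ for some zero $\rho$, $Z_X(s,\chi)$ is the limit of $Z_X(s_0,\chi)$ as $s_0 \to s$ through the other points. Then $Z_X(s,\chi)$ is well defined: for $\chi$ primitive modulo $R \neq 1$ and $X \geq 1$ the sum over zeros converges absolutely at every point $s$ that is not exceptional, the points that are not exceptional are dense in $\mathbb{C}$, and $Z_X(s_0,\chi) \to Z_X(s,\chi)$ as $s_0 \to s$ through them, for every $s \in \mathbb{C}$. For all $X \geq 1$ and all $R \in \mathcal{M}$, $R \neq 1$, with $\phi^*(R) \neq 0$, $$\frac{1}{\phi^*(R)} \sum^*_{\chi \bmod R} \Big| Z_X\Big(\frac12,\chi\Big) \Big|^2 = \frac{1}{\phi^*(R)} \sum^*_{\chi \bmod R} \Big| L\Big(\frac12,\chi\Big)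 P_X\Big(\frac12,\chi\Big)^{-1} \Big|^2 .$$ For fixed $q$, as $X, \deg R \to \infty$ with $X \leq \log_q \deg R$ and $\phi^*(R) \neq 0$, both sides are asymptotic to $$\frac{\deg R}{e^\gamma X} \prod_{\deg P > X,\ P \mid R} \Big( 1 - \frac{1}{|P|} \Big),$$ where $\gamma$ is the Euler–Mascheroni constant. Moreover, in the same regime the second moment splits: $$\frac{1}{\phi^*(R)} \sum^*_{\chi \bmod R} \Big| L\Big(\frac12,\chi\Big) \Big|^2 \sim \Big( \frac{1}{\phi^*(R)} \sum^*_{\chi \bmod R} \Big| P_X\Big(\frac12,\chi\Big) \Big|^2 \Big) \Big( \frac{1}{\phi^*(R)} \sum^*_{\chi \bmod R} \Big| Z_X\Big(\frac12,\chi\Big) \Big|^2 \Big).$$ -/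

import Mathlib

open Filter Topology Asymptotics MeasureTheory Polynomial
open scoped ContDiff

noncomputable section

namespace FqT

/-! Arithmetic of the ring `𝔽_q[T]`, where `𝔽_q = F` and `q = Nat.card F`. -/

/-- The absolute value `|A| = q ^ deg A` for `A ≠ 0`, and `|0| = 0`. -/
def absVal {F : Type*} [Field F] (A : F[X]) : ℝ :=
  open Classical in if A = 0 then 0 else (Nat.card F : ℝ) ^ A.natDegree

theorem finite_monics {F : Type*} [Field F] [Finite F] (n : ℕ) :
    {A : F[X] | A.Monic ∧ A.natDegree = n}.Finite := by
  refine Set.Finite.of_injOn (f := fun (A : F[X]) (i : Fin (n + 1)) => A.coeff i)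
    (t := Set.univ) (fun _ _ => Set.mem_univ _) ?_ Set.finite_univ
  intro A hA B hB h
  ext i
  by_cases hi : i < n + 1
  · exact congrFun h ⟨i, hi⟩
  · rw [coeff_eq_zero_of_natDegree_lt (by have := hA.2; omega),
      coeff_eq_zero_of_natDegree_lt (by have := hB.2; omega)]

/-- The finite set of monic polynomials of degree `n`. -/
def monics (F : Type*) [Field F] [Finite F] (n : ℕ) : Finset F[X] :=
  (finite_monics (F := F) n).toFinset

/-- The finite set of monic polynomials of degree at most `n`. -/
def monicsLE (F : Type*) [Field F] [Finite F] (n : ℕ) : Finset F[X] :=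
  open Classical in (Finset.range (n + 1)).biUnion (monics F)

/-- A prime of `𝔽_q[T]`: a monic irreducible polynomial. -/
def IsPrimePoly {F : Type*} [Field F] (P : F[X]) : Prop := P.Monic ∧ Irreducible P

/-- The von Mangoldt function: `Λ(P ^ m) = log |P|` for `P` prime and `m ≥ 1`, and `Λ(A) = 0`
when `A` is not of this form. -/
def vonMangoldt {F : Type*} [Field F] (A : F[X]) : ℝ :=
  open Classical in
  if h : ∃ P : F[X], IsPrimePoly P ∧ ∃ m : ℕ, 1 ≤ m ∧ A = P ^ m then
    Real.log (absVal h.choose)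
  else 0

/-! Dirichlet characters. -/

/-- Dirichlet characters of modulus `R`: multiplicative characters of `𝔽_q[T] / (R)`,
extended by zero to the classes that are not invertible. -/
abbrev DirChar {F : Type*} [Field F] (R : F[X]) : Type _ :=
  MulChar (F[X] ⧸ Ideal.span {R}) ℂ

/-- The value `χ(A)` at a polynomial `A`. -/
def DirChar.val {F : Type*} [Field F] {R : F[X]} (χ : DirChar R) (A : F[X]) : ℂ :=
  χ (Ideal.Quotient.mk (Ideal.span {R}) A)

/-- `S` is an induced modulus of `χ`: `S` is a monic divisor of `R`, and `χ` agrees with a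
character of modulus `S` on all polynomials coprime to `R` (on the others `χ` is zero). -/
def IsInducedModulus {F : Type*} [Field F] {R : F[X]} (χ : DirChar R) (S : F[X]) : Prop :=
  S.Monic ∧ S ∣ R ∧ ∃ χ₁ : DirChar S, ∀ A : F[X], IsCoprime A R → χ.val A = χ₁.val A

/-- `χ` is primitive: it has no induced modulus of degree smaller than that of its modulus. -/
def IsPrimitive {F : Type*} [Field F] {R : F[X]} (χ : DirChar R) : Prop :=
  ∀ S : F[X], IsInducedModulus χ S → ¬ S.natDegree < R.natDegree

/-- The number of primitive characters of modulus `R`. -/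
def phiStar {F : Type*} [Field F] (R : F[X]) : ℕ :=
  {χ : DirChar R | IsPrimitive χ}.ncard

/-- The average of `f` over the primitive characters of modulus `R`. -/
def primAvg {F : Type*} [Field F] (R : F[X]) (f : DirChar R → ℝ) : ℝ :=
  (1 / (phiStar R : ℝ)) * ∑ᶠ χ ∈ {χ : DirChar R | IsPrimitive χ}, f χ

/-- The Dirichlet `L`-function `L(s, χ) = ∑ χ(A) / |A| ^ s` over monic `A`, summed degree by
degree. For `Re s > 1` this is the (absolutely convergent) Dirichlet series. For nontrivial `χ` the
terms with `n ≥ deg R` vanish, so that the sum is finite for every `s` and is the analytic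
continuation to `ℂ`. -/
def L {F : Type*} [Field F] [Finite F] {R : F[X]} (χ : DirChar R) (s : ℂ) : ℂ :=
  ∑' n : ℕ, ∑ A ∈ monics F n, χ.val A / (absVal A : ℂ) ^ s

/-! The Euler product part and the Hadamard product part of `L(s, χ)`. -/

/-- `P_X(s, χ) = exp (∑ χ(A) Λ(A) / (|A| ^ s log |A|))`, over monic `A` with `deg A ≤ X`.
(The term of `A = 1` is zero, because `Λ(1) = 0`.) -/
def eulerPart {F : Type*} [Field F] [Finite F] {R : F[X]} (X : ℕ) (χ : DirChar R) (s : ℂ) : ℂ :=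
  Complex.exp (∑ A ∈ monicsLE F X,
    χ.val A * (vonMangoldt A : ℂ) / ((absVal A : ℂ) ^ s * (Real.log (absVal A) : ℂ)))

/-- The smooth weights: `u` is a nonnegative smooth function on `ℝ` with support in
`[e, e ^ (1 + q ^ (-X))]` and integral one. -/
structure IsWeight (q X : ℕ) (u : ℝ → ℝ) : Prop where
  smooth : ContDiff ℝ ∞ u
  nonneg : ∀ x, 0 ≤ u x
  support : Function.support u ⊆
    Set.Icc (Real.exp 1) (Real.exp (1 + ((q : ℝ) ^ X)⁻¹))
  integral : ∫ x in Set.Ioi (0 : ℝ), u x = 1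

/-- The exponential integral `E₁(y) = ∫ e ^ (-w) / w dw` along the ray from `y` to `y + ∞`. -/
def expInt (y : ℂ) : ℂ :=
  ∫ t in Set.Ioi (0 : ℝ), Complex.exp (-(y + t)) / (y + t)

/-- `U(z) = ∫₀^∞ u(x) E₁(z log x) dx`. -/
def U (u : ℝ → ℝ) (z : ℂ) : ℂ :=
  ∫ x in Set.Ioi (0 : ℝ), (u x : ℂ) * expInt (z * (Real.log x : ℂ))

/-- The term of the zero `ρ` of `L(·, χ)` in the sum over zeros, which counts multiplicities. -/
def zeroTerm {F : Type*} [Field F] [Finite F] {R : F[X]} (u : ℝ → ℝ) (X : ℕ) (χ : DirChar R)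
    (s ρ : ℂ) : ℂ :=
  (analyticOrderNatAt (L χ) ρ : ℂ) * U u ((s - ρ) * (Real.log (Nat.card F) : ℂ) * (X : ℂ))

/-- The points `s` at which every term of the sum over zeros is defined:
`s ≠ ρ` and `arg (s - ρ) ≠ π` for every zero `ρ` of `L(·, χ)`. -/
def regularPoints {F : Type*} [Field F] [Finite F] {R : F[X]} (χ : DirChar R) : Set ℂ :=
  {s | ∀ ρ : ℂ, L χ ρ = 0 → s ≠ ρ ∧ (s - ρ).arg ≠ Real.pi}

/-- `exp (- ∑_ρ U((s - ρ) (log q) X))`, the sum being over all zeros `ρ` of `L(·, χ)`. -/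
def hadamardExp {F : Type*} [Field F] [Finite F] {R : F[X]} (u : ℝ → ℝ) (X : ℕ) (χ : DirChar R)
    (s : ℂ) : ℂ :=
  Complex.exp (-∑' ρ : {ρ : ℂ // L χ ρ = 0}, zeroTerm u X χ s ρ)

/-- `Z_X(s, χ)`: the exponential above at the points where it is defined, and its limit through
such points elsewhere. -/
def hadamardPart {F : Type*} [Field F] [Finite F] {R : F[X]} (u : ℝ → ℝ) (X : ℕ) (χ : DirChar R)
    (s : ℂ) : ℂ :=
  open Classical in
  if s ∈ regularPoints χ then hadamardExp u X χ s
  else limUnder (𝓝[regularPoints χ] s) (hadamardExp u X χ)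

/-! The asymptotic regime and the main term. -/

/-- The regime `X, deg R → ∞` with `X ≤ log_q (deg R)`, for pairs `(X, R)` with `R` monic and
such that there are primitive characters of modulus `R`. -/
def regime (F : Type*) [Field F] : Filter (ℕ × F[X]) :=
  comap (fun p => p.1) atTop ⊓ comap (fun p => p.2.natDegree) atTop ⊓
    𝓟 {p | p.2.Monic ∧ (p.1 : ℝ) ≤ Real.logb (Nat.card F) p.2.natDegree ∧
      ∃ χ : DirChar p.2, IsPrimitive χ}

/-- The finite set of primes `P` with `P ∣ R` and `deg P > X` (for `R ≠ 0`). -/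
def largePrimeFactors {F : Type*} [Field F] [Finite F] (X : ℕ) (R : F[X]) : Finset F[X] :=
  open Classical in
  (monicsLE F R.natDegree).filter fun P => IsPrimePoly P ∧ P ∣ R ∧ X < P.natDegree

/-- `(deg R / (e ^ γ X)) ∏ (1 - 1 / |P|)`, over primes `P ∣ R` with `deg P > X`. -/
def mainTerm {F : Type*} [Field F] [Finite F] (X : ℕ) (R : F[X]) : ℝ :=
  (R.natDegree : ℝ) / (Real.exp Real.eulerMascheroniConstant * X) *
    ∏ P ∈ largePrimeFactors X R, (1 - 1 / absVal P)

end FqT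

end

open Filter Topology Asymptotics MeasureTheory Polynomial
open scoped ContDiff

noncomputable section

namespace FqT

variable {F : Type*} [Field F] [Finite F]

lemma mem_monics {n : ℕ} {A : F[X]} : A ∈ monics F n ↔ A.Monic ∧ A.natDegree = n := by
  simp [monics]

lemma mem_monicsLE {n : ℕ} {A : F[X]} : A ∈ monicsLE F n ↔ A.Monic ∧ A.natDegree ≤ n := by
  classical
  simp only [monicsLE, Finset.mem_biUnion, Finset.mem_range, mem_monics]
  constructor
  · rintro ⟨m, hm, h1, h2⟩
    exact ⟨h1, by omega⟩
  · rintro ⟨h1, h2⟩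
    exact ⟨_, by omega, h1, rfl⟩

lemma sum_monicsLE {M : Type*} [AddCommMonoid M] (n : ℕ) (f : F[X] → M) :
    ∑ A ∈ monicsLE F n, f A = ∑ m ∈ Finset.range (n + 1), ∑ A ∈ monics F m, f A := by
  classical
  rw [monicsLE, Finset.sum_biUnion]
  · intro a _ b _ hab
    refine Finset.disjoint_left.2 fun A hA hB => hab ?_
    rw [← (mem_monics.1 hA).2, ← (mem_monics.1 hB).2]

lemma card_monics (n : ℕ) : (monics F n).card = Nat.card F ^ n := by
  classical
  have := Fintype.ofFinite F
  have h1 : Nat.card {p : F[X] // p.Monic ∧ p.natDegree = n} = Nat.card (degreeLT F n) :=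
    Nat.card_congr (Polynomial.monicEquivDegreeLT n)
  rw [Nat.card_congr (degreeLTEquiv F n).toEquiv] at h1
  rw [monics, ← Nat.card_eq_card_finite_toFinset]
  have : Nat.card {A : F[X] | A.Monic ∧ A.natDegree = n} = Nat.card (Fin n → F) := h1
  rw [this]
  simp

lemma monics_zero : monics F 0 = {1} := by
  ext A
  rw [mem_monics, Finset.mem_singleton]
  constructor
  · rintro ⟨h1, h2⟩
    exact h1.natDegree_eq_zero.1 h2
  · rintro rfl
    simp [monic_one]

lemma one_lt_card : 1 < Nat.card F := Finite.one_lt_card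

lemma two_le_card : (2 : ℝ) ≤ (Nat.card F : ℝ) := by exact_mod_cast one_lt_card (F := F)

lemma absVal_monic {A : F[X]} (hA : A.Monic) : absVal A = (Nat.card F : ℝ) ^ A.natDegree := by
  simp [absVal, hA.ne_zero]

lemma log_card_pos : 0 < Real.log (Nat.card F : ℝ) :=
  Real.log_pos (by exact_mod_cast one_lt_card (F := F))

/-- The pairs of monic polynomials with product `D`. -/
def dpairs (D : F[X]) : Finset (F[X] × F[X]) :=
  open Classical in
  (monicsLE F D.natDegree ×ˢ monicsLE F D.natDegree).filter fun p => p.1 * p.2 = D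

lemma mem_dpairs {D : F[X]} {p : F[X] × F[X]} :
    p ∈ dpairs D ↔ p.1.Monic ∧ p.2.Monic ∧ p.1 * p.2 = D := by
  simp only [dpairs, Finset.mem_filter, Finset.mem_product, mem_monicsLE]
  constructor
  · rintro ⟨⟨⟨h1, _⟩, ⟨h2, _⟩⟩, h3⟩
    exact ⟨h1, h2, h3⟩
  · rintro ⟨h1, h2, rfl⟩
    rw [h1.natDegree_mul h2]
    refine ⟨⟨⟨h1, by omega⟩, ⟨h2, by omega⟩⟩, rfl⟩

lemma natDegree_of_mem_dpairs {D : F[X]} {p : F[X] × F[X]} (hp : p ∈ dpairs D) :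
    p.1.natDegree + p.2.natDegree = D.natDegree := by
  obtain ⟨h1, h2, rfl⟩ := mem_dpairs.1 hp
  rw [h1.natDegree_mul h2]

lemma sum_dpairs_swap {M : Type*} [AddCommMonoid M] (D : F[X]) (f : F[X] × F[X] → M) :
    ∑ p ∈ dpairs D, f p = ∑ p ∈ dpairs D, f p.swap := by
  refine Finset.sum_nbij' Prod.swap Prod.swap ?_ ?_ ?_ ?_ ?_
  · rintro p hp
    obtain ⟨h1, h2, h3⟩ := mem_dpairs.1 hp
    exact mem_dpairs.2 ⟨h2, h1, by rw [← h3, mul_comm]; rfl⟩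
  · rintro p hp
    obtain ⟨h1, h2, h3⟩ := mem_dpairs.1 hp
    exact mem_dpairs.2 ⟨h2, h1, by rw [← h3, mul_comm]; rfl⟩
  · simp
  · simp
  · simp

lemma sum_dpairs_assoc {M : Type*} [AddCommMonoid M] (D : F[X])
    (f : F[X] → F[X] → F[X] → M) :
    ∑ p ∈ dpairs D, ∑ r ∈ dpairs p.1, f r.1 r.2 p.2 =
      ∑ p ∈ dpairs D, ∑ r ∈ dpairs p.2, f p.1 r.1 r.2 := by
  rw [Finset.sum_sigma', Finset.sum_sigma']
  refine Finset.sum_nbij' (fun x => ⟨(x.2.1, x.2.2 * x.1.2), (x.2.2, x.1.2)⟩)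
    (fun x => ⟨(x.1.1 * x.2.1, x.2.2), (x.1.1, x.2.1)⟩) ?_ ?_ ?_ ?_ ?_
  · rintro ⟨⟨a, b⟩, ⟨c, d⟩⟩ h
    simp only [Finset.mem_sigma, mem_dpairs] at h ⊢
    obtain ⟨⟨h1, h2, h3⟩, h4, h5, h6⟩ := h
    exact ⟨⟨h4, h5.mul h2, by rw [← h3, ← h6, mul_assoc]⟩, h5, h2, trivial⟩
  · rintro ⟨⟨a, b⟩, ⟨c, d⟩⟩ h
    simp only [Finset.mem_sigma, mem_dpairs] at h ⊢
    obtain ⟨⟨h1, h2, h3⟩, h4, h5, h6⟩ := h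
    exact ⟨⟨h1.mul h4, h5, by rw [← h3, ← h6, mul_assoc]⟩, h1, h4, trivial⟩
  · rintro ⟨⟨a, b⟩, ⟨c, d⟩⟩ h
    simp only [Finset.mem_sigma, mem_dpairs] at h ⊢
    obtain ⟨⟨h1, h2, h3⟩, h4, h5, h6⟩ := h
    simp [h6]
  · rintro ⟨⟨a, b⟩, ⟨c, d⟩⟩ h
    simp only [Finset.mem_sigma, mem_dpairs] at h ⊢
    obtain ⟨⟨h1, h2, h3⟩, h4, h5, h6⟩ := h
    simp [h6]
  · rintro ⟨⟨a, b⟩, ⟨c, d⟩⟩ h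
    rfl

lemma sum_monics_dpairs {M : Type*} [AddCommMonoid M] (n : ℕ) (f : F[X] → F[X] → M) :
    ∑ D ∈ monics F n, ∑ p ∈ dpairs D, f p.1 p.2 =
      ∑ ij ∈ Finset.HasAntidiagonal.antidiagonal n, ∑ A ∈ monics F ij.1, ∑ B ∈ monics F ij.2, f A B := by
  simp_rw [← Finset.sum_product']
  rw [Finset.sum_sigma', Finset.sum_sigma']
  refine Finset.sum_nbij' (fun x => ⟨(x.2.1.natDegree, x.2.2.natDegree), x.2⟩)
    (fun x => ⟨x.2.1 * x.2.2, x.2⟩) ?_ ?_ ?_ ?_ ?_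
  · rintro ⟨D, A, B⟩ h
    simp only [Finset.mem_sigma, mem_dpairs, mem_monics, Finset.HasAntidiagonal.mem_antidiagonal,
      Finset.mem_product] at h ⊢
    obtain ⟨⟨h1, h2⟩, h4, h5, h6⟩ := h
    exact ⟨by rw [← h2, ← h6, h4.natDegree_mul h5], ⟨h4, trivial⟩, h5, trivial⟩
  · rintro ⟨⟨i, j⟩, A, B⟩ h
    simp only [Finset.mem_sigma, mem_dpairs, mem_monics, Finset.HasAntidiagonal.mem_antidiagonal,
      Finset.mem_product] at h ⊢
    obtain ⟨h1, ⟨h4, rfl⟩, h5, rfl⟩ := h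
    exact ⟨⟨h4.mul h5, by rw [← h1, h4.natDegree_mul h5]⟩, h4, h5, trivial⟩
  · rintro ⟨D, A, B⟩ h
    simp only [Finset.mem_sigma, mem_dpairs] at h
    simp [h.2.2.2]
  · rintro ⟨⟨i, j⟩, A, B⟩ h
    simp only [Finset.mem_sigma, mem_monics, Finset.mem_product] at h
    simp [h.2.1.2, h.2.2.2]
  · rintro ⟨D, A, B⟩ h
    rfl

lemma IsPrimePoly.prime {P : F[X]} (h : IsPrimePoly P) : Prime P := h.2.prime

lemma IsPrimePoly.natDegree_pos {P : F[X]} (h : IsPrimePoly P) : 0 < P.natDegree :=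
  h.2.natDegree_pos

lemma IsPrimePoly.eq_of_dvd {P Q : F[X]} (hP : IsPrimePoly P) (hQ : IsPrimePoly Q) (h : P ∣ Q) :
    P = Q :=
  eq_of_monic_of_associated hP.1 hQ.1 (hP.2.associated_of_dvd hQ.2 h)

lemma exists_isPrimePoly_dvd {A : F[X]} (hA : A.Monic) (h1 : A ≠ 1) :
    ∃ P, IsPrimePoly P ∧ P ∣ A := by
  obtain ⟨P, hP, hd⟩ := Polynomial.exists_monic_irreducible_factor A
    (fun h => h1 (hA.eq_one_of_isUnit h))
  exact ⟨P, ⟨hP, hd.1⟩, hd.2⟩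

/-- The von Mangoldt function in units of `log q`. -/
def vm (A : F[X]) : ℝ := vonMangoldt A / Real.log (Nat.card F)

lemma vm_prime_pow {P : F[X]} (hP : IsPrimePoly P) {m : ℕ} (hm : 1 ≤ m) :
    vm (P ^ m) = P.natDegree := by
  have h : ∃ P' : F[X], IsPrimePoly P' ∧ ∃ m' : ℕ, 1 ≤ m' ∧ P ^ m = P' ^ m' := ⟨P, hP, m, hm, rfl⟩
  rw [vm, vonMangoldt, dif_pos h]
  obtain ⟨h1, m', h2, h3⟩ := h.choose_spec
  have : P = h.choose := by
    refine hP.eq_of_dvd h1 (hP.prime.dvd_of_dvd_pow (n := m') ?_)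
    rw [← h3]
    exact dvd_pow_self _ (by omega)
  rw [← this, absVal_monic hP.1, Real.log_pow, mul_div_assoc, div_self log_card_pos.ne', mul_one]

lemma exists_of_vm_ne_zero {A : F[X]} (h : vm A ≠ 0) :
    ∃ P : F[X], IsPrimePoly P ∧ ∃ m : ℕ, 1 ≤ m ∧ A = P ^ m := by
  by_contra h'
  exact h (by rw [vm, vonMangoldt, dif_neg h', zero_div])

lemma vm_nonneg (A : F[X]) : 0 ≤ vm A := by
  by_cases h : vm A = 0
  · exact h.ge
  · obtain ⟨P, hP, m, hm, rfl⟩ := exists_of_vm_ne_zero h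
    rw [vm_prime_pow hP hm]
    positivity

lemma vm_one : vm (1 : F[X]) = 0 := by
  by_contra h
  obtain ⟨P, hP, m, hm, h⟩ := exists_of_vm_ne_zero h
  exact hP.2.not_isUnit (isUnit_of_dvd_one (h ▸ dvd_pow_self _ (by omega)))

lemma vonMangoldt_eq (A : F[X]) : vonMangoldt A = vm A * Real.log (Nat.card F) := by
  rw [vm, div_mul_cancel₀ _ log_card_pos.ne']

lemma sum_dpairs_vm {D : F[X]} (hD : D.Monic) : ∑ p ∈ dpairs D, vm p.1 = D.natDegree := by
  classical
  set s := UniqueFactorizationMonoid.normalizedFactors D with hs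
  have hfac : ∀ P ∈ s, IsPrimePoly P := fun P hP =>
    ⟨by
      have h := UniqueFactorizationMonoid.normalize_normalized_factor P hP
      rw [← h]
      exact Polynomial.monic_normalize (UniqueFactorizationMonoid.irreducible_of_normalized_factor
        P hP).ne_zero, UniqueFactorizationMonoid.irreducible_of_normalized_factor P hP⟩
  have hprod : s.prod = D := by
    have hm : s.prod.Monic := by
      have := monic_multiset_prod_of_monic s id fun P hP => (hfac P hP).1
      rwa [Multiset.map_id] at this
    exact eq_of_monic_of_associated hm hD
      (UniqueFactorizationMonoid.prod_normalizedFactors hD.ne_zero)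
  have hdeg : D.natDegree = ∑ P ∈ s.toFinset, ∑ k ∈ Finset.Icc 1 (s.count P), P.natDegree := by
    conv_lhs => rw [← hprod]
    rw [natDegree_multiset_prod_of_monic _ (fun P hP => (hfac P hP).1),
      Finset.sum_multiset_map_count]
    refine Finset.sum_congr rfl fun P _ => ?_
    simp
  rw [hdeg]
  push_cast
  rw [Finset.sum_sigma', ← Finset.sum_filter_ne_zero]
  symm
  refine Finset.sum_bij (fun x _ => (x.1 ^ x.2, D /ₘ (x.1 ^ x.2))) ?_ ?_ ?_ ?_
  · rintro ⟨P, k⟩ h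
    simp only [Finset.mem_sigma, Multiset.mem_toFinset, Finset.mem_Icc] at h
    have hP := hfac P h.1
    have hdvd : P ^ k ∣ D := by
      rw [← hprod]
      have h1 := Multiset.prod_dvd_prod_of_le (Multiset.le_count_iff_replicate_le.1 h.2.2)
      rwa [Multiset.prod_replicate] at h1
    obtain ⟨B, hB⟩ := hdvd
    have hBm : B.Monic := (hP.1.pow k).of_mul_monic_left (hB ▸ hD)
    have h2 : D /ₘ (P ^ k) = B := by
      rw [hB]; exact Polynomial.mul_divByMonic_cancel_left _ (hP.1.pow k)
    simp only [Finset.mem_filter, mem_dpairs, h2]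
    refine ⟨⟨hP.1.pow k, hBm, hB.symm⟩, ?_⟩
    rw [vm_prime_pow hP h.2.1]
    exact_mod_cast hP.natDegree_pos.ne'
  · rintro ⟨P, k⟩ h ⟨Q, l⟩ h' he
    simp only [Finset.mem_sigma, Multiset.mem_toFinset, Finset.mem_Icc] at h h'
    have hP := hfac P h.1
    have hQ := hfac Q h'.1
    simp only [Prod.mk.injEq] at he
    have hPQ : P = Q := hP.eq_of_dvd hQ (hP.prime.dvd_of_dvd_pow (n := l)
      (he.1 ▸ dvd_pow_self _ (by omega)))
    subst hPQ
    have : k = l := by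
      have := congrArg natDegree he.1
      rw [natDegree_pow, natDegree_pow] at this
      exact Nat.eq_of_mul_eq_mul_right hP.natDegree_pos this
    subst this
    rfl
  · rintro ⟨A, B⟩ h
    simp only [Finset.mem_filter, mem_dpairs] at h
    obtain ⟨⟨hA, hB, hAB⟩, hv⟩ := h
    obtain ⟨P, hP, m, hm, rfl⟩ := exists_of_vm_ne_zero hv
    have hPn : normalize P = P := hP.1.normalize_eq_self
    have hle : m ≤ s.count P := by
      have h1 := (UniqueFactorizationMonoid.dvd_iff_normalizedFactors_le_normalizedFactors
        (pow_ne_zero m hP.2.ne_zero) hD.ne_zero).1 ⟨B, hAB.symm⟩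
      rw [UniqueFactorizationMonoid.normalizedFactors_pow,
        UniqueFactorizationMonoid.normalizedFactors_irreducible hP.2, hPn] at h1
      have := Multiset.le_iff_count.1 h1 P
      simpa using this
    refine ⟨⟨P, m⟩, ?_, ?_⟩
    · simp only [Finset.mem_sigma, Multiset.mem_toFinset, Finset.mem_Icc]
      exact ⟨Multiset.count_pos.1 (by omega), hm, hle⟩
    · simp only [Prod.mk.injEq, true_and]
      rw [← hAB]; exact Polynomial.mul_divByMonic_cancel_left _ (hP.1.pow m)
  · rintro ⟨P, k⟩ h
    simp only [Finset.mem_sigma, Multiset.mem_toFinset, Finset.mem_Icc] at h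
    exact (vm_prime_pow (hfac P h.1) h.2.1).symm

/-- `∑ Λ(A) = q ^ n` over monic `A` of degree `n`. -/
lemma sum_monics_vm {n : ℕ} (hn : 1 ≤ n) :
    ∑ A ∈ monics F n, vm A = (Nat.card F : ℝ) ^ n := by
  induction n using Nat.strong_induction_on with
  | _ n ih =>
    have h1 : ∑ D ∈ monics F n, ∑ p ∈ dpairs D, vm p.1 = n * (Nat.card F : ℝ) ^ n := by
      rw [Finset.sum_congr rfl (fun D hD => sum_dpairs_vm (mem_monics.1 hD).1),
        Finset.sum_congr rfl (g := fun _ => (n : ℝ)) (fun D hD => by rw [(mem_monics.1 hD).2])]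
      simp [card_monics, mul_comm]
    rw [sum_monics_dpairs n (fun A _ => vm A)] at h1
    simp only [Finset.sum_const, card_monics, nsmul_eq_mul, ← Finset.mul_sum] at h1
    rw [Finset.Nat.sum_antidiagonal_eq_sum_range_succ
      (fun i j => ((Nat.card F ^ j : ℕ) : ℝ) * ∑ A ∈ monics F i, vm A),
      Finset.sum_range_succ] at h1
    obtain ⟨k, rfl⟩ : ∃ k, n = k + 1 := ⟨n - 1, by omega⟩
    rw [Finset.sum_range_succ'] at h1
    have h2 : ∑ x ∈ Finset.range k, ((Nat.card F ^ (k + 1 - (x + 1)) : ℕ) : ℝ) *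
        ∑ A ∈ monics F (x + 1), vm A = ∑ x ∈ Finset.range k, (Nat.card F : ℝ) ^ (k + 1) := by
      refine Finset.sum_congr rfl fun x hx => ?_
      rw [Finset.mem_range] at hx
      rw [ih (x + 1) (by omega) (by omega)]
      push_cast
      rw [← pow_add]
      congr 1
      omega
    rw [h2] at h1
    simp only [monics_zero, Finset.sum_singleton, vm_one, Finset.sum_const, Finset.card_range,
      nsmul_eq_mul, tsub_self, pow_zero, Nat.cast_one, one_mul, mul_zero, add_zero] at h1
    push_cast at h1 ⊢
    linarith

/-- Dirichlet convolution on monic polynomials. -/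
def conv (f g : F[X] → ℝ) (D : F[X]) : ℝ := ∑ p ∈ dpairs D, f p.1 * g p.2

lemma conv_comm (f g : F[X] → ℝ) (D : F[X]) : conv f g D = conv g f D := by
  rw [conv, sum_dpairs_swap]
  exact Finset.sum_congr rfl fun p _ => mul_comm _ _

lemma conv_assoc (f g h : F[X] → ℝ) (D : F[X]) :
    conv (conv f g) h D = conv f (conv g h) D := by
  have := sum_dpairs_assoc D (fun a b c => f a * g b * h c)
  simp only [conv, Finset.sum_mul, Finset.mul_sum, ← mul_assoc] at this ⊢
  exact this

/-- The solution of `deg D * f D = ∑ λ(A) f(B)` over `A * B = D` with `f 1 = 1`, i.e. the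
coefficients of the exponential of the Dirichlet series `∑ λ(A) / (deg A |A| ^ s)`. -/
def expConv (l : F[X] → ℝ) (D : F[X]) : ℝ :=
  if D.natDegree = 0 then 1 else
    (1 / (D.natDegree : ℝ)) * ∑ p ∈ (dpairs D).attach,
      if h : p.1.2.natDegree < D.natDegree then l p.1.1 * expConv l p.1.2 else 0
termination_by D.natDegree

lemma expConv_one (l : F[X] → ℝ) : expConv l (1 : F[X]) = 1 := by
  rw [expConv]; simp

lemma eq_one_of_mem_dpairs {D : F[X]} {p : F[X] × F[X]} (hp : p ∈ dpairs D)
    (h : ¬ p.2.natDegree < D.natDegree) : p.1 = 1 := by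
  have h1 := natDegree_of_mem_dpairs hp
  exact (mem_dpairs.1 hp).1.natDegree_eq_zero.1 (by omega)

lemma expConv_rec {l : F[X] → ℝ} (hl : l 1 = 0) {D : F[X]} (hD : D.Monic) :
    D.natDegree * expConv l D = conv l (expConv l) D := by
  by_cases h0 : D.natDegree = 0
  · have h1 := hD.natDegree_eq_zero.1 h0
    subst h1
    rw [conv]
    simp only [natDegree_one, Nat.cast_zero, zero_mul]
    symm
    refine Finset.sum_eq_zero fun p hp => ?_
    rw [eq_one_of_mem_dpairs hp (by simp), hl, zero_mul]
  · rw [expConv, if_neg h0, ← mul_assoc, mul_one_div_cancel (by exact_mod_cast h0), one_mul, conv,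
      ← Finset.sum_attach (dpairs D)]
    refine Finset.sum_congr rfl fun p _ => ?_
    split_ifs with h
    · rfl
    · rw [eq_one_of_mem_dpairs p.2 h, hl, zero_mul]

lemma conv_congr_right {l f g : F[X] → ℝ} (hl : l 1 = 0) {D : F[X]}
    (h : ∀ p ∈ dpairs D, p.2.natDegree < D.natDegree → l p.1 ≠ 0 → f p.2 = g p.2) :
    conv l f D = conv l g D := by
  refine Finset.sum_congr rfl fun p hp => ?_
  by_cases h0 : l p.1 = 0
  · simp [h0]
  by_cases h1 : p.2.natDegree < D.natDegree
  · rw [h p hp h1 h0]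
  · exact absurd (by rw [eq_one_of_mem_dpairs hp h1, hl]) h0

lemma eq_expConv {l g : F[X] → ℝ} (hl : l 1 = 0) (h1 : g 1 = 1)
    (h : ∀ D : F[X], D.Monic → D.natDegree * g D = conv l g D) {D : F[X]} (hD : D.Monic) :
    g D = expConv l D := by
  induction hn : D.natDegree using Nat.strong_induction_on generalizing D with
  | _ n ih =>
    by_cases h0 : D.natDegree = 0
    · rw [hD.natDegree_eq_zero.1 h0, h1, expConv_one]
    · have h2 : (D.natDegree : ℝ) * g D = D.natDegree * expConv l D := by
        rw [h D hD, expConv_rec hl hD]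
        refine conv_congr_right hl fun p hp hlt _ => ?_
        exact ih _ (hn ▸ hlt) (mem_dpairs.1 hp).2.1 rfl
      exact mul_left_cancel₀ (by exact_mod_cast h0) h2

lemma degree_conv (f g : F[X] → ℝ) (D : F[X]) :
    D.natDegree * conv f g D =
      conv (fun A => A.natDegree * f A) g D + conv f (fun A => A.natDegree * g A) D := by
  simp only [conv]
  rw [Finset.mul_sum, ← Finset.sum_add_distrib]
  refine Finset.sum_congr rfl fun p hp => ?_
  rw [← natDegree_of_mem_dpairs hp]
  push_cast
  ring

lemma conv_congr {f g f' g' : F[X] → ℝ} {D : F[X]} (hf : ∀ A : F[X], A.Monic → f A = f' A)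
    (hg : ∀ A : F[X], A.Monic → g A = g' A) : conv f g D = conv f' g' D :=
  Finset.sum_congr rfl fun p hp => by
    rw [hf _ (mem_dpairs.1 hp).1, hg _ (mem_dpairs.1 hp).2.1]

lemma dpairs_one : dpairs (1 : F[X]) = {(1, 1)} := by
  ext p
  rw [Finset.mem_singleton]
  constructor
  · intro hp
    have h1 := natDegree_of_mem_dpairs hp
    rw [natDegree_one] at h1
    exact Prod.ext ((mem_dpairs.1 hp).1.natDegree_eq_zero.1 (by omega))
      ((mem_dpairs.1 hp).2.1.natDegree_eq_zero.1 (by omega))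
  · rintro rfl
    simp [mem_dpairs, monic_one]

lemma conv_expConv {l m : F[X] → ℝ} (hl : l 1 = 0) (hm : m 1 = 0) {D : F[X]} (hD : D.Monic) :
    conv (expConv l) (expConv m) D = expConv (fun A => l A + m A) D := by
  refine eq_expConv (g := conv (expConv l) (expConv m)) (by simp [hl, hm]) ?_ ?_ hD
  · simp [conv, dpairs_one, expConv_one]
  · intro D hD
    have h1 : conv (fun A => l A + m A) (conv (expConv l) (expConv m)) D =
        conv l (conv (expConv l) (expConv m)) D + conv m (conv (expConv l) (expConv m)) D := by
      simp only [conv, add_mul, Finset.sum_add_distrib]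
    rw [degree_conv, h1, ← conv_assoc, ← conv_assoc m, conv_congr (g' := expConv m)
      (fun A hA => expConv_rec hl hA) fun _ _ => rfl]
    congr 1
    rw [conv_congr (f := conv m (expConv l)) (f' := conv (expConv l) m) (g' := expConv m)
      (fun A _ => conv_comm _ _ _) (fun _ _ => rfl), conv_assoc]
    exact conv_congr (fun _ _ => rfl) fun A hA => expConv_rec hm hA

lemma expConv_vm {D : F[X]} (hD : D.Monic) : expConv vm D = 1 := by
  refine (eq_expConv (g := fun _ => 1) vm_one rfl ?_ hD).symm
  intro D hD
  simp only [conv, mul_one]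
  rw [sum_dpairs_vm hD]

lemma abs_expConv_le {l m : F[X] → ℝ} (hm : m 1 = 0) (h : ∀ A, |l A| ≤ m A) {D : F[X]}
    (hD : D.Monic) : |expConv l D| ≤ expConv m D := by
  have hl : l 1 = 0 := by
    have := h 1
    rw [hm] at this
    exact abs_eq_zero.1 (le_antisymm this (abs_nonneg _))
  induction hn : D.natDegree using Nat.strong_induction_on generalizing D with
  | _ n ih =>
    by_cases h0 : D.natDegree = 0
    · rw [hD.natDegree_eq_zero.1 h0, expConv_one, expConv_one, abs_one]
    · have hpos : (0 : ℝ) < D.natDegree := by exact_mod_cast Nat.pos_of_ne_zero h0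
      refine le_of_mul_le_mul_left ?_ hpos
      rw [← abs_of_pos hpos, ← abs_mul, abs_of_pos hpos, expConv_rec hl hD, expConv_rec hm hD]
      refine (Finset.abs_sum_le_sum_abs _ _).trans (Finset.sum_le_sum fun p hp => ?_)
      rw [abs_mul]
      by_cases h1 : p.2.natDegree < D.natDegree
      · exact mul_le_mul (h _) (ih _ (hn ▸ h1) (mem_dpairs.1 hp).2.1 rfl) (abs_nonneg _)
          ((abs_nonneg _).trans (h _))
      · rw [eq_one_of_mem_dpairs hp h1, hl, hm]; simp

lemma expConv_congr_of_dvd {l m : F[X] → ℝ} (hl : l 1 = 0) {D : F[X]} (hD : D.Monic)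
    (h : ∀ A : F[X], A.Monic → A ∣ D → l A = m A) : expConv l D = expConv m D := by
  have hm : m 1 = 0 := by rw [← h 1 monic_one (one_dvd _), hl]
  induction hn : D.natDegree using Nat.strong_induction_on generalizing D with
  | _ n ih =>
    by_cases h0 : D.natDegree = 0
    · rw [hD.natDegree_eq_zero.1 h0, expConv_one, expConv_one]
    · refine mul_left_cancel₀ (a := (D.natDegree : ℝ)) (by exact_mod_cast h0) ?_
      rw [expConv_rec hl hD, expConv_rec hm hD]
      refine Finset.sum_congr rfl fun p hp => ?_
      obtain ⟨hp1, hp2, hp3⟩ := mem_dpairs.1 hp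
      rw [← h p.1 hp1 ⟨_, hp3.symm⟩]
      by_cases h1 : p.2.natDegree < D.natDegree
      · rw [ih _ (hn ▸ h1) hp2 (fun A hA hAD => h A hA (hAD.trans ⟨p.1, by rw [← hp3, mul_comm]⟩))
          rfl]
      · rw [eq_one_of_mem_dpairs hp h1, hl]; simp

/-- `Λ`, in units of `log q`, on polynomials of degree at most `n`. -/
def vmLE (n : ℕ) (A : F[X]) : ℝ := if A.natDegree ≤ n then vm A else 0

/-- `Λ`, in units of `log q`, on polynomials of degree greater than `n`. -/
def vmGT (n : ℕ) (A : F[X]) : ℝ := if A.natDegree ≤ n then 0 else vm A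

/-- The coefficients of the Dirichlet series of `P_X`. -/
def eulerCoeff (n : ℕ) : F[X] → ℝ := expConv (vmLE n)

/-- The coefficients of the Dirichlet series of `1 / P_X`. -/
def invCoeff (n : ℕ) : F[X] → ℝ := expConv (fun A => -vmLE n A)

/-- The coefficients of the Dirichlet series of `L / P_X`. -/
def hadCoeff (n : ℕ) : F[X] → ℝ := expConv (vmGT n)

lemma vmLE_one (n : ℕ) : vmLE n (1 : F[X]) = 0 := by simp [vmLE, vm_one]
lemma vmGT_one (n : ℕ) : vmGT n (1 : F[X]) = 0 := by simp [vmGT]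

lemma vmLE_nonneg (n : ℕ) (A : F[X]) : 0 ≤ vmLE n A := by
  rw [vmLE]; split_ifs <;> simp [vm_nonneg]

lemma vmGT_nonneg (n : ℕ) (A : F[X]) : 0 ≤ vmGT n A := by
  rw [vmGT]; split_ifs <;> simp [vm_nonneg]

lemma expConv_nonneg {l : F[X] → ℝ} (hl : l 1 = 0) (h : ∀ A, 0 ≤ l A) {D : F[X]}
    (hD : D.Monic) : 0 ≤ expConv l D :=
  (abs_nonneg _).trans (abs_expConv_le (l := l) hl (fun A => (abs_of_nonneg (h A)).le) hD)

lemma eulerCoeff_nonneg (n : ℕ) {D : F[X]} (hD : D.Monic) : 0 ≤ eulerCoeff n D :=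
  expConv_nonneg (vmLE_one n) (vmLE_nonneg n) hD

lemma hadCoeff_nonneg (n : ℕ) {D : F[X]} (hD : D.Monic) : 0 ≤ hadCoeff n D :=
  expConv_nonneg (vmGT_one n) (vmGT_nonneg n) hD

lemma eulerCoeff_le_one (n : ℕ) {D : F[X]} (hD : D.Monic) : eulerCoeff n D ≤ 1 := by
  refine (le_abs_self _).trans ((abs_expConv_le (m := vm) vm_one (fun A => ?_) hD).trans
    (expConv_vm hD).le)
  rw [abs_of_nonneg (vmLE_nonneg n A), vmLE]
  split_ifs <;> simp [vm_nonneg]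

lemma hadCoeff_le_one (n : ℕ) {D : F[X]} (hD : D.Monic) : hadCoeff n D ≤ 1 := by
  refine (le_abs_self _).trans ((abs_expConv_le (m := vm) vm_one (fun A => ?_) hD).trans
    (expConv_vm hD).le)
  rw [abs_of_nonneg (vmGT_nonneg n A), vmGT]
  split_ifs <;> simp [vm_nonneg]

lemma abs_invCoeff_le (n : ℕ) {D : F[X]} (hD : D.Monic) : |invCoeff n D| ≤ eulerCoeff n D :=
  abs_expConv_le (vmLE_one n) (fun A => by rw [abs_neg, abs_of_nonneg (vmLE_nonneg n A)]) hD

lemma conv_one_invCoeff (n : ℕ) {D : F[X]} (hD : D.Monic) :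
    conv (fun _ => 1) (invCoeff n) D = hadCoeff n D := by
  rw [conv_congr (f' := expConv vm) (g' := invCoeff n) (fun A hA => (expConv_vm hA).symm)
    fun _ _ => rfl, invCoeff, conv_expConv vm_one (by simp [vmLE_one]) hD, hadCoeff]
  congr 1
  ext A
  rw [vmLE, vmGT]
  split_ifs <;> simp

/-- All prime factors have degree at most `n`. -/
def IsSmooth (n : ℕ) (D : F[X]) : Prop := ∀ P, IsPrimePoly P → P ∣ D → P.natDegree ≤ n

/-- All prime factors have degree greater than `n`. -/
def IsRough (n : ℕ) (D : F[X]) : Prop := ∀ P, IsPrimePoly P → P ∣ D → n < P.natDegree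

/-- A prime of degree at most `n` divides `D` to a power of degree greater than `n`. -/
def HasHighPower (n : ℕ) (D : F[X]) : Prop :=
  ∃ P, IsPrimePoly P ∧ P.natDegree ≤ n ∧ P ^ (n / P.natDegree + 1) ∣ D

lemma lt_mul_div_succ_natDegree {P : F[X]} (hP : IsPrimePoly P) {n k : ℕ} :
    n < k * P.natDegree ↔ n / P.natDegree + 1 ≤ k := by
  rw [Nat.succ_le_iff, Nat.div_lt_iff_lt_mul hP.natDegree_pos]

lemma isSmooth_of_eulerCoeff_ne_zero {n : ℕ} {D : F[X]} (hD : D.Monic)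
    (h : eulerCoeff n D ≠ 0) : IsSmooth n D := by
  induction hn : D.natDegree using Nat.strong_induction_on generalizing D with
  | _ k ih =>
    intro P hP hPD
    by_contra hlt
    by_cases h0 : D.natDegree = 0
    · rw [hD.natDegree_eq_zero.1 h0] at hPD
      exact hP.2.not_isUnit (isUnit_of_dvd_one hPD)
    apply h
    refine (mul_eq_zero_iff_left (a := (D.natDegree : ℝ)) (by exact_mod_cast h0)).1 ?_
    rw [eulerCoeff, expConv_rec (vmLE_one n) hD]
    refine Finset.sum_eq_zero fun p hp => ?_
    by_contra hne
    obtain ⟨h1, h2⟩ := mul_ne_zero_iff.1 hne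
    obtain ⟨hp1, hp2, hp3⟩ := mem_dpairs.1 hp
    have h3 : p.1.natDegree ≤ n ∧ vm p.1 ≠ 0 := by
      rw [vmLE] at h1
      split_ifs at h1 with h4
      · exact ⟨h4, h1⟩
      · exact absurd rfl h1
    obtain ⟨Q, hQ, m, hm, hQm⟩ := exists_of_vm_ne_zero h3.2
    rw [← hp3] at hPD
    rcases hP.prime.dvd_or_dvd hPD with h5 | h5
    · have h6 := natDegree_le_of_dvd h5 hp1.ne_zero
      omega
    · have hdeg := natDegree_of_mem_dpairs hp
      have hQpos : 0 < p.1.natDegree := by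
        rw [hQm, natDegree_pow]
        exact Nat.mul_pos (by omega) hQ.natDegree_pos
      exact hlt (ih _ (by omega) hp2 h2 rfl P hP h5)

lemma hasHighPower_of_hadCoeff_ne_zero {n : ℕ} {D : F[X]} (hD : D.Monic)
    (h : hadCoeff n D ≠ 0) (hr : ¬ IsRough n D) : HasHighPower n D := by
  rw [IsRough] at hr
  push Not at hr
  obtain ⟨P, hP, hPD, hPn⟩ := hr
  refine ⟨P, hP, hPn, ?_⟩
  induction hn : D.natDegree using Nat.strong_induction_on generalizing D with
  | _ k ih =>
    by_contra hlt
    by_cases h0 : D.natDegree = 0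
    · rw [hD.natDegree_eq_zero.1 h0] at hPD
      exact hP.2.not_isUnit (isUnit_of_dvd_one hPD)
    apply h
    refine (mul_eq_zero_iff_left (a := (D.natDegree : ℝ)) (by exact_mod_cast h0)).1 ?_
    rw [hadCoeff, expConv_rec (vmGT_one n) hD]
    refine Finset.sum_eq_zero fun p hp => ?_
    by_contra hne
    obtain ⟨h1, h2⟩ := mul_ne_zero_iff.1 hne
    obtain ⟨hp1, hp2, hp3⟩ := mem_dpairs.1 hp
    have h3 : n < p.1.natDegree ∧ vm p.1 ≠ 0 := by
      rw [vmGT] at h1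
      split_ifs at h1 with h4
      · exact absurd rfl h1
      · exact ⟨by omega, h1⟩
    obtain ⟨Q, hQ, m, hm, hQm⟩ := exists_of_vm_ne_zero h3.2
    rw [← hp3] at hPD
    rcases hP.prime.dvd_or_dvd hPD with h5 | h5
    · rw [hQm] at h5
      have hPQ := hP.eq_of_dvd hQ (hP.prime.dvd_of_dvd_pow h5)
      subst hPQ
      have h6 := h3.1
      rw [hQm, natDegree_pow, lt_mul_div_succ_natDegree hP] at h6
      exact hlt ((pow_dvd_pow P h6).trans (hQm ▸ ⟨_, hp3.symm⟩))
    · have hdeg := natDegree_of_mem_dpairs hp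
      exact hlt ((ih _ (by omega) hp2 h2 h5 rfl).trans ⟨p.1, by rw [← hp3, mul_comm]⟩)

lemma hadCoeff_eq_one_of_isRough {n : ℕ} {D : F[X]} (hD : D.Monic) (h : IsRough n D) :
    hadCoeff n D = 1 := by
  rw [hadCoeff, ← expConv_vm hD]
  refine expConv_congr_of_dvd (vmGT_one n) hD fun A hA hAD => ?_
  rw [vmGT]
  split_ifs with h1
  · by_contra hne
    obtain ⟨P, hP, m, hm, rfl⟩ := exists_of_vm_ne_zero (Ne.symm hne)
    have h2 := h P hP ((dvd_pow_self P (by omega)).trans hAD)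
    rw [natDegree_pow] at h1
    nlinarith
  · rfl

lemma eulerCoeff_eq_one {n : ℕ} {D : F[X]} (hD : D.Monic) (h : IsSmooth n D)
    (h' : ¬ HasHighPower n D) : eulerCoeff n D = 1 := by
  rw [eulerCoeff, ← expConv_vm hD]
  refine expConv_congr_of_dvd (vmLE_one n) hD fun A hA hAD => ?_
  rw [vmLE]
  split_ifs with h1
  · rfl
  · by_contra hne
    obtain ⟨P, hP, m, hm, rfl⟩ := exists_of_vm_ne_zero (Ne.symm hne)
    refine h' ⟨P, hP, h P hP ((dvd_pow_self P (by omega)).trans hAD), ?_⟩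
    rw [natDegree_pow, not_le, lt_mul_div_succ_natDegree hP] at h1
    exact (pow_dvd_pow P h1).trans hAD

/-- Coefficients of the one-variable generating series of `expConv l` twisted by a completely
multiplicative function satisfy the recursion of an exponential. -/
lemma sum_monics_expConv_rec {l : F[X] → ℝ} (hl : l 1 = 0) {χ : F[X] → ℂ}
    (hχ : ∀ A B, χ (A * B) = χ A * χ B) (n : ℕ) :
    (n : ℂ) * ∑ D ∈ monics F n, (expConv l D : ℂ) * χ D =
      ∑ ij ∈ Finset.HasAntidiagonal.antidiagonal n, (∑ A ∈ monics F ij.1, (l A : ℂ) * χ A) *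
        ∑ B ∈ monics F ij.2, (expConv l B : ℂ) * χ B := by
  simp_rw [Finset.sum_mul_sum]
  rw [← sum_monics_dpairs n (fun A B => ((l A : ℂ) * χ A) * ((expConv l B : ℂ) * χ B)),
    Finset.mul_sum]
  refine Finset.sum_congr rfl fun D hD => ?_
  have h1 := expConv_rec hl (mem_monics.1 hD).1
  rw [(mem_monics.1 hD).2] at h1
  rw [← mul_assoc]
  have h2 : (n : ℂ) * (expConv l D : ℂ) = (conv l (expConv l) D : ℝ) := by
    rw [← h1]; push_cast; rfl
  rw [h2, conv]
  push_cast
  rw [Finset.sum_mul]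
  refine Finset.sum_congr rfl fun p hp => ?_
  rw [← (mem_dpairs.1 hp).2.2, hχ]
  ring

lemma iteratedDeriv_eval (p : ℂ[X]) (n : ℕ) :
    iteratedDeriv n (fun w => p.eval w) = fun w => (derivative^[n] p).eval w := by
  induction n with
  | zero => simp
  | succ n ih =>
    rw [iteratedDeriv_succ, ih]
    ext w
    rw [Function.iterate_succ_apply']
    exact Polynomial.deriv _

/-- A sequence satisfying the exponential recursion with finitely many nonzero `l m` has the
exponential `exp (∑ l m w ^ m / m)` as its generating function. -/
lemma hasSum_of_exp_recursion {X : ℕ} {l c : ℕ → ℂ} (hl : ∀ m, X < m → l m = 0) (hl0 : l 0 = 0)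
    (hc0 : c 0 = 1) (hc : ∀ n : ℕ, (n : ℂ) * c n =
      ∑ ij ∈ Finset.HasAntidiagonal.antidiagonal n, l ij.1 * c ij.2) (w : ℂ) :
    HasSum (fun n => c n * w ^ n)
      (Complex.exp (∑ m ∈ Finset.range (X + 1), l m * w ^ m / m)) := by
  set f : ℂ → ℂ := fun w => Complex.exp (∑ m ∈ Finset.range (X + 1), l m * w ^ m / m) with hf
  set p : ℂ[X] := ∑ m ∈ Finset.range X, C (l (m + 1)) * Polynomial.X ^ m with hp
  have hpc : ∀ i, p.coeff i = l (i + 1) := by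
    intro i
    simp only [hp, finsetSum_coeff, coeff_C_mul, coeff_X_pow, mul_ite, mul_one, mul_zero,
      Finset.sum_ite_eq, Finset.mem_range]
    split_ifs with h
    · rfl
    · rw [hl _ (by omega)]
  have hd : ∀ w, HasDerivAt f (p.eval w * f w) w := by
    intro w
    have h1 : HasDerivAt (fun w : ℂ => ∑ m ∈ Finset.range (X + 1), l m * w ^ m / m)
        (p.eval w) w := by
      have h2 : p.eval w = ∑ m ∈ Finset.range (X + 1), l m * (m * w ^ (m - 1)) / m := by
        rw [Finset.sum_range_succ', hp, eval_finsetSum]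
        simp only [eval_mul, eval_C, eval_pow, eval_X, hl0, zero_mul, zero_div, add_zero]
        refine Finset.sum_congr rfl fun m _ => ?_
        have : ((m + 1 : ℕ) : ℂ) ≠ 0 := by exact_mod_cast Nat.succ_ne_zero m
        simp only [Nat.add_sub_cancel]
        field_simp
      rw [h2]
      refine HasDerivAt.fun_sum fun m _ => ?_
      exact ((hasDerivAt_pow m w).const_mul (l m)).div_const _
    have := h1.cexp
    rwa [mul_comm] at this
  have hdiff : Differentiable ℂ f := fun w => (hd w).differentiableAt
  have hder : deriv f = fun w => p.eval w * f w := funext fun w => (hd w).deriv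
  have hts := Complex.hasSum_taylorSeries_of_entire hdiff 0 w
  have hcoef : ∀ n, c n = (n.factorial : ℂ)⁻¹ * iteratedDeriv n f 0 := by
    intro n
    induction n using Nat.strong_induction_on with
    | _ n ih =>
      cases n with
      | zero =>
        simp only [hc0, Nat.factorial_zero, Nat.cast_one, inv_one, iteratedDeriv_zero, one_mul, hf]
        rw [Finset.sum_eq_zero, Complex.exp_zero]
        intro m _
        rcases Nat.eq_zero_or_pos m with rfl | hm
        · simp
        · simp [zero_pow hm.ne']
      | succ n =>
        have hn : ((n + 1 : ℕ) : ℂ) ≠ 0 := by exact_mod_cast Nat.succ_ne_zero n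
        refine mul_left_cancel₀ hn ?_
        rw [hc, iteratedDeriv_succ', hder, iteratedDeriv_fun_mul
          (Polynomial.differentiable p).contDiff.contDiffAt hdiff.contDiff.contDiffAt,
          Finset.Nat.sum_antidiagonal_eq_sum_range_succ (fun i j => l i * c j),
          Finset.sum_range_succ']
        simp only [hl0, zero_mul, add_zero, Finset.mul_sum]
        refine Finset.sum_congr rfl fun i hi => ?_
        rw [Finset.mem_range] at hi
        rw [Nat.add_sub_add_right, ih _ (by omega), iteratedDeriv_eval]
        have h3 : (derivative^[i] p).eval 0 = i.factorial * l (i + 1) := by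
          rw [← coeff_zero_eq_eval_zero, coeff_iterate_derivative, zero_add, hpc,
            Nat.descFactorial_self, nsmul_eq_mul]
        simp only [h3, Nat.factorial_succ]
        have h4 : (n.choose i : ℂ) * i.factorial * (n - i).factorial = n.factorial := by
          exact_mod_cast Nat.choose_mul_factorial_mul_factorial (by omega : i ≤ n)
        have h5 : ((n - i).factorial : ℂ) ≠ 0 := by exact_mod_cast Nat.factorial_ne_zero _
        have h6 : (n.factorial : ℂ) ≠ 0 := by exact_mod_cast Nat.factorial_ne_zero _
        push_cast at hn ⊢
        field_simp
        linear_combination (-(l (i + 1) * iteratedDeriv (n - i) f 0)) * h4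
  have h : (fun n => c n * w ^ n) =
      fun n : ℕ => (n.factorial : ℂ)⁻¹ • (w - 0) ^ n • iteratedDeriv n f 0 := by
    ext n
    rw [hcoef]
    simp only [sub_zero, smul_eq_mul]
    ring
  rw [h]
  exact hts

/-! Counting monic polynomials. -/

/-- The number of monic polynomials of degree `n` with property `p`. -/
def cnt (p : F[X] → Prop) (n : ℕ) : ℝ := open Classical in ((monics F n).filter p).card

lemma cnt_eq_card (p : F[X] → Prop) [DecidablePred p] (n : ℕ) :
    cnt p n = ((monics F n).filter p).card := by
  rw [cnt]; congr!

lemma cnt_nonneg (p : F[X] → Prop) (n : ℕ) : 0 ≤ cnt p n := Nat.cast_nonneg _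

lemma cnt_congr {p p' : F[X] → Prop} {n : ℕ} (h : ∀ D : F[X], D.Monic → (p D ↔ p' D)) :
    cnt p n = cnt p' n := by
  classical
  rw [cnt, cnt, Finset.filter_congr fun D hD => h D (mem_monics.1 hD).1]

lemma cnt_mono {p p' : F[X] → Prop} {n : ℕ} (h : ∀ D : F[X], D.Monic → p D → p' D) :
    cnt p n ≤ cnt p' n := by
  classical
  rw [cnt, cnt]
  exact_mod_cast Finset.card_le_card fun D hD => by
    rw [Finset.mem_filter] at hD ⊢
    exact ⟨hD.1, h D (mem_monics.1 hD.1).1 hD.2⟩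

lemma cnt_true (n : ℕ) : cnt (fun _ : F[X] => True) n = (Nat.card F : ℝ) ^ n := by
  classical
  rw [cnt_eq_card, Finset.filter_true_of_mem (by simp), card_monics]
  push_cast; rfl

lemma cnt_eq_sum (p : F[X] → Prop) (n : ℕ) :
    cnt p n = open Classical in ∑ D ∈ monics F n, if p D then 1 else 0 := by
  classical
  rw [cnt, Finset.card_filter]
  push_cast
  congr!

lemma cnt_split (p p' : F[X] → Prop) (n : ℕ) :
    cnt p n = cnt (fun D => p D ∧ p' D) n + cnt (fun D => p D ∧ ¬ p' D) n := by
  classical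
  simp only [cnt_eq_sum, ← Finset.sum_add_distrib]
  refine Finset.sum_congr rfl fun D _ => ?_
  by_cases h : p D <;> by_cases h' : p' D <;> simp [h, h']

lemma cnt_dvd {G : F[X]} (hG : G.Monic) (p : F[X] → Prop) (n : ℕ) :
    cnt (fun D => p D ∧ G ∣ D) n =
      if G.natDegree ≤ n then cnt (fun D => p (G * D)) (n - G.natDegree) else 0 := by
  classical
  split_ifs with h
  · rw [cnt_eq_card, cnt_eq_card]
    congr 1
    symm
    refine Finset.card_bij (fun D _ => G * D) ?_ ?_ ?_
    · intro D hD
      rw [Finset.mem_filter, mem_monics] at hD ⊢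
      refine ⟨⟨hG.mul hD.1.1, ?_⟩, hD.2, dvd_mul_right _ _⟩
      rw [hG.natDegree_mul hD.1.1, hD.1.2]
      omega
    · intro D _ D' _ h
      exact mul_left_cancel₀ hG.ne_zero h
    · intro D hD
      rw [Finset.mem_filter, mem_monics] at hD
      obtain ⟨⟨h1, h2⟩, h3, D', rfl⟩ := hD
      have hD' : D'.Monic := hG.of_mul_monic_left h1
      refine ⟨D', ?_, rfl⟩
      rw [Finset.mem_filter, mem_monics]
      rw [hG.natDegree_mul hD'] at h2
      exact ⟨⟨hD', by omega⟩, h3⟩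
  · rw [cnt_eq_card, Finset.filter_eq_empty_iff.2, Finset.card_empty, Nat.cast_zero]
    rintro D hD ⟨_, hGD⟩
    have := natDegree_le_of_dvd hGD (mem_monics.1 hD).1.ne_zero
    rw [(mem_monics.1 hD).2] at this
    exact h this

lemma sum_range_shift (f : ℕ → ℝ) (k N : ℕ) :
    (∑ n ∈ Finset.range N, if k ≤ n then f (n - k) else 0) = ∑ n ∈ Finset.range (N - k), f n := by
  induction N with
  | zero => simp
  | succ N ih =>
    rw [Finset.sum_range_succ, ih]
    split_ifs with h
    · rw [Nat.succ_sub h, Finset.sum_range_succ]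
    · rw [add_zero, show N - k = 0 by omega, show N + 1 - k = 0 by omega]

/-- No element of `S` divides `D`. -/
def Avoids (S : Finset F[X]) (D : F[X]) : Prop := ∀ P ∈ S, ¬ P ∣ D

/-- The density of monic polynomials of degree `n` without prime factors in `S`. -/
def dens (S : Finset F[X]) (n : ℕ) : ℝ := cnt (Avoids S) n / (Nat.card F : ℝ) ^ n

/-- The product of `1 - 1 / |P|` over `S`. -/
def kap (S : Finset F[X]) : ℝ := ∏ P ∈ S, (1 - 1 / (Nat.card F : ℝ) ^ P.natDegree)

lemma card_pow_pos (n : ℕ) : (0 : ℝ) < (Nat.card F : ℝ) ^ n := by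
  have := two_le_card (F := F)
  positivity

lemma one_div_card_pow_le {P : F[X]} (hP : IsPrimePoly P) :
    1 / (Nat.card F : ℝ) ^ P.natDegree ≤ 1 / 2 := by
  refine one_div_le_one_div_of_le (by norm_num) ?_
  calc (2 : ℝ) ≤ Nat.card F := two_le_card
    _ = (Nat.card F : ℝ) ^ 1 := (pow_one _).symm
    _ ≤ _ := pow_le_pow_right₀ (by linarith [two_le_card (F := F)]) hP.natDegree_pos

lemma kap_pos {S : Finset F[X]} (hS : ∀ P ∈ S, IsPrimePoly P) : 0 < kap S :=
  Finset.prod_pos fun P hP => by linarith [one_div_card_pow_le (hS P hP)]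

lemma kap_le_one {S : Finset F[X]} (hS : ∀ P ∈ S, IsPrimePoly P) : kap S ≤ 1 :=
  Finset.prod_le_one (fun P hP => by linarith [one_div_card_pow_le (hS P hP)])
    fun P _ => by linarith [one_div_pos.2 (card_pow_pos (F := F) P.natDegree)]

open Classical in
lemma dens_insert {S : Finset F[X]} (hS : ∀ P ∈ S, IsPrimePoly P) {P : F[X]}
    (hP : IsPrimePoly P) (hPS : P ∉ S) (n : ℕ) :
    dens (insert P S) n = dens S n - 1 / (Nat.card F : ℝ) ^ P.natDegree *
      (if P.natDegree ≤ n then dens S (n - P.natDegree) else 0) := by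
  have h1 : cnt (Avoids (insert P S)) n = cnt (fun D => Avoids S D ∧ ¬ P ∣ D) n :=
    cnt_congr fun D _ => by
      simp only [Avoids, Finset.forall_mem_insert]
      tauto
  have h2 : ∀ D : F[X], Avoids S (P * D) ↔ Avoids S D := fun D => by
    refine forall₂_congr fun Q hQ => not_congr ?_
    refine ⟨fun h => ((hS Q hQ).prime.dvd_or_dvd h).resolve_left fun h => hPS ?_,
      fun h => h.mul_left _⟩
    rwa [← (hS Q hQ).eq_of_dvd hP h]
  have h3 := cnt_split (Avoids S) (fun D => P ∣ D) n
  rw [cnt_dvd hP.1, cnt_congr (fun D _ => h2 D)] at h3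
  rw [dens, h1]
  have hq := card_pow_pos (F := F) P.natDegree
  have hq' := card_pow_pos (F := F) n
  split_ifs at h3 ⊢ with hn
  · have hq'' := card_pow_pos (F := F) (n - P.natDegree)
    rw [dens, dens, h3]
    have : (Nat.card F : ℝ) ^ n = (Nat.card F : ℝ) ^ P.natDegree *
        (Nat.card F : ℝ) ^ (n - P.natDegree) := by
      rw [← pow_add]; congr 1; omega
    rw [this]
    field_simp
    ring
  · rw [dens, h3]
    simp

lemma dens_nonneg (S : Finset F[X]) (n : ℕ) : 0 ≤ dens S n :=
  div_nonneg (cnt_nonneg _ _) (card_pow_pos n).le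

lemma dens_empty (n : ℕ) : dens (∅ : Finset F[X]) n = 1 := by
  rw [dens, cnt_congr (p' := fun _ => True) (fun D _ => by simp [Avoids]), cnt_true,
    div_self (card_pow_pos n).ne']

open Classical in
lemma kap_insert {S : Finset F[X]} {P : F[X]} (hPS : P ∉ S) :
    kap (insert P S) = (1 - 1 / (Nat.card F : ℝ) ^ P.natDegree) * kap S :=
  Finset.prod_insert hPS

/-- The number of polynomials without prime factors in `S` is exactly as expected in high
degrees. -/
lemma dens_eq_kap {S : Finset F[X]} (hS : ∀ P ∈ S, IsPrimePoly P) {n : ℕ}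
    (hn : ∑ P ∈ S, P.natDegree ≤ n) : dens S n = kap S := by
  classical
  induction S using Finset.induction_on generalizing n with
  | empty => rw [dens_empty]; simp [kap]
  | insert P S hPS ih =>
    rw [Finset.sum_insert hPS] at hn
    rw [Finset.forall_mem_insert] at hS
    rw [dens_insert hS.2 hS.1 hPS, if_pos (by omega), ih hS.2 (by omega), ih hS.2 (by omega),
      kap_insert hPS]
    ring

/-- The sum of `1 / |D|` over `deg D < N` without prime factors in `S`. -/
lemma abs_sum_dens_sub_le {S : Finset F[X]} (hS : ∀ P ∈ S, IsPrimePoly P) (N : ℕ) :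
    |∑ n ∈ Finset.range N, dens S n - N * kap S| ≤
      (∏ P ∈ S, (1 + 1 / (Nat.card F : ℝ) ^ P.natDegree)) *
        ∑ P ∈ S, (P.natDegree : ℝ) / (Nat.card F : ℝ) ^ P.natDegree := by
  classical
  induction S using Finset.induction_on generalizing N with
  | empty => simp [dens_empty, kap]
  | insert P S hPS ih =>
    rw [Finset.forall_mem_insert] at hS
    have h1 : ∑ n ∈ Finset.range N, dens (insert P S) n = ∑ n ∈ Finset.range N, dens S n -
        1 / (Nat.card F : ℝ) ^ P.natDegree * ∑ n ∈ Finset.range (N - P.natDegree), dens S n := by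
      rw [← sum_range_shift, Finset.mul_sum, ← Finset.sum_sub_distrib]
      exact Finset.sum_congr rfl fun n _ => dens_insert hS.2 hS.1 hPS n
    rw [h1, kap_insert hPS, Finset.prod_insert hPS, Finset.sum_insert hPS]
    set x := 1 / (Nat.card F : ℝ) ^ P.natDegree with hx
    have hx0 : 0 < x := one_div_pos.2 (card_pow_pos _)
    set E := ∏ P ∈ S, (1 + 1 / (Nat.card F : ℝ) ^ P.natDegree)
    set W := ∑ P ∈ S, (P.natDegree : ℝ) / (Nat.card F : ℝ) ^ P.natDegree
    have hE : 1 ≤ E := by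
      rw [← Finset.prod_const_one (s := S)]
      refine Finset.prod_le_prod (fun _ _ => zero_le_one) fun Q _ => ?_
      linarith [one_div_pos.2 (card_pow_pos (F := F) Q.natDegree)]
    have hk0 := kap_pos hS.2
    have hk1 := kap_le_one hS.2
    have i1 := ih hS.2 N
    have i2 := ih hS.2 (N - P.natDegree)
    have i3 : |((N - P.natDegree : ℕ) : ℝ) - N| ≤ P.natDegree := by
      rcases le_total P.natDegree N with h | h
      · rw [Nat.cast_sub h]; simp
      · rw [Nat.sub_eq_zero_of_le h]; simpa using h
    have hdiv : (P.natDegree : ℝ) / (Nat.card F : ℝ) ^ P.natDegree = x * P.natDegree := by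
      rw [hx]; ring
    rw [hdiv]
    have hd0 : (0 : ℝ) ≤ P.natDegree := Nat.cast_nonneg _
    rw [abs_le] at i1 i2 i3 ⊢
    have hW : 0 ≤ E * W := by
      refine mul_nonneg (by linarith) (Finset.sum_nonneg fun Q _ => ?_)
      exact div_nonneg (Nat.cast_nonneg _) (card_pow_pos _).le
    have j1 := mul_le_mul_of_nonneg_left i2.1 hx0.le
    have j2 := mul_le_mul_of_nonneg_left i2.2 hx0.le
    have j3 := mul_le_mul_of_nonneg_left i3.1 (mul_pos hx0 hk0).le
    have j4 := mul_le_mul_of_nonneg_left i3.2 (mul_pos hx0 hk0).le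
    have j5 : x * kap S * P.natDegree ≤ (1 + x) * E * (x * P.natDegree) := by
      have : kap S ≤ (1 + x) * E := by nlinarith
      nlinarith [mul_nonneg hx0.le hd0]
    constructor <;> nlinarith

lemma hasSum_expConv {X : ℕ} {l : F[X] → ℝ} (hl1 : l 1 = 0)
    (hl : ∀ A : F[X], X < A.natDegree → l A = 0) {χ : F[X] → ℂ}
    (hχ : ∀ A B, χ (A * B) = χ A * χ B) (hχ1 : χ 1 = 1) (w : ℂ) :
    HasSum (fun n => (∑ D ∈ monics F n, (expConv l D : ℂ) * χ D) * w ^ n)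
      (Complex.exp (∑ m ∈ Finset.range (X + 1),
        (∑ A ∈ monics F m, (l A : ℂ) * χ A) * w ^ m / m)) := by
  refine hasSum_of_exp_recursion ?_ ?_ ?_ (fun n => sum_monics_expConv_rec hl1 hχ n) w
  · intro m hm
    refine Finset.sum_eq_zero fun A hA => ?_
    rw [hl A (by rw [(mem_monics.1 hA).2]; exact hm)]
    simp
  · simp [monics_zero, hl1]
  · simp [monics_zero, expConv_one, hχ1]

/-- The finite set of primes of degree at most `n`. -/
def primeSet (F : Type*) [Field F] [Finite F] (n : ℕ) : Finset F[X] :=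
  open Classical in (monicsLE F n).filter IsPrimePoly

lemma mem_primeSet {n : ℕ} {P : F[X]} :
    P ∈ primeSet F n ↔ IsPrimePoly P ∧ P.natDegree ≤ n := by
  simp only [primeSet, Finset.mem_filter, mem_monicsLE]
  exact ⟨fun h => ⟨h.2, h.1.2⟩, fun h => ⟨⟨h.1.1, h.2⟩, h.1⟩⟩

lemma sum_primeSet_le {g : ℕ → ℝ} (hg : ∀ n, 0 ≤ g n) (t : ℕ) :
    ∑ P ∈ primeSet F t, g P.natDegree ≤
      ∑ n ∈ Finset.range t, (Nat.card F : ℝ) ^ (n + 1) / ((n : ℝ) + 1) * g (n + 1) := by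
  classical
  have h1 : ∑ P ∈ primeSet F t, g P.natDegree =
      ∑ P ∈ monicsLE F t, if IsPrimePoly P then g P.natDegree else 0 := by
    rw [primeSet, Finset.sum_filter]
  rw [h1, sum_monicsLE, Finset.sum_range_succ']
  have h0 : ∑ A ∈ monics F 0, (if IsPrimePoly A then g A.natDegree else 0) = 0 := by
    refine Finset.sum_eq_zero fun A hA => ?_
    rw [if_neg]
    intro h
    have := h.natDegree_pos
    have := (mem_monics.1 hA).2
    omega
  rw [h0, add_zero]
  refine Finset.sum_le_sum fun n _ => ?_
  have h2 : ((n : ℝ) + 1) * ∑ A ∈ monics F (n + 1), (if IsPrimePoly A then (1 : ℝ) else 0) ≤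
      (Nat.card F : ℝ) ^ (n + 1) := by
    rw [← sum_monics_vm (by omega : 1 ≤ n + 1), Finset.mul_sum]
    refine Finset.sum_le_sum fun A hA => ?_
    split_ifs with h
    · have := vm_prime_pow h le_rfl
      rw [pow_one] at this
      rw [this, (mem_monics.1 hA).2]
      push_cast
      linarith
    · simpa using vm_nonneg A
  have h3 : ∑ A ∈ monics F (n + 1), (if IsPrimePoly A then g A.natDegree else 0) =
      (∑ A ∈ monics F (n + 1), (if IsPrimePoly A then (1 : ℝ) else 0)) * g (n + 1) := by
    rw [Finset.sum_mul]
    refine Finset.sum_congr rfl fun A hA => ?_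
    rw [(mem_monics.1 hA).2]
    split_ifs <;> simp
  rw [h3]
  refine mul_le_mul_of_nonneg_right ?_ (hg _)
  rw [le_div_iff₀ (by positivity)]
  linarith

lemma sum_primes_le {g : ℕ → ℝ} (hg : ∀ n, 0 ≤ g n) {t : ℕ} {S : Finset F[X]}
    (hS : ∀ P ∈ S, IsPrimePoly P) {c : ℝ} (hc : (S.card : ℝ) ≤ (Nat.card F : ℝ) ^ t)
    (hgt : ∀ n, t < n → g n ≤ c / (Nat.card F : ℝ) ^ t) (hc0 : 0 ≤ c) :
    ∑ P ∈ S, g P.natDegree ≤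
      ∑ n ∈ Finset.range t, (Nat.card F : ℝ) ^ (n + 1) / ((n : ℝ) + 1) * g (n + 1) + c := by
  classical
  rw [← Finset.sum_filter_add_sum_filter_not S (fun P => P.natDegree ≤ t)]
  refine add_le_add ((Finset.sum_le_sum_of_subset_of_nonneg (t := primeSet F t) ?_
    fun P _ _ => hg _).trans (sum_primeSet_le hg t)) ?_
  · intro P hP
    rw [Finset.mem_filter] at hP
    exact mem_primeSet.2 ⟨hS P hP.1, hP.2⟩
  · have h1 : ∑ P ∈ S.filter (fun P => ¬ P.natDegree ≤ t), g P.natDegree ≤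
        ∑ P ∈ S.filter (fun P => ¬ P.natDegree ≤ t), c / (Nat.card F : ℝ) ^ t :=
      Finset.sum_le_sum fun P hP => hgt _ (by
        rw [Finset.mem_filter] at hP
        omega)
    refine h1.trans ?_
    rw [Finset.sum_const, nsmul_eq_mul]
    have h2 : ((S.filter (fun P => ¬ P.natDegree ≤ t)).card : ℝ) ≤ (Nat.card F : ℝ) ^ t :=
      le_trans (by exact_mod_cast Finset.card_filter_le _ _) hc
    calc _ ≤ (Nat.card F : ℝ) ^ t * (c / (Nat.card F : ℝ) ^ t) :=
          mul_le_mul_of_nonneg_right h2 (div_nonneg hc0 (card_pow_pos t).le)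
      _ = c := mul_div_cancel₀ _ (card_pow_pos t).ne'

lemma sum_one_div_primes_le {t : ℕ} (ht : 1 ≤ t) {S : Finset F[X]}
    (hS : ∀ P ∈ S, IsPrimePoly P) (hc : (S.card : ℝ) ≤ (Nat.card F : ℝ) ^ t) :
    ∑ P ∈ S, 1 / (Nat.card F : ℝ) ^ P.natDegree ≤ Real.log t + 2 := by
  have h := sum_primes_le (g := fun n => 1 / (Nat.card F : ℝ) ^ n)
    (fun n => (one_div_pos.2 (card_pow_pos n)).le) hS (c := 1) hc
    (fun n hn => one_div_le_one_div_of_le (card_pow_pos t)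
      (pow_le_pow_right₀ (by linarith [two_le_card (F := F)]) hn.le)) zero_le_one
  have h1 : ∑ n ∈ Finset.range t, (Nat.card F : ℝ) ^ (n + 1) / ((n : ℝ) + 1) *
      (1 / (Nat.card F : ℝ) ^ (n + 1)) = (harmonic t : ℝ) := by
    rw [harmonic]
    push_cast
    refine Finset.sum_congr rfl fun n _ => ?_
    have := card_pow_pos (F := F) (n + 1)
    field_simp
  rw [h1] at h
  linarith [harmonic_le_one_add_log t]

lemma prod_one_add_le {t : ℕ} (ht : 1 ≤ t) {S : Finset F[X]}
    (hS : ∀ P ∈ S, IsPrimePoly P) (hc : (S.card : ℝ) ≤ (Nat.card F : ℝ) ^ t) :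
    ∏ P ∈ S, (1 + 1 / (Nat.card F : ℝ) ^ P.natDegree) ≤ Real.exp 2 * t := by
  calc _ ≤ ∏ P ∈ S, Real.exp (1 / (Nat.card F : ℝ) ^ P.natDegree) := by
        refine Finset.prod_le_prod (fun P _ => ?_) fun P _ => ?_
        · linarith [one_div_pos.2 (card_pow_pos (F := F) P.natDegree)]
        · linarith [Real.add_one_le_exp (1 / (Nat.card F : ℝ) ^ P.natDegree)]
    _ = Real.exp (∑ P ∈ S, 1 / (Nat.card F : ℝ) ^ P.natDegree) := (Real.exp_sum _ _).symm
    _ ≤ Real.exp (Real.log t + 2) := Real.exp_le_exp.2 (sum_one_div_primes_le ht hS hc)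
    _ = _ := by rw [Real.exp_add, Real.exp_log (by exact_mod_cast ht), mul_comm]

lemma exp_neg_two_mul_le {x : ℝ} (h0 : 0 ≤ x) (h1 : x ≤ 1 / 2) : Real.exp (-(2 * x)) ≤ 1 - x := by
  rw [Real.exp_neg, inv_le_comm₀ (Real.exp_pos _) (by linarith)]
  refine le_trans ?_ (Real.add_one_le_exp _)
  rw [inv_le_iff_one_le_mul₀ (by linarith)]
  nlinarith

lemma le_kap {t : ℕ} (ht : 1 ≤ t) {S : Finset F[X]}
    (hS : ∀ P ∈ S, IsPrimePoly P) (hc : (S.card : ℝ) ≤ (Nat.card F : ℝ) ^ t) :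
    Real.exp (-4) / (t : ℝ) ^ 2 ≤ kap S := by
  have ht0 : (0 : ℝ) < t := by exact_mod_cast ht
  calc Real.exp (-4) / (t : ℝ) ^ 2 = Real.exp (-(2 * (Real.log t + 2))) := by
        rw [show -(2 * (Real.log t + 2)) = -4 - (Real.log t + Real.log t) by ring, Real.exp_sub,
          Real.exp_add, Real.exp_log ht0, sq]
    _ ≤ Real.exp (∑ P ∈ S, -(2 * (1 / (Nat.card F : ℝ) ^ P.natDegree))) := by
        refine Real.exp_le_exp.2 ?_
        rw [Finset.sum_neg_distrib, ← Finset.mul_sum]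
        linarith [sum_one_div_primes_le ht hS hc]
    _ = ∏ P ∈ S, Real.exp (-(2 * (1 / (Nat.card F : ℝ) ^ P.natDegree))) := Real.exp_sum _ _
    _ ≤ kap S := by
        refine Finset.prod_le_prod (fun P _ => (Real.exp_pos _).le) fun P hP => ?_
        exact exp_neg_two_mul_le (one_div_pos.2 (card_pow_pos _)).le
          (one_div_card_pow_le (hS P hP))

lemma div_card_pow_antitone {m n : ℕ} (hm : 1 ≤ m) (h : m ≤ n) :
    (n : ℝ) / (Nat.card F : ℝ) ^ n ≤ m / (Nat.card F : ℝ) ^ m := by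
  induction n, h using Nat.le_induction with
  | base => exact le_rfl
  | succ n hmn ih =>
    refine le_trans ?_ ih
    rw [div_le_div_iff₀ (card_pow_pos _) (card_pow_pos _), pow_succ]
    have h1 := two_le_card (F := F)
    have h2 := card_pow_pos (F := F) n
    have h3 : (1 : ℝ) ≤ n := by exact_mod_cast hm.trans hmn
    push_cast
    nlinarith [mul_nonneg h2.le (by nlinarith : (0:ℝ) ≤ n * (Nat.card F : ℝ) - (n + 1))]

lemma sum_natDegree_div_le {t : ℕ} (ht : 1 ≤ t) {S : Finset F[X]}
    (hS : ∀ P ∈ S, IsPrimePoly P) (hc : (S.card : ℝ) ≤ (Nat.card F : ℝ) ^ t) :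
    ∑ P ∈ S, (P.natDegree : ℝ) / (Nat.card F : ℝ) ^ P.natDegree ≤ 2 * t := by
  have h := sum_primes_le (g := fun n => (n : ℝ) / (Nat.card F : ℝ) ^ n)
    (fun n => div_nonneg (Nat.cast_nonneg _) (card_pow_pos n).le) hS (c := t) hc
    (fun n hn => div_card_pow_antitone ht hn.le) (Nat.cast_nonneg _)
  have h1 : ∑ n ∈ Finset.range t, (Nat.card F : ℝ) ^ (n + 1) / ((n : ℝ) + 1) *
      (((n + 1 : ℕ) : ℝ) / (Nat.card F : ℝ) ^ (n + 1)) = t := by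
    rw [Finset.sum_congr rfl (g := fun _ => (1 : ℝ))]
    · simp
    intro n _
    have := card_pow_pos (F := F) (n + 1)
    push_cast
    have h3 : (n : ℝ) + 1 ≠ 0 := by positivity
    field_simp
  rw [h1] at h
  linarith

lemma card_primeSet_le (t : ℕ) : ((primeSet F t).card : ℝ) ≤ (Nat.card F : ℝ) ^ (t + 1) := by
  have h := sum_primeSet_le (F := F) (g := fun _ => 1) (fun _ => zero_le_one) t
  simp only [Finset.sum_const, nsmul_eq_mul, mul_one] at h
  refine h.trans ?_
  have h2 : ∀ t : ℕ, ∑ n ∈ Finset.range t, (Nat.card F : ℝ) ^ (n + 1) ≤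
      (Nat.card F : ℝ) ^ (t + 1) := by
    intro t
    induction t with
    | zero => simp
    | succ t ih =>
      rw [Finset.sum_range_succ, pow_succ _ (t + 1)]
      nlinarith [card_pow_pos (F := F) (t + 1), two_le_card (F := F)]
  refine le_trans (Finset.sum_le_sum fun n _ => ?_) (h2 t)
  exact div_le_self (card_pow_pos _).le (by linarith [(Nat.cast_nonneg n : (0:ℝ) ≤ n)])

lemma card_primes_le {S : Finset F[X]} (hS : ∀ P ∈ S, IsPrimePoly P) {d : ℕ}
    (hd : ∑ P ∈ S, P.natDegree ≤ d) (w : ℕ) :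
    (S.card : ℝ) ≤ (Nat.card F : ℝ) ^ (w + 1) + d / (w + 1) := by
  classical
  rw [← Finset.card_filter_add_card_filter_not (s := S) (fun P => P.natDegree ≤ w)]
  push_cast
  refine add_le_add (le_trans ?_ (card_primeSet_le w)) ?_
  · refine Nat.cast_le.2 (Finset.card_le_card fun P hP => ?_)
    rw [Finset.mem_filter] at hP
    exact mem_primeSet.2 ⟨hS P hP.1, hP.2⟩
  · rw [le_div_iff₀ (by positivity)]
    have h1 : (S.filter (fun P => ¬ P.natDegree ≤ w)).card * (w + 1) ≤ d := by
      refine le_trans ?_ hd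
      rw [← smul_eq_mul, ← Finset.sum_const]
      refine (Finset.sum_le_sum fun P hP => ?_).trans
        (Finset.sum_le_sum_of_subset (Finset.filter_subset _ S))
      rw [Finset.mem_filter] at hP
      omega
    exact_mod_cast h1

/-- All prime factors lie in `S`. -/
def FactorsIn (S : Finset F[X]) (D : F[X]) : Prop := ∀ P, IsPrimePoly P → P ∣ D → P ∈ S

lemma cnt_factorsIn_empty (n : ℕ) :
    cnt (FactorsIn (∅ : Finset F[X])) n = if n = 0 then 1 else 0 := by
  classical
  have h : ∀ D : F[X], D.Monic → (FactorsIn ∅ D ↔ D = 1) := by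
    intro D hD
    constructor
    · intro h
      by_contra h1
      obtain ⟨P, hP, hPD⟩ := exists_isPrimePoly_dvd hD h1
      simpa using h P hP hPD
    · rintro rfl P hP hP1
      exact absurd (isUnit_of_dvd_one hP1) hP.2.not_isUnit
  rw [cnt_congr h, cnt_eq_card]
  split_ifs with hn
  · subst hn
    rw [monics_zero, Finset.filter_singleton, if_pos rfl]
    simp
  · rw [Finset.filter_eq_empty_iff.2]
    · simp
    · rintro D hD rfl
      have := (mem_monics.1 hD).2
      simp at this
      omega

open Classical in
lemma cnt_factorsIn_insert {S : Finset F[X]} {P : F[X]} (hP : IsPrimePoly P)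
    (hPS : P ∉ S) (n : ℕ) :
    cnt (FactorsIn (insert P S)) n = cnt (FactorsIn S) n +
      if P.natDegree ≤ n then cnt (FactorsIn (insert P S)) (n - P.natDegree) else 0 := by
  rw [cnt_split _ (fun D => P ∣ D), cnt_dvd hP.1, add_comm]
  congr 1
  · refine cnt_congr fun D _ => ?_
    constructor
    · rintro ⟨h1, h2⟩ Q hQ hQD
      rcases Finset.mem_insert.1 (h1 Q hQ hQD) with rfl | h
      · exact absurd hQD h2
      · exact h
    · intro h
      exact ⟨fun Q hQ hQD => Finset.mem_insert_of_mem (h Q hQ hQD), fun h' => hPS (h P hP h')⟩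
  · congr 1
    refine cnt_congr fun D _ => ?_
    constructor
    · intro h Q hQ hQD
      exact h Q hQ (hQD.mul_left _)
    · intro h Q hQ hQD
      rcases hQ.prime.dvd_or_dvd hQD with h1 | h1
      · exact Finset.mem_insert.2 (Or.inl (hQ.eq_of_dvd hP h1))
      · exact h Q hQ h1

/-- The Euler product over a finite set of primes. -/
lemma hasSum_factorsIn {S : Finset F[X]} (hS : ∀ P ∈ S, IsPrimePoly P) {w : ℝ} (hw : 0 ≤ w)
    (hw1 : ∀ P ∈ S, w ^ P.natDegree < 1) :
    HasSum (fun n => cnt (FactorsIn S) n * w ^ n) (∏ P ∈ S, (1 - w ^ P.natDegree)⁻¹) := by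
  classical
  induction S using Finset.induction_on with
  | empty =>
    simp only [cnt_factorsIn_empty, Finset.prod_empty]
    convert hasSum_ite_eq (0 : ℕ) (1 : ℝ) using 2 with n
    split_ifs with h
    · simp [h]
    · simp
  | insert P S hPS ih =>
    rw [Finset.forall_mem_insert] at hS hw1
    have ih := ih hS.2 hw1.2
    rw [Finset.prod_insert hPS]
    set a := fun n => cnt (FactorsIn S) n * w ^ n with ha
    set b := fun n => cnt (FactorsIn (insert P S)) n * w ^ n with hb
    set x := w ^ P.natDegree with hx
    have hx0 : 0 ≤ x := pow_nonneg hw _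
    have hb0 : ∀ n, 0 ≤ b n := fun n => mul_nonneg (cnt_nonneg _ _) (pow_nonneg hw _)
    have ha0 : ∀ n, 0 ≤ a n := fun n => mul_nonneg (cnt_nonneg _ _) (pow_nonneg hw _)
    have hrec : ∀ n, b n = a n + x * if P.natDegree ≤ n then b (n - P.natDegree) else 0 := by
      intro n
      simp only [ha, hb]
      rw [cnt_factorsIn_insert hS.1 hPS, add_mul]
      congr 1
      split_ifs with h
      · have : w ^ n = x * w ^ (n - P.natDegree) := by
          rw [hx, ← pow_add]; congr 1; omega
        rw [this]; ring
      · simp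
    have hpart : ∀ N, ∑ n ∈ Finset.range N, b n = ∑ n ∈ Finset.range N, a n +
        x * ∑ n ∈ Finset.range (N - P.natDegree), b n := by
      intro N
      rw [← sum_range_shift b, Finset.mul_sum, ← Finset.sum_add_distrib]
      exact Finset.sum_congr rfl fun n _ => hrec n
    have hbd : ∀ N, ∑ n ∈ Finset.range N, b n ≤ (∑' n, a n) / (1 - x) := by
      intro N
      rw [le_div_iff₀ (by linarith [hw1.1])]
      have h1 : ∑ n ∈ Finset.range (N - P.natDegree), b n ≤ ∑ n ∈ Finset.range N, b n :=
        Finset.sum_le_sum_of_subset_of_nonneg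
          (Finset.range_subset_range.2 (Nat.sub_le _ _)) fun n _ _ => hb0 n
      have h2 := ih.summable.sum_le_tsum (Finset.range N) fun n _ => ha0 n
      have h3 := hpart N
      nlinarith
    have hsum : Summable b := summable_of_sum_range_le hb0 hbd
    have hlim := hsum.hasSum.tendsto_sum_nat
    have hlim' : Tendsto (fun N => ∑ n ∈ Finset.range N, a n +
        x * ∑ n ∈ Finset.range (N - P.natDegree), b n) atTop
        (𝓝 (∏ P ∈ S, (1 - w ^ P.natDegree)⁻¹ + x * ∑' n, b n)) :=
      ih.tendsto_sum_nat.add ((hlim.comp (tendsto_sub_atTop_nat P.natDegree)).const_mul x)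
    have heq : ∑' n, b n = ∏ P ∈ S, (1 - w ^ P.natDegree)⁻¹ + x * ∑' n, b n :=
      tendsto_nhds_unique hlim (hlim'.congr fun N => (hpart N).symm)
    have : (1 - x)⁻¹ * ∏ P ∈ S, (1 - w ^ P.natDegree)⁻¹ = ∑' n, b n := by
      rw [inv_mul_eq_iff_eq_mul₀ (by linarith [hw1.1])]
      linarith
    rw [this]
    exact hsum.hasSum

/-- The sum of `1 / |P ^ k|` over primes of degree at most `X`, with `k` minimal such that
`deg (P ^ k) > X`. -/
def highPowerSum (F : Type*) [Field F] [Finite F] (X : ℕ) : ℝ :=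
  ∑ P ∈ primeSet F X, 1 / (Nat.card F : ℝ) ^ ((X / P.natDegree + 1) * P.natDegree)

lemma highPowerSum_nonneg (X : ℕ) : 0 ≤ highPowerSum F X :=
  Finset.sum_nonneg fun _ _ => (one_div_pos.2 (card_pow_pos _)).le

lemma sum_cnt_highPower_le {p : F[X] → Prop} (hp : ∀ A B : F[X], p (A * B) → p B) (X N : ℕ) :
    ∑ n ∈ Finset.range N, cnt (fun D => p D ∧ HasHighPower X D) n / (Nat.card F : ℝ) ^ n ≤
      highPowerSum F X * ∑ n ∈ Finset.range N, cnt p n / (Nat.card F : ℝ) ^ n := by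
  classical
  have h1 : ∀ n, cnt (fun D => p D ∧ HasHighPower X D) n ≤ ∑ P ∈ primeSet F X,
      if (X / P.natDegree + 1) * P.natDegree ≤ n then
        cnt p (n - (X / P.natDegree + 1) * P.natDegree) else 0 := by
    intro n
    have h2 : cnt (fun D => p D ∧ HasHighPower X D) n ≤ ∑ P ∈ primeSet F X,
        cnt (fun D => p D ∧ P ^ (X / P.natDegree + 1) ∣ D) n := by
      simp only [cnt_eq_card]
      rw [← Nat.cast_sum, Nat.cast_le]
      refine le_trans (Finset.card_le_card ?_) Finset.card_biUnion_le
      intro D hD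
      rw [Finset.mem_filter] at hD
      obtain ⟨hDm, hD, P, hP, hPX, hPD⟩ := hD
      rw [Finset.mem_biUnion]
      exact ⟨P, mem_primeSet.2 ⟨hP, hPX⟩, Finset.mem_filter.2 ⟨hDm, hD, hPD⟩⟩
    refine h2.trans (Finset.sum_le_sum fun P hP => ?_)
    have hPm := (mem_primeSet.1 hP).1.1
    rw [cnt_dvd (hPm.pow _), natDegree_pow]
    split_ifs with h
    · exact cnt_mono fun D _ h => hp _ _ h
    · exact le_rfl
  have haux : ∀ n k : ℕ, (if k ≤ n then cnt p (n - k) else 0) ≤ 1 / (Nat.card F : ℝ) ^ k *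
      (if k ≤ n then cnt p (n - k) / (Nat.card F : ℝ) ^ (n - k) else 0) *
        (Nat.card F : ℝ) ^ n := by
    intro n k
    split_ifs with h
    · have e : (Nat.card F : ℝ) ^ n = (Nat.card F : ℝ) ^ k * (Nat.card F : ℝ) ^ (n - k) := by
        rw [← pow_add]; congr 1; omega
      have := card_pow_pos (F := F) k
      have := card_pow_pos (F := F) (n - k)
      rw [e]
      apply le_of_eq
      field_simp
    · simp
  calc _ ≤ ∑ n ∈ Finset.range N, ∑ P ∈ primeSet F X,
        1 / (Nat.card F : ℝ) ^ ((X / P.natDegree + 1) * P.natDegree) *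
        (if (X / P.natDegree + 1) * P.natDegree ≤ n then
        cnt p (n - (X / P.natDegree + 1) * P.natDegree) /
          (Nat.card F : ℝ) ^ (n - (X / P.natDegree + 1) * P.natDegree) else 0) := by
        refine Finset.sum_le_sum fun n _ => ?_
        rw [div_le_iff₀ (card_pow_pos n), Finset.sum_mul]
        refine (h1 n).trans (Finset.sum_le_sum fun P _ => ?_)
        exact haux n _
    _ ≤ _ := by
        rw [Finset.sum_comm, highPowerSum, Finset.sum_mul]
        refine Finset.sum_le_sum fun P _ => ?_
        rw [← Finset.mul_sum, sum_range_shift (fun n => cnt p n / (Nat.card F : ℝ) ^ n)]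
        refine mul_le_mul_of_nonneg_left ?_ (one_div_pos.2 (card_pow_pos _)).le
        exact Finset.sum_le_sum_of_subset_of_nonneg
          (Finset.range_subset_range.2 (Nat.sub_le _ _))
          fun n _ _ => div_nonneg (cnt_nonneg _ _) (card_pow_pos n).le

lemma highPowerSum_le (X : ℕ) :
    highPowerSum F X ≤ (1 - ((2 : ℝ) ^ (-(1 / 4) : ℝ)) ^ 2)⁻¹ * ((2 : ℝ) ^ (-(1 / 4) : ℝ)) ^ X := by
  set q : ℝ := (Nat.card F : ℝ) with hq
  have hq2 : 2 ≤ q := two_le_card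
  set r : ℝ := q ^ (-(1 / 4) : ℝ) with hr
  have hr0 : 0 < r := Real.rpow_pos_of_pos (by linarith) _
  have hr2 : r ≤ (2 : ℝ) ^ (-(1 / 4) : ℝ) :=
    Real.rpow_le_rpow_of_nonpos (by norm_num) hq2 (by norm_num)
  set s : ℝ := (2 : ℝ) ^ (-(1 / 4) : ℝ) with hs
  have hs1 : s < 1 := Real.rpow_lt_one_of_one_lt_of_neg (by norm_num) (by norm_num)
  have hs0 : 0 < s := Real.rpow_pos_of_pos (by norm_num) _
  have hrq : r ^ 4 = q⁻¹ := by
    rw [hr, ← Real.rpow_natCast, ← Real.rpow_mul (by linarith)]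
    norm_num
    rw [Real.rpow_neg_one]
  have h1 : ∀ P ∈ primeSet F X, 1 / q ^ ((X / P.natDegree + 1) * P.natDegree) ≤
      r ^ (X + 6 * P.natDegree) := by
    intro P hP
    have hP := mem_primeSet.1 hP
    set k := X / P.natDegree + 1 with hk
    have h2 : X < k * P.natDegree := (lt_mul_div_succ_natDegree hP.1).2 le_rfl
    have h3 : 2 ≤ k := by
      have : 1 ≤ X / P.natDegree := (Nat.one_le_div_iff hP.1.natDegree_pos).2 hP.2
      omega
    have h4 : X + 6 * P.natDegree ≤ 4 * (k * P.natDegree) := by nlinarith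
    rw [one_div, ← inv_pow, ← hrq, ← pow_mul]
    exact pow_le_pow_of_le_one hr0.le (hr2.trans hs1.le) h4
  calc highPowerSum F X ≤ ∑ P ∈ primeSet F X, r ^ (X + 6 * P.natDegree) := Finset.sum_le_sum h1
    _ ≤ ∑ n ∈ Finset.range X, q ^ (n + 1) / ((n : ℝ) + 1) * r ^ (X + 6 * (n + 1)) :=
        sum_primeSet_le (g := fun n => r ^ (X + 6 * n)) (fun n => (pow_pos hr0 _).le) X
    _ ≤ ∑ n ∈ Finset.range X, s ^ X * (s ^ 2) ^ n := by
        refine Finset.sum_le_sum fun n _ => ?_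
        have e : q ^ (n + 1) * r ^ (X + 6 * (n + 1)) = r ^ X * (r ^ 2) ^ (n + 1) := by
          have h5 : q ^ (n + 1) * (r ^ 4) ^ (n + 1) = 1 := by
            rw [hrq, ← mul_pow, mul_inv_cancel₀ (by linarith), one_pow]
          calc _ = (q ^ (n + 1) * (r ^ 4) ^ (n + 1)) * (r ^ X * (r ^ 2) ^ (n + 1)) := by ring
            _ = _ := by rw [h5, one_mul]
        have h6 : q ^ (n + 1) / ((n : ℝ) + 1) * r ^ (X + 6 * (n + 1)) ≤
            q ^ (n + 1) * r ^ (X + 6 * (n + 1)) := by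
          refine mul_le_mul_of_nonneg_right ?_ (by positivity)
          exact div_le_self (by positivity) (by linarith [(Nat.cast_nonneg n : (0:ℝ) ≤ n)])
        refine h6.trans (e.le.trans ?_)
        have h7 : r ^ X ≤ s ^ X := pow_le_pow_left₀ hr0.le hr2 _
        have h8 : (r ^ 2) ^ (n + 1) ≤ (s ^ 2) ^ n :=
          (pow_le_pow_left₀ (by positivity) (pow_le_pow_left₀ hr0.le hr2 2) _).trans
            (pow_le_pow_of_le_one (by positivity) (by nlinarith) (Nat.le_succ n))
        exact mul_le_mul h7 h8 (by positivity) (by positivity)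
    _ ≤ s ^ X * (1 - s ^ 2)⁻¹ := by
        rw [← Finset.mul_sum]
        refine mul_le_mul_of_nonneg_left ?_ (by positivity)
        have h9 : s ^ 2 < 1 := by nlinarith
        rw [← tsum_geometric_of_lt_one (by positivity) h9]
        exact (summable_geometric_of_lt_one (by positivity) h9).sum_le_tsum _
          fun n _ => by positivity
    _ = _ := mul_comm _ _

lemma tendsto_mul_highPowerSum : Tendsto (fun X : ℕ => (X : ℝ) * highPowerSum F X) atTop (𝓝 0) := by
  set s : ℝ := (2 : ℝ) ^ (-(1 / 4) : ℝ) with hs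
  have hs1 : s < 1 := Real.rpow_lt_one_of_one_lt_of_neg (by norm_num) (by norm_num)
  have hs0 : 0 < s := Real.rpow_pos_of_pos (by norm_num) _
  have h := (tendsto_self_mul_const_pow_of_lt_one hs0.le hs1).const_mul (1 - s ^ 2)⁻¹
  rw [mul_zero] at h
  refine squeeze_zero (fun X => mul_nonneg (Nat.cast_nonneg _) (highPowerSum_nonneg X))
    (fun X => ?_) h
  calc _ ≤ (X : ℝ) * ((1 - s ^ 2)⁻¹ * s ^ X) :=
        mul_le_mul_of_nonneg_left (highPowerSum_le X) (Nat.cast_nonneg _)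
    _ = _ := by ring

lemma tendsto_highPowerSum : Tendsto (fun X : ℕ => highPowerSum F X) atTop (𝓝 0) := by
  refine tendsto_of_tendsto_of_tendsto_of_le_of_le' tendsto_const_nhds
    (tendsto_mul_highPowerSum (F := F)) (Eventually.of_forall fun X => highPowerSum_nonneg X) ?_
  filter_upwards [eventually_ge_atTop 1] with X hX
  have : (1 : ℝ) ≤ X := by exact_mod_cast hX
  nlinarith [highPowerSum_nonneg (F := F) X]

lemma isSmooth_iff_factorsIn {X : ℕ} {D : F[X]} : IsSmooth X D ↔ FactorsIn (primeSet F X) D :=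
  ⟨fun h P hP hPD => mem_primeSet.2 ⟨hP, h P hP hPD⟩,
    fun h P hP hPD => (mem_primeSet.1 (h P hP hPD)).2⟩

lemma factorsIn_of_mul {S : Finset F[X]} {A B : F[X]} (h : FactorsIn S (A * B)) :
    FactorsIn S B := fun P hP hPB => h P hP (hPB.mul_left _)

lemma hasSum_factorsIn_inv {S : Finset F[X]} (hS : ∀ P ∈ S, IsPrimePoly P) :
    HasSum (fun n => cnt (FactorsIn S) n / (Nat.card F : ℝ) ^ n) (kap S)⁻¹ := by
  have h := hasSum_factorsIn hS (w := (Nat.card F : ℝ)⁻¹) (by positivity) (fun P hP => by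
    have := one_div_card_pow_le (hS P hP)
    rw [inv_pow, ← one_div]
    linarith)
  have e : ∏ P ∈ S, (1 - ((Nat.card F : ℝ)⁻¹) ^ P.natDegree)⁻¹ = (kap S)⁻¹ := by
    rw [kap, Finset.prod_inv_distrib]
    simp only [inv_pow, one_div]
  rw [e] at h
  simpa only [div_eq_mul_inv, inv_pow] using h

lemma hasSum_eulerCoeff (X : ℕ) :
    HasSum (fun n => (∑ D ∈ monics F n, eulerCoeff X D) / (Nat.card F : ℝ) ^ n)
      (Real.exp (harmonic X)) := by
  have h := hasSum_expConv (X := X) (l := vmLE (F := F) X) (vmLE_one X)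
    (fun A hA => by rw [vmLE, if_neg (by omega)]) (χ := fun _ => 1) (fun _ _ => by simp) rfl
    ((Nat.card F : ℂ)⁻¹)
  have hq0 : (Nat.card F : ℂ) ≠ 0 := by
    have := two_le_card (F := F)
    intro h
    have h' : (Nat.card F : ℝ) = 0 := by exact_mod_cast h
    linarith
  have e : ∑ m ∈ Finset.range (X + 1), (∑ A ∈ monics F m, ((vmLE X A : ℝ) : ℂ) * 1) *
      ((Nat.card F : ℂ)⁻¹) ^ m / m = ((harmonic X : ℝ) : ℂ) := by
    rw [Finset.sum_range_succ', harmonic]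
    simp only [monics_zero, Finset.sum_singleton, vmLE_one]
    push_cast
    simp only [zero_mul, zero_div, add_zero, mul_one]
    refine Finset.sum_congr rfl fun m hm => ?_
    rw [Finset.mem_range] at hm
    have h2 : ∑ A ∈ monics F (m + 1), ((vmLE X A : ℝ) : ℂ) = (Nat.card F : ℂ) ^ (m + 1) := by
      have h3 := sum_monics_vm (F := F) (by omega : 1 ≤ m + 1)
      rw [← Complex.ofReal_sum, Finset.sum_congr rfl (g := vm) fun A hA => ?_, h3]
      · push_cast; rfl
      · rw [vmLE, if_pos (by rw [(mem_monics.1 hA).2]; omega)]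
    rw [h2, ← mul_pow, mul_inv_cancel₀ hq0, one_pow, one_div]
  rw [e, ← Complex.ofReal_exp] at h
  rw [← Complex.hasSum_ofReal]
  convert h using 2 with n
  push_cast
  simp only [mul_one, eulerCoeff]
  rw [inv_pow, div_eq_mul_inv]

lemma sum_eulerCoeff_le_cnt (X n : ℕ) :
    ∑ D ∈ monics F n, eulerCoeff X D ≤ cnt (FactorsIn (primeSet F X)) n := by
  classical
  rw [cnt_eq_sum]
  refine Finset.sum_le_sum fun D hD => ?_
  have hm := (mem_monics.1 hD).1
  split_ifs with h
  · exact eulerCoeff_le_one X hm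
  · by_contra hne
    exact h (isSmooth_iff_factorsIn.1 (isSmooth_of_eulerCoeff_ne_zero hm
      (fun h0 => hne (h0 ▸ le_rfl))))

lemma cnt_sub_le_sum_eulerCoeff (X n : ℕ) :
    cnt (FactorsIn (primeSet F X)) n -
      cnt (fun D => FactorsIn (primeSet F X) D ∧ HasHighPower X D) n ≤
      ∑ D ∈ monics F n, eulerCoeff X D := by
  classical
  rw [cnt_eq_sum, cnt_eq_sum, ← Finset.sum_sub_distrib]
  refine Finset.sum_le_sum fun D hD => ?_
  have hm := (mem_monics.1 hD).1
  have h0 := eulerCoeff_nonneg X hm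
  by_cases h1 : FactorsIn (primeSet F X) D
  · by_cases h2 : HasHighPower X D
    · simpa [h1, h2] using h0
    · simp [h1, h2, eulerCoeff_eq_one hm (isSmooth_iff_factorsIn.2 h1) h2]
  · simpa [h1] using h0

/-- Mertens' theorem. -/
lemma tendsto_kap_primeSet :
    Tendsto (fun X : ℕ => kap (primeSet F X) * (Real.exp Real.eulerMascheroniConstant * X))
      atTop (𝓝 1) := by
  have hS : ∀ X, ∀ P ∈ primeSet F X, IsPrimePoly P := fun X P hP => (mem_primeSet.1 hP).1
  have up : ∀ X, Real.exp (harmonic X) ≤ (kap (primeSet F X))⁻¹ := fun X =>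
    hasSum_le (fun n => div_le_div_of_nonneg_right (sum_eulerCoeff_le_cnt X n)
      (card_pow_pos n).le) (hasSum_eulerCoeff X) (hasSum_factorsIn_inv (hS X))
  have low : ∀ X, (1 - highPowerSum F X) * (kap (primeSet F X))⁻¹ ≤ Real.exp (harmonic X) := by
    intro X
    have h1 := (hasSum_factorsIn_inv (hS X)).tendsto_sum_nat
    have h2 := (hasSum_eulerCoeff (F := F) X).tendsto_sum_nat
    refine le_of_tendsto_of_tendsto' (h1.const_mul (1 - highPowerSum F X)) h2 fun N => ?_
    have h3 := sum_cnt_highPower_le (p := FactorsIn (primeSet F X))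
      (fun A B h => factorsIn_of_mul h) X N
    rw [sub_mul, one_mul]
    have h4 : ∑ n ∈ Finset.range N, cnt (FactorsIn (primeSet F X)) n / (Nat.card F : ℝ) ^ n -
        ∑ n ∈ Finset.range N, cnt (fun D => FactorsIn (primeSet F X) D ∧ HasHighPower X D) n /
          (Nat.card F : ℝ) ^ n ≤
        ∑ n ∈ Finset.range N, (∑ D ∈ monics F n, eulerCoeff X D) / (Nat.card F : ℝ) ^ n := by
      rw [← Finset.sum_sub_distrib]
      refine Finset.sum_le_sum fun n _ => ?_
      rw [← sub_div]
      exact div_le_div_of_nonneg_right (cnt_sub_le_sum_eulerCoeff X n) (card_pow_pos n).le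
    linarith
  have hlim : Tendsto (fun X : ℕ => Real.exp (Real.eulerMascheroniConstant -
      ((harmonic X : ℝ) - Real.log X))) atTop (𝓝 1) := by
    have := (Real.tendsto_harmonic_sub_log.const_sub Real.eulerMascheroniConstant).rexp
    simpa using this
  have hlow := (tendsto_highPowerSum (F := F)).const_sub 1 |>.mul hlim
  rw [sub_zero, mul_one] at hlow
  refine tendsto_of_tendsto_of_tendsto_of_le_of_le' hlow hlim ?_ ?_
  all_goals
    filter_upwards [eventually_ge_atTop 1] with X hX
    have hX0 : (0 : ℝ) < X := by exact_mod_cast hX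
    have hk := kap_pos (hS X)
    have e : Real.exp (Real.eulerMascheroniConstant - ((harmonic X : ℝ) - Real.log X)) =
        (Real.exp (harmonic X))⁻¹ * (Real.exp Real.eulerMascheroniConstant * X) := by
      rw [show Real.eulerMascheroniConstant - ((harmonic X : ℝ) - Real.log X) =
        -(harmonic X : ℝ) + (Real.eulerMascheroniConstant + Real.log X) by ring, Real.exp_add,
        Real.exp_add, Real.exp_log hX0, Real.exp_neg]
    rw [e]
    have he := Real.exp_pos (harmonic X)
    have hg : 0 < Real.exp Real.eulerMascheroniConstant * X := by positivity
  · rw [← mul_assoc]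
    refine mul_le_mul_of_nonneg_right ?_ hg.le
    have := low X
    rw [← div_eq_mul_inv, div_le_iff₀ hk] at this
    rw [← div_eq_mul_inv, div_le_iff₀ he]
    linarith
  · refine mul_le_mul_of_nonneg_right ?_ hg.le
    exact (le_inv_comm₀ he hk).1 (up X)

/-! Residues and characters. -/

lemma finite_quot {R : F[X]} (hR : R.Monic) : Finite (F[X] ⧸ Ideal.span {R}) := by
  have : Module.Finite F (F[X] ⧸ Ideal.span {R}) := (AdjoinRoot.powerBasis' hR).finite
  exact Module.finite_of_finite F

lemma card_quot {R : F[X]} (hR : R.Monic) :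
    Nat.card (F[X] ⧸ Ideal.span {R}) = Nat.card F ^ R.natDegree := by
  have : Module.Finite F (F[X] ⧸ Ideal.span {R}) := (AdjoinRoot.powerBasis' hR).finite
  rw [Module.natCard_eq_pow_finrank (K := F)]
  congr 1
  have h := (AdjoinRoot.powerBasis' hR).finrank
  rwa [AdjoinRoot.powerBasis'_dim] at h

lemma mk_eq_mk {R A B : F[X]} :
    Ideal.Quotient.mk (Ideal.span {R}) A = Ideal.Quotient.mk (Ideal.span {R}) B ↔ R ∣ A - B := by
  rw [Ideal.Quotient.eq, Ideal.mem_span_singleton]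

lemma isUnit_mk {R A : F[X]} :
    IsUnit (Ideal.Quotient.mk (Ideal.span {R}) A) ↔ IsCoprime A R := by
  constructor
  · intro h
    obtain ⟨b, hb⟩ := h.exists_right_inv
    obtain ⟨B, rfl⟩ := Ideal.Quotient.mk_surjective b
    rw [← map_mul, ← map_one (Ideal.Quotient.mk _), mk_eq_mk] at hb
    obtain ⟨C, hC⟩ := hb
    exact ⟨B, -C, by linear_combination hC⟩
  · rintro ⟨a, b, h⟩
    refine IsUnit.of_mul_eq_one (Ideal.Quotient.mk _ a) ?_
    rw [← map_mul, ← map_one (Ideal.Quotient.mk _), mk_eq_mk]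
    exact ⟨-b, by linear_combination h⟩

lemma isCoprime_iff {A R : F[X]} (hR : R.Monic) :
    IsCoprime A R ↔ ∀ P, IsPrimePoly P → P ∣ R → ¬ P ∣ A := by
  constructor
  · intro h P hP hPR hPA
    exact hP.2.not_isUnit (h.isUnit_of_dvd' hPA hPR)
  · intro h
    refine isCoprime_of_irreducible_dvd (fun h0 => hR.ne_zero h0.2) fun z hz hzA hzR => ?_
    obtain ⟨P, hP, hd⟩ := Polynomial.exists_monic_irreducible_factor z hz.not_isUnit
    exact h P ⟨hP, hd.1⟩ (hd.2.trans hzR) (hd.2.trans hzA)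

lemma val_mul {R : F[X]} (χ : DirChar R) (A B : F[X]) : χ.val (A * B) = χ.val A * χ.val B := by
  simp [DirChar.val]

lemma val_one {R : F[X]} (χ : DirChar R) : χ.val 1 = 1 := by
  simp [DirChar.val]

lemma val_eq_zero {R : F[X]} (χ : DirChar R) {A : F[X]} (h : ¬ IsCoprime A R) : χ.val A = 0 :=
  χ.map_nonunit (fun h' => h (isUnit_mk.1 h'))

lemma val_congr {R : F[X]} (χ : DirChar R) {A B : F[X]} (h : R ∣ A - B) : χ.val A = χ.val B := by
  rw [DirChar.val, DirChar.val, mk_eq_mk.2 h]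

lemma norm_apply_units {R : F[X]} (hR : R.Monic) (χ : DirChar R)
    (a : (F[X] ⧸ Ideal.span {R})ˣ) : ‖χ a‖ = 1 := by
  have := finite_quot hR
  have h : χ a ^ Nat.card (F[X] ⧸ Ideal.span {R})ˣ = 1 := by
    rw [← map_pow, ← Units.val_pow_eq_pow_val, pow_card_eq_one']
    simp
  exact Complex.norm_eq_one_of_pow_eq_one h Nat.card_pos.ne'

lemma norm_val {R : F[X]} (hR : R.Monic) (χ : DirChar R) {A : F[X]} (h : IsCoprime A R) :
    ‖χ.val A‖ = 1 := by
  obtain ⟨a, ha⟩ := isUnit_mk.2 h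
  rw [DirChar.val, ← ha, norm_apply_units hR]

lemma norm_val_le {R : F[X]} (hR : R.Monic) (χ : DirChar R) (A : F[X]) : ‖χ.val A‖ ≤ 1 := by
  by_cases h : IsCoprime A R
  · exact (norm_val hR χ h).le
  · rw [val_eq_zero χ h]; simp

/-- The units of the residue ring modulo `R` that are `1` modulo the divisor `K` of `R`. -/
def unitKer (R K : F[X]) : Subgroup (F[X] ⧸ Ideal.span {R})ˣ :=
  (Units.map (Ideal.Quotient.mk
    (Ideal.span {Ideal.Quotient.mk (Ideal.span {R}) K})).toMonoidHom).ker

lemma mem_unitKer {R K : F[X]} (hK : K ∣ R) {u : (F[X] ⧸ Ideal.span {R})ˣ} {A : F[X]}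
    (hA : (u : F[X] ⧸ Ideal.span {R}) = Ideal.Quotient.mk _ A) :
    u ∈ unitKer R K ↔ K ∣ A - 1 := by
  rw [unitKer, MonoidHom.mem_ker, Units.ext_iff]
  simp only [RingHom.toMonoidHom_eq_coe, Units.coe_map, MonoidHom.coe_coe, Units.val_one, hA]
  rw [← map_one (Ideal.Quotient.mk (Ideal.span {Ideal.Quotient.mk (Ideal.span {R}) K})),
    Ideal.Quotient.eq, Ideal.mem_span_singleton, ← map_one (Ideal.Quotient.mk (Ideal.span {R})),
    ← map_sub]
  constructor
  · rintro ⟨c, hc⟩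
    obtain ⟨C, rfl⟩ := Ideal.Quotient.mk_surjective c
    rw [← map_mul, mk_eq_mk] at hc
    have := dvd_add (hK.trans hc) (dvd_mul_right K C)
    rwa [sub_add_cancel] at this
  · intro h
    exact map_dvd _ h

lemma exists_rep {R : F[X]} (u : (F[X] ⧸ Ideal.span {R})ˣ) :
    ∃ A : F[X], (u : F[X] ⧸ Ideal.span {R}) = Ideal.Quotient.mk _ A ∧ IsCoprime A R := by
  obtain ⟨A, hA⟩ := Ideal.Quotient.mk_surjective (u : F[X] ⧸ Ideal.span {R})
  exact ⟨A, hA.symm, isUnit_mk.1 (hA ▸ u.isUnit)⟩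

lemma unitKer_anti {R K K' : F[X]} (hK : K ∣ R) (h : K' ∣ K) : unitKer R K ≤ unitKer R K' := by
  intro u hu
  obtain ⟨A, hA, -⟩ := exists_rep u
  rw [mem_unitKer (h.trans hK) hA]
  exact h.trans ((mem_unitKer hK hA).1 hu)

/-- `χ` is trivial on the subgroup `H`. -/
def TrivialOn {R : F[X]} (χ : DirChar R) (H : Subgroup (F[X] ⧸ Ideal.span {R})ˣ) : Prop :=
  ∀ u ∈ H, χ (u : F[X] ⧸ Ideal.span {R}) = 1

lemma exists_extension_of_ker_le {G G' : Type*} [CommGroup G] [CommGroup G'] [Finite G']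
    (f : G →* G') (χ : G →* ℂˣ) (h : f.ker ≤ χ.ker) : ∃ ψ : G' →* ℂˣ, ∀ a, ψ (f a) = χ a := by
  set g : f.range →* ℂˣ := (QuotientGroup.lift f.ker χ h).comp
    (QuotientGroup.quotientKerEquivRange f).symm.toMonoidHom with hg
  obtain ⟨ψ, hψ⟩ := MonoidHom.domRestrict_surjective ℂ f.range g
  refine ⟨ψ, fun a => ?_⟩
  have h2 : ψ (f a) = g ⟨f a, a, rfl⟩ := by
    rw [← hψ]; rfl
  have h3 : (QuotientGroup.quotientKerEquivRange f).symm ⟨f a, a, rfl⟩ =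
      (QuotientGroup.mk a : _ ⧸ f.ker) := by
    rw [MulEquiv.symm_apply_eq]; rfl
  rw [h2, hg]
  simp only [MulEquiv.toMonoidHom_eq_coe, MonoidHom.coe_comp, MonoidHom.coe_coe,
    Function.comp_apply, h3]
  rfl

lemma exists_mulChar_extension {M M' : Type*} [CommMonoid M] [CommMonoid M'] [Finite M']
    (f : M →* M') (χ : MulChar M ℂ) (h : ∀ u : Mˣ, f u = 1 → χ u = 1) :
    ∃ ψ : MulChar M' ℂ, ∀ a : M, IsUnit a → χ a = ψ (f a) := by
  obtain ⟨ψ, hψ⟩ := exists_extension_of_ker_le (Units.map f) χ.toUnitHom (fun u hu => by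
    rw [MonoidHom.mem_ker, Units.ext_iff] at hu ⊢
    rw [MulChar.coe_toUnitHom, Units.val_one]
    exact h u hu)
  refine ⟨MulChar.ofUnitHom ψ, ?_⟩
  rintro _ ⟨u, rfl⟩
  have h1 : f (u : M) = ((Units.map f u : M'ˣ) : M') := rfl
  rw [h1, MulChar.ofUnitHom_coe, ← MulChar.coe_toUnitHom, hψ]

lemma isInducedModulus_of_trivialOn {R K : F[X]} (hR : R.Monic) (hKm : K.Monic) (hK : K ∣ R)
    (χ : DirChar R) (h : TrivialOn χ (unitKer R K)) : IsInducedModulus χ K := by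
  refine ⟨hKm, hK, ?_⟩
  have := finite_quot hR
  have := finite_quot hKm
  have hle : Ideal.span {R} ≤ Ideal.span {K} := by
    rw [Ideal.span_singleton_le_span_singleton]; exact hK
  obtain ⟨ψ, hψ⟩ := exists_mulChar_extension
    (Ideal.Quotient.factor hle : _ →* F[X] ⧸ Ideal.span {K}) χ (fun u hu => by
      obtain ⟨A, hA, -⟩ := exists_rep u
      refine h u ((mem_unitKer hK hA).2 ?_)
      rw [hA] at hu
      simp only [MonoidHom.coe_coe, Ideal.Quotient.factor_mk] at hu
      rwa [← map_one (Ideal.Quotient.mk _), mk_eq_mk] at hu)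
  exact ⟨ψ, fun A hA => hψ _ (isUnit_mk.2 hA)⟩

lemma natDegree_pos_of_ne_one {R : F[X]} (hR : R.Monic) (h1 : R ≠ 1) : 0 < R.natDegree := by
  rw [Nat.pos_iff_ne_zero]
  exact fun h => h1 (hR.natDegree_eq_zero.1 h)

lemma mul_divByMonic_self {R P : F[X]} (hP : P.Monic) (h : P ∣ R) : P * (R /ₘ P) = R := by
  obtain ⟨K, rfl⟩ := h
  rw [Polynomial.mul_divByMonic_cancel_left _ hP]

lemma monic_divByMonic {R P : F[X]} (hR : R.Monic) (hP : P.Monic) (h : P ∣ R) :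
    (R /ₘ P).Monic :=
  hP.of_mul_monic_left (by rwa [mul_divByMonic_self hP h])

lemma divByMonic_dvd {R P : F[X]} (hP : P.Monic) (h : P ∣ R) : R /ₘ P ∣ R :=
  ⟨P, by rw [mul_comm, mul_divByMonic_self hP h]⟩

lemma isPrimitive_iff {R : F[X]} (hR : R.Monic) (χ : DirChar R) :
    IsPrimitive χ ↔ ∀ P, IsPrimePoly P → P ∣ R → ¬ TrivialOn χ (unitKer R (R /ₘ P)) := by
  constructor
  · intro h P hP hPR htriv
    refine h _ (isInducedModulus_of_trivialOn hR (monic_divByMonic hR hP.1 hPR)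
      (divByMonic_dvd hP.1 hPR) χ htriv) ?_
    conv_rhs => rw [← mul_divByMonic_self hP.1 hPR]
    rw [hP.1.natDegree_mul (monic_divByMonic hR hP.1 hPR)]
    have := hP.natDegree_pos
    omega
  · intro h S ⟨hS, ⟨T, hT⟩, χ₁, hχ⟩ hdeg
    have hTm : T.Monic := hS.of_mul_monic_left (hT ▸ hR)
    have hT1 : T ≠ 1 := by
      rintro rfl
      rw [hT, mul_one] at hdeg
      exact lt_irrefl _ hdeg
    obtain ⟨P, hP, T', rfl⟩ := exists_isPrimePoly_dvd hTm hT1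
    have hPR : P ∣ R := ⟨S * T', by rw [hT]; ring⟩
    refine h P hP hPR fun u hu => ?_
    obtain ⟨A, hA, hAc⟩ := exists_rep u
    have h1 : R /ₘ P = S * T' := by
      rw [hT, show S * (P * T') = P * (S * T') by ring,
        Polynomial.mul_divByMonic_cancel_left _ hP.1]
    rw [mem_unitKer (divByMonic_dvd hP.1 hPR) hA, h1] at hu
    have h2 := hχ A hAc
    rw [DirChar.val, ← hA] at h2
    rw [h2, val_congr χ₁ (B := 1) ((dvd_mul_right S T').trans hu), val_one]

/-- The prime factors of `R`. -/
def primesOf (R : F[X]) : Finset F[X] :=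
  open Classical in (primeSet F R.natDegree).filter fun P => P ∣ R

lemma mem_primesOf {R : F[X]} (hR : R.Monic) {P : F[X]} :
    P ∈ primesOf R ↔ IsPrimePoly P ∧ P ∣ R := by
  simp only [primesOf, Finset.mem_filter, mem_primeSet]
  exact ⟨fun h => ⟨h.1.1, h.2⟩, fun h => ⟨⟨h.1, natDegree_le_of_dvd h.2 hR.ne_zero⟩, h.2⟩⟩

lemma isPrime_of_mem_primesOf {R : F[X]} {P : F[X]} (h : P ∈ primesOf R) : IsPrimePoly P := by
  simp only [primesOf, Finset.mem_filter, mem_primeSet] at h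
  exact h.1.1

lemma dvd_of_mem_primesOf {R : F[X]} {P : F[X]} (h : P ∈ primesOf R) : P ∣ R := by
  simp only [primesOf, Finset.mem_filter, mem_primeSet] at h
  exact h.2

lemma isCoprime_iff_avoids {A R : F[X]} (hR : R.Monic) :
    IsCoprime A R ↔ Avoids (primesOf R) A := by
  rw [isCoprime_iff hR]
  exact ⟨fun h P hP => h P (isPrime_of_mem_primesOf hP) (dvd_of_mem_primesOf hP),
    fun h P hP hPR => h P ((mem_primesOf hR).2 ⟨hP, hPR⟩)⟩

lemma prod_dvd_of_primes {S : Finset F[X]} (hS : ∀ P ∈ S, IsPrimePoly P) {R : F[X]}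
    (h : ∀ P ∈ S, P ∣ R) : ∏ P ∈ S, P ∣ R := by
  refine Finset.prod_dvd_of_isRelPrime (fun P hP Q hQ hPQ => ?_) h
  refine (IsCoprime.isRelPrime ?_)
  exact (hS P hP).2.coprime_iff_not_dvd.2 fun hd => hPQ ((hS P hP).eq_of_dvd (hS Q hQ) hd)

lemma sum_natDegree_primesOf_le {R : F[X]} (hR : R.Monic) :
    ∑ P ∈ primesOf R, P.natDegree ≤ R.natDegree := by
  rw [← natDegree_prod_of_monic _ _ fun P hP => (isPrime_of_mem_primesOf hP).1]
  exact natDegree_le_of_dvd (prod_dvd_of_primes (fun P hP => isPrime_of_mem_primesOf hP)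
    fun P hP => dvd_of_mem_primesOf hP) hR.ne_zero

/-- The number of reduced residues is at least `|R| ∏ (1 - 1 / |P|)`. -/
lemma le_card_units {R : F[X]} (hR : R.Monic) :
    (Nat.card F : ℝ) ^ R.natDegree * kap (primesOf R) ≤
      Nat.card (F[X] ⧸ Ideal.span {R})ˣ := by
  classical
  have := finite_quot hR
  rw [← dens_eq_kap (fun P hP => isPrime_of_mem_primesOf hP) (sum_natDegree_primesOf_le hR), dens,
    mul_div_cancel₀ _ (card_pow_pos _).ne', cnt_eq_card, Nat.cast_le]
  have hu : ∀ A : {A // A ∈ (monics F R.natDegree).filter (Avoids (primesOf R))},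
      IsUnit (Ideal.Quotient.mk (Ideal.span {R}) A.1) := fun A =>
    isUnit_mk.2 ((isCoprime_iff_avoids hR).2 (Finset.mem_filter.1 A.2).2)
  have hinj : Function.Injective (fun A => (hu A).unit) := by
    intro A B h
    have h1 : Ideal.Quotient.mk (Ideal.span {R}) A.1 = Ideal.Quotient.mk (Ideal.span {R}) B.1 :=
      congrArg Units.val h
    rw [mk_eq_mk] at h1
    have hA := mem_monics.1 (Finset.mem_filter.1 A.2).1
    have hB := mem_monics.1 (Finset.mem_filter.1 B.2).1
    refine Subtype.ext (sub_eq_zero.1 (eq_zero_of_dvd_of_degree_lt h1 ?_))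
    refine (degree_sub_lt_left ?_ hA.1.ne_zero ?_).trans_eq ?_
    · rw [degree_eq_natDegree hA.1.ne_zero, degree_eq_natDegree hB.1.ne_zero, hA.2, hB.2]
    · rw [hA.1.leadingCoeff, hB.1.leadingCoeff]
    · rw [degree_eq_natDegree hA.1.ne_zero, degree_eq_natDegree hR.ne_zero, hA.2]
  have := Nat.card_le_card_of_injective _ hinj
  rwa [Nat.card_eq_fintype_card, Fintype.card_coe] at this

lemma half_pow_le_kap {S : Finset F[X]} (hS : ∀ P ∈ S, IsPrimePoly P) :
    (1 / 2 : ℝ) ^ S.card ≤ kap S := by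
  rw [kap, ← Finset.prod_const]
  exact Finset.prod_le_prod (fun _ _ => by norm_num) fun P hP => by
    linarith [one_div_card_pow_le (hS P hP)]

lemma finite_degreeLT (n : ℕ) : (degreeLT F n : Set F[X]).Finite := by
  have : Finite (degreeLT F n) := Finite.of_equiv _ (degreeLTEquiv F n).toEquiv.symm
  exact Set.toFinite _

/-- The polynomials of degree less than `n`. -/
def polysLT (F : Type*) [Field F] [Finite F] (n : ℕ) : Finset F[X] :=
  (finite_degreeLT (F := F) n).toFinset

lemma mem_polysLT {n : ℕ} {A : F[X]} : A ∈ polysLT F n ↔ A.degree < n := by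
  rw [polysLT, Set.Finite.mem_toFinset, SetLike.mem_coe, mem_degreeLT]

lemma card_polysLT (n : ℕ) : (polysLT F n).card = Nat.card F ^ n := by
  have := Fintype.ofFinite F
  rw [polysLT, ← Nat.card_eq_card_finite_toFinset]
  have h : Nat.card (degreeLT F n : Set F[X]) = Nat.card (Fin n → F) :=
    Nat.card_congr (degreeLTEquiv F n).toEquiv
  rw [h]
  simp

lemma card_sup_of_disjoint {G : Type*} [CommGroup G] [Finite G] {H K : Subgroup G}
    (h : Disjoint H K) : Nat.card (H ⊔ K : Subgroup G) = Nat.card H * Nat.card K := by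
  rw [← Nat.card_prod]
  symm
  refine Nat.card_congr (Equiv.ofBijective
    (fun g : H × K => (⟨g.1 * g.2, Subgroup.mul_mem_sup g.1.2 g.2.2⟩ : (H ⊔ K : Subgroup G)))
    ⟨fun x y hxy => Subgroup.mul_injective_of_disjoint h (congrArg Subtype.val hxy), ?_⟩)
  rintro ⟨g, hg⟩
  obtain ⟨y, hy, z, hz, rfl⟩ := Subgroup.mem_sup.1 hg
  exact ⟨⟨⟨y, hy⟩, ⟨z, hz⟩⟩, rfl⟩

lemma card_sup_units {M : Type*} [CommRing M] [Finite M] {H K : Subgroup Mˣ}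
    (h : Disjoint H K) : Nat.card (H ⊔ K : Subgroup Mˣ) = Nat.card H * Nat.card K :=
  card_sup_of_disjoint h

/-- The subgroup generated by the kernels belonging to the primes in `S`. -/
def kerSup (R : F[X]) (S : Finset F[X]) : Subgroup (F[X] ⧸ Ideal.span {R})ˣ :=
  S.sup fun P => unitKer R (R /ₘ P)

lemma disjoint_kerSup {R : F[X]} (hR : R.Monic) {S : Finset F[X]} (hS : S ⊆ primesOf R) {P : F[X]}
    (hP : P ∈ primesOf R) (hPS : P ∉ S) :
    Disjoint (unitKer R (R /ₘ P)) (kerSup R S) := by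
  have hPp := isPrime_of_mem_primesOf hP
  have hPR := dvd_of_mem_primesOf hP
  obtain ⟨M, hRM, hM⟩ := (FiniteMultiplicity.of_prime_left hPp.prime hR.ne_zero).exists_eq_pow_mul_and_not_dvd
  set v := multiplicity P R with hvdef
  clear_value v
  have hv : v ≠ 0 := by
    rintro rfl
    rw [pow_zero, one_mul] at hRM
    exact hM (hRM ▸ hPR)
  have hcop : ∀ k, IsCoprime (P ^ k) M := fun k =>
    (hPp.2.coprime_iff_not_dvd.2 hM).pow_left
  have h1 : kerSup R S ≤ unitKer R (P ^ v) := by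
    refine Finset.sup_le fun Q hQ => ?_
    have hQp := isPrime_of_mem_primesOf (hS hQ)
    have hQR := dvd_of_mem_primesOf (hS hQ)
    refine unitKer_anti (divByMonic_dvd hQp.1 hQR) ?_
    have h2 : P ^ v ∣ Q * (R /ₘ Q) := by
      rw [mul_divByMonic_self hQp.1 hQR, hRM]; exact dvd_mul_right _ _
    refine IsCoprime.dvd_of_dvd_mul_left ?_ h2
    refine IsCoprime.pow_left (hPp.2.coprime_iff_not_dvd.2 fun hd => ?_)
    exact hPS ((hPp.eq_of_dvd hQp hd) ▸ hQ)
  rw [Subgroup.disjoint_def]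
  intro u hu hu'
  obtain ⟨A, hA, -⟩ := exists_rep u
  have h3 := (mem_unitKer (divByMonic_dvd hPp.1 hPR) hA).1 hu
  have h4 := (mem_unitKer (K := P ^ v) ⟨M, hRM⟩ hA).1 (h1 hu')
  have h5 : M ∣ R /ₘ P := by
    obtain ⟨w, rfl⟩ := Nat.exists_eq_succ_of_ne_zero hv
    refine ⟨P ^ w, ?_⟩
    rw [hRM, pow_succ', mul_assoc, Polynomial.mul_divByMonic_cancel_left _ hPp.1, mul_comm]
  have h6 : R ∣ A - 1 := by
    rw [hRM]
    exact (hcop v).mul_dvd h4 (h5.trans h3)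
  rw [Units.ext_iff, hA, Units.val_one, ← map_one (Ideal.Quotient.mk _), mk_eq_mk]
  exact h6

open Classical in
lemma kerSup_insert (R : F[X]) (S : Finset F[X]) (P : F[X]) :
    kerSup R (insert P S) = unitKer R (R /ₘ P) ⊔ kerSup R S := Finset.sup_insert

lemma card_kerSup {R : F[X]} (hR : R.Monic) {S : Finset F[X]} (hS : S ⊆ primesOf R) :
    Nat.card (kerSup R S) = ∏ P ∈ S, Nat.card (unitKer R (R /ₘ P)) := by
  classical
  have := finite_quot hR
  induction S using Finset.induction_on with
  | empty => simp [kerSup]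
  | insert P S hPS ih =>
    rw [Finset.insert_subset_iff] at hS
    rw [kerSup_insert, card_sup_units (disjoint_kerSup hR hS.2 hS.1 hPS), ih hS.2,
      Finset.prod_insert hPS]

lemma kerSup_le {R : F[X]} (hR : R.Monic) {S : Finset F[X]} (hS : S ⊆ primesOf R) :
    kerSup R S ≤ unitKer R (R /ₘ ∏ P ∈ S, P) := by
  classical
  have hp : ∏ P ∈ S, P ∣ R := prod_dvd_of_primes (fun P hP => isPrime_of_mem_primesOf (hS hP))
    fun P hP => dvd_of_mem_primesOf (hS hP)
  have hpm : (∏ P ∈ S, P).Monic :=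
    monic_prod_of_monic _ _ fun P hP => (isPrime_of_mem_primesOf (hS hP)).1
  refine Finset.sup_le fun P hP => ?_
  have hPm := (isPrime_of_mem_primesOf (hS hP)).1
  have hPR := dvd_of_mem_primesOf (hS hP)
  refine unitKer_anti (divByMonic_dvd hPm hPR) ⟨∏ Q ∈ S.erase P, Q, ?_⟩
  refine mul_left_cancel₀ hPm.ne_zero ?_
  rw [mul_divByMonic_self hPm hPR]
  calc R = (∏ P ∈ S, P) * (R /ₘ ∏ P ∈ S, P) := (mul_divByMonic_self hpm hp).symm
    _ = (P * ∏ Q ∈ S.erase P, Q) * (R /ₘ ∏ P ∈ S, P) := by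
        rw [Finset.mul_prod_erase S (fun Q => Q) hP]
    _ = _ := by ring

lemma half_norm_le_card_unitKer {R : F[X]} (hR : R.Monic) {P : F[X]} (hP : P ∈ primesOf R) :
    (Nat.card F : ℝ) ^ P.natDegree / 2 ≤ Nat.card (unitKer R (R /ₘ P)) := by
  classical
  have := finite_quot hR
  have hPp := isPrime_of_mem_primesOf hP
  have hPR := dvd_of_mem_primesOf hP
  set K := R /ₘ P with hK
  have hRK : P * K = R := mul_divByMonic_self hPp.1 hPR
  have hKm : K.Monic := monic_divByMonic hR hPp.1 hPR
  have hKR : K ∣ R := divByMonic_dvd hPp.1 hPR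
  set T := (polysLT F P.natDegree).filter fun C => IsCoprime (1 + K * C) R with hT
  have key : ∀ C C' : F[X], C ∈ polysLT F P.natDegree → C' ∈ polysLT F P.natDegree →
      P ∣ C - C' → C = C' := by
    intro C C' hC hC' h
    rw [mem_polysLT] at hC hC'
    refine sub_eq_zero.1 (eq_zero_of_dvd_of_degree_lt h ?_)
    rw [degree_eq_natDegree hPp.1.ne_zero]
    exact (degree_sub_le _ _).trans_lt (max_lt hC hC')
  have hnot : ((polysLT F P.natDegree).filter fun C => ¬ IsCoprime (1 + K * C) R).card ≤ 1 := by
    rw [Finset.card_le_one]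
    have hd : ∀ C, ¬ IsCoprime (1 + K * C) R → P ∣ 1 + K * C := by
      intro C hC
      rw [isCoprime_iff hR] at hC
      push Not at hC
      obtain ⟨Q, hQ, hQR, hQC⟩ := hC
      rw [← hRK] at hQR
      rcases hQ.prime.dvd_or_dvd hQR with h | h
      · rwa [← hQ.eq_of_dvd hPp h]
      · exact absurd (isUnit_of_dvd_one ((dvd_add_left (h.mul_right C)).1 hQC)) hQ.2.not_isUnit
    intro C hC C' hC'
    rw [Finset.mem_filter] at hC hC'
    have h1 := hd C hC.2
    have h2 := hd C' hC'.2
    have h3 : P ∣ K * (C - C') := by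
      have := dvd_sub h1 h2
      rwa [show 1 + K * C - (1 + K * C') = K * (C - C') by ring] at this
    have hPK : ¬ P ∣ K := fun h =>
      hPp.2.not_isUnit (isUnit_of_dvd_one ((dvd_add_left (h.mul_right C)).1 h1))
    exact key C C' hC.1 hC'.1 ((hPp.prime.dvd_or_dvd h3).resolve_left hPK)
  have hTcard : (Nat.card F : ℝ) ^ P.natDegree - 1 ≤ T.card := by
    have := Finset.card_filter_add_card_filter_not (s := polysLT F P.natDegree)
      (fun C => IsCoprime (1 + K * C) R)
    rw [card_polysLT] at this
    have h2 : Nat.card F ^ P.natDegree ≤ T.card + 1 := by rw [hT]; omega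
    have h3 : ((Nat.card F ^ P.natDegree : ℕ) : ℝ) ≤ ((T.card + 1 : ℕ) : ℝ) := Nat.cast_le.2 h2
    push_cast at h3
    linarith
  have hu : ∀ C : {C // C ∈ T}, IsUnit (Ideal.Quotient.mk (Ideal.span {R}) (1 + K * C.1)) :=
    fun C => isUnit_mk.2 (Finset.mem_filter.1 C.2).2
  have hinj : Function.Injective (fun C : {C // C ∈ T} =>
      (⟨(hu C).unit, (mem_unitKer hKR (A := 1 + K * C.1) rfl).2 (by simp)⟩ : unitKer R K)) := by
    intro C C' h
    have h1 : Ideal.Quotient.mk (Ideal.span {R}) (1 + K * C.1) =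
        Ideal.Quotient.mk (Ideal.span {R}) (1 + K * C'.1) :=
      congrArg (fun u => (Units.val (Subtype.val u))) h
    rw [mk_eq_mk, show 1 + K * C.1 - (1 + K * C'.1) = K * (C.1 - C'.1) by ring, ← hRK,
      mul_comm P] at h1
    exact Subtype.ext (key _ _ (Finset.mem_filter.1 C.2).1 (Finset.mem_filter.1 C'.2).1
      ((mul_dvd_mul_iff_left hKm.ne_zero).1 h1))
  have hle := Nat.card_le_card_of_injective _ hinj
  rw [Nat.card_eq_fintype_card, Fintype.card_coe] at hle
  have hle' : (T.card : ℝ) ≤ Nat.card (unitKer R K) := Nat.cast_le.2 hle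
  have := one_div_card_pow_le hPp
  rw [div_le_div_iff₀ (card_pow_pos _) (by norm_num)] at this
  linarith

/-- The finite set of primitive characters. -/
def primSet {R : F[X]} (hR : R.Monic) : Finset (DirChar R) :=
  have := finite_quot hR
  (Set.toFinite {χ : DirChar R | IsPrimitive χ}).toFinset

lemma mem_primSet {R : F[X]} (hR : R.Monic) {χ : DirChar R} : χ ∈ primSet hR ↔ IsPrimitive χ := by
  simp [primSet]

lemma phiStar_eq {R : F[X]} (hR : R.Monic) : phiStar R = (primSet hR).card := by
  have := finite_quot hR
  rw [phiStar, primSet, Set.ncard_eq_toFinset_card]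

lemma primAvg_eq {R : F[X]} (hR : R.Monic) (f : DirChar R → ℝ) :
    primAvg R f = (1 / ((primSet hR).card : ℝ)) * ∑ χ ∈ primSet hR, f χ := by
  have := finite_quot hR
  rw [primAvg, phiStar_eq hR, primSet, finsum_mem_eq_finite_toFinset_sum]

/-- The characters trivial on `H`. -/
def trivSet {R : F[X]} (hR : R.Monic) (H : Subgroup (F[X] ⧸ Ideal.span {R})ˣ) :
    Finset (DirChar R) :=
  have := finite_quot hR
  (Set.toFinite {χ : DirChar R | TrivialOn χ H}).toFinset

lemma mem_trivSet {R : F[X]} (hR : R.Monic) {H : Subgroup (F[X] ⧸ Ideal.span {R})ˣ}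
    {χ : DirChar R} : χ ∈ trivSet hR H ↔ TrivialOn χ H := by
  simp [trivSet]

lemma card_trivSet {R : F[X]} (hR : R.Monic) (H : Subgroup (F[X] ⧸ Ideal.span {R})ˣ) :
    (trivSet hR H).card * Nat.card H = Nat.card (F[X] ⧸ Ideal.span {R})ˣ := by
  have := finite_quot hR
  rw [Subgroup.card_eq_card_quotient_mul_card_subgroup H,
    ← MulChar.card_subgroupOrderIsoSubgroupMulChar (M := F[X] ⧸ Ideal.span {R}) (R := ℂ),
    trivSet, ← Nat.card_eq_card_finite_toFinset]
  congr 1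
  refine Nat.card_congr (Equiv.subtypeEquivRight fun χ => ?_)
  rw [MulChar.mem_subgroupOrderIsoSubgroupMulChar_iff]
  rfl

lemma sum_trivSet_eq_zero {R : F[X]} (hR : R.Monic) {H : Subgroup (F[X] ⧸ Ideal.span {R})ˣ}
    {u : (F[X] ⧸ Ideal.span {R})ˣ} (hu : u ∉ H) :
    ∑ χ ∈ trivSet hR H, χ (u : F[X] ⧸ Ideal.span {R}) = 0 := by
  have := finite_quot hR
  obtain ⟨χ₀, h0, h1⟩ : ∃ χ₀ : DirChar R, TrivialOn χ₀ H ∧ χ₀ (u : F[X] ⧸ Ideal.span {R}) ≠ 1 := by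
    by_contra! hcon
    apply hu
    rw [← (MulChar.subgroupOrderIsoSubgroupMulChar (F[X] ⧸ Ideal.span {R}) ℂ).symm_apply_apply H]
    refine MulChar.mem_subgroupOrderIsoSubgroupMulChar_symm_iff.2 fun χ hχ => hcon χ ?_
    exact MulChar.mem_subgroupOrderIsoSubgroupMulChar_iff.1 hχ
  have h2 : ∑ χ ∈ trivSet hR H, χ (u : F[X] ⧸ Ideal.span {R}) =
      χ₀ u * ∑ χ ∈ trivSet hR H, χ (u : F[X] ⧸ Ideal.span {R}) := by
    rw [Finset.mul_sum]
    refine Finset.sum_nbij' (fun χ => χ₀⁻¹ * χ) (fun χ => χ₀ * χ) ?_ ?_ ?_ ?_ ?_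
    · intro χ hχ
      rw [mem_trivSet] at hχ ⊢
      intro v hv
      have e : (χ₀⁻¹ * χ) (v : F[X] ⧸ Ideal.span {R}) * χ₀ v = χ v := by
        rw [← MulChar.mul_apply, mul_comm χ₀⁻¹, inv_mul_cancel_right]
      rw [h0 v hv, hχ v hv, mul_one] at e
      exact e
    · intro χ hχ
      rw [mem_trivSet] at hχ ⊢
      intro v hv
      rw [MulChar.mul_apply, h0 v hv, hχ v hv, one_mul]
    · intro χ _; simp
    · intro χ _; simp
    · intro χ _
      rw [← MulChar.mul_apply, mul_inv_cancel_left]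
  exact (mul_eq_zero.1 (show (χ₀ u - 1) * ∑ χ ∈ trivSet hR H,
    χ (u : F[X] ⧸ Ideal.span {R}) = 0 by linear_combination -h2)).resolve_left (sub_ne_zero.2 h1)

lemma trivialOn_kerSup {R : F[X]} (χ : DirChar R) (S : Finset F[X]) :
    TrivialOn χ (kerSup R S) ↔ ∀ P ∈ S, TrivialOn χ (unitKer R (R /ₘ P)) := by
  constructor
  · intro h P hP u hu
    exact h u ((Finset.le_sup (f := fun P => unitKer R (R /ₘ P)) hP) hu)
  · intro h
    have h1 : kerSup R S ≤ χ.toUnitHom.ker := by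
      refine Finset.sup_le fun P hP u hu => ?_
      rw [MonoidHom.mem_ker, Units.ext_iff, MulChar.coe_toUnitHom, h P hP u hu, Units.val_one]
    intro u hu
    have := h1 hu
    rwa [MonoidHom.mem_ker, Units.ext_iff, MulChar.coe_toUnitHom, Units.val_one] at this

/-- Sums over primitive characters by inclusion-exclusion over the prime factors of the modulus. -/
lemma sum_primSet {R : F[X]} (hR : R.Monic) (f : DirChar R → ℂ) :
    ∑ χ ∈ primSet hR, f χ = ∑ S ∈ (primesOf R).powerset,
      (-1) ^ S.card * ∑ χ ∈ trivSet hR (kerSup R S), f χ := by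
  classical
  have := finite_quot hR
  have := Fintype.ofFinite (DirChar R)
  have h1 : primSet hR = (primesOf R).inf fun P => (trivSet hR (unitKer R (R /ₘ P)))ᶜ := by
    ext χ
    rw [Finset.mem_inf, mem_primSet, isPrimitive_iff hR]
    refine ⟨fun h P hP => ?_, fun h P hP hPR => ?_⟩
    · rw [Finset.mem_compl, mem_trivSet]
      exact h P (isPrime_of_mem_primesOf hP) (dvd_of_mem_primesOf hP)
    · have := h P ((mem_primesOf hR).2 ⟨hP, hPR⟩)
      rwa [Finset.mem_compl, mem_trivSet] at this
  rw [h1, Finset.inclusion_exclusion_sum_inf_compl]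
  refine Finset.sum_congr rfl fun S hS => ?_
  rw [zsmul_eq_mul]
  push_cast
  congr 1
  refine Finset.sum_congr ?_ fun _ _ => rfl
  ext χ
  rw [Finset.mem_inf, mem_trivSet, trivialOn_kerSup]
  simp only [mem_trivSet]

lemma card_trivSet_le {R : F[X]} (hR : R.Monic) {S : Finset F[X]} (hS : S ⊆ primesOf R) :
    ((trivSet hR (kerSup R S)).card : ℝ) ≤
      2 ^ S.card * (Nat.card F : ℝ) ^ (R /ₘ ∏ P ∈ S, P).natDegree := by
  have := finite_quot hR
  have h1 : ((trivSet hR (kerSup R S)).card : ℝ) * Nat.card (kerSup R S) ≤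
      (Nat.card F : ℝ) ^ R.natDegree := by
    have h := card_trivSet hR (kerSup R S)
    have h2 : Nat.card (F[X] ⧸ Ideal.span {R})ˣ ≤ Nat.card F ^ R.natDegree := by
      rw [← card_quot hR]
      exact Nat.card_le_card_of_injective _ Units.val_injective
    rw [← h] at h2
    exact_mod_cast h2
  have hp : ∏ P ∈ S, P ∣ R := prod_dvd_of_primes (fun P hP => isPrime_of_mem_primesOf (hS hP))
    fun P hP => dvd_of_mem_primesOf (hS hP)
  have hpm : (∏ P ∈ S, P).Monic :=
    monic_prod_of_monic _ _ fun P hP => (isPrime_of_mem_primesOf (hS hP)).1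
  have hdeg : R.natDegree = ∑ P ∈ S, P.natDegree + (R /ₘ ∏ P ∈ S, P).natDegree := by
    conv_lhs => rw [← mul_divByMonic_self hpm hp]
    rw [hpm.natDegree_mul (monic_divByMonic hR hpm hp),
      natDegree_prod_of_monic _ _ fun P hP => (isPrime_of_mem_primesOf (hS hP)).1]
  have h3 : (Nat.card F : ℝ) ^ (∑ P ∈ S, P.natDegree) ≤ 2 ^ S.card * Nat.card (kerSup R S) := by
    rw [card_kerSup hR hS, ← Finset.prod_pow_eq_pow_sum, ← Finset.prod_const]
    push_cast
    rw [← Finset.prod_mul_distrib]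
    refine Finset.prod_le_prod (fun P _ => (card_pow_pos _).le) fun P hP => ?_
    have := half_norm_le_card_unitKer hR (hS hP)
    linarith
  rw [hdeg, pow_add] at h1
  have h4 : (0 : ℝ) < Nat.card (kerSup R S) := by exact_mod_cast Nat.card_pos
  have h5 := card_pow_pos (F := F) (R /ₘ ∏ P ∈ S, P).natDegree
  have h6 := h1.trans (mul_le_mul_of_nonneg_right h3 h5.le)
  refine le_of_mul_le_mul_right (h6.trans_eq ?_) h4
  ring

lemma card_primSet_eq {R : F[X]} (hR : R.Monic) :
    ((primSet hR).card : ℝ) = Nat.card (F[X] ⧸ Ideal.span {R})ˣ *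
      ∏ P ∈ primesOf R, (1 - 1 / (Nat.card (unitKer R (R /ₘ P)) : ℝ)) := by
  classical
  have := finite_quot hR
  have h := sum_primSet hR fun _ => 1
  simp only [Finset.sum_const, nsmul_eq_mul, mul_one] at h
  have h' : ((primSet hR).card : ℝ) = ∑ S ∈ (primesOf R).powerset,
      (-1) ^ S.card * ((trivSet hR (kerSup R S)).card : ℝ) := by exact_mod_cast h
  have h2 : ∏ P ∈ primesOf R, (1 - 1 / (Nat.card (unitKer R (R /ₘ P)) : ℝ)) =
      ∑ S ∈ (primesOf R).powerset, ∏ P ∈ S, (-(1 / (Nat.card (unitKer R (R /ₘ P)) : ℝ))) := by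
    rw [← Finset.prod_one_add]
    exact Finset.prod_congr rfl fun _ _ => by ring
  rw [h', h2, Finset.mul_sum]
  refine Finset.sum_congr rfl fun S hS => ?_
  rw [Finset.mem_powerset] at hS
  have h3 : ((trivSet hR (kerSup R S)).card : ℝ) * ∏ P ∈ S, (Nat.card (unitKer R (R /ₘ P)) : ℝ) =
      Nat.card (F[X] ⧸ Ideal.span {R})ˣ := by
    rw [← card_trivSet hR (kerSup R S), card_kerSup hR hS]
    push_cast; rfl
  have h4 : ∏ P ∈ S, (Nat.card (unitKer R (R /ₘ P)) : ℝ) ≠ 0 :=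
    Finset.prod_ne_zero_iff.2 fun P _ => by exact_mod_cast Nat.card_pos.ne'
  rw [← h3, Finset.prod_neg, Finset.prod_div_distrib, Finset.prod_const_one]
  field_simp

lemma le_card_primSet {R : F[X]} (hR : R.Monic) (h : ∃ χ : DirChar R, IsPrimitive χ) :
    (Nat.card F : ℝ) ^ R.natDegree * (1 / 4) ^ (primesOf R).card ≤ ((primSet hR).card : ℝ) := by
  have := finite_quot hR
  obtain ⟨χ, hχ⟩ := h
  have h1 : (1 / 2 : ℝ) ^ (primesOf R).card ≤
      ∏ P ∈ primesOf R, (1 - 1 / (Nat.card (unitKer R (R /ₘ P)) : ℝ)) := by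
    rw [← Finset.prod_const]
    refine Finset.prod_le_prod (fun _ _ => by norm_num) fun P hP => ?_
    have h2 : 1 < Nat.card (unitKer R (R /ₘ P)) := by
      rw [Subgroup.one_lt_card_iff_ne_bot]
      intro hbot
      refine (isPrimitive_iff hR χ).1 hχ P (isPrime_of_mem_primesOf hP) (dvd_of_mem_primesOf hP) ?_
      intro u hu
      rw [hbot, Subgroup.mem_bot] at hu
      rw [hu, Units.val_one, map_one]
    have h3 : (2 : ℝ) ≤ Nat.card (unitKer R (R /ₘ P)) := by exact_mod_cast h2
    have := one_div_le_one_div_of_le (by norm_num) h3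
    linarith
  have h4 := (mul_le_mul_of_nonneg_left
    (half_pow_le_kap fun P hP => isPrime_of_mem_primesOf hP)
    (card_pow_pos R.natDegree).le).trans (le_card_units hR)
  rw [card_primSet_eq hR]
  calc _ = (Nat.card F : ℝ) ^ R.natDegree * (1 / 2) ^ (primesOf R).card *
        (1 / 2) ^ (primesOf R).card := by
        rw [mul_assoc, ← mul_pow]; norm_num
    _ ≤ _ := mul_le_mul h4 h1 (by positivity) (by positivity)

lemma norm_sum_trivSet_le {R : F[X]} (hR : R.Monic) {S : Finset F[X]} (hS : S ⊆ primesOf R)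
    (A B : F[X]) : ‖∑ χ ∈ trivSet hR (kerSup R S), χ.val A * (starRingEnd ℂ) (χ.val B)‖ ≤
      open Classical in if (R /ₘ ∏ P ∈ S, P) ∣ A - B then
        2 ^ S.card * (Nat.card F : ℝ) ^ (R /ₘ ∏ P ∈ S, P).natDegree else 0 := by
  classical
  have hp : ∏ P ∈ S, P ∣ R := prod_dvd_of_primes (fun P hP => isPrime_of_mem_primesOf (hS hP))
    fun P hP => dvd_of_mem_primesOf (hS hP)
  have hpm : (∏ P ∈ S, P).Monic :=
    monic_prod_of_monic _ _ fun P hP => (isPrime_of_mem_primesOf (hS hP)).1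
  split_ifs with hd
  · refine (norm_sum_le _ _).trans (le_trans ?_ (card_trivSet_le hR hS))
    rw [← nsmul_one, ← Finset.sum_const]
    refine Finset.sum_le_sum fun χ _ => ?_
    rw [norm_mul, RCLike.norm_conj]
    exact mul_le_one₀ (norm_val_le hR χ A) (norm_nonneg _) (norm_val_le hR χ B)
  · rw [norm_le_zero_iff]
    by_cases hA : IsCoprime A R
    swap
    · exact Finset.sum_eq_zero fun χ _ => by rw [val_eq_zero χ hA, zero_mul]
    by_cases hB : IsCoprime B R
    swap
    · exact Finset.sum_eq_zero fun χ _ => by rw [val_eq_zero χ hB, map_zero, mul_zero]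
    obtain ⟨a, ha⟩ := isUnit_mk.2 hA
    obtain ⟨b, hb⟩ := isUnit_mk.2 hB
    have hu : a * b⁻¹ ∉ kerSup R S := by
      intro hmem
      obtain ⟨C, hC, -⟩ := exists_rep (a * b⁻¹)
      have h1 := (mem_unitKer (divByMonic_dvd hpm hp) hC).1 (kerSup_le hR hS hmem)
      have h2 : Ideal.Quotient.mk (Ideal.span {R}) A = Ideal.Quotient.mk _ (C * B) := by
        rw [map_mul, ← hC, ← ha, ← hb, Units.val_mul, mul_assoc, Units.inv_mul, mul_one]
      rw [mk_eq_mk] at h2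
      apply hd
      have h3 := dvd_add ((divByMonic_dvd hpm hp).trans h2) (h1.mul_right B)
      rwa [show A - C * B + (C - 1) * B = A - B by ring] at h3
    rw [← sum_trivSet_eq_zero hR hu]
    refine Finset.sum_congr rfl fun χ _ => ?_
    rw [DirChar.val, DirChar.val, ← ha, ← hb, Units.val_mul, map_mul]
    congr 1
    have h4 : χ (b : F[X] ⧸ Ideal.span {R}) * χ ((b⁻¹ : _) : F[X] ⧸ Ideal.span {R}) = 1 := by
      rw [← map_mul, Units.mul_inv, map_one]
    rw [← Complex.inv_eq_conj (norm_apply_units hR χ b)]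
    exact inv_eq_of_mul_eq_one_right h4

lemma norm_sum_primSet_le {R : F[X]} (hR : R.Monic) (A B : F[X]) :
    ‖∑ χ ∈ primSet hR, χ.val A * (starRingEnd ℂ) (χ.val B)‖ ≤
      ∑ S ∈ (primesOf R).powerset, open Classical in if (R /ₘ ∏ P ∈ S, P) ∣ A - B then
        2 ^ S.card * (Nat.card F : ℝ) ^ (R /ₘ ∏ P ∈ S, P).natDegree else 0 := by
  rw [sum_primSet hR]
  refine (norm_sum_le _ _).trans (Finset.sum_le_sum fun S hS => ?_)
  rw [norm_mul, norm_pow, norm_neg, norm_one, one_pow, one_mul]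
  exact norm_sum_trivSet_le hR (Finset.mem_powerset.1 hS) A B

lemma card_congruent_le {K : F[X]} (hK : K.Monic) (B : F[X]) {m : ℕ} (hm : K.natDegree ≤ m) :
    cnt (fun A => K ∣ A - B) m ≤ (Nat.card F : ℝ) ^ (m - K.natDegree) := by
  classical
  rw [cnt_eq_card, ← Nat.cast_pow, ← card_monics, Nat.cast_le]
  refine Finset.card_le_card_of_injOn (fun A => A /ₘ K) ?_ ?_
  · intro A hA
    have hA := Finset.mem_filter.1 hA
    have h1 := mem_monics.1 hA.1
    refine mem_monics.2 ⟨?_, ?_⟩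
    · rw [Monic, leadingCoeff_divByMonic_of_monic hK]
      · exact h1.1
      · rw [degree_eq_natDegree hK.ne_zero, degree_eq_natDegree h1.1.ne_zero, h1.2]
        exact_mod_cast hm
    · rw [natDegree_divByMonic _ hK, h1.2]
  · intro A hA A' hA' h
    have hA := Finset.mem_filter.1 hA
    have hA' := Finset.mem_filter.1 hA'
    have h2 : A %ₘ K = A' %ₘ K := by
      rw [← sub_eq_zero, ← sub_modByMonic, modByMonic_eq_zero_iff_dvd hK]
      have := dvd_sub hA.2 hA'.2
      rwa [show A - B - (A' - B) = A - A' by ring] at this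
    simp only [] at h
    rw [← modByMonic_add_div A K, ← modByMonic_add_div A' K, h, h2]

lemma cnt_congruent_le {K : F[X]} (hK : K.Monic) (m n : ℕ) (hmn : n ≤ m) :
    (∑ B ∈ monics F n, cnt (fun A => A ≠ B ∧ K ∣ A - B) m) ≤
      (Nat.card F : ℝ) ^ (m + n) / (Nat.card F : ℝ) ^ K.natDegree := by
  classical
  rcases le_or_gt K.natDegree m with h | h
  · calc _ ≤ ∑ B ∈ monics F n, (Nat.card F : ℝ) ^ (m - K.natDegree) :=
          Finset.sum_le_sum fun B _ => (cnt_mono fun A _ h => h.2).trans (card_congruent_le hK B h)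
      _ = _ := by
          rw [Finset.sum_const, card_monics, nsmul_eq_mul, eq_div_iff (card_pow_pos _).ne']
          push_cast
          rw [mul_assoc, ← pow_add, ← pow_add]
          congr 1
          omega
  · rw [Finset.sum_eq_zero]
    · positivity
    intro B hB
    rw [cnt_eq_card, Finset.filter_eq_empty_iff.2]
    · simp
    rintro A hA ⟨h1, h2⟩
    refine h1 (sub_eq_zero.1 (eq_zero_of_dvd_of_degree_lt h2 ?_))
    rw [mem_monics] at hA hB
    rw [degree_eq_natDegree hK.ne_zero]
    refine (degree_sub_le _ _).trans_lt (max_lt ?_ ?_)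
    · rw [degree_eq_natDegree hA.1.ne_zero, hA.2]; exact_mod_cast h
    · rw [degree_eq_natDegree hB.1.ne_zero, hB.2]; exact_mod_cast hmn.trans_lt h

open Classical in
lemma sum_congruent_le {K : F[X]} (hK : K.Monic) (m n : ℕ) :
    (∑ A ∈ monics F m, ∑ B ∈ monics F n, if A ≠ B ∧ K ∣ A - B then (1 : ℝ) else 0) ≤
      (Nat.card F : ℝ) ^ (m + n) / (Nat.card F : ℝ) ^ K.natDegree := by
  rcases le_total n m with h | h
  · rw [Finset.sum_comm]
    refine le_trans (le_of_eq ?_) (cnt_congruent_le hK m n h)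
    refine Finset.sum_congr rfl fun B _ => ?_
    rw [cnt_eq_sum]
    exact Finset.sum_congr rfl fun _ _ => by congr!
  · rw [add_comm m n]
    refine le_trans (le_of_eq ?_) (cnt_congruent_le hK n m h)
    refine Finset.sum_congr rfl fun A _ => ?_
    rw [cnt_eq_sum]
    refine Finset.sum_congr rfl fun B _ => ?_
    have : (A ≠ B ∧ K ∣ A - B) ↔ (B ≠ A ∧ K ∣ B - A) := by
      rw [ne_comm, dvd_sub_comm]
    by_cases hh : A ≠ B ∧ K ∣ A - B
    · rw [if_pos hh, if_pos (this.1 hh)]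
    · rw [if_neg hh, if_neg (fun h => hh (this.2 h))]

/-- `q ^ (-1/2)`. -/
def rt (F : Type*) [Field F] : ℝ := (Real.sqrt (Nat.card F))⁻¹

lemma rt_pos : 0 < rt F := by
  have := two_le_card (F := F)
  rw [rt]; positivity

lemma rt_sq : rt F ^ 2 = (Nat.card F : ℝ)⁻¹ := by
  rw [rt, inv_pow, Real.sq_sqrt (Nat.cast_nonneg _)]

lemma rt_pow_sq (n : ℕ) : (rt F ^ n) ^ 2 = 1 / (Nat.card F : ℝ) ^ n := by
  rw [← pow_mul, mul_comm, pow_mul, rt_sq, inv_pow, one_div]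

/-- The monic polynomials of degree less than `n`. -/
def monicsLT (F : Type*) [Field F] [Finite F] (n : ℕ) : Finset F[X] :=
  (monicsLE F n).filter fun A => A.natDegree < n

lemma mem_monicsLT {n : ℕ} {A : F[X]} : A ∈ monicsLT F n ↔ A.Monic ∧ A.natDegree < n := by
  rw [monicsLT, Finset.mem_filter, mem_monicsLE]
  exact ⟨fun h => ⟨h.1.1, h.2⟩, fun h => ⟨⟨h.1, h.2.le⟩, h.2⟩⟩

lemma sum_monicsLT {M : Type*} [AddCommMonoid M] (n : ℕ) (f : F[X] → M) :
    ∑ A ∈ monicsLT F n, f A = ∑ m ∈ Finset.range n, ∑ A ∈ monics F m, f A := by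
  classical
  rw [← Finset.sum_biUnion]
  · refine Finset.sum_congr ?_ fun _ _ => rfl
    ext A
    simp only [mem_monicsLT, Finset.mem_biUnion, Finset.mem_range, mem_monics]
    exact ⟨fun h => ⟨_, h.2, h.1, rfl⟩, fun ⟨m, hm, h1, h2⟩ => ⟨h1, h2 ▸ hm⟩⟩
  · intro a _ b _ hab
    refine Finset.disjoint_left.2 fun A hA hB => hab ?_
    rw [← (mem_monics.1 hA).2, ← (mem_monics.1 hB).2]

/-- The Dirichlet polynomial with coefficients `f` of length `M`, at the central point. -/
def dpoly {R : F[X]} (f : F[X] → ℝ) (M : ℕ) (χ : DirChar R) : ℂ :=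
  ∑ D ∈ monicsLT F M, ((f D * rt F ^ D.natDegree : ℝ) : ℂ) * χ.val D

/-- The diagonal contribution to the mean square of `dpoly f M`. -/
def diag (R : F[X]) (f : F[X] → ℝ) (M : ℕ) : ℝ :=
  open Classical in
  ∑ D ∈ monicsLT F M, if IsCoprime D R then f D ^ 2 / (Nat.card F : ℝ) ^ D.natDegree else 0

lemma sq_sum_le (M : ℕ) :
    (∑ m ∈ Finset.range M, (rt F * Nat.card F) ^ m) ^ 2 ≤ 6 * (Nat.card F : ℝ) ^ M := by
  set s := Real.sqrt (Nat.card F) with hs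
  have hq := two_le_card (F := F)
  have hs2 : s ^ 2 = Nat.card F := Real.sq_sqrt (Nat.cast_nonneg _)
  have hs0 : 0 < s := Real.sqrt_pos.2 (by linarith)
  have e : rt F * Nat.card F = s := by
    rw [rt, ← hs]
    field_simp
    exact hs2.symm
  have hs1 : 141 / 100 ≤ s := by
    rw [hs]; exact Real.le_sqrt_of_sq_le (by norm_num; linarith)
  rw [e, geom_sum_eq (by linarith)]
  have h1 : 1 ≤ s ^ M := one_le_pow₀ (by linarith)
  have h3 : (Nat.card F : ℝ) ^ M = (s ^ M) ^ 2 := by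
    rw [← hs2, ← pow_mul, ← pow_mul, mul_comm]
  rw [h3, div_pow, div_le_iff₀ (by nlinarith)]
  have h5 : (s ^ M - 1) ^ 2 ≤ (s ^ M) ^ 2 := by nlinarith
  have h6 : 1 ≤ 6 * (s - 1) ^ 2 := by nlinarith
  nlinarith [sq_nonneg (s ^ M)]

open Classical in
lemma sum_congruent_weighted_le {K : F[X]} (hK : K.Monic) (M : ℕ) :
    (∑ A ∈ monicsLT F M, ∑ B ∈ monicsLT F M, if A ≠ B ∧ K ∣ A - B then
      rt F ^ A.natDegree * rt F ^ B.natDegree else 0) ≤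
      6 * (Nat.card F : ℝ) ^ M / (Nat.card F : ℝ) ^ K.natDegree := by
  calc _ = ∑ m ∈ Finset.range M, ∑ n ∈ Finset.range M, rt F ^ m * rt F ^ n *
        ∑ A ∈ monics F m, ∑ B ∈ monics F n, if A ≠ B ∧ K ∣ A - B then (1 : ℝ) else 0 := by
        rw [sum_monicsLT]
        refine Finset.sum_congr rfl fun m _ => ?_
        rw [Finset.sum_congr rfl fun A _ => sum_monicsLT M _, Finset.sum_comm]
        refine Finset.sum_congr rfl fun n _ => ?_
        rw [Finset.mul_sum]
        refine Finset.sum_congr rfl fun A hA => ?_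
        rw [Finset.mul_sum]
        refine Finset.sum_congr rfl fun B hB => ?_
        rw [(mem_monics.1 hA).2, (mem_monics.1 hB).2, mul_ite, mul_one, mul_zero]
    _ ≤ ∑ m ∈ Finset.range M, ∑ n ∈ Finset.range M, rt F ^ m * rt F ^ n *
        ((Nat.card F : ℝ) ^ (m + n) / (Nat.card F : ℝ) ^ K.natDegree) := by
        refine Finset.sum_le_sum fun m _ => Finset.sum_le_sum fun n _ => ?_
        have := rt_pos (F := F)
        exact mul_le_mul_of_nonneg_left (sum_congruent_le hK m n) (by positivity)
    _ = (∑ m ∈ Finset.range M, (rt F * Nat.card F) ^ m) ^ 2 / (Nat.card F : ℝ) ^ K.natDegree := by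
        rw [sq, Finset.sum_mul_sum, Finset.sum_div]
        refine Finset.sum_congr rfl fun m _ => ?_
        rw [Finset.sum_div]
        refine Finset.sum_congr rfl fun n _ => ?_
        rw [mul_pow, mul_pow, pow_add]; ring
    _ ≤ _ := div_le_div_of_nonneg_right (sq_sum_le M) (card_pow_pos _).le

lemma norm_sq_dpoly {R : F[X]} (f : F[X] → ℝ) (M : ℕ) (χ : DirChar R) :
    ((‖dpoly f M χ‖ ^ 2 : ℝ) : ℂ) = ∑ A ∈ monicsLT F M, ∑ B ∈ monicsLT F M,
      ((f A * rt F ^ A.natDegree * (f B * rt F ^ B.natDegree) : ℝ) : ℂ) *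
        (χ.val A * (starRingEnd ℂ) (χ.val B)) := by
  rw [Complex.ofReal_pow, ← Complex.mul_conj', dpoly, map_sum, Finset.sum_mul_sum]
  refine Finset.sum_congr rfl fun A _ => Finset.sum_congr rfl fun B _ => ?_
  rw [map_mul, Complex.conj_ofReal]
  push_cast
  ring

theorem abs_primAvg_sub_diag_le {R : F[X]} (hR : R.Monic) (h : ∃ χ : DirChar R, IsPrimitive χ)
    {f : F[X] → ℝ} {C : ℝ} {M : ℕ} (hf : ∀ D : F[X], D.Monic → D.natDegree < M → |f D| ≤ C) :
    |primAvg R (fun χ => ‖dpoly f M χ‖ ^ 2) - diag R f M| ≤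
      6 * 16 ^ (primesOf R).card * C ^ 2 * ((Nat.card F : ℝ) ^ M / (Nat.card F : ℝ) ^ R.natDegree) := by
  classical
  have hcard := le_card_primSet hR h
  set W : ℝ := ((primSet hR).card : ℝ) with hW
  have hq := card_pow_pos (F := F) R.natDegree
  have hWpos : 0 < W := lt_of_lt_of_le (by positivity) hcard
  have hr := rt_pos (F := F)
  set g : F[X] → ℝ := fun A => f A * rt F ^ A.natDegree with hg
  set T : F[X] → F[X] → ℂ := fun A B => ∑ χ ∈ primSet hR, χ.val A * (starRingEnd ℂ) (χ.val B)
    with hT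
  have key : |∑ χ ∈ primSet hR, ‖dpoly f M χ‖ ^ 2 - W * diag R f M| ≤
      6 * 4 ^ (primesOf R).card * C ^ 2 * (Nat.card F : ℝ) ^ M := by
    have e1 : ((∑ χ ∈ primSet hR, ‖dpoly f M χ‖ ^ 2 : ℝ) : ℂ) =
        ∑ A ∈ monicsLT F M, ∑ B ∈ monicsLT F M, ((g A * g B : ℝ) : ℂ) * T A B := by
      rw [Complex.ofReal_sum, Finset.sum_congr rfl fun χ _ => norm_sq_dpoly f M χ,
        Finset.sum_comm]
      refine Finset.sum_congr rfl fun A _ => ?_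
      rw [Finset.sum_comm]
      refine Finset.sum_congr rfl fun B _ => ?_
      rw [hT, Finset.mul_sum]
    have e2 : ((W * diag R f M : ℝ) : ℂ) =
        ∑ A ∈ monicsLT F M, ∑ B ∈ monicsLT F M,
          if A = B then ((g A * g B : ℝ) : ℂ) * T A B else 0 := by
      rw [diag, Finset.mul_sum, Complex.ofReal_sum]
      refine Finset.sum_congr rfl fun A hA => ?_
      rw [Finset.sum_ite_eq, if_pos hA]
      split_ifs with hc
      · have : T A A = W := by
          rw [hT, hW]
          simp only [Complex.mul_conj']
          rw [Finset.sum_congr rfl fun χ _ => by rw [norm_val hR χ hc]]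
          simp
        rw [this, ← Complex.ofReal_mul]
        congr 1
        have h2 := rt_pow_sq (F := F) A.natDegree
        rw [hg]
        simp only []
        rw [show f A * rt F ^ A.natDegree * (f A * rt F ^ A.natDegree) =
          f A ^ 2 * (rt F ^ A.natDegree) ^ 2 by ring, h2]
        ring
      · have : T A A = 0 := by
          rw [hT]
          exact Finset.sum_eq_zero fun χ _ => by rw [val_eq_zero χ hc, zero_mul]
        rw [this]
        simp
    have e3 : ((∑ χ ∈ primSet hR, ‖dpoly f M χ‖ ^ 2 - W * diag R f M : ℝ) : ℂ) =
        ∑ A ∈ monicsLT F M, ∑ B ∈ monicsLT F M,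
          if A ≠ B then ((g A * g B : ℝ) : ℂ) * T A B else 0 := by
      rw [Complex.ofReal_sub, e1, e2, ← Finset.sum_sub_distrib]
      refine Finset.sum_congr rfl fun A _ => ?_
      rw [← Finset.sum_sub_distrib]
      refine Finset.sum_congr rfl fun B _ => ?_
      by_cases hAB : A = B <;> simp [hAB]
    rw [← Real.norm_eq_abs, ← Complex.norm_real, e3]
    calc _ ≤ ∑ A ∈ monicsLT F M, ∑ B ∈ monicsLT F M, ∑ S ∈ (primesOf R).powerset,
          C ^ 2 * (2 ^ S.card * (Nat.card F : ℝ) ^ (R /ₘ ∏ P ∈ S, P).natDegree) *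
          (if A ≠ B ∧ (R /ₘ ∏ P ∈ S, P) ∣ A - B then
            rt F ^ A.natDegree * rt F ^ B.natDegree else 0) := by
          refine (norm_sum_le _ _).trans (Finset.sum_le_sum fun A hA => ?_)
          refine (norm_sum_le _ _).trans (Finset.sum_le_sum fun B hB => ?_)
          have hA' := mem_monicsLT.1 hA
          have hB' := mem_monicsLT.1 hB
          have hfA := hf A hA'.1 hA'.2
          have hfB := hf B hB'.1 hB'.2
          have hC : 0 ≤ C := (abs_nonneg _).trans hfA
          by_cases hAB : A = B
          · simp [hAB]
          · rw [if_pos hAB, norm_mul, Complex.norm_real, Real.norm_eq_abs]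
            have h1 : |g A * g B| ≤ C ^ 2 * (rt F ^ A.natDegree * rt F ^ B.natDegree) := by
              rw [hg]
              simp only [abs_mul, abs_pow, abs_of_pos hr]
              have := mul_le_mul hfA hfB (abs_nonneg _) hC
              have h3 : 0 < rt F ^ A.natDegree * rt F ^ B.natDegree := by positivity
              nlinarith
            refine (mul_le_mul h1 (norm_sum_primSet_le hR A B) (norm_nonneg _)
              (by positivity)).trans_eq ?_
            rw [Finset.mul_sum]
            refine Finset.sum_congr rfl fun S _ => ?_
            by_cases hd : (R /ₘ ∏ P ∈ S, P) ∣ A - B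
            · rw [if_pos hd, if_pos ⟨hAB, hd⟩]; ring
            · rw [if_neg hd, if_neg (fun h => hd h.2)]; ring
      _ = ∑ S ∈ (primesOf R).powerset,
          C ^ 2 * (2 ^ S.card * (Nat.card F : ℝ) ^ (R /ₘ ∏ P ∈ S, P).natDegree) *
          ∑ A ∈ monicsLT F M, ∑ B ∈ monicsLT F M,
          (if A ≠ B ∧ (R /ₘ ∏ P ∈ S, P) ∣ A - B then
            rt F ^ A.natDegree * rt F ^ B.natDegree else 0) := by
          rw [Finset.sum_congr rfl fun A _ => Finset.sum_comm, Finset.sum_comm]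
          refine Finset.sum_congr rfl fun S _ => ?_
          rw [Finset.mul_sum]
          exact Finset.sum_congr rfl fun A _ => by rw [Finset.mul_sum]
      _ ≤ ∑ S ∈ (primesOf R).powerset, C ^ 2 * 2 ^ (primesOf R).card *
          (6 * (Nat.card F : ℝ) ^ M) := by
          refine Finset.sum_le_sum fun S hS => ?_
          have hS := Finset.mem_powerset.1 hS
          have hp : ∏ P ∈ S, P ∣ R := prod_dvd_of_primes
            (fun P hP => isPrime_of_mem_primesOf (hS hP)) fun P hP => dvd_of_mem_primesOf (hS hP)
          have hpm : (∏ P ∈ S, P).Monic :=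
            monic_prod_of_monic _ _ fun P hP => (isPrime_of_mem_primesOf (hS hP)).1
          have hK := monic_divByMonic hR hpm hp
          have hk := card_pow_pos (F := F) (R /ₘ ∏ P ∈ S, P).natDegree
          have hM := card_pow_pos (F := F) M
          calc _ ≤ C ^ 2 * (2 ^ S.card * (Nat.card F : ℝ) ^ (R /ₘ ∏ P ∈ S, P).natDegree) *
                (6 * (Nat.card F : ℝ) ^ M / (Nat.card F : ℝ) ^ (R /ₘ ∏ P ∈ S, P).natDegree) :=
                mul_le_mul_of_nonneg_left (sum_congruent_weighted_le hK M) (by positivity)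
            _ = C ^ 2 * 2 ^ S.card * (6 * (Nat.card F : ℝ) ^ M) := by
                field_simp
            _ ≤ _ := by
                have : (2 : ℝ) ^ S.card ≤ 2 ^ (primesOf R).card :=
                  pow_le_pow_right₀ (by norm_num) (Finset.card_le_card hS)
                gcongr
      _ = _ := by
          rw [Finset.sum_const, Finset.card_powerset, nsmul_eq_mul]
          push_cast
          rw [show (4 : ℝ) = 2 * 2 by norm_num, mul_pow]
          ring
  rw [primAvg_eq hR, ← hW]
  have e : 1 / W * ∑ χ ∈ primSet hR, ‖dpoly f M χ‖ ^ 2 - diag R f M =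
      (∑ χ ∈ primSet hR, ‖dpoly f M χ‖ ^ 2 - W * diag R f M) / W := by
    field_simp
  rw [e, abs_div, abs_of_pos hWpos, div_le_iff₀ hWpos]
  refine key.trans ?_
  have h16 : (16 : ℝ) ^ (primesOf R).card * (1 / 4) ^ (primesOf R).card =
      4 ^ (primesOf R).card := by rw [← mul_pow]; norm_num
  calc 6 * 4 ^ (primesOf R).card * C ^ 2 * (Nat.card F : ℝ) ^ M =
      6 * 16 ^ (primesOf R).card * C ^ 2 * ((Nat.card F : ℝ) ^ M / (Nat.card F : ℝ) ^ R.natDegree) *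
        ((Nat.card F : ℝ) ^ R.natDegree * (1 / 4) ^ (primesOf R).card) := by
        rw [← h16]; field_simp
    _ ≤ _ := mul_le_mul_of_nonneg_left hcard (by positivity)

/-- The quadratic mean over the primitive characters. -/
def qmean (R : F[X]) (f : DirChar R → ℂ) : ℝ := Real.sqrt (primAvg R fun χ => ‖f χ‖ ^ 2)

lemma primAvg_nonneg {R : F[X]} (hR : R.Monic) {f : DirChar R → ℝ} (hf : ∀ χ, 0 ≤ f χ) :
    0 ≤ primAvg R f := by
  rw [primAvg_eq hR]
  exact mul_nonneg (by positivity) (Finset.sum_nonneg fun χ _ => hf χ)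

lemma primAvg_mono {R : F[X]} (hR : R.Monic) {f g : DirChar R → ℝ}
    (h : ∀ χ, IsPrimitive χ → f χ ≤ g χ) : primAvg R f ≤ primAvg R g := by
  rw [primAvg_eq hR, primAvg_eq hR]
  exact mul_le_mul_of_nonneg_left
    (Finset.sum_le_sum fun χ hχ => h χ ((mem_primSet hR).1 hχ)) (by positivity)

lemma primAvg_congr {R : F[X]} (hR : R.Monic) {f g : DirChar R → ℝ}
    (h : ∀ χ, IsPrimitive χ → f χ = g χ) : primAvg R f = primAvg R g :=
  le_antisymm (primAvg_mono hR fun χ hχ => (h χ hχ).le) (primAvg_mono hR fun χ hχ => (h χ hχ).ge)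

lemma sq_qmean {R : F[X]} (hR : R.Monic) (f : DirChar R → ℂ) :
    qmean R f ^ 2 = primAvg R fun χ => ‖f χ‖ ^ 2 :=
  Real.sq_sqrt (primAvg_nonneg hR fun _ => sq_nonneg _)

lemma qmean_nonneg (R : F[X]) (f : DirChar R → ℂ) : 0 ≤ qmean R f := Real.sqrt_nonneg _

lemma qmean_mono {R : F[X]} (hR : R.Monic) {f g : DirChar R → ℂ}
    (h : ∀ χ, IsPrimitive χ → ‖f χ‖ ≤ ‖g χ‖) : qmean R f ≤ qmean R g :=
  Real.sqrt_le_sqrt (primAvg_mono hR fun χ hχ => pow_le_pow_left₀ (norm_nonneg _) (h χ hχ) 2)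

lemma qmean_eq_norm {R : F[X]} (hR : R.Monic) (f : DirChar R → ℂ) :
    qmean R f = Real.sqrt (1 / ((primSet hR).card : ℝ)) *
      ‖WithLp.toLp 2 fun χ : primSet hR => f χ‖ := by
  rw [qmean, primAvg_eq hR, Real.sqrt_mul (by positivity), EuclideanSpace.norm_eq,
    ← Finset.sum_coe_sort]

lemma qmean_add_le {R : F[X]} (hR : R.Monic) (f g : DirChar R → ℂ) :
    qmean R (fun χ => f χ + g χ) ≤ qmean R f + qmean R g := by
  rw [qmean_eq_norm hR, qmean_eq_norm hR, qmean_eq_norm hR, ← mul_add]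
  exact mul_le_mul_of_nonneg_left (norm_add_le (WithLp.toLp 2 fun χ : primSet hR => f χ)
    (WithLp.toLp 2 fun χ : primSet hR => g χ)) (Real.sqrt_nonneg _)

lemma abs_qmean_sub_le {R : F[X]} (hR : R.Monic) (f g : DirChar R → ℂ) :
    |qmean R f - qmean R g| ≤ qmean R (fun χ => f χ - g χ) := by
  rw [qmean_eq_norm hR, qmean_eq_norm hR, qmean_eq_norm hR, ← mul_sub, abs_mul,
    abs_of_nonneg (Real.sqrt_nonneg _)]
  exact mul_le_mul_of_nonneg_left (abs_norm_sub_norm_le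
    (WithLp.toLp 2 fun χ : primSet hR => f χ) (WithLp.toLp 2 fun χ : primSet hR => g χ))
    (Real.sqrt_nonneg _)

lemma qmean_mul_le {R : F[X]} (hR : R.Monic) {f g : DirChar R → ℂ} {C : ℝ} (hC : 0 ≤ C)
    (h : ∀ χ, IsPrimitive χ → ‖g χ‖ ≤ C) : qmean R (fun χ => f χ * g χ) ≤ C * qmean R f := by
  refine Real.sqrt_le_iff.2 ⟨mul_nonneg hC (qmean_nonneg _ _), ?_⟩
  rw [mul_pow, sq_qmean hR, primAvg_eq hR, primAvg_eq hR, mul_left_comm, Finset.mul_sum (a := C ^ 2)]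
  have h0 : (0 : ℝ) ≤ 1 / ((primSet hR).card : ℝ) := by positivity
  refine mul_le_mul_of_nonneg_left (Finset.sum_le_sum fun χ hχ => ?_) h0
  rw [norm_mul, mul_pow, mul_comm]
  exact mul_le_mul_of_nonneg_right
    (pow_le_pow_left₀ (norm_nonneg _) (h χ ((mem_primSet hR).1 hχ)) 2) (sq_nonneg _)

lemma dpoly_eq {R : F[X]} (f : F[X] → ℝ) (M : ℕ) (χ : DirChar R) :
    dpoly f M χ = ∑ n ∈ Finset.range M, (∑ D ∈ monics F n, (f D : ℂ) * χ.val D) * (rt F : ℂ) ^ n := by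
  rw [dpoly, sum_monicsLT]
  refine Finset.sum_congr rfl fun n _ => ?_
  rw [Finset.sum_mul]
  refine Finset.sum_congr rfl fun D hD => ?_
  rw [(mem_monics.1 hD).2]
  push_cast
  ring

lemma sum_range_mul_sum_range {a b : ℕ → ℂ} {M M' : ℕ} (ha : ∀ n, M ≤ n → a n = 0)
    (hb : ∀ n, M' ≤ n → b n = 0) :
    (∑ n ∈ Finset.range M, a n) * ∑ n ∈ Finset.range M', b n =
      ∑ n ∈ Finset.range (M + M'), ∑ ij ∈ Finset.HasAntidiagonal.antidiagonal n, a ij.1 * b ij.2 := by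
  classical
  rw [Finset.sum_mul_sum, ← Finset.sum_product', Finset.sum_sigma']
  refine Finset.sum_bij_ne_zero (fun p _ _ => ⟨p.1 + p.2, p⟩) ?_ ?_ ?_ ?_
  · rintro ⟨i, j⟩ h -
    simp only [Finset.mem_product, Finset.mem_range, Finset.mem_sigma,
      Finset.HasAntidiagonal.mem_antidiagonal] at h ⊢
    exact ⟨by omega, trivial⟩
  · rintro p _ _ p' _ _ h
    simp only [Sigma.mk.injEq] at h
    exact eq_of_heq h.2
  · rintro ⟨n, i, j⟩ h h0
    simp only [Finset.mem_sigma, Finset.HasAntidiagonal.mem_antidiagonal, Finset.mem_range] at h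
    have hi : i < M := by
      by_contra hc
      exact h0 (by simp [ha i (not_lt.1 hc)])
    have hj : j < M' := by
      by_contra hc
      exact h0 (by simp [hb j (not_lt.1 hc)])
    refine ⟨(i, j), ?_, h0, ?_⟩
    · simp [hi, hj]
    · simp only [h.2]
  · intros; rfl

lemma dpoly_mul {R : F[X]} {f g : F[X] → ℝ} {M M' : ℕ}
    (hf : ∀ D : F[X], M ≤ D.natDegree → f D = 0) (hg : ∀ D : F[X], M' ≤ D.natDegree → g D = 0)
    (χ : DirChar R) : dpoly f M χ * dpoly g M' χ = dpoly (conv f g) (M + M') χ := by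
  rw [dpoly_eq, dpoly_eq, dpoly_eq, sum_range_mul_sum_range]
  · refine Finset.sum_congr rfl fun n _ => ?_
    have h1 : ∑ D ∈ monics F n, (conv f g D : ℂ) * χ.val D =
        ∑ D ∈ monics F n, ∑ p ∈ dpairs D, ((f p.1 : ℂ) * χ.val p.1) * ((g p.2 : ℂ) * χ.val p.2) := by
      refine Finset.sum_congr rfl fun D _ => ?_
      rw [conv, Complex.ofReal_sum, Finset.sum_mul]
      refine Finset.sum_congr rfl fun p hp => ?_
      rw [← (mem_dpairs.1 hp).2.2, val_mul]
      push_cast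
      ring
    rw [h1, sum_monics_dpairs n fun A B => ((f A : ℂ) * χ.val A) * ((g B : ℂ) * χ.val B),
      Finset.sum_mul]
    refine Finset.sum_congr rfl fun ij hij => ?_
    rw [← Finset.HasAntidiagonal.mem_antidiagonal.1 hij, pow_add, ← Finset.sum_mul_sum]
    ring
  · intro n hn
    rw [Finset.sum_eq_zero, zero_mul]
    intro D hD
    rw [hf D (by rw [(mem_monics.1 hD).2]; exact hn)]
    simp
  · intro n hn
    rw [Finset.sum_eq_zero, zero_mul]
    intro D hD
    rw [hg D (by rw [(mem_monics.1 hD).2]; exact hn)]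
    simp

section GaussSum

variable {K : Type*} [CommRing K] [Fintype K]

lemma gaussSum_mulShift_eq_zero {χ : MulChar K ℂ} (ψ : AddChar K ℂ) {a : K} {u : Kˣ}
    (hu : χ u ≠ 1) (ha : a * u = a) : gaussSum χ (ψ.mulShift a) = 0 := by
  have h := gaussSum_mulShift χ (ψ.mulShift a) u
  have h2 : (ψ.mulShift a).mulShift (u : K) = ψ.mulShift a := by
    ext x
    simp only [AddChar.mulShift_apply]
    rw [← mul_assoc, ha]
  rw [h2] at h
  by_contra h0
  exact hu (mul_right_cancel₀ h0 (h.trans (one_mul _).symm))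

lemma inv_apply_eq_conj (χ : MulChar K ℂ) (a : K) : χ⁻¹ a = (starRingEnd ℂ) (χ a) := by
  rw [← MulChar.star_apply']; rfl

lemma gaussSum_inv_mulShift {χ : MulChar K ℂ} {ψ : AddChar K ℂ}
    (h : ∀ a : K, ¬ IsUnit a → gaussSum χ⁻¹ (ψ.mulShift a) = 0) (a : K) :
    gaussSum χ⁻¹ (ψ.mulShift a) = χ a * gaussSum χ⁻¹ ψ := by
  by_cases ha : IsUnit a
  · obtain ⟨u, rfl⟩ := ha
    rw [← gaussSum_mulShift χ⁻¹ ψ u, ← mul_assoc, ← MulChar.mul_apply, mul_inv_cancel,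
      MulChar.one_apply_coe, one_mul]
  · rw [h a ha, MulChar.map_nonunit χ ha, zero_mul]

lemma sum_norm_sq_gaussSum (χ : MulChar K ℂ) {ψ : AddChar K ℂ} (hψ : ψ.IsPrimitive) :
    ∑ a, ‖gaussSum χ (ψ.mulShift a)‖ ^ 2 = Fintype.card K * ∑ b, ‖χ b‖ ^ 2 := by
  classical
  have h : ((∑ a, ‖gaussSum χ (ψ.mulShift a)‖ ^ 2 : ℝ) : ℂ) =
      ((Fintype.card K * ∑ b, ‖χ b‖ ^ 2 : ℝ) : ℂ) := by
    calc _ = ∑ a, ∑ b, ∑ b', χ b * (starRingEnd ℂ) (χ b') * ψ (a * (b - b')) := by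
          push_cast
          refine Finset.sum_congr rfl fun a _ => ?_
          rw [← Complex.mul_conj', gaussSum, map_sum, Finset.sum_mul_sum]
          refine Finset.sum_congr rfl fun b _ => Finset.sum_congr rfl fun b' _ => ?_
          rw [map_mul, AddChar.mulShift_apply, AddChar.mulShift_apply, ← AddChar.map_neg_eq_conj,
            mul_sub, sub_eq_add_neg, AddChar.map_add_eq_mul]
          ring
      _ = ∑ b, ∑ b', χ b * (starRingEnd ℂ) (χ b') * ∑ a, ψ (a * (b - b')) := by
          rw [Finset.sum_comm]
          refine Finset.sum_congr rfl fun b _ => ?_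
          rw [Finset.sum_comm]
          exact Finset.sum_congr rfl fun b' _ => by rw [Finset.mul_sum]
      _ = _ := by
          push_cast
          rw [Finset.mul_sum]
          refine Finset.sum_congr rfl fun b _ => ?_
          rw [Finset.sum_eq_single b]
          · rw [AddChar.sum_mulShift _ hψ, sub_self, if_pos rfl, Complex.mul_conj']
            ring
          · intro b' _ hb'
            rw [AddChar.sum_mulShift _ hψ, if_neg (sub_ne_zero.2 hb'.symm)]
            simp
          · simp
  exact_mod_cast h

lemma norm_sq_gaussSum_inv {χ : MulChar K ℂ} {ψ : AddChar K ℂ} (hψ : ψ.IsPrimitive)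
    (h : ∀ a : K, ¬ IsUnit a → gaussSum χ⁻¹ (ψ.mulShift a) = 0) :
    ‖gaussSum χ⁻¹ ψ‖ ^ 2 = Fintype.card K := by
  have h1 := sum_norm_sq_gaussSum χ⁻¹ hψ
  simp only [gaussSum_inv_mulShift h, norm_mul, mul_pow, inv_apply_eq_conj, RCLike.norm_conj] at h1
  rw [← Finset.sum_mul, mul_comm] at h1
  refine mul_right_cancel₀ (ne_of_gt ?_) h1
  refine lt_of_lt_of_le ?_ (Finset.single_le_sum (f := fun b => ‖χ b‖ ^ 2)
    (fun _ _ => sq_nonneg _) (Finset.mem_univ (1 : K)))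
  simp

end GaussSum

/-- The coefficient of `T ^ (deg R - 1)` in the remainder modulo `R`. -/
def resLin (R : F[X]) : F[X] →ₗ[F] F := lcoeff F (R.natDegree - 1) ∘ₗ modByMonicHom R

lemma resLin_apply (R A : F[X]) : resLin R A = (A %ₘ R).coeff (R.natDegree - 1) := rfl

lemma resLin_of_degree_lt {R A : F[X]} (hR : R.Monic) (h : A.natDegree < R.natDegree) :
    resLin R A = A.coeff (R.natDegree - 1) := by
  rw [resLin_apply, (modByMonic_eq_self_iff hR).2]
  exact degree_lt_degree h

lemma resLin_eq_of_dvd {R A B : F[X]} (hR : R.Monic) (h : R ∣ A - B) :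
    resLin R A = resLin R B := by
  rw [← sub_eq_zero, ← map_sub, resLin_apply, (modByMonic_eq_zero_iff_dvd hR).2 h, coeff_zero]

lemma mk_surjInv {R : F[X]} (x : F[X] ⧸ Ideal.span {R}) :
    Ideal.Quotient.mk (Ideal.span {R}) (Function.surjInv Ideal.Quotient.mk_surjective x) = x :=
  Function.surjInv_eq Ideal.Quotient.mk_surjective x

/-- The additive character of `𝔽_q[T] / (R)` attached to an additive character of `𝔽_q`. -/
def resChar {R : F[X]} (hR : R.Monic) (ψ : AddChar F ℂ) :
    AddChar (F[X] ⧸ Ideal.span {R}) ℂ where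
  toFun x := ψ (resLin R (Function.surjInv Ideal.Quotient.mk_surjective x))
  map_zero_eq_one' := by
    rw [resLin_eq_of_dvd hR (B := 0), map_zero, AddChar.map_zero_eq_one]
    rw [← mk_eq_mk, mk_surjInv, map_zero]
  map_add_eq_mul' x y := by
    rw [← AddChar.map_add_eq_mul, ← map_add]
    congr 1
    refine resLin_eq_of_dvd hR ?_
    rw [← mk_eq_mk, map_add, mk_surjInv, mk_surjInv, mk_surjInv]

lemma resChar_mk {R : F[X]} (hR : R.Monic) (ψ : AddChar F ℂ) (A : F[X]) :
    resChar hR ψ (Ideal.Quotient.mk _ A) = ψ (resLin R A) := by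
  change ψ (resLin R (Function.surjInv Ideal.Quotient.mk_surjective _)) = _
  congr 1
  refine resLin_eq_of_dvd hR ?_
  rw [← mk_eq_mk, mk_surjInv]

lemma resLin_monomial_mul {R B : F[X]} (hR : R.Monic) (hB : B ≠ 0)
    (hd : B.natDegree < R.natDegree) (s : F) :
    resLin R (monomial (R.natDegree - 1 - B.natDegree) (s / B.leadingCoeff) * B) = s := by
  rw [resLin_of_degree_lt hR]
  · have : R.natDegree - 1 = B.natDegree + (R.natDegree - 1 - B.natDegree) := by omega
    generalize R.natDegree - 1 - B.natDegree = e at this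
    rw [this, coeff_monomial_mul, coeff_natDegree, div_mul_cancel₀]
    rwa [Ne, leadingCoeff_eq_zero]
  · refine lt_of_le_of_lt natDegree_mul_le ?_
    have := natDegree_monomial_le (s / B.leadingCoeff) (m := R.natDegree - 1 - B.natDegree)
    omega

lemma isPrimitive_resChar {R : F[X]} (hR : R.Monic) {ψ : AddChar F ℂ} (hψ : ψ ≠ 1) :
    (resChar hR ψ).IsPrimitive := by
  intro x hx h
  obtain ⟨A, rfl⟩ := Ideal.Quotient.mk_surjective x
  have hB : (Ideal.Quotient.mk (Ideal.span {R})) A = Ideal.Quotient.mk _ (A %ₘ R) := by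
    rw [mk_eq_mk]
    exact ⟨A /ₘ R, by rw [sub_eq_iff_eq_add', modByMonic_add_div]⟩
  have hB0 : A %ₘ R ≠ 0 := by
    intro h0
    rw [hB, h0, map_zero] at hx
    exact hx rfl
  have hR1 : R ≠ 1 := by
    rintro rfl
    exact hB0 (modByMonic_one A)
  have hlt := natDegree_modByMonic_lt A hR hR1
  apply hψ
  ext s
  have := DFunLike.congr_fun h (Ideal.Quotient.mk (Ideal.span {R})
    (monomial (R.natDegree - 1 - (A %ₘ R).natDegree) (s / (A %ₘ R).leadingCoeff)))
  rw [AddChar.mulShift_apply, hB, mul_comm, ← map_mul, resChar_mk,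
    resLin_monomial_mul hR hB0 hlt] at this
  simpa using this

lemma sum_monics_resLin {R : F[X]} (hR : R.Monic) {ψ : AddChar F ℂ} (hψ : ψ ≠ 1) {B : F[X]}
    (hB : B ≠ 0) (hd : B.natDegree < R.natDegree) (n : ℕ) :
    ∑ A ∈ monics F n, ψ (resLin R (A * B)) =
      if n + B.natDegree + 1 < R.natDegree then (Nat.card F : ℂ) ^ n
      else if n + B.natDegree + 1 = R.natDegree then (Nat.card F : ℂ) ^ n * ψ B.leadingCoeff
      else 0 := by
  have hdeg : ∀ A ∈ monics F n, (A * B).natDegree = n + B.natDegree := fun A hA => by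
    rw [natDegree_mul (mem_monics.1 hA).1.ne_zero hB, (mem_monics.1 hA).2]
  split_ifs with h1 h2
  · rw [Finset.sum_congr rfl fun A hA => by
      rw [resLin_of_degree_lt hR (by rw [hdeg A hA]; omega),
        coeff_eq_zero_of_natDegree_lt (by rw [hdeg A hA]; omega), AddChar.map_zero_eq_one]]
    simp [card_monics]
  · rw [Finset.sum_congr rfl fun A hA => by
      rw [resLin_of_degree_lt hR (by rw [hdeg A hA]; omega),
        show R.natDegree - 1 = (A * B).natDegree by rw [hdeg A hA]; omega, coeff_natDegree,
        leadingCoeff_mul, (mem_monics.1 hA).1.leadingCoeff, one_mul]]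
    simp [card_monics]
  · obtain ⟨s, hs⟩ : ∃ s, ψ s ≠ 1 := by
      by_contra! h
      exact hψ (by ext s; simpa using h s)
    set E : F[X] := monomial (R.natDegree - 1 - B.natDegree) (s / B.leadingCoeff) with hE
    have hEdeg : E.degree < n := by
      refine (degree_monomial_le _ _).trans_lt ?_
      norm_cast
      omega
    have hmem : ∀ A ∈ monics F n, ∀ E : F[X], E.degree < n → A + E ∈ monics F n := by
      intro A hA E hE
      rw [mem_monics] at hA ⊢
      have : E.degree < A.degree := by
        rw [degree_eq_natDegree hA.1.ne_zero, hA.2]; exact hE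
      exact ⟨hA.1.add_of_left this, by
        rw [natDegree_add_eq_left_of_degree_lt this, hA.2]⟩
    have h : ∑ A ∈ monics F n, ψ (resLin R (A * B)) =
        ψ s * ∑ A ∈ monics F n, ψ (resLin R (A * B)) := by
      rw [Finset.mul_sum]
      symm
      refine Finset.sum_nbij' (fun A => A + E) (fun A => A + -E) (fun A hA => hmem A hA E hEdeg)
        (fun A hA => hmem A hA _ (by rwa [degree_neg])) (fun A _ => by simp) (fun A _ => by simp)
        fun A _ => ?_
      rw [add_mul, map_add, resLin_monomial_mul hR hB hd, AddChar.map_add_eq_mul, mul_comm]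
    by_contra h0
    exact hs (mul_right_cancel₀ h0 (h.symm.trans (one_mul _).symm))

/-- The nonzero elements of the field of constants. -/
def scalars (F : Type*) [Field F] [Finite F] : Finset F := (Set.toFinite {b : F | b ≠ 0}).toFinset

lemma mem_scalars {b : F} : b ∈ scalars F ↔ b ≠ 0 := by simp [scalars]

lemma sum_quot {R : F[X]} (hR : R.Monic) [Fintype (F[X] ⧸ Ideal.span {R})]
    (f : F[X] ⧸ Ideal.span {R} → ℂ) (h0 : f 0 = 0) :
    ∑ x, f x = ∑ m ∈ Finset.range R.natDegree, ∑ B ∈ monics F m, ∑ b ∈ scalars F,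
      f (Ideal.Quotient.mk _ (C b * B)) := by
  classical
  rw [← sum_monicsLT, ← Finset.sum_product']
  symm
  refine Finset.sum_bij_ne_zero (fun p _ _ => Ideal.Quotient.mk _ (C p.2 * p.1))
    (fun _ _ _ => Finset.mem_univ _) ?_ ?_ fun _ _ _ => rfl
  · rintro ⟨B, b⟩ h1 _ ⟨B', b'⟩ h2 _ h
    simp only [Finset.mem_product, mem_monicsLT, mem_scalars] at h1 h2
    simp only [] at h
    rw [mk_eq_mk] at h
    have h3 : C b * B = C b' * B' := by
      rw [← sub_eq_zero]
      refine eq_zero_of_dvd_of_degree_lt h ((degree_sub_le _ _).trans_lt (max_lt ?_ ?_))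
      · rw [degree_C_mul h1.2]; exact degree_lt_degree h1.1.2
      · rw [degree_C_mul h2.2]; exact degree_lt_degree h2.1.2
    have h4 : b = b' := by
      have := congrArg leadingCoeff h3
      rwa [leadingCoeff_mul, leadingCoeff_mul, leadingCoeff_C, leadingCoeff_C,
        h1.1.1.leadingCoeff, h2.1.1.leadingCoeff, mul_one, mul_one] at this
    subst h4
    rw [mul_left_cancel₀ (C_ne_zero.2 h1.2) h3]
  · intro x _ hx
    obtain ⟨A, rfl⟩ := Ideal.Quotient.mk_surjective x
    have hB : (Ideal.Quotient.mk (Ideal.span {R})) A = Ideal.Quotient.mk _ (A %ₘ R) := by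
      rw [mk_eq_mk]
      exact ⟨A /ₘ R, by rw [sub_eq_iff_eq_add', modByMonic_add_div]⟩
    rw [hB] at hx ⊢
    have hB0 : A %ₘ R ≠ 0 := by
      intro hz
      rw [hz, map_zero, h0] at hx
      exact hx rfl
    have hR1 : R ≠ 1 := by
      rintro rfl
      exact hB0 (modByMonic_one A)
    have hl : (A %ₘ R).leadingCoeff ≠ 0 := leadingCoeff_ne_zero.2 hB0
    have e : C (A %ₘ R).leadingCoeff * (A %ₘ R * C (A %ₘ R).leadingCoeff⁻¹) = A %ₘ R := by
      rw [mul_left_comm, ← C_mul, mul_inv_cancel₀ hl, C_1, mul_one]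
    refine ⟨(A %ₘ R * C (A %ₘ R).leadingCoeff⁻¹, (A %ₘ R).leadingCoeff), ?_, ?_, ?_⟩
    · simp only [Finset.mem_product, mem_monicsLT, mem_scalars]
      refine ⟨⟨monic_mul_leadingCoeff_inv hB0, ?_⟩, hl⟩
      rw [natDegree_mul_leadingCoeff_inv _ hB0]
      exact natDegree_modByMonic_lt A hR hR1
    · simpa only [e] using hx
    · simp only [e]

/-- The sum of `χ` over the monic polynomials of degree `n`. -/
def csum {R : F[X]} (χ : DirChar R) (n : ℕ) : ℂ := ∑ A ∈ monics F n, χ.val A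

lemma exists_ne_one_of_isPrimitive {R : F[X]} (hR : R.Monic) {χ : DirChar R} (hχ : IsPrimitive χ)
    (a : F[X] ⧸ Ideal.span {R}) (ha : ¬ IsUnit a) :
    ∃ u : (F[X] ⧸ Ideal.span {R})ˣ, χ u ≠ 1 ∧ a * u = a := by
  obtain ⟨A, rfl⟩ := Ideal.Quotient.mk_surjective a
  rw [isUnit_mk, isCoprime_iff hR] at ha
  push Not at ha
  obtain ⟨P, hP, hPR, hPA⟩ := ha
  have h := (isPrimitive_iff hR χ).1 hχ P hP hPR
  rw [TrivialOn] at h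
  push Not at h
  obtain ⟨u, hu, hu1⟩ := h
  refine ⟨u, hu1, ?_⟩
  obtain ⟨B, hB, -⟩ := exists_rep u
  rw [mem_unitKer (divByMonic_dvd hP.1 hPR) hB] at hu
  rw [hB, ← map_mul, mk_eq_mk]
  have := mul_dvd_mul hPA hu
  rwa [mul_divByMonic_self hP.1 hPR, mul_sub, mul_one] at this

lemma exists_addChar_ne_one : ∃ ψ : AddChar F ℂ, ψ ≠ 1 := by
  obtain ⟨ψ, h⟩ := AddChar.exists_apply_ne_zero.2 (one_ne_zero (α := F))
  exact ⟨ψ, fun h1 => h (by rw [h1]; rfl)⟩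

lemma mul_csum_eq {R : F[X]} (hR : R.Monic) (hR1 : R ≠ 1) {χ : DirChar R} (hχ : IsPrimitive χ)
    {ψ : AddChar F ℂ} (hψ : ψ ≠ 1) : ∃ τ : ℂ, ‖τ‖ ^ 2 = (Nat.card F : ℝ) ^ R.natDegree ∧
    ∀ n, τ * csum χ n = ∑ m ∈ Finset.range R.natDegree, (starRingEnd ℂ) (csum χ m) *
      (if n + m + 1 < R.natDegree then
        (Nat.card F : ℂ) ^ n * ∑ b ∈ scalars F, (starRingEnd ℂ) (χ.val (C b))
      else if n + m + 1 = R.natDegree then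
        (Nat.card F : ℂ) ^ n * ∑ b ∈ scalars F, (starRingEnd ℂ) (χ.val (C b)) * ψ b
      else 0) := by
  have := finite_quot hR
  letI := Fintype.ofFinite (F[X] ⧸ Ideal.span {R})
  have hv : ∀ a : F[X] ⧸ Ideal.span {R}, ¬ IsUnit a →
      gaussSum χ⁻¹ ((resChar hR ψ).mulShift a) = 0 := by
    intro a ha
    obtain ⟨u, hu, hau⟩ := exists_ne_one_of_isPrimitive hR hχ a ha
    refine gaussSum_mulShift_eq_zero _ (u := u) ?_ hau
    rw [inv_apply_eq_conj]
    intro h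
    apply hu
    rw [← Complex.conj_conj (χ _), h, map_one]
  refine ⟨gaussSum χ⁻¹ (resChar hR ψ), ?_, fun n => ?_⟩
  · rw [norm_sq_gaussSum_inv (isPrimitive_resChar hR hψ) hv, Fintype.card_eq_nat_card,
      card_quot hR]
    push_cast; rfl
  have h0 : χ 0 = 0 := by
    refine MulChar.map_nonunit χ fun h => hR1 ?_
    rw [← map_zero (Ideal.Quotient.mk (Ideal.span {R})), isUnit_mk, isCoprime_zero_left] at h
    exact hR.eq_one_of_isUnit h
  calc _ = ∑ A ∈ monics F n, gaussSum χ⁻¹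
        ((resChar hR ψ).mulShift (Ideal.Quotient.mk _ A)) := by
        rw [csum, Finset.mul_sum]
        refine Finset.sum_congr rfl fun A _ => ?_
        rw [gaussSum_inv_mulShift hv, mul_comm]; rfl
    _ = ∑ x, (starRingEnd ℂ) (χ x) *
        ∑ A ∈ monics F n, resChar hR ψ (Ideal.Quotient.mk _ A * x) := by
        simp only [gaussSum]
        rw [Finset.sum_comm]
        refine Finset.sum_congr rfl fun x _ => ?_
        rw [Finset.mul_sum]
        refine Finset.sum_congr rfl fun A _ => ?_
        rw [inv_apply_eq_conj, AddChar.mulShift_apply]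
    _ = ∑ m ∈ Finset.range R.natDegree, ∑ B ∈ monics F m, ∑ b ∈ scalars F,
        (starRingEnd ℂ) (χ.val (C b * B)) * ∑ A ∈ monics F n, ψ (resLin R (A * (C b * B))) := by
        rw [sum_quot hR _ (by rw [h0, map_zero, zero_mul])]
        refine Finset.sum_congr rfl fun m _ => Finset.sum_congr rfl fun B _ =>
          Finset.sum_congr rfl fun b _ => ?_
        congr 1
        refine Finset.sum_congr rfl fun A _ => ?_
        rw [← map_mul, resChar_mk]
    _ = _ := by
        refine Finset.sum_congr rfl fun m hm => ?_
        rw [csum, map_sum, Finset.sum_mul]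
        refine Finset.sum_congr rfl fun B hB => ?_
        rw [mem_monics] at hB
        have h1 : ∀ b ∈ scalars F, (starRingEnd ℂ) (χ.val (C b * B)) *
            ∑ A ∈ monics F n, ψ (resLin R (A * (C b * B))) =
            (starRingEnd ℂ) (χ.val B) * ((starRingEnd ℂ) (χ.val (C b)) *
              if n + m + 1 < R.natDegree then (Nat.card F : ℂ) ^ n
              else if n + m + 1 = R.natDegree then (Nat.card F : ℂ) ^ n * ψ b else 0) := by
          intro b hb
          rw [mem_scalars] at hb
          have hdeg : (C b * B).natDegree = m := by rw [natDegree_C_mul hb, hB.2]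
          rw [sum_monics_resLin hR hψ (mul_ne_zero (C_ne_zero.2 hb) hB.1.ne_zero)
            (by rw [hdeg]; exact Finset.mem_range.1 hm), hdeg, val_mul, map_mul, leadingCoeff_mul,
            leadingCoeff_C, hB.1.leadingCoeff, mul_one]
          ring
        rw [Finset.sum_congr rfl h1, ← Finset.mul_sum]
        congr 1
        split_ifs
        · rw [Finset.mul_sum]
          exact Finset.sum_congr rfl fun b _ => mul_comm _ _
        · rw [Finset.mul_sum]
          exact Finset.sum_congr rfl fun b _ => by ring
        · simp

/-- The restriction of a Dirichlet character to the constants. -/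
def constChar {R : F[X]} (hR : R.Monic) (hR1 : R ≠ 1) (χ : DirChar R) : MulChar F ℂ where
  toFun b := χ.val (C b)
  map_one' := by rw [C_1, val_one]
  map_mul' a b := by rw [C_mul, val_mul]
  map_nonunit' a ha := by
    have : a = 0 := by simpa using ha
    rw [this, C_0]
    refine val_eq_zero χ fun h => hR1 ?_
    rw [isCoprime_zero_left] at h
    exact hR.eq_one_of_isUnit h

lemma constChar_apply {R : F[X]} (hR : R.Monic) (hR1 : R ≠ 1) (χ : DirChar R) (b : F) :
    constChar hR hR1 χ b = χ.val (C b) := rfl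

lemma sum_scalars [Fintype F] (f : F → ℂ) (h0 : f 0 = 0) : ∑ b ∈ scalars F, f b = ∑ b, f b := by
  refine Finset.sum_subset (Finset.subset_univ _) fun b _ hb => ?_
  rw [mem_scalars, not_not] at hb
  rw [hb, h0]

lemma scalar_sums {R : F[X]} (hR : R.Monic) (hR1 : R ≠ 1) (χ : DirChar R)
    {ψ : AddChar F ℂ} (hψ : ψ ≠ 1) :
    (∑ b ∈ scalars F, (starRingEnd ℂ) (χ.val (C b)) = 0 ∧
      ‖∑ b ∈ scalars F, (starRingEnd ℂ) (χ.val (C b)) * ψ b‖ ^ 2 = Nat.card F) ∨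
    (∑ b ∈ scalars F, (starRingEnd ℂ) (χ.val (C b)) = (Nat.card F : ℂ) - 1 ∧
      ∑ b ∈ scalars F, (starRingEnd ℂ) (χ.val (C b)) * ψ b = -1) := by
  classical
  letI := Fintype.ofFinite F
  have h0 : χ.val (C 0) = 0 := by
    rw [← constChar_apply hR hR1]
    exact MulChar.map_nonunit _ (by simp)
  have e1 : ∑ b ∈ scalars F, (starRingEnd ℂ) (χ.val (C b)) = ∑ b, (constChar hR hR1 χ)⁻¹ b := by
    rw [sum_scalars _ (by rw [h0, map_zero])]
    exact Finset.sum_congr rfl fun b _ => by rw [inv_apply_eq_conj, constChar_apply]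
  have e2 : ∑ b ∈ scalars F, (starRingEnd ℂ) (χ.val (C b)) * ψ b =
      gaussSum (constChar hR hR1 χ)⁻¹ ψ := by
    rw [sum_scalars _ (by rw [h0, map_zero, zero_mul]), gaussSum]
    exact Finset.sum_congr rfl fun b _ => by rw [inv_apply_eq_conj, constChar_apply]
  have hp := AddChar.IsPrimitive.of_ne_one hψ
  by_cases h : constChar hR hR1 χ = 1
  · right
    have e3 : ∀ b ∈ scalars F, (starRingEnd ℂ) (χ.val (C b)) = 1 := fun b hb => by
      rw [← constChar_apply hR hR1, h, MulChar.one_apply (isUnit_iff_ne_zero.2 (mem_scalars.1 hb)),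
        map_one]
    have e4 : scalars F = Finset.univ.erase 0 := by ext b; simp [mem_scalars]
    refine ⟨?_, ?_⟩
    · rw [Finset.sum_congr rfl e3, e4, Finset.sum_const, Finset.card_erase_of_mem
        (Finset.mem_univ _), Finset.card_univ, Fintype.card_eq_nat_card, nsmul_eq_mul, mul_one,
        Nat.cast_sub one_lt_card.le, Nat.cast_one]
    · rw [Finset.sum_congr rfl fun b hb => by rw [e3 b hb, one_mul], e4]
      have := AddChar.sum_eq_zero_of_ne_one hψ
      rw [← Finset.add_sum_erase _ _ (Finset.mem_univ (0 : F)), AddChar.map_zero_eq_one] at this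
      linear_combination this
  · left
    have h1 : ∑ b, (constChar hR hR1 χ)⁻¹ b = 0 :=
      MulChar.sum_eq_zero_of_ne_one (inv_ne_one.2 h)
    refine ⟨by rw [e1, h1], ?_⟩
    rw [e2, norm_sq_gaussSum_inv hp, Fintype.card_eq_nat_card]
    intro a ha
    have : a = 0 := by simpa using ha
    rw [this, gaussSum, ← h1]
    refine Finset.sum_congr rfl fun b _ => ?_
    rw [AddChar.mulShift_apply, zero_mul, AddChar.map_zero_eq_one, mul_one]
  
lemma csum_eq_zero {R : F[X]} (hR : R.Monic) (hR1 : R ≠ 1) {χ : DirChar R} (hχ : IsPrimitive χ)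
    {n : ℕ} (hn : R.natDegree ≤ n) : csum χ n = 0 := by
  obtain ⟨ψ, hψ⟩ := exists_addChar_ne_one (F := F)
  obtain ⟨τ, h1, h2⟩ := mul_csum_eq hR hR1 hχ hψ
  have h := h2 n
  rw [Finset.sum_eq_zero] at h
  · refine (mul_eq_zero.1 h).resolve_left ?_
    rintro rfl
    have := card_pow_pos (F := F) R.natDegree
    simp at h1
    linarith
  · intro m hm
    rw [if_neg (by omega), if_neg (by omega), mul_zero]

lemma csum_zero {R : F[X]} (χ : DirChar R) : csum χ 0 = 1 := by
  rw [csum, monics_zero, Finset.sum_singleton, val_one]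

/-- The coefficients `β` in the reflected polynomial of even characters. -/
def reflCoeff (F : Type*) [Field F] (Y j : ℕ) : ℝ :=
  1 - ((rt F)⁻¹ + 1) * rt F ^ (Y - j)

lemma sum_reflect_even (c : ℕ → ℂ) (Y : ℕ) :
    ∑ k ∈ Finset.range Y, (rt F : ℂ) ^ k * (((Nat.card F : ℂ) - 1) * ∑ m ∈ Finset.range k, c m - c k) =
      (rt F : ℂ)⁻¹ * ∑ j ∈ Finset.range Y, (reflCoeff F Y j : ℂ) * c j * (rt F : ℂ) ^ j := by
  have hr : (rt F : ℂ) ≠ 0 := by exact_mod_cast (rt_pos (F := F)).ne'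
  have hq : (Nat.card F : ℂ) = ((rt F : ℂ)⁻¹) ^ 2 := by
    have := rt_sq (F := F)
    rw [inv_pow, ← Complex.ofReal_pow, this]
    simp
  have e : ∀ Y : ℕ, (rt F : ℂ)⁻¹ * ∑ j ∈ Finset.range Y, (reflCoeff F Y j : ℂ) * c j * (rt F : ℂ) ^ j =
      (rt F : ℂ)⁻¹ * ∑ j ∈ Finset.range Y, (rt F : ℂ) ^ j * c j -
        (rt F : ℂ)⁻¹ * ((rt F : ℂ)⁻¹ + 1) * (rt F : ℂ) ^ Y * ∑ j ∈ Finset.range Y, c j := by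
    intro Y
    rw [Finset.mul_sum, Finset.mul_sum, Finset.mul_sum, ← Finset.sum_sub_distrib]
    refine Finset.sum_congr rfl fun j hj => ?_
    have : (rt F : ℂ) ^ Y = (rt F : ℂ) ^ (Y - j) * (rt F : ℂ) ^ j := by
      rw [← pow_add, Nat.sub_add_cancel (Finset.mem_range.1 hj).le]
    rw [this, reflCoeff]
    push_cast
    ring
  rw [e, hq]
  induction Y with
  | zero => simp
  | succ Y ih =>
    rw [Finset.sum_range_succ, ih, Finset.sum_range_succ, Finset.sum_range_succ]
    generalize ∑ j ∈ Finset.range Y, (rt F : ℂ) ^ j * c j = a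
    generalize ∑ j ∈ Finset.range Y, c j = b
    field_simp
    ring

lemma norm_sum_csum_eq {R : F[X]} (hR : R.Monic) (hR1 : R ≠ 1) {χ : DirChar R}
    (hχ : IsPrimitive χ) {N : ℕ} (hN : N ≤ R.natDegree) :
    ‖∑ n ∈ Finset.Ico N R.natDegree, csum χ n * (rt F : ℂ) ^ n‖ =
        ‖∑ j ∈ Finset.range (R.natDegree - N), csum χ j * (rt F : ℂ) ^ j‖ ∨
      ‖∑ n ∈ Finset.Ico N R.natDegree, csum χ n * (rt F : ℂ) ^ n‖ =
        ‖∑ j ∈ Finset.range (R.natDegree - N),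
          (reflCoeff F (R.natDegree - N) j : ℂ) * csum χ j * (rt F : ℂ) ^ j‖ := by
  obtain ⟨ψ, hψ⟩ := exists_addChar_ne_one (F := F)
  obtain ⟨τ, hτ, h⟩ := mul_csum_eq hR hR1 hχ hψ
  set d := R.natDegree with hd
  have hd0 : 0 < d := natDegree_pos_of_ne_one hR hR1
  have hr0 := rt_pos (F := F)
  have hr : (rt F : ℂ) ≠ 0 := by exact_mod_cast hr0.ne'
  have hq : (Nat.card F : ℂ) = ((rt F : ℂ)⁻¹) ^ 2 := by
    have := rt_sq (F := F)
    rw [inv_pow, ← Complex.ofReal_pow, this]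
    simp
  have hqr : (Nat.card F : ℝ) = ((rt F)⁻¹) ^ 2 := by
    rw [inv_pow, rt_sq, inv_inv]
  set g0 := ∑ b ∈ scalars F, (starRingEnd ℂ) (χ.val (C b)) with hg0
  set g1 := ∑ b ∈ scalars F, (starRingEnd ℂ) (χ.val (C b)) * ψ b with hg1
  have h1 : ∀ k < d, τ * csum χ (d - 1 - k) = (Nat.card F : ℂ) ^ (d - 1 - k) *
      (g0 * ∑ m ∈ Finset.range k, (starRingEnd ℂ) (csum χ m) + g1 * (starRingEnd ℂ) (csum χ k)) := by
    intro k hk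
    rw [h, ← Finset.sum_range_add_sum_Ico _ (show k + 1 ≤ d by omega), Finset.sum_range_succ,
      Finset.sum_eq_zero (s := Finset.Ico _ _), if_neg (by omega), if_pos (by omega),
      Finset.sum_congr rfl fun m hm => by
        rw [if_pos (by have := Finset.mem_range.1 hm; omega)], ← Finset.sum_mul]
    · ring
    · intro m hm
      have := Finset.mem_Ico.1 hm
      rw [if_neg (by omega), if_neg (by omega), mul_zero]
  have h2 : τ * ∑ n ∈ Finset.Ico N d, csum χ n * (rt F : ℂ) ^ n =
      ((rt F : ℂ)⁻¹) ^ (d - 1) * ∑ k ∈ Finset.range (d - N), (rt F : ℂ) ^ k *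
      (g0 * ∑ m ∈ Finset.range k, (starRingEnd ℂ) (csum χ m) + g1 * (starRingEnd ℂ) (csum χ k)) := by
    have e := Finset.sum_Ico_reflect (fun n => csum χ n * (rt F : ℂ) ^ n) 0
      (show d - N ≤ d - 1 + 1 by omega)
    rw [show d - 1 + 1 - (d - N) = N by omega, show d - 1 + 1 - 0 = d by omega] at e
    rw [← e, Finset.range_eq_Ico, Finset.mul_sum, Finset.mul_sum]
    refine Finset.sum_congr rfl fun k hk => ?_
    have hk := Finset.mem_Ico.1 hk
    rw [← mul_assoc, h1 k (by omega), hq, ← pow_mul]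
    have e : ((rt F : ℂ)⁻¹) ^ (d - 1) = ((rt F : ℂ)⁻¹) ^ (d - 1 - k) * ((rt F : ℂ)⁻¹) ^ k := by
      rw [← pow_add]; congr 1; omega
    rw [e, mul_comm 2, pow_mul]
    generalize ∑ m ∈ Finset.range k, (starRingEnd ℂ) (csum χ m) = s
    simp only [inv_pow]
    field_simp
  have hτ0 : ‖τ‖ = ((rt F)⁻¹) ^ d := by
    rw [hqr, ← pow_mul, mul_comm, pow_mul] at hτ
    exact (pow_left_inj₀ (norm_nonneg _) (by positivity) two_ne_zero).1 hτ
  have hτpos : 0 < ‖τ‖ := by rw [hτ0]; positivity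
  have hrd : ((rt F)⁻¹) ^ d = ((rt F)⁻¹) ^ (d - 1) * (rt F)⁻¹ := by
    rw [← pow_succ]; congr 1; omega
  have h3 := congrArg norm h2
  rw [norm_mul, norm_mul, norm_pow, norm_inv, Complex.norm_real, Real.norm_of_nonneg hr0.le,
    hτ0, hrd, mul_assoc] at h3
  have h4 := mul_left_cancel₀ (by positivity) h3
  rcases scalar_sums hR hR1 χ hψ with ⟨e0, e1⟩ | ⟨e0, e1⟩
  · left
    rw [← hg0] at e0
    rw [← hg1, hqr] at e1
    have e1' := (pow_left_inj₀ (norm_nonneg _) (by positivity) two_ne_zero).1 e1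
    refine mul_left_cancel₀ (inv_ne_zero hr0.ne') (h4.trans ?_)
    rw [← e1', ← RCLike.norm_conj (∑ j ∈ _, csum χ j * (rt F : ℂ) ^ j), ← norm_mul, map_sum,
      Finset.mul_sum, e0]
    congr 1
    refine Finset.sum_congr rfl fun k _ => ?_
    simp only [map_mul, map_pow, Complex.conj_ofReal]
    ring
  · right
    rw [← hg0] at e0
    rw [← hg1] at e1
    refine mul_left_cancel₀ (inv_ne_zero hr0.ne') (h4.trans ?_)
    rw [e0, e1]
    simp only [neg_one_mul, ← sub_eq_add_neg]
    rw [sum_reflect_even, norm_mul, norm_inv, Complex.norm_real, Real.norm_of_nonneg hr0.le]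
    congr 1
    rw [← RCLike.norm_conj, map_sum]
    congr 1
    refine Finset.sum_congr rfl fun k _ => ?_
    simp only [map_mul, map_pow, Complex.conj_ofReal, Complex.conj_conj]

/-- The weight in the logarithmic variable. -/
def logWeight (u : ℝ → ℝ) (s : ℝ) : ℝ := Real.exp s * u (Real.exp s)

lemma integral_Ioi_eq_integral_exp {E : Type*} [NormedAddCommGroup E] [NormedSpace ℝ E]
    (g : ℝ → E) : ∫ x in Set.Ioi (0 : ℝ), g x = ∫ s, Real.exp s • g (Real.exp s) := by
  have h := integral_image_eq_integral_abs_deriv_smul (s := Set.univ) (f := Real.exp)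
    (f' := Real.exp) MeasurableSet.univ (fun x _ => (Real.hasDerivAt_exp x).hasDerivWithinAt)
    Real.exp_injective.injOn g
  rw [Set.image_univ, Real.range_exp, Measure.restrict_univ] at h
  rw [h]
  simp only [abs_of_pos (Real.exp_pos _)]

lemma U_eq_integral (u : ℝ → ℝ) (z : ℂ) :
    U u z = ∫ s, (logWeight u s : ℂ) * expInt (z * s) := by
  rw [U, integral_Ioi_eq_integral_exp]
  refine integral_congr_ae (Eventually.of_forall fun s => ?_)
  simp only [Real.log_exp, logWeight, Complex.real_smul]
  push_cast
  ring

lemma expInt_mul (z : ℂ) {a : ℝ} (ha : 0 < a) :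
    expInt (z * a) = ∫ t in Set.Ioi (0 : ℝ), Complex.exp (-(z + t) * a) / (z + t) := by
  have h := integral_comp_mul_left_Ioi
    (fun t : ℝ => Complex.exp (-(z * a + t)) / (z * a + t)) 0 ha
  rw [mul_zero] at h
  rw [expInt, ← inv_smul_smul₀ ha.ne' (∫ t in Set.Ioi (0 : ℝ), _), ← smul_comm, ← h, ← integral_smul]
  refine integral_congr_ae (Eventually.of_forall fun t => ?_)
  simp only [Complex.real_smul]
  have ha' : (a : ℂ) ≠ 0 := by exact_mod_cast ha.ne'
  push_cast
  rw [show z * a + a * t = a * (z + t) by ring, ← mul_div_assoc, mul_div_mul_left _ _ ha']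
  congr 2
  ring

lemma exists_le_norm_add {z : ℂ} (hz : z ∈ Complex.slitPlane) :
    ∃ m > 0, ∀ t : ℝ, 0 ≤ t → m ≤ ‖z + t‖ := by
  rcases hz with h | h
  · refine ⟨z.re, h, fun t ht => le_trans ?_ (Complex.re_le_norm _)⟩
    simp [ht]
  · refine ⟨|z.im|, abs_pos.2 h, fun t ht => le_trans ?_ (Complex.abs_im_le_norm _)⟩
    simp

lemma norm_exp_neg_mul_le {z : ℂ} {s t c : ℝ} (hs : 1 ≤ s) (hs2 : s ≤ 2) (ht : 0 ≤ t)
    (hc : |z.re| ≤ c) :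
    ‖Complex.exp (-(z + t) * s)‖ ≤ Real.exp (2 * c) * Real.exp (-t) := by
  rw [Complex.norm_exp, ← Real.exp_add, Real.exp_le_exp]
  simp only [neg_mul, Complex.neg_re, Complex.mul_re, Complex.add_re, Complex.ofReal_re,
    Complex.ofReal_im, mul_zero, sub_zero]
  have := neg_abs_le z.re
  have h1 := abs_nonneg z.re
  nlinarith

/-- The measure `ds × dt` on `ℝ × (0, ∞)`. -/
def stripMeasure : Measure (ℝ × ℝ) := (volume : Measure ℝ).prod (volume.restrict (Set.Ioi 0))

lemma ae_strip : ∀ᵐ p ∂stripMeasure, 0 < p.2 := by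
  have h : stripMeasure = (volume : Measure (ℝ × ℝ)).restrict (Set.univ ×ˢ Set.Ioi 0) := by
    rw [stripMeasure, Measure.volume_eq_prod, ← Measure.prod_restrict, Measure.restrict_univ]
  rw [h, ae_restrict_iff' (MeasurableSet.univ.prod measurableSet_Ioi)]
  exact Eventually.of_forall fun p hp => hp.2

lemma integrable_strip {g : ℝ → ℝ} (hg : Integrable g) (c : ℝ) :
    Integrable (fun p : ℝ × ℝ => c * (|g p.1| * Real.exp (-p.2))) stripMeasure :=
  ((hg.abs).mul_prod (g := fun t : ℝ => Real.exp (-t))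
    (by simpa [IntegrableOn] using exp_neg_integrableOn_Ioi 0 one_pos)).const_mul c

lemma norm_strip_integrand_le {g : ℝ → ℝ} (hg : Function.support g ⊆ Set.Icc 1 2) {z : ℂ} {c : ℝ}
    (hc : |z.re| ≤ c) {p : ℝ × ℝ} (hp : 0 < p.2) :
    ‖(g p.1 : ℂ) * Complex.exp (-(z + p.2) * p.1)‖ ≤
      Real.exp (2 * c) * (|g p.1| * Real.exp (-p.2)) := by
  by_cases h : g p.1 = 0
  · simp [h]
  · have h1 := hg h
    rw [norm_mul, Complex.norm_real, Real.norm_eq_abs]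
    have := mul_le_mul_of_nonneg_left (norm_exp_neg_mul_le h1.1 h1.2 hp.le hc) (abs_nonneg (g p.1))
    linarith

lemma integrable_of_support {g : ℝ → ℝ} (hg : Continuous g) (hs : Function.support g ⊆ Set.Icc 1 2) :
    Integrable g :=
  hg.integrable_of_hasCompactSupport (HasCompactSupport.of_support_subset_isCompact isCompact_Icc hs)

lemma support_deriv_subset_Icc {g : ℝ → ℝ} (hs : Function.support g ⊆ Set.Icc 1 2) :
    Function.support (deriv g) ⊆ Set.Icc 1 2 :=
  support_deriv_subset.trans (closure_minimal hs isClosed_Icc)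

lemma integral_deriv_mul_exp {g : ℝ → ℝ} (hg : ContDiff ℝ 1 g)
    (hs : Function.support g ⊆ Set.Icc 1 2) (z : ℂ) :
    ∫ s, ((deriv g s : ℝ) : ℂ) * Complex.exp (-z * s) = z * ∫ s, (g s : ℂ) * Complex.exp (-z * s) := by
  have hc : HasCompactSupport g := HasCompactSupport.of_support_subset_isCompact isCompact_Icc hs
  have hgc := hg.continuous
  have hgc' := hg.continuous_deriv le_rfl
  have i1 : Integrable fun s : ℝ => (g s : ℂ) * Complex.exp (-z * s) := by
    refine Continuous.integrable_of_hasCompactSupport (by fun_prop) ?_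
    refine HasCompactSupport.of_support_subset_isCompact isCompact_Icc fun s hs' => hs ?_
    intro h
    exact hs' (by simp [h])
  have i2 : Integrable fun s : ℝ => ((deriv g s : ℝ) : ℂ) * Complex.exp (-z * s) := by
    refine Continuous.integrable_of_hasCompactSupport (by fun_prop) ?_
    refine HasCompactSupport.of_support_subset_isCompact isCompact_Icc fun s hs' =>
      support_deriv_subset_Icc hs ?_
    intro h
    exact hs' (by simp [h])
  have hd : ∀ s : ℝ, HasDerivAt (fun s : ℝ => (g s : ℂ) * Complex.exp (-z * s))
      (((deriv g s : ℝ) : ℂ) * Complex.exp (-z * s) - z * ((g s : ℂ) * Complex.exp (-z * s))) s := by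
    intro s
    have h1 := ((hg.differentiable one_ne_zero) s).hasDerivAt.ofReal_comp
    have h2 : HasDerivAt (fun s : ℝ => Complex.exp (-z * s)) (Complex.exp (-z * s) * (-z * 1)) s :=
      ((Complex.ofRealCLM.hasDerivAt (x := s)).const_mul (-z)).cexp
    exact (h1.mul h2).congr_deriv (by ring)
  have h := integral_eq_zero_of_hasDerivAt_of_integrable hd (i2.sub (i1.const_mul z)) i1
  rw [integral_sub i2 (i1.const_mul z), integral_const_mul, sub_eq_zero] at h
  exact h

lemma integral_weight_mul_expInt {g : ℝ → ℝ} (hg : ContDiff ℝ 1 g)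
    (hs : Function.support g ⊆ Set.Icc 1 2) {z : ℂ} (hz : z ∈ Complex.slitPlane) :
    ∫ s, (g s : ℂ) * expInt (z * s) = ∫ p, ((deriv g p.1 : ℝ) : ℂ) * Complex.exp (-(z + p.2) * p.1) /
      (z + p.2) ^ 2 ∂stripMeasure := by
  obtain ⟨m, hm, hmz⟩ := exists_le_norm_add hz
  have hgc := hg.continuous
  have hgc' := hg.continuous_deriv le_rfl
  have i1 : Integrable (fun p : ℝ × ℝ => (g p.1 : ℂ) * Complex.exp (-(z + p.2) * p.1) / (z + p.2))
      stripMeasure := by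
    refine (integrable_strip (integrable_of_support hgc hs) (Real.exp (2 * |z.re|) / m)).mono'
      (Measurable.aestronglyMeasurable (by fun_prop)) ?_
    filter_upwards [ae_strip] with p hp
    rw [norm_div, div_mul_eq_mul_div]
    exact div_le_div₀ (by positivity) (norm_strip_integrand_le hs le_rfl hp) hm (hmz _ hp.le)
  have i2 : Integrable (fun p : ℝ × ℝ => ((deriv g p.1 : ℝ) : ℂ) * Complex.exp (-(z + p.2) * p.1) /
      (z + p.2) ^ 2) stripMeasure := by
    refine (integrable_strip (integrable_of_support hgc' (support_deriv_subset_Icc hs))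
      (Real.exp (2 * |z.re|) / m ^ 2)).mono' (Measurable.aestronglyMeasurable (by fun_prop)) ?_
    filter_upwards [ae_strip] with p hp
    rw [norm_div, div_mul_eq_mul_div, norm_pow]
    exact div_le_div₀ (by positivity)
      (norm_strip_integrand_le (support_deriv_subset_Icc hs) le_rfl hp)
      (by positivity) (pow_le_pow_left₀ hm.le (hmz _ hp.le) 2)
  calc _ = ∫ s, ∫ t in Set.Ioi (0 : ℝ), (g s : ℂ) * Complex.exp (-(z + t) * s) / (z + t) := by
        refine integral_congr_ae (Eventually.of_forall fun s => ?_)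
        by_cases h : g s = 0
        · simp [h]
        · simp only []
          rw [expInt_mul z (lt_of_lt_of_le one_pos (hs h).1), ← integral_const_mul]
          simp only [mul_div_assoc]
    _ = ∫ t in Set.Ioi (0 : ℝ), ∫ s, (g s : ℂ) * Complex.exp (-(z + t) * s) / (z + t) :=
        integral_integral_swap i1
    _ = ∫ t in Set.Ioi (0 : ℝ), ∫ s, ((deriv g s : ℝ) : ℂ) * Complex.exp (-(z + t) * s) / (z + t) ^ 2 := by
        refine setIntegral_congr_fun measurableSet_Ioi fun t ht => ?_
        have h0 : z + t ≠ 0 := norm_pos_iff.1 (hm.trans_le (hmz t (le_of_lt ht)))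
        rw [integral_div, integral_div, integral_deriv_mul_exp hg hs]
        field_simp
    _ = _ := (integral_prod_symm _ i2).symm

lemma norm_integral_weight_mul_expInt_le {g : ℝ → ℝ} (hg : ContDiff ℝ 1 g)
    (hs : Function.support g ⊆ Set.Icc 1 2) : ∃ A, 0 ≤ A ∧ ∀ z ∈ Complex.slitPlane, ∀ c m : ℝ,
      |z.re| ≤ c → 0 < m → (∀ t : ℝ, 0 ≤ t → m ≤ ‖z + t‖) →
      ‖∫ s, (g s : ℂ) * expInt (z * s)‖ ≤ A * Real.exp (2 * c) / m ^ 2 := by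
  have hgc' := hg.continuous_deriv le_rfl
  refine ⟨∫ p : ℝ × ℝ, 1 * (|deriv g p.1| * Real.exp (-p.2)) ∂stripMeasure,
    integral_nonneg fun p => by positivity, fun z hz c m hc hm hmz => ?_⟩
  rw [integral_weight_mul_expInt hg hs hz, mul_div_assoc, mul_comm, ← integral_const_mul]
  have i := integrable_strip (integrable_of_support hgc' (support_deriv_subset_Icc hs))
  refine norm_integral_le_of_norm_le ((i 1).const_mul _) ?_
  filter_upwards [ae_strip] with p hp
  rw [norm_div, norm_pow, one_mul, div_mul_eq_mul_div]
  exact div_le_div₀ (by positivity)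
    (norm_strip_integrand_le (support_deriv_subset_Icc hs) hc hp)
    (by positivity) (pow_le_pow_left₀ hm.le (hmz _ hp.le) 2)

lemma differentiableAt_integral_weight_mul_expInt {g : ℝ → ℝ} (hg : ContDiff ℝ 1 g)
    (hs : Function.support g ⊆ Set.Icc 1 2) {z : ℂ} (hz : z ∈ Complex.slitPlane) :
    DifferentiableAt ℂ (fun z : ℂ => ∫ s, (g s : ℂ) * expInt (z * s)) z := by
  obtain ⟨m, hm, hmz⟩ := exists_le_norm_add hz
  have hgc' := hg.continuous_deriv le_rfl
  have hs' := support_deriv_subset_Icc hs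
  have hm2 : ∀ w ∈ Metric.ball z (m / 2), ∀ t : ℝ, 0 ≤ t → m / 2 ≤ ‖w + t‖ := by
    intro w hw t ht
    have h1 := hmz t ht
    have h2 : ‖z + t‖ ≤ ‖w + t‖ + ‖z - w‖ := by
      calc ‖z + t‖ = ‖(w + t) + (z - w)‖ := by congr 1; ring
        _ ≤ _ := norm_add_le _ _
    rw [Metric.mem_ball, dist_comm, dist_eq_norm] at hw
    linarith
  have hre : ∀ w ∈ Metric.ball z (m / 2), |w.re| ≤ |z.re| + m := by
    intro w hw
    rw [Metric.mem_ball, dist_eq_norm] at hw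
    have h1 := Complex.abs_re_le_norm (w - z)
    rw [Complex.sub_re] at h1
    have := abs_sub_abs_le_abs_sub w.re z.re
    linarith
  set c := |z.re| + m with hc
  have hI : ∀ w ∈ Metric.ball z (m / 2), AEStronglyMeasurable (fun p : ℝ × ℝ =>
      ((deriv g p.1 : ℝ) : ℂ) * Complex.exp (-(w + p.2) * p.1) / (w + p.2) ^ 2) stripMeasure :=
    fun w _ => Measurable.aestronglyMeasurable (by fun_prop)
  have key := hasDerivAt_integral_of_dominated_loc_of_deriv_le (μ := stripMeasure) (𝕜 := ℂ)
    (F := fun w p => ((deriv g p.1 : ℝ) : ℂ) * Complex.exp (-(w + p.2) * p.1) / (w + p.2) ^ 2)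
    (F' := fun w p => ((deriv g p.1 : ℝ) : ℂ) * Complex.exp (-(w + p.2) * p.1) *
      (-p.1 / (w + p.2) ^ 2 - 2 / (w + p.2) ^ 3)) (x₀ := z)
    (bound := fun p => (Real.exp (2 * c) * (2 / (m / 2) ^ 2 + 2 / (m / 2) ^ 3)) *
      (|deriv g p.1| * Real.exp (-p.2)))
    (Metric.ball_mem_nhds z (half_pos hm)) ?_ ?_ ?_ ?_ ?_ ?_
  · have h := key.2.differentiableAt
    refine h.congr_of_eventuallyEq ?_
    filter_upwards [Complex.isOpen_slitPlane.mem_nhds hz] with w hw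
    exact integral_weight_mul_expInt hg hs hw
  · filter_upwards [Metric.ball_mem_nhds z (half_pos hm)] with w hw using hI w hw
  · refine (integrable_strip (integrable_of_support hgc' hs')
      (Real.exp (2 * |z.re|) / m ^ 2)).mono' (hI z (Metric.mem_ball_self (half_pos hm))) ?_
    filter_upwards [ae_strip] with p hp
    rw [norm_div, div_mul_eq_mul_div, norm_pow]
    exact div_le_div₀ (by positivity) (norm_strip_integrand_le hs' le_rfl hp)
      (by positivity) (pow_le_pow_left₀ hm.le (hmz _ hp.le) 2)
  · exact Measurable.aestronglyMeasurable (by fun_prop)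
  · filter_upwards [ae_strip] with p hp w hw
    by_cases h0 : deriv g p.1 = 0
    · simp [h0]
    have h1 := hs' h0
    have h2 := norm_strip_integrand_le hs' (hre w hw) hp
    have h3 := hm2 w hw p.2 hp.le
    have hm0 := half_pos hm
    rw [norm_mul]
    have h4 : ‖-(p.1 : ℂ) / (w + p.2) ^ 2 - 2 / (w + p.2) ^ 3‖ ≤
        2 / (m / 2) ^ 2 + 2 / (m / 2) ^ 3 := by
      refine (norm_sub_le _ _).trans (add_le_add ?_ ?_)
      · rw [norm_div, norm_neg, norm_pow, Complex.norm_real, Real.norm_of_nonneg (by linarith [h1.1])]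
        exact div_le_div₀ (by norm_num) h1.2 (by positivity) (pow_le_pow_left₀ hm0.le h3 2)
      · rw [norm_div, norm_pow, Complex.norm_ofNat]
        exact div_le_div₀ (by norm_num) le_rfl (by positivity) (pow_le_pow_left₀ hm0.le h3 3)
    refine (mul_le_mul h2 h4 (norm_nonneg _) (by positivity)).trans_eq ?_
    ring
  · exact integrable_strip (integrable_of_support hgc' hs') _
  · filter_upwards [ae_strip] with p hp w hw
    have h0 : w + p.2 ≠ 0 :=
      norm_pos_iff.1 ((half_pos hm).trans_le (hm2 w hw p.2 hp.le))
    have h1 : HasDerivAt (fun w : ℂ => w + p.2) 1 w := (hasDerivAt_id w).add_const _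
    have h2 := (h1.neg.mul_const (p.1 : ℂ)).cexp
    have h3 := h1.pow 2
    have h4 := (h2.const_mul ((deriv g p.1 : ℝ) : ℂ)).div h3 (pow_ne_zero 2 h0)
    refine h4.congr_deriv ?_
    simp only [Pi.pow_apply, Pi.neg_apply]
    field_simp
    push_cast
    ring

lemma expInt_mul_eq_integral_Ioi {z : ℂ} (hz : 0 < z.re) {a : ℝ} (ha : 0 < a) :
    expInt (z * a) = ∫ t in Set.Ioi a, Complex.exp (-z * t) / t := by
  have i1 : Integrable (fun p : ℝ × ℝ => Complex.exp (-z * p.1) * Complex.exp (-(p.2 * p.1 : ℝ)))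
      ((volume.restrict (Set.Ioi a)).prod (volume.restrict (Set.Ioi 0))) := by
    have h1 : IntegrableOn (fun t : ℝ => Real.exp (-z.re * t)) (Set.Ioi a) :=
      exp_neg_integrableOn_Ioi a hz
    have h2 : IntegrableOn (fun t : ℝ => Real.exp (-a * t)) (Set.Ioi 0) :=
      exp_neg_integrableOn_Ioi 0 ha
    refine (Integrable.mul_prod h1 h2).mono' (Measurable.aestronglyMeasurable (by fun_prop)) ?_
    rw [Measure.prod_restrict, ae_restrict_iff' (measurableSet_Ioi.prod measurableSet_Ioi)]
    refine Eventually.of_forall fun p hp => ?_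
    have hp1 : a < p.1 := hp.1
    have hp2 : 0 < p.2 := hp.2
    rw [norm_mul, Complex.norm_exp, Complex.norm_exp]
    simp only [neg_mul, Complex.neg_re, Complex.mul_re, Complex.ofReal_re, Complex.ofReal_im,
      mul_zero, sub_zero]
    refine mul_le_mul_of_nonneg_left (Real.exp_le_exp.2 ?_) (Real.exp_nonneg _)
    nlinarith
  calc expInt (z * a) = ∫ σ in Set.Ioi (0 : ℝ), ∫ t in Set.Ioi a,
        Complex.exp (-z * t) * Complex.exp (-(σ * t : ℝ)) := by
        rw [expInt_mul z ha]
        refine setIntegral_congr_fun measurableSet_Ioi fun σ hσ => ?_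
        have hσ : 0 < σ := hσ
        have h := integral_exp_mul_complex_Ioi (a := -(z + σ)) (by simp; linarith) a
        rw [neg_div_neg_eq] at h
        rw [← h]
        refine integral_congr_ae (Eventually.of_forall fun t => ?_)
        simp only []
        rw [← Complex.exp_add]
        congr 1
        push_cast
        ring
    _ = ∫ t in Set.Ioi a, ∫ σ in Set.Ioi (0 : ℝ),
        Complex.exp (-z * t) * Complex.exp (-(σ * t : ℝ)) := (integral_integral_swap i1).symm
    _ = _ := by
        refine setIntegral_congr_fun measurableSet_Ioi fun t ht => ?_
        have ht : 0 < t := ha.trans ht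
        rw [integral_const_mul]
        have h := integral_exp_mul_complex_Ioi (a := -(t : ℂ)) (by simpa using ht) 0
        rw [Complex.ofReal_zero, mul_zero, Complex.exp_zero, neg_div_neg_eq] at h
        rw [div_eq_mul_one_div (Complex.exp _), ← h]
        congr 1
        refine integral_congr_ae (Eventually.of_forall fun σ => ?_)
        simp only []
        congr 1
        push_cast
        ring

/-- The cumulative weight. -/
def cumWeight (g : ℝ → ℝ) (t : ℝ) : ℝ := ∫ s in Set.Iic t, g s

lemma cumWeight_eq_zero {g : ℝ → ℝ} (hs : Function.support g ⊆ Set.Icc 1 2) {t : ℝ} (ht : t ≤ 1) :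
    cumWeight g t = 0 := by
  rw [cumWeight, integral_Iic_eq_integral_Iio]
  refine setIntegral_eq_zero_of_forall_eq_zero fun s h => ?_
  by_contra h0
  exact absurd (hs h0).1 (not_le.2 (lt_of_lt_of_le h ht))

lemma cumWeight_eq_integral {g : ℝ → ℝ} {b : ℝ} (hs : Function.support g ⊆ Set.Icc 1 b) {t : ℝ}
    (ht : b ≤ t) : cumWeight g t = ∫ s, g s := by
  rw [cumWeight]
  refine setIntegral_eq_integral_of_forall_compl_eq_zero fun s h => ?_
  by_contra h0
  exact h ((hs h0).2.trans ht)

lemma continuous_cumWeight {g : ℝ → ℝ} (hg : Continuous g)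
    (hs : Function.support g ⊆ Set.Icc 1 2) : Continuous (cumWeight g) := by
  have hi := integrable_of_support hg hs
  have h : cumWeight g = fun t => ∫ s in (0 : ℝ)..t, g s := by
    funext t
    rw [← intervalIntegral.integral_Iic_sub_Iic hi.integrableOn hi.integrableOn]
    have := cumWeight_eq_zero hs (zero_le_one (α := ℝ))
    rw [cumWeight] at this
    rw [this, sub_zero, cumWeight]
  rw [h]
  exact intervalIntegral.continuous_primitive (fun _ _ => hg.intervalIntegrable _ _) 0

lemma abs_cumWeight_le (g : ℝ → ℝ) (hg : Integrable g) (t : ℝ) :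
    |cumWeight g t| ≤ ∫ s, |g s| := by
  rw [cumWeight]
  exact (abs_integral_le_integral_abs).trans
    (setIntegral_le_integral hg.abs (Eventually.of_forall fun s => abs_nonneg _))

/-- The function `e ^ (-v t) W(t) / t` to which Poisson summation is applied. -/
def tailFun (g : ℝ → ℝ) (X : ℕ) (v : ℂ) (t : ℝ) : ℂ :=
  Complex.exp (-v * t) * ((cumWeight g (t / X) / max t 1 : ℝ) : ℂ)

section Tail

variable {g : ℝ → ℝ} {X : ℕ} {v : ℂ}

lemma continuous_tailFun (hg : Continuous g) (hs : Function.support g ⊆ Set.Icc 1 2) (X : ℕ)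
    (v : ℂ) : Continuous (tailFun g X v) := by
  have h := continuous_cumWeight hg hs
  unfold tailFun
  refine Continuous.mul (by fun_prop) (Complex.continuous_ofReal.comp ?_)
  refine Continuous.div (by fun_prop) (by fun_prop) fun t => ?_
  exact (lt_of_lt_of_le one_pos (le_max_right t 1)).ne'

lemma tailFun_eq_zero (hs : Function.support g ⊆ Set.Icc 1 2) (hX : 1 ≤ X) {t : ℝ} (ht : t ≤ X) :
    tailFun g X v t = 0 := by
  have hX' : (0 : ℝ) < X := by exact_mod_cast hX
  rw [tailFun, cumWeight_eq_zero hs ((div_le_one hX').2 ht)]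
  simp

lemma tailFun_nat {b : ℝ} (hs : Function.support g ⊆ Set.Icc 1 b) (hX : 1 ≤ X)
    (hb : b * X ≤ X + 1) (hint : ∫ s, g s = 1) {n : ℕ} (hn : X < n) :
    tailFun g X v n = Complex.exp (-v) ^ n / n := by
  have hX' : (0 : ℝ) < X := by exact_mod_cast hX
  have hn' : (X : ℝ) + 1 ≤ n := by exact_mod_cast hn
  rw [tailFun, cumWeight_eq_integral hs ((le_div_iff₀ hX').2 (hb.trans hn')), hint,
    max_eq_left (by linarith), ← Complex.exp_nat_mul]
  push_cast
  rw [mul_one_div, mul_comm (n : ℂ)]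

lemma norm_tailFun_le (hg : Integrable g) (X : ℕ) (v : ℂ) (t : ℝ) :
    ‖tailFun g X v t‖ ≤ Real.exp (-v.re * t) * ∫ s, |g s| := by
  rw [tailFun, norm_mul, Complex.norm_exp, Complex.norm_real, Real.norm_eq_abs, abs_div]
  simp only [neg_mul, Complex.neg_re, Complex.mul_re, Complex.ofReal_re, Complex.ofReal_im,
      mul_zero, sub_zero]
  refine mul_le_mul_of_nonneg_left ?_ (Real.exp_nonneg _)
  have h1 : 1 ≤ |max t 1| := by
    rw [abs_of_pos (lt_of_lt_of_le one_pos (le_max_right t 1))]; exact le_max_right t 1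
  exact (div_le_self (abs_nonneg _) h1).trans (abs_cumWeight_le g hg _)

lemma isBigO_tailFun (hg : Continuous g) (hs : Function.support g ⊆ Set.Icc 1 2) (hX : 1 ≤ X)
    (hv : 0 < v.re) : tailFun g X v =O[cocompact ℝ] fun t => |t| ^ (-2 : ℝ) := by
  rw [cocompact_eq_atBot_atTop, isBigO_sup]
  constructor
  · refine EventuallyEq.trans_isBigO ?_ (isBigO_zero _ _)
    filter_upwards [eventually_le_atBot (X : ℝ)] with t ht
    exact tailFun_eq_zero hs hX ht
  · have h1 := (isLittleO_exp_neg_mul_rpow_atTop hv (-2)).isBigO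
    have h2 : (fun t : ℝ => |t| ^ (-2 : ℝ)) =ᶠ[atTop] fun t => t ^ (-2 : ℝ) := by
      filter_upwards [eventually_ge_atTop 0] with t ht
      rw [abs_of_nonneg ht]
    refine IsBigO.trans_eventuallyEq (IsBigO.trans ?_ h1) h2.symm
    refine IsBigO.of_bound (∫ s, |g s|) (Eventually.of_forall fun t => ?_)
    rw [Real.norm_of_nonneg (Real.exp_nonneg _), mul_comm]
    exact norm_tailFun_le (integrable_of_support hg hs) X v t

lemma fourier_tailFun (hg : Continuous g) (hs : Function.support g ⊆ Set.Icc 1 2) (hX : 1 ≤ X)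
    (hv : 0 < v.re) (k : ℝ) : FourierTransform.fourier (tailFun g X v) k =
      ∫ s, (g s : ℂ) * expInt ((v + 2 * Real.pi * Complex.I * k) * X * s) := by
  have hX' : (0 : ℝ) < X := by exact_mod_cast hX
  have hX1 : (1 : ℝ) ≤ X := by exact_mod_cast hX
  have hi := integrable_of_support hg hs
  set z : ℂ := v + 2 * Real.pi * Complex.I * k with hz
  have hzre : z.re = v.re := by simp [hz]
  set f : ℝ → ℝ → ℂ := fun s t => Set.indicator {p : ℝ × ℝ | p.1 ≤ p.2 / X}
    (fun p => (g p.1 : ℂ) * (Complex.exp (-z * p.2) * ((1 / max p.2 1 : ℝ) : ℂ))) (s, t) with hf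
  have hmeas : Measurable (Function.uncurry f) := by
    refine Measurable.indicator (by fun_prop) (measurableSet_le (by fun_prop) (by fun_prop))
  have hint : Integrable (Function.uncurry f)
      ((volume : Measure ℝ).prod (volume.restrict (Set.Ioi 0))) := by
    have h2 : IntegrableOn (fun t : ℝ => Real.exp (-z.re * t)) (Set.Ioi 0) :=
      exp_neg_integrableOn_Ioi 0 (hzre ▸ hv)
    refine (Integrable.mul_prod hi.abs h2).mono' hmeas.aestronglyMeasurable
      (Eventually.of_forall fun p => ?_)
    refine (norm_indicator_le_norm_self (fun p : ℝ × ℝ =>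
      (g p.1 : ℂ) * (Complex.exp (-z * p.2) * ((1 / max p.2 1 : ℝ) : ℂ))) p).trans ?_
    rw [norm_mul, norm_mul, Complex.norm_real, Complex.norm_exp, Complex.norm_real,
      Real.norm_eq_abs]
    refine mul_le_mul_of_nonneg_left ?_ (abs_nonneg _)
    simp only [neg_mul, Complex.neg_re, Complex.mul_re, Complex.ofReal_re, Complex.ofReal_im,
      mul_zero, sub_zero]
    refine mul_le_of_le_one_right (Real.exp_nonneg _) ?_
    rw [Real.norm_of_nonneg (by positivity)]
    exact (div_le_one (lt_of_lt_of_le one_pos (le_max_right _ _))).2 (le_max_right _ _)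
  have e1 : FourierTransform.fourier (tailFun g X v) k =
      ∫ t in Set.Ioi (0 : ℝ), ∫ s, f s t := by
    rw [Real.fourier_real_eq_integral_exp_smul]
    rw [← setIntegral_eq_integral_of_forall_compl_eq_zero (s := Set.Ioi (0 : ℝ))]
    · refine setIntegral_congr_fun measurableSet_Ioi fun t _ => ?_
      simp only [hf, Set.indicator_apply, Set.mem_ofPred_eq]
      have h1 : ∀ s : ℝ, (if s ≤ t / X then
          (g s : ℂ) * (Complex.exp (-z * t) * ((1 / max t 1 : ℝ) : ℂ)) else 0) =
          (((Set.Iic (t / X)).indicator g s : ℝ) : ℂ) *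
            (Complex.exp (-z * t) * ((1 / max t 1 : ℝ) : ℂ)) := by
        intro s
        rw [Set.indicator_apply]
        simp only [Set.mem_Iic]
        split_ifs <;> simp
      simp only [h1]
      rw [integral_mul_const, integral_complex_ofReal, integral_indicator measurableSet_Iic]
      rw [tailFun, smul_eq_mul, ← mul_assoc, ← Complex.exp_add, ← cumWeight]
      rw [show ((-2 * Real.pi * t * k : ℝ) : ℂ) * Complex.I + -v * t = -z * t by
        rw [hz]; push_cast; ring]
      push_cast
      ring
    · intro t ht
      have ht : t ≤ 0 := not_lt.1 ht
      rw [tailFun_eq_zero hs hX (ht.trans hX'.le), smul_zero]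
  rw [e1, ← integral_integral_swap hint]
  refine integral_congr_ae (Eventually.of_forall fun s => ?_)
  simp only []
  by_cases h0 : g s = 0
  · rw [h0, Complex.ofReal_zero, zero_mul]
    refine integral_eq_zero_of_ae (Eventually.of_forall fun t => ?_)
    simp only [hf, Set.indicator_apply, h0]
    simp
  have hs1 := (hs h0).1
  have hXs : 0 < X * s := by positivity
  have e2 : expInt (z * X * s) = ∫ t in Set.Ioi (X * s), Complex.exp (-z * t) / t := by
    rw [← expInt_mul_eq_integral_Ioi (hzre ▸ hv) hXs]
    congr 1
    push_cast
    ring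
  rw [e2, ← integral_const_mul]
  have e3 : ∀ t, f s t = (Set.Ici (X * s)).indicator
      (fun t : ℝ => (g s : ℂ) * (Complex.exp (-z * t) / t)) t := by
    intro t
    simp only [hf, Set.indicator_apply, Set.mem_ofPred_eq, Set.mem_Ici, le_div_iff₀ hX',
      mul_comm (X : ℝ) s]
    split_ifs with h
    · rw [max_eq_left (by nlinarith)]
      push_cast
      ring
    · rfl
  simp only [e3]
  have e4 : Set.Ici (X * s) ∩ Set.Ioi 0 = Set.Ici (X * s) :=
    Set.inter_eq_left.2 fun t ht => Set.mem_Ioi.2 (hXs.trans_le (Set.mem_Ici.1 ht))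
  rw [integral_indicator measurableSet_Ici, Measure.restrict_restrict measurableSet_Ici,
    e4, integral_Ici_eq_integral_Ioi]

end Tail

/-- The integral `∫ g(s) E₁(z s) ds`. -/
def weightInt (g : ℝ → ℝ) (z : ℂ) : ℂ := ∫ s, (g s : ℂ) * expInt (z * s)

/-- The points `v` such that no `v + 2 π i k` lies on the ray `(-∞, 0]`. -/
def slitStrip : Set ℂ := {v | ∀ k : ℤ, v + 2 * Real.pi * Complex.I * k ∈ Complex.slitPlane}

lemma exp_add_two_pi (v : ℂ) (k : ℤ) :
    Complex.exp (v + 2 * Real.pi * Complex.I * k) = Complex.exp v := by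
  rw [Complex.exp_add, show 2 * (Real.pi : ℂ) * Complex.I * k = k * (2 * Real.pi * Complex.I) by ring,
    Complex.exp_int_mul_two_pi_mul_I, mul_one]

lemma mem_slitStrip_iff {v : ℂ} : v ∈ slitStrip ↔
    Complex.exp v ∉ {x : ℂ | x.im = 0 ∧ 0 ≤ x.re ∧ x.re ≤ 1} := by
  constructor
  · rintro h ⟨h1, h2, h3⟩
    have h4 : Complex.exp v = ((Complex.exp v).re : ℂ) := Complex.ext rfl (by simpa using h1)
    set r := (Complex.exp v).re with hr
    have h5 : 0 < r := by
      refine lt_of_le_of_ne h2 fun h0 => Complex.exp_ne_zero v ?_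
      rw [h4, ← h0, Complex.ofReal_zero]
    have h6 : Complex.exp v = Complex.exp (Real.log r : ℝ) := by
      rw [h4, ← Complex.ofReal_exp, Real.exp_log h5]
    obtain ⟨n, hn⟩ := Complex.exp_eq_exp_iff_exists_int.1 h6
    have h7 := h (-n)
    rw [hn, show ((Real.log r : ℝ) : ℂ) + n * (2 * Real.pi * Complex.I) +
      2 * Real.pi * Complex.I * ((-n : ℤ) : ℂ) = (Real.log r : ℝ) by push_cast; ring] at h7
    rw [Complex.ofReal_mem_slitPlane] at h7
    exact absurd (Real.log_nonpos h5.le h3) (not_le.2 h7)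
  · intro h k
    by_contra h0
    rw [Complex.mem_slitPlane_iff, not_or, not_lt, not_not] at h0
    apply h
    rw [← exp_add_two_pi v k]
    refine ⟨?_, ?_, ?_⟩
    · rw [Complex.exp_im, h0.2, Real.sin_zero, mul_zero]
    · rw [Complex.exp_re, h0.2, Real.cos_zero, mul_one]; positivity
    · rw [Complex.exp_re, h0.2, Real.cos_zero, mul_one]; exact Real.exp_le_one_iff.2 h0.1

lemma isOpen_slitStrip : IsOpen slitStrip := by
  have : slitStrip = Complex.exp ⁻¹' {x : ℂ | x.im = 0 ∧ 0 ≤ x.re ∧ x.re ≤ 1}ᶜ := by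
    ext v; exact mem_slitStrip_iff
  rw [this]
  refine IsOpen.preimage Complex.continuous_exp (isOpen_compl_iff.2 ?_)
  exact (isClosed_eq Complex.continuous_im continuous_const).inter
    ((isClosed_le continuous_const Complex.continuous_re).inter
      (isClosed_le Complex.continuous_re continuous_const))

lemma add_mem_slitStrip {v : ℂ} (hv : v ∈ slitStrip) {t : ℝ} (ht : 0 ≤ t) :
    v + t ∈ slitStrip := by
  intro k
  have := hv k
  rw [Complex.mem_slitPlane_iff] at this ⊢
  refine this.imp (fun h => ?_) fun h => ?_
  · rw [add_right_comm, Complex.add_re, Complex.ofReal_re]; linarith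
  · rw [add_right_comm, Complex.add_im, Complex.ofReal_im, add_zero]; exact h

lemma mem_slitStrip_of_re_pos {v : ℂ} (hv : 0 < v.re) : v ∈ slitStrip := by
  intro k
  left
  simpa using hv

lemma isPreconnected_slitStrip : IsPreconnected slitStrip := by
  refine isPreconnected_of_forall 1 fun v hv => ?_
  have hh : IsPreconnected {w : ℂ | 0 < w.re} := (convex_halfSpace_re_gt 0).isPreconnected
  have hr : IsPreconnected ((fun t : ℝ => v + t) '' Set.Ici 0) :=
    isPreconnected_Ici.image _ (by fun_prop)
  refine ⟨{w : ℂ | 0 < w.re} ∪ (fun t : ℝ => v + t) '' Set.Ici 0, ?_, ?_, ?_, ?_⟩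
  · rintro w (hw | ⟨t, ht, rfl⟩)
    · exact mem_slitStrip_of_re_pos hw
    · exact add_mem_slitStrip hv ht
  · left; simp
  · right; exact ⟨0, by simp, by simp⟩
  · refine IsPreconnected.union (v + (|v.re| + 1 : ℝ)) ?_ ?_ hh hr
    · simp only [Set.mem_ofPred_eq, Complex.add_re, Complex.ofReal_re]
      linarith [neg_abs_le v.re]
    · exact ⟨_, by simp; positivity, rfl⟩

lemma exists_ball_slitStrip {v₀ : ℂ} (hv : v₀ ∈ slitStrip) : ∃ r > 0, ∀ v ∈ Metric.ball v₀ r,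
    v ∈ slitStrip ∧ ∀ k : ℤ, ∀ t : ℝ, 0 ≤ t → r ≤ ‖v + 2 * Real.pi * Complex.I * k + t‖ := by
  obtain ⟨ε, hε, h⟩ := Metric.isOpen_iff.1 isOpen_slitStrip v₀ hv
  refine ⟨ε / 2, half_pos hε, fun v hv => ⟨h (Metric.ball_subset_ball (by linarith) hv), ?_⟩⟩
  intro k t ht
  by_contra! hlt
  have h1 : -(2 * Real.pi * Complex.I * k) - t ∈ slitStrip := by
    apply h
    rw [Metric.mem_ball] at hv ⊢
    refine (dist_triangle _ v _).trans_lt ?_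
    rw [dist_eq_norm (_ - _), ← norm_neg]
    rw [show -(-(2 * Real.pi * Complex.I * k) - t - v) = v + 2 * Real.pi * Complex.I * k + t by ring]
    linarith
  have h2 := h1 k
  rw [show -(2 * (Real.pi : ℂ) * Complex.I * k) - t + 2 * Real.pi * Complex.I * k = ((-t : ℝ) : ℂ) by
    push_cast; ring, Complex.ofReal_mem_slitPlane] at h2
  linarith

lemma summable_one_add_abs_int : Summable fun k : ℤ => 1 / (1 + |(k : ℝ)|) ^ 2 := by
  have h : Summable fun n : ℕ => 1 / (1 + (n : ℝ)) ^ 2 := by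
    have := (summable_nat_add_iff 1).2 (Real.summable_one_div_nat_pow.2 (one_lt_two))
    refine this.congr fun n => ?_
    push_cast
    rw [add_comm]
  rw [summable_int_iff_summable_nat_and_neg]
  constructor <;> refine h.congr fun n => ?_ <;> simp

section

variable {g : ℝ → ℝ} {X : ℕ}

lemma mul_mem_slitPlane {z : ℂ} (hz : z ∈ Complex.slitPlane) {a : ℝ} (ha : 0 < a) :
    z * a ∈ Complex.slitPlane := by
  rw [Complex.mem_slitPlane_iff] at hz ⊢
  refine hz.imp (fun h => ?_) fun h => ?_
  · simpa using mul_pos h ha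
  · simpa [ha.ne'] using h

lemma exists_summable_bound (hg : ContDiff ℝ 1 g) (hs : Function.support g ⊆ Set.Icc 1 2)
    (hX : 1 ≤ X) {v₀ : ℂ} (hv : v₀ ∈ slitStrip) : ∃ r > 0, ∃ M : ℤ → ℝ, Summable M ∧
      ∀ v ∈ Metric.ball v₀ r, v ∈ slitStrip ∧
        ∀ k : ℤ, ‖weightInt g ((v + 2 * Real.pi * Complex.I * k) * X)‖ ≤ M k := by
  obtain ⟨A, hA, hb⟩ := norm_integral_weight_mul_expInt_le hg hs
  obtain ⟨r, hr, h⟩ := exists_ball_slitStrip hv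
  have hX' : (1 : ℝ) ≤ X := by exact_mod_cast hX
  set B := |v₀.im| + r with hB
  have hB0 : 0 ≤ B := by positivity
  set θ := r / (1 + r + B) with hθ
  have hθ0 : 0 < θ := by positivity
  have hθ1 : θ ≤ 1 := (div_le_one (by positivity)).2 (by linarith)
  have hθ2 : θ * (1 + B) ≤ r := by
    rw [hθ, div_mul_eq_mul_div, div_le_iff₀ (by positivity)]; nlinarith
  refine ⟨r, hr, fun k => A * Real.exp (2 * ((|v₀.re| + r) * X)) / θ ^ 2 * (1 / (1 + |(k : ℝ)|) ^ 2),
    summable_one_add_abs_int.mul_left _, fun v hvr => ⟨(h v hvr).1, fun k => ?_⟩⟩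
  have hvr' := hvr
  rw [Metric.mem_ball, dist_eq_norm] at hvr'
  have hre := (Complex.abs_re_le_norm (v - v₀))
  have him := (Complex.abs_im_le_norm (v - v₀))
  rw [Complex.sub_re] at hre
  rw [Complex.sub_im] at him
  have hre2 := abs_sub_abs_le_abs_sub v.re v₀.re
  have him2 := abs_sub_abs_le_abs_sub v.im v₀.im
  have hz : (v + 2 * Real.pi * Complex.I * k) * X ∈ Complex.slitPlane := by
    have := mul_mem_slitPlane ((h v hvr).1 k) (show (0 : ℝ) < X by linarith)
    simpa using this
  refine (hb _ hz ((|v₀.re| + r) * X) (θ * (1 + |(k : ℝ)|)) ?_ (by positivity) ?_).trans_eq ?_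
  · have : ((v + 2 * Real.pi * Complex.I * k) * X).re = v.re * X := by simp
    rw [this, abs_mul, abs_of_nonneg (by linarith : (0 : ℝ) ≤ X)]
    gcongr
    linarith
  · intro t ht
    have e : (v + 2 * Real.pi * Complex.I * k) * X + t =
        (v + 2 * Real.pi * Complex.I * k + (t / X : ℝ)) * X := by
      push_cast
      have : (X : ℂ) ≠ 0 := by exact_mod_cast (by linarith : (X : ℝ) ≠ 0)
      field_simp
    rw [e, norm_mul, Complex.norm_natCast]
    set y := v + 2 * Real.pi * Complex.I * k + (t / X : ℝ) with hy
    have h1 : r ≤ ‖y‖ := (h v hvr).2 k (t / X) (by positivity)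
    have h2 : 2 * Real.pi * |(k : ℝ)| - B ≤ ‖y‖ := by
      refine le_trans ?_ (Complex.abs_im_le_norm y)
      have e2 : y.im = 2 * Real.pi * k + v.im := by
        rw [hy]; simp; ring
      rw [e2]
      have h3 := abs_sub_abs_le_abs_sub (2 * Real.pi * k) (-v.im)
      rw [abs_neg, sub_neg_eq_add, abs_mul, abs_of_pos Real.two_pi_pos] at h3
      linarith
    have h3 : θ * (1 + |(k : ℝ)|) ≤ ‖y‖ := by
      rcases le_or_gt |(k : ℝ)| B with hk | hk
      · nlinarith
      · have hk1 : 1 ≤ |(k : ℝ)| := by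
          have h0 : k ≠ 0 := by
            rintro rfl
            simp at hk
            linarith
          exact_mod_cast Int.one_le_abs h0
        have := Real.pi_gt_three
        nlinarith
    nlinarith [norm_nonneg y]
  · rw [mul_pow]
    field_simp

lemma differentiableOn_tsum_weightInt (hg : ContDiff ℝ 1 g)
    (hs : Function.support g ⊆ Set.Icc 1 2) (hX : 1 ≤ X) :
    DifferentiableOn ℂ (fun v => ∑' k : ℤ, weightInt g ((v + 2 * Real.pi * Complex.I * k) * X))
      slitStrip := by
  intro v₀ hv₀
  obtain ⟨r, hr, M, hM, h⟩ := exists_summable_bound hg hs hX hv₀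
  have hX' : (0 : ℝ) < X := by exact_mod_cast hX
  refine DifferentiableAt.differentiableWithinAt ?_
  refine (Complex.differentiableOn_tsum_of_summable_norm hM ?_ Metric.isOpen_ball
    fun k w hw => (h w hw).2 k).differentiableAt (Metric.ball_mem_nhds v₀ hr)
  intro k w hw
  refine DifferentiableAt.differentiableWithinAt ?_
  have hz : (w + 2 * Real.pi * Complex.I * k) * X ∈ Complex.slitPlane := by
    have := mul_mem_slitPlane ((h w hw).1 k) hX'
    simpa using this
  exact (differentiableAt_integral_weight_mul_expInt hg hs hz).comp w
    (f := fun w : ℂ => (w + 2 * Real.pi * Complex.I * k) * X) (by fun_prop)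

lemma summable_weightInt (hg : ContDiff ℝ 1 g)
    (hs : Function.support g ⊆ Set.Icc 1 2) (hX : 1 ≤ X) {v : ℂ} (hv : v ∈ slitStrip) :
    Summable fun k : ℤ => weightInt g ((v + 2 * Real.pi * Complex.I * k) * X) := by
  obtain ⟨r, hr, M, hM, h⟩ := exists_summable_bound hg hs hX hv
  exact hM.of_norm_bounded (h v (Metric.mem_ball_self hr)).2

lemma tsum_weightInt_of_re_pos {b : ℝ} (hg : ContDiff ℝ 1 g)
    (hs : Function.support g ⊆ Set.Icc 1 b) (hb2 : b ≤ 2) (hX : 1 ≤ X) (hb : b * X ≤ X + 1)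
    (hint : ∫ s, g s = 1) {v : ℂ} (hv : 0 < v.re) :
    ∑' k : ℤ, weightInt g ((v + 2 * Real.pi * Complex.I * k) * X) =
      -Complex.log (1 - Complex.exp (-v)) -
        ∑ n ∈ Finset.range (X + 1), Complex.exp (-v) ^ n / n := by
  have hs2 : Function.support g ⊆ Set.Icc 1 2 := hs.trans (Set.Icc_subset_Icc_right hb2)
  have hf : ∀ k : ℤ, FourierTransform.fourier (tailFun g X v) (k : ℝ) =
      weightInt g ((v + 2 * Real.pi * Complex.I * k) * X) := by
    intro k
    rw [fourier_tailFun hg.continuous hs2 hX hv, weightInt]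
    simp
  have hsum : Summable fun k : ℤ => FourierTransform.fourier (tailFun g X v) (k : ℝ) := by
    simp only [hf]
    exact summable_weightInt hg hs2 hX (mem_slitStrip_of_re_pos hv)
  have hP := Real.tsum_eq_tsum_fourier_of_rpow_decay_of_summable
    (continuous_tailFun hg.continuous hs2 X v) one_lt_two
    (isBigO_tailFun hg.continuous hs2 hX hv) hsum 0
  simp only [hf, zero_add, QuotientAddGroup.mk_zero, fourier_eval_zero, mul_one] at hP
  rw [← hP]
  have hw : ‖Complex.exp (-v)‖ < 1 := by
    rw [Complex.norm_exp, Complex.neg_re]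
    exact Real.exp_lt_one_iff.2 (by linarith)
  have h1 := Complex.hasSum_taylorSeries_neg_log hw
  have h2 : HasSum (fun n : ℕ => if n ∈ Finset.range (X + 1) then Complex.exp (-v) ^ n / n else 0)
      (∑ n ∈ Finset.range (X + 1), Complex.exp (-v) ^ n / (n : ℂ)) := by
    rw [← Finset.sum_congr rfl fun n (hn : n ∈ Finset.range (X + 1)) =>
      if_pos (c := n ∈ Finset.range (X + 1)) (t := Complex.exp (-v) ^ n / (n : ℂ)) (e := 0) hn]
    exact hasSum_sum_of_ne_finset_zero fun n hn => if_neg hn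
  have h3 : HasSum ((fun n : ℤ => tailFun g X v n) ∘ ((↑) : ℕ → ℤ))
      (-Complex.log (1 - Complex.exp (-v)) -
        ∑ n ∈ Finset.range (X + 1), Complex.exp (-v) ^ n / (n : ℂ)) := by
    have e : (fun n : ℤ => tailFun g X v n) ∘ ((↑) : ℕ → ℤ) = fun n : ℕ =>
        Complex.exp (-v) ^ n / (n : ℂ) -
          if n ∈ Finset.range (X + 1) then Complex.exp (-v) ^ n / n else 0 := by
      funext n
      simp only [Function.comp_apply, Int.cast_natCast, Finset.mem_range]
      split_ifs with h
      · rw [sub_self, tailFun_eq_zero hs2 hX (by exact_mod_cast Nat.lt_succ_iff.1 h)]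
      · rw [sub_zero, tailFun_nat hs hX hb hint (by omega)]
    rw [e]
    exact h1.sub h2
  refine HasSum.tsum_eq ?_
  refine (Function.Injective.hasSum_iff (f := fun n : ℤ => tailFun g X v n)
    (Nat.cast_injective (R := ℤ)) ?_).1 h3
  intro n hn
  have : n < 0 := by
    by_contra! h0
    exact hn ⟨n.toNat, by simpa using h0⟩
  refine tailFun_eq_zero hs2 hX ?_
  have h4 : (n : ℝ) < 0 := by exact_mod_cast this
  have : (0 : ℝ) ≤ X := Nat.cast_nonneg _
  linarith

theorem exp_neg_tsum_weightInt {b : ℝ} (hg : ContDiff ℝ 1 g)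
    (hs : Function.support g ⊆ Set.Icc 1 b) (hb2 : b ≤ 2) (hX : 1 ≤ X) (hb : b * X ≤ X + 1)
    (hint : ∫ s, g s = 1) {v : ℂ} (hv : v ∈ slitStrip) :
    Complex.exp (-∑' k : ℤ, weightInt g ((v + 2 * Real.pi * Complex.I * k) * X)) =
      (1 - Complex.exp (-v)) *
        Complex.exp (∑ n ∈ Finset.range (X + 1), Complex.exp (-v) ^ n / n) := by
  have hs2 : Function.support g ⊆ Set.Icc 1 2 := hs.trans (Set.Icc_subset_Icc_right hb2)
  have hd := differentiableOn_tsum_weightInt hg hs2 hX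
  have h1 : AnalyticOnNhd ℂ (fun v => Complex.exp
      (-∑' k : ℤ, weightInt g ((v + 2 * Real.pi * Complex.I * k) * X))) slitStrip :=
    (hd.neg.cexp).analyticOnNhd isOpen_slitStrip
  have h2 : AnalyticOnNhd ℂ (fun v => (1 - Complex.exp (-v)) *
        Complex.exp (∑ n ∈ Finset.range (X + 1), Complex.exp (-v) ^ n / n)) slitStrip := by
    refine DifferentiableOn.analyticOnNhd (Differentiable.differentiableOn ?_) isOpen_slitStrip
    fun_prop
  refine h1.eqOn_of_preconnected_of_eventuallyEq h2 isPreconnected_slitStrip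
    (mem_slitStrip_of_re_pos (v := 1) (by simp)) ?_ hv
  have ho : IsOpen {w : ℂ | 0 < w.re} := isOpen_lt continuous_const Complex.continuous_re
  filter_upwards [ho.mem_nhds (show (1 : ℂ) ∈ {w : ℂ | 0 < w.re} by simp)] with w hw
  rw [tsum_weightInt_of_re_pos hg hs hb2 hX hb hint hw, neg_sub, sub_neg_eq_add, add_comm,
    Complex.exp_add, Complex.exp_log]
  have hw1 : ‖Complex.exp (-w)‖ < 1 := by
    rw [Complex.norm_exp, Complex.neg_re]
    exact Real.exp_lt_one_iff.2 (by simpa using hw)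
  intro h0
  rw [← sub_eq_zero.1 h0] at hw1
  simp at hw1

end

section

variable {q X : ℕ} {u : ℝ → ℝ}

lemma IsWeight.contDiff_logWeight (hu : IsWeight q X u) : ContDiff ℝ 1 (logWeight u) :=
  Real.contDiff_exp.mul ((hu.smooth.of_le (by exact_mod_cast le_top)).comp Real.contDiff_exp)

lemma IsWeight.support_logWeight (hu : IsWeight q X u) :
    Function.support (logWeight u) ⊆ Set.Icc 1 (1 + ((q : ℝ) ^ X)⁻¹) := by
  intro s hs
  have h : u (Real.exp s) ≠ 0 := fun h0 => hs (by simp [logWeight, h0])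
  have := hu.support h
  exact ⟨Real.exp_le_exp.1 this.1, Real.exp_le_exp.1 this.2⟩

lemma IsWeight.integral_logWeight (hu : IsWeight q X u) : ∫ s, logWeight u s = 1 := by
  rw [← hu.integral, integral_Ioi_eq_integral_exp]
  rfl

theorem IsWeight.exp_neg_tsum_U (hq : 2 ≤ q) (hX : 1 ≤ X) (hu : IsWeight q X u) {v : ℂ}
    (hv : v ∈ slitStrip) :
    Summable (fun k : ℤ => U u ((v + 2 * Real.pi * Complex.I * k) * X)) ∧
    Complex.exp (-∑' k : ℤ, U u ((v + 2 * Real.pi * Complex.I * k) * X)) =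
      (1 - Complex.exp (-v)) *
        Complex.exp (∑ n ∈ Finset.range (X + 1), Complex.exp (-v) ^ n / n) := by
  have hq' : (2 : ℝ) ≤ q := by exact_mod_cast hq
  have hp : (X : ℝ) + 1 ≤ (q : ℝ) ^ X := by
    have h1 : X < 2 ^ X := Nat.lt_two_pow_self
    have h2 : (X : ℝ) + 1 ≤ (2 : ℝ) ^ X := by exact_mod_cast h1
    exact h2.trans (pow_le_pow_left₀ (by norm_num) hq' X)
  have hX' : (1 : ℝ) ≤ X := by exact_mod_cast hX
  have h0 : (0 : ℝ) < (q : ℝ) ^ X := by positivity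
  have hb2 : 1 + ((q : ℝ) ^ X)⁻¹ ≤ 2 := by
    have : ((q : ℝ) ^ X)⁻¹ ≤ 1 := inv_le_one_of_one_le₀ (by linarith)
    linarith
  have hb : (1 + ((q : ℝ) ^ X)⁻¹) * X ≤ X + 1 := by
    have : ((q : ℝ) ^ X)⁻¹ * X ≤ 1 := by
      rw [inv_mul_le_iff₀ h0]; linarith
    linarith
  have e : ∀ z, U u z = weightInt (logWeight u) z := U_eq_integral u
  simp only [e]
  exact ⟨summable_weightInt hu.contDiff_logWeight
    (hu.support_logWeight.trans (Set.Icc_subset_Icc_right hb2)) hX hv,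
    exp_neg_tsum_weightInt hu.contDiff_logWeight hu.support_logWeight hb2 hX hb
      hu.integral_logWeight hv⟩

end

/-- The variable `q ^ (-s)`. -/
def zvar (F : Type*) [Field F] (s : ℂ) : ℂ := Complex.exp (-(s * (Real.log (Nat.card F) : ℂ)))

lemma absVal_cpow {A : F[X]} (hA : A.Monic) (s : ℂ) :
    ((absVal A : ℂ) ^ s)⁻¹ = zvar F s ^ A.natDegree := by
  have h := card_pow_pos (F := F) A.natDegree
  rw [absVal_monic hA, Complex.cpow_def_of_ne_zero (by exact_mod_cast h.ne'), ← Complex.exp_neg,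
    zvar, ← Complex.exp_nat_mul, ← Complex.ofReal_log h.le, Real.log_pow]
  congr 1
  push_cast
  ring

lemma zvar_half : zvar F (1 / 2) = (rt F : ℂ) := by
  have h : (0 : ℝ) < Nat.card F := by have := two_le_card (F := F); linarith
  rw [zvar, rt, Real.sqrt_eq_rpow, ← Real.rpow_neg h.le, Real.rpow_def_of_pos h]
  push_cast
  congr 1
  ring

lemma zvar_ne_zero (s : ℂ) : zvar F s ≠ 0 := Complex.exp_ne_zero _

lemma L_eq_sum {R : F[X]} (hR : R.Monic) (hR1 : R ≠ 1) {χ : DirChar R} (hχ : IsPrimitive χ)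
    (s : ℂ) : L χ s = ∑ n ∈ Finset.range R.natDegree, csum χ n * zvar F s ^ n := by
  have h : ∀ n, ∑ A ∈ monics F n, χ.val A / (absVal A : ℂ) ^ s = csum χ n * zvar F s ^ n := by
    intro n
    rw [csum, Finset.sum_mul]
    refine Finset.sum_congr rfl fun A hA => ?_
    rw [div_eq_mul_inv, absVal_cpow (mem_monics.1 hA).1, (mem_monics.1 hA).2]
  rw [L, tsum_eq_sum (s := Finset.range R.natDegree)]
  · exact Finset.sum_congr rfl fun n _ => h n
  · intro n hn
    rw [h, csum_eq_zero hR hR1 hχ (by simpa using hn), zero_mul]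

/-- The sum of `Λ χ`, in units of `log q`, over the monic polynomials of degree `n`. -/
def lamSum {R : F[X]} (χ : DirChar R) (n : ℕ) : ℂ := ∑ A ∈ monics F n, (vm A : ℂ) * χ.val A

lemma lamSum_zero {R : F[X]} (χ : DirChar R) : lamSum χ 0 = 0 := by
  rw [lamSum, monics_zero, Finset.sum_singleton, vm_one]; simp

lemma eulerPart_eq {R : F[X]} (X : ℕ) (χ : DirChar R) (s : ℂ) : eulerPart X χ s =
    Complex.exp (∑ m ∈ Finset.range (X + 1), lamSum χ m * zvar F s ^ m / m) := by
  rw [eulerPart, sum_monicsLE]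
  congr 1
  refine Finset.sum_congr rfl fun m _ => ?_
  rw [lamSum, Finset.sum_mul, Finset.sum_div]
  refine Finset.sum_congr rfl fun A hA => ?_
  have hA := mem_monics.1 hA
  have hl : (Real.log (Nat.card F : ℝ) : ℂ) ≠ 0 := by
    exact_mod_cast (log_card_pos (F := F)).ne'
  rw [vonMangoldt_eq, div_eq_mul_inv, mul_inv, absVal_cpow hA.1, absVal_monic hA.1, Real.log_pow,
    hA.2, Complex.ofReal_mul, Complex.ofReal_mul, Complex.ofReal_natCast]
  generalize (Real.log (Nat.card F : ℝ) : ℂ) = l at hl ⊢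
  rw [mul_inv]
  field_simp

lemma csum_recursion {R : F[X]} (χ : DirChar R) (n : ℕ) : (n : ℂ) * csum χ n =
    ∑ ij ∈ Finset.HasAntidiagonal.antidiagonal n, lamSum χ ij.1 * csum χ ij.2 := by
  have h := sum_monics_expConv_rec (l := vm) vm_one (val_mul χ) n
  have e : ∀ m, ∑ D ∈ monics F m, (expConv vm D : ℂ) * χ.val D = csum χ m := fun m =>
    Finset.sum_congr rfl fun D hD => by
      rw [expConv_vm (mem_monics.1 hD).1, Complex.ofReal_one, one_mul]
  simp only [e] at h
  exact h

section Newton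

open PowerSeries in
lemma newton_powerSeries (s : Multiset ℂ) :
    (PowerSeries.X : ℂ⟦X⟧) * PowerSeries.derivative ℂ
        (s.map fun a => (1 - PowerSeries.C a * PowerSeries.X : ℂ⟦X⟧)).prod =
      -((s.map fun a => (1 - PowerSeries.C a * PowerSeries.X : ℂ⟦X⟧)).prod *
        PowerSeries.mk fun n => if n = 0 then 0 else (s.map (· ^ n)).sum) := by
  induction s using Multiset.induction with
  | empty =>
    have : (PowerSeries.mk fun n => if n = 0 then (0 : ℂ) else
        ((0 : Multiset ℂ).map (· ^ n)).sum) = 0 := by ext n; simp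
    rw [this]
    simp
  | cons a s ih =>
    have hgeom : (1 - PowerSeries.C a * PowerSeries.X : ℂ⟦X⟧) *
        (PowerSeries.mk fun n => if n = 0 then 0 else a ^ n) =
        PowerSeries.C a * PowerSeries.X := by
      ext n
      rw [sub_mul, one_mul, mul_assoc, map_sub, PowerSeries.coeff_mk, PowerSeries.coeff_C_mul,
        PowerSeries.coeff_C_mul]
      rcases n with _ | n
      · simp
      · rw [PowerSeries.coeff_succ_X_mul, PowerSeries.coeff_mk, if_neg (Nat.succ_ne_zero n),
          PowerSeries.coeff_X]
        rcases n with _ | n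
        · simp
        · simp [pow_succ']
    have hadd : (PowerSeries.mk fun n => if n = 0 then (0 : ℂ) else
        ((a ::ₘ s).map (· ^ n)).sum) =
        (PowerSeries.mk fun n => if n = 0 then 0 else a ^ n) +
        PowerSeries.mk fun n => if n = 0 then 0 else (s.map (· ^ n)).sum := by
      ext n
      rw [map_add, PowerSeries.coeff_mk, PowerSeries.coeff_mk, PowerSeries.coeff_mk]
      split_ifs <;> simp
    have hder : PowerSeries.derivative ℂ (1 - PowerSeries.C a * PowerSeries.X : ℂ⟦X⟧) =
        -PowerSeries.C a := by
      ext n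
      rw [PowerSeries.coeff_derivative, map_sub, PowerSeries.coeff_C_mul, PowerSeries.coeff_one,
        PowerSeries.coeff_X, map_neg, PowerSeries.coeff_C]
      rcases n with _ | n <;> simp
    have leib : ∀ f g : ℂ⟦X⟧, PowerSeries.derivative ℂ (f * g) =
        f * PowerSeries.derivative ℂ g + g * PowerSeries.derivative ℂ f :=
      fun f g => (PowerSeries.derivative ℂ).leibniz f g
    rw [Multiset.map_cons, Multiset.prod_cons, leib, hadd, hder]
    linear_combination (1 - PowerSeries.C a * PowerSeries.X) * ih +
      (s.map fun a => (1 - PowerSeries.C a * PowerSeries.X : ℂ⟦X⟧)).prod * hgeom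

lemma neg_powerSum_of_recursion {c l : ℕ → ℂ} {s : Multiset ℂ} (hl0 : l 0 = 0) (hc0 : c 0 = 1)
    (hc : PowerSeries.mk c =
      (s.map fun a => (1 - PowerSeries.C a * PowerSeries.X : PowerSeries ℂ)).prod)
    (h : ∀ n : ℕ, (n : ℂ) * c n =
      ∑ ij ∈ Finset.HasAntidiagonal.antidiagonal n, l ij.1 * c ij.2) {n : ℕ} (hn : n ≠ 0) :
    l n = -(s.map (· ^ n)).sum := by
  have h1 := newton_powerSeries s
  rw [← hc] at h1
  have h2 : (PowerSeries.X : PowerSeries ℂ) * PowerSeries.derivative ℂ (PowerSeries.mk c) =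
      PowerSeries.mk c * PowerSeries.mk l := by
    ext n
    rw [mul_comm (PowerSeries.mk c), PowerSeries.coeff_mul n (PowerSeries.mk l)]
    simp only [PowerSeries.coeff_mk]
    rw [← h n]
    rcases n with _ | n
    · simp
    · rw [PowerSeries.coeff_succ_X_mul, PowerSeries.coeff_derivative, PowerSeries.coeff_mk]
      push_cast
      ring
  have hne : PowerSeries.mk c ≠ 0 := by
    intro h0
    have := congrArg (PowerSeries.coeff 0) h0
    rw [PowerSeries.coeff_mk, hc0] at this
    simp at this
  have h3 : PowerSeries.mk l =
      -PowerSeries.mk fun n => if n = 0 then 0 else (s.map (· ^ n)).sum := by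
    refine mul_left_cancel₀ hne ?_
    rw [← h2, h1, mul_neg]
  have h4 := congrArg (PowerSeries.coeff n) h3
  rw [map_neg, PowerSeries.coeff_mk, PowerSeries.coeff_mk, if_neg hn] at h4
  exact h4

end Newton

/-- The polynomial `L(s, χ)` in the variable `q ^ (-s)`. -/
def Lpoly {R : F[X]} (χ : DirChar R) : ℂ[X] :=
  ∑ n ∈ Finset.range R.natDegree, C (csum χ n) * X ^ n

section LPoly

variable {R : F[X]} {χ : DirChar R}

lemma coeff_Lpoly (hR : R.Monic) (hR1 : R ≠ 1) (hχ : IsPrimitive χ) (n : ℕ) :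
    (Lpoly χ).coeff n = csum χ n := by
  rw [Lpoly, finsetSum_coeff]
  simp only [coeff_C_mul, coeff_X_pow, mul_ite, mul_one, mul_zero]
  rw [Finset.sum_ite_eq]
  split_ifs with h
  · rfl
  · rw [csum_eq_zero hR hR1 hχ (by simpa using h)]

lemma eval_Lpoly (hR : R.Monic) (hR1 : R ≠ 1) (hχ : IsPrimitive χ) (s : ℂ) :
    (Lpoly χ).eval (zvar F s) = L χ s := by
  rw [L_eq_sum hR hR1 hχ, Lpoly, eval_finsetSum]
  simp

lemma Lpoly_ne_zero (hR : R.Monic) (hR1 : R ≠ 1) (hχ : IsPrimitive χ) : Lpoly χ ≠ 0 := by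
  intro h
  have := coeff_Lpoly hR hR1 hχ 0
  rw [h, csum_zero] at this
  simp at this

lemma zero_notMem_roots (hR : R.Monic) (hR1 : R ≠ 1) (hχ : IsPrimitive χ) {r : ℂ}
    (hr : r ∈ (Lpoly χ).roots) : r ≠ 0 := by
  rintro rfl
  have h := (mem_roots (Lpoly_ne_zero hR hR1 hχ)).1 hr
  rw [IsRoot, ← coeff_zero_eq_eval_zero, coeff_Lpoly hR hR1 hχ, csum_zero] at h
  exact one_ne_zero h

lemma Lpoly_eq_prod (hR : R.Monic) (hR1 : R ≠ 1) (hχ : IsPrimitive χ) :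
    Lpoly χ = ((Lpoly χ).roots.map fun r => 1 - C r⁻¹ * X).prod := by
  have h1 := (IsAlgClosed.splits (Lpoly χ)).eq_prod_roots
  have h2 : ((Lpoly χ).roots.map fun r => X - C r).prod =
      C ((Lpoly χ).roots.map fun r => -r).prod *
        ((Lpoly χ).roots.map fun r => 1 - C r⁻¹ * X).prod := by
    rw [Multiset.prod_hom _ (C : ℂ →+* ℂ[X]) |>.symm, Multiset.map_map, ← Multiset.prod_map_mul]
    refine congrArg _ (Multiset.map_congr rfl fun r hr => ?_)
    have hr0 := zero_notMem_roots hR hR1 hχ hr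
    simp only [Function.comp_apply]
    rw [mul_sub, ← mul_assoc, ← C_mul, neg_mul, mul_inv_cancel₀ hr0]
    simp
    ring
  rw [h2, ← mul_assoc, ← C_mul] at h1
  set a := (Lpoly χ).leadingCoeff * ((Lpoly χ).roots.map fun r => -r).prod with ha
  have h3 : a = 1 := by
    have h := congrArg (eval 0) h1
    rw [← coeff_zero_eq_eval_zero, coeff_Lpoly hR hR1 hχ, csum_zero, eval_mul, eval_C,
      eval_multiset_prod, Multiset.map_map] at h
    simpa using h.symm
  rw [h3, C_1, one_mul] at h1
  exact h1

lemma lamSum_eq (hR : R.Monic) (hR1 : R ≠ 1) (hχ : IsPrimitive χ) {n : ℕ} (hn : n ≠ 0) :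
    lamSum χ n = -∑ r ∈ (Lpoly χ).roots.toFinset, ((Lpoly χ).roots.count r : ℂ) * r⁻¹ ^ n := by
  classical
  rw [neg_powerSum_of_recursion (s := (Lpoly χ).roots.map (·⁻¹)) (lamSum_zero χ) (csum_zero χ) ?_
    (csum_recursion χ) hn, Multiset.map_map, Finset.sum_multiset_map_count]
  · simp only [Function.comp_apply, nsmul_eq_mul]
  · have h1 : PowerSeries.mk (csum χ) = (Lpoly χ : PowerSeries ℂ) := by
      ext n
      rw [PowerSeries.coeff_mk, Polynomial.coeff_coe, coeff_Lpoly hR hR1 hχ]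
    have h2 := Multiset.prod_hom ((Lpoly χ).roots.map fun r => 1 - C r⁻¹ * Polynomial.X)
      (Polynomial.coeToPowerSeries.ringHom (R := ℂ))
    rw [← Lpoly_eq_prod hR hR1 hχ, Polynomial.coeToPowerSeries.ringHom_apply] at h2
    rw [h1, ← h2, Multiset.map_map, Multiset.map_map]
    refine congrArg _ (Multiset.map_congr rfl fun r _ => ?_)
    simp

lemma L_mul_inv_eulerPart (hR : R.Monic) (hR1 : R ≠ 1) (hχ : IsPrimitive χ) (N : ℕ) (s : ℂ) :
    L χ s * (eulerPart N χ s)⁻¹ = ∏ r ∈ (Lpoly χ).roots.toFinset, ((1 - r⁻¹ * zvar F s) *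
      Complex.exp (∑ n ∈ Finset.range (N + 1), (r⁻¹ * zvar F s) ^ n / n)) ^
        (Lpoly χ).roots.count r := by
  classical
  simp only [mul_pow, Finset.prod_mul_distrib]
  congr 1
  · rw [← eval_Lpoly hR hR1 hχ]
    conv_lhs => rw [Lpoly_eq_prod hR hR1 hχ]
    rw [eval_multiset_prod, Multiset.map_map, Finset.prod_multiset_map_count]
    simp only [Function.comp_apply]
    congr! 2
    simp
  · simp only [← Complex.exp_nat_mul]
    rw [eulerPart_eq, ← Complex.exp_neg, ← Complex.exp_sum]
    congr 1
    rw [← Finset.sum_neg_distrib]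
    simp only [Finset.mul_sum]
    rw [Finset.sum_comm]
    refine Finset.sum_congr rfl fun n _ => ?_
    rcases eq_or_ne n 0 with rfl | hn
    · simp
    · rw [lamSum_eq hR hR1 hχ hn, neg_mul, neg_div, neg_neg, Finset.sum_mul, Finset.sum_div]
      exact Finset.sum_congr rfl fun r _ => by ring

end LPoly

lemma hasSum_finite_prod {ι : Type*} [Fintype ι] {f : ι × ℤ → ℂ} {a : ι → ℂ}
    (h : ∀ i, HasSum (fun k => f (i, k)) (a i)) : HasSum f (∑ i, a i) := by
  classical
  have h1 : ∀ i, HasSum (fun p : ι × ℤ => if p.1 = i then f p else 0) (a i) := by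
    intro i
    have hinj : Function.Injective fun k : ℤ => (i, k) := fun k k' hk => (Prod.mk.inj hk).2
    refine (hinj.hasSum_iff ?_).1 ?_
    · rintro ⟨j, k⟩ hp
      refine if_neg fun hj => hp ⟨k, ?_⟩
      rw [← hj]
    · have e : (fun p : ι × ℤ => if p.1 = i then f p else 0) ∘ (fun k : ℤ => (i, k)) =
          fun k => f (i, k) := by funext k; simp
      rw [e]
      exact h i
  have h2 := hasSum_sum (s := Finset.univ) fun i _ => h1 i
  have e : (fun p : ι × ℤ => ∑ i, if p.1 = i then f p else 0) = f := by
    funext p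
    simp
  rwa [e] at h2

section Zeros

variable {R : F[X]} {χ : DirChar R}

lemma log_card_ne_zero : (Real.log (Nat.card F : ℝ) : ℂ) ≠ 0 := by
  exact_mod_cast (log_card_pos (F := F)).ne'

/-- The zeros of `L(s, χ)` belonging to a root of the `L`-polynomial. -/
def zeroAt (F : Type*) [Field F] (r : ℂ) (k : ℤ) : ℂ :=
  -(Complex.log r + 2 * Real.pi * Complex.I * k) / (Real.log (Nat.card F : ℝ) : ℂ)

lemma zvar_zeroAt {r : ℂ} (hr : r ≠ 0) (k : ℤ) : zvar F (zeroAt F r k) = r := by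
  rw [zvar, zeroAt, div_mul_cancel₀ _ log_card_ne_zero, neg_neg, exp_add_two_pi, Complex.exp_log hr]

lemma L_zeroAt (hR : R.Monic) (hR1 : R ≠ 1) (hχ : IsPrimitive χ)
    (p : (Lpoly χ).roots.toFinset × ℤ) : L χ (zeroAt F p.1 p.2) = 0 := by
  classical
  have hr := Multiset.mem_toFinset.1 p.1.2
  rw [← eval_Lpoly hR hR1 hχ, zvar_zeroAt (zero_notMem_roots hR hR1 hχ hr)]
  exact (mem_roots (Lpoly_ne_zero hR hR1 hχ)).1 hr

/-- The parametrization of the zeros of `L(s, χ)`. -/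
def zeroEquiv (hR : R.Monic) (hR1 : R ≠ 1) (hχ : IsPrimitive χ) :
    (Lpoly χ).roots.toFinset × ℤ ≃ {ρ : ℂ // L χ ρ = 0} := by
  classical
  refine Equiv.ofBijective (fun p => ⟨zeroAt F p.1 p.2, L_zeroAt hR hR1 hχ p⟩) ⟨?_, ?_⟩
  · rintro ⟨⟨r, hr⟩, k⟩ ⟨⟨r', hr'⟩, k'⟩ h
    have h : zeroAt F r k = zeroAt F r' k' := congrArg Subtype.val h
    have hr0 := zero_notMem_roots hR hR1 hχ (Multiset.mem_toFinset.1 hr)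
    have hr0' := zero_notMem_roots hR hR1 hχ (Multiset.mem_toFinset.1 hr')
    have e : r = r' := by rw [← zvar_zeroAt (F := F) hr0 k, h, zvar_zeroAt hr0']
    subst e
    rw [zeroAt, zeroAt, div_left_inj' log_card_ne_zero, neg_inj, add_right_inj,
      mul_right_inj' Complex.two_pi_I_ne_zero] at h
    have : k = k' := by exact_mod_cast h
    rw [this]
  · rintro ⟨ρ, hρ⟩
    have hroot : zvar F ρ ∈ (Lpoly χ).roots := by
      rw [mem_roots (Lpoly_ne_zero hR hR1 hχ), IsRoot, eval_Lpoly hR hR1 hχ, hρ]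
    obtain ⟨n, hn⟩ := Complex.exp_eq_exp_iff_exists_int.1
      (show Complex.exp (-(ρ * (Real.log (Nat.card F) : ℂ))) =
        Complex.exp (Complex.log (zvar F ρ)) by
        rw [Complex.exp_log (zvar_ne_zero ρ)]; rfl)
    refine ⟨(⟨zvar F ρ, Multiset.mem_toFinset.2 hroot⟩, n), Subtype.ext ?_⟩
    change zeroAt F (zvar F ρ) n = ρ
    rw [zeroAt, div_eq_iff log_card_ne_zero]
    linear_combination hn

lemma zeroEquiv_apply (hR : R.Monic) (hR1 : R ≠ 1) (hχ : IsPrimitive χ)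
    (p : (Lpoly χ).roots.toFinset × ℤ) :
    (zeroEquiv hR hR1 hχ p : ℂ) = zeroAt F p.1 p.2 := rfl

lemma analyticOrderAt_eval {p : ℂ[X]} (hp : p ≠ 0) (a : ℂ) :
    analyticOrderAt (fun z => p.eval z) a = p.rootMultiplicity a := by
  have han : ∀ (p : ℂ[X]) (a : ℂ), AnalyticAt ℂ (fun z => p.eval z) a := fun p a =>
    (Polynomial.differentiable p).analyticAt a
  rw [(han p a).analyticOrderAt_eq_natCast]
  obtain ⟨g, h1, h2⟩ := exists_eq_pow_rootMultiplicity_mul_and_not_dvd p hp a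
  refine ⟨fun z => g.eval z, han g a, ?_, Eventually.of_forall fun z => ?_⟩
  · rwa [dvd_iff_isRoot] at h2
  · conv_lhs => rw [h1]
    simp

lemma analyticOrderNatAt_L (hR : R.Monic) (hR1 : R ≠ 1) (hχ : IsPrimitive χ) (ρ : ℂ) :
    analyticOrderNatAt (L χ) ρ = (Lpoly χ).roots.count (zvar F ρ) := by
  have e : L χ = (fun z => (Lpoly χ).eval z) ∘ zvar F := by
    funext s
    rw [Function.comp_apply, eval_Lpoly hR hR1 hχ]
  have hd : HasDerivAt (zvar F) (zvar F ρ * -(1 * (Real.log (Nat.card F : ℝ) : ℂ))) ρ :=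
    (((hasDerivAt_id ρ).mul_const _).neg).cexp
  have hdiff : Differentiable ℂ (zvar F) := by
    unfold zvar
    fun_prop
  rw [count_roots, analyticOrderNatAt, e, analyticOrderAt_comp_of_deriv_ne_zero
    (hdiff.analyticAt ρ), analyticOrderAt_eval (Lpoly_ne_zero hR hR1 hχ)]
  · simp
  · rw [hd.deriv]
    exact mul_ne_zero (zvar_ne_zero _) (neg_ne_zero.2 (by rw [one_mul]; exact log_card_ne_zero))

lemma mem_slitStrip_of_mem_regularPoints (hR : R.Monic) (hR1 : R ≠ 1) (hχ : IsPrimitive χ) {s : ℂ}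
    (hs : s ∈ regularPoints χ) (r : (Lpoly χ).roots.toFinset) :
    s * (Real.log (Nat.card F : ℝ) : ℂ) + Complex.log r ∈ slitStrip := by
  intro k
  have h := hs _ (L_zeroAt hR hR1 hχ (r, k))
  have h1 : s - zeroAt F r k ∈ Complex.slitPlane :=
    Complex.mem_slitPlane_iff_arg.2 ⟨h.2, sub_ne_zero.2 h.1⟩
  have h2 := mul_mem_slitPlane h1 (log_card_pos (F := F))
  rw [sub_mul, zeroAt, div_mul_cancel₀ _ log_card_ne_zero] at h2
  rwa [show s * (Real.log (Nat.card F : ℝ) : ℂ) + Complex.log r + 2 * Real.pi * Complex.I * k =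
    s * (Real.log (Nat.card F : ℝ) : ℂ) - -(Complex.log r + 2 * Real.pi * Complex.I * k) by ring]

lemma hasSum_zeroTerm {u : ℝ → ℝ} {N : ℕ} (hN : 1 ≤ N) (hu : IsWeight (Nat.card F) N u)
    (hR : R.Monic) (hR1 : R ≠ 1) (hχ : IsPrimitive χ) {s : ℂ} (hs : s ∈ regularPoints χ) :
    HasSum (fun ρ : {ρ : ℂ // L χ ρ = 0} => zeroTerm u N χ s ρ)
      (∑ r : (Lpoly χ).roots.toFinset, ((Lpoly χ).roots.count (r : ℂ) : ℂ) *
        ∑' k : ℤ, U u ((s * (Real.log (Nat.card F : ℝ) : ℂ) + Complex.log r +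
          2 * Real.pi * Complex.I * k) * N)) := by
  classical
  rw [← (zeroEquiv hR hR1 hχ).hasSum_iff]
  refine hasSum_finite_prod fun r => ?_
  have hq : 2 ≤ Nat.card F := one_lt_card
  have h := (hu.exp_neg_tsum_U hq hN (mem_slitStrip_of_mem_regularPoints hR hR1 hχ hs r)).1
  have e : (fun k : ℤ => ((fun ρ : {ρ : ℂ // L χ ρ = 0} => zeroTerm u N χ s ρ) ∘
      zeroEquiv hR hR1 hχ) (r, k)) = fun k : ℤ => ((Lpoly χ).roots.count (r : ℂ) : ℂ) *
        U u ((s * (Real.log (Nat.card F : ℝ) : ℂ) + Complex.log r +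
          2 * Real.pi * Complex.I * k) * N) := by
    funext k
    have hr0 := zero_notMem_roots hR hR1 hχ (Multiset.mem_toFinset.1 r.2)
    rw [Function.comp_apply, zeroTerm, zeroEquiv_apply, analyticOrderNatAt_L hR hR1 hχ,
      zvar_zeroAt hr0, sub_mul, zeroAt, div_mul_cancel₀ _ log_card_ne_zero]
    congr 3
    ring
  rw [e]
  exact h.hasSum.mul_left _

lemma hadamardExp_eq {u : ℝ → ℝ} {N : ℕ} (hN : 1 ≤ N) (hu : IsWeight (Nat.card F) N u)
    (hR : R.Monic) (hR1 : R ≠ 1) (hχ : IsPrimitive χ) {s : ℂ} (hs : s ∈ regularPoints χ) :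
    hadamardExp u N χ s = L χ s * (eulerPart N χ s)⁻¹ := by
  classical
  have hq : 2 ≤ Nat.card F := one_lt_card
  rw [hadamardExp, (hasSum_zeroTerm hN hu hR hR1 hχ hs).tsum_eq, L_mul_inv_eulerPart hR hR1 hχ,
    ← Finset.sum_neg_distrib, Complex.exp_sum,
    ← Finset.prod_coe_sort (Lpoly χ).roots.toFinset]
  refine Finset.prod_congr rfl fun r _ => ?_
  have hr0 := zero_notMem_roots hR hR1 hχ (Multiset.mem_toFinset.1 r.2)
  have h := (hu.exp_neg_tsum_U hq hN (mem_slitStrip_of_mem_regularPoints hR hR1 hχ hs r)).2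
  have e : Complex.exp (-(s * (Real.log (Nat.card F : ℝ) : ℂ) + Complex.log r)) =
      (r : ℂ)⁻¹ * zvar F s := by
    rw [neg_add, Complex.exp_add, Complex.exp_neg (Complex.log r), Complex.exp_log hr0, zvar,
      mul_comm]
  rw [e] at h
  rw [← mul_neg, Complex.exp_nat_mul, h]

lemma neBot_nhdsWithin_regularPoints (hR : R.Monic) (hR1 : R ≠ 1) (hχ : IsPrimitive χ) (s : ℂ) :
    (𝓝[regularPoints χ] s).NeBot := by
  have hc : Countable {ρ : ℂ // L χ ρ = 0} := (zeroEquiv hR hR1 hχ).countable_iff.1 inferInstance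
  have hd : Dense (Set.range fun ρ : {ρ : ℂ // L χ ρ = 0} => (ρ : ℂ).im)ᶜ :=
    (Set.countable_range _).dense_compl ℝ
  have h := hd.preimage Complex.isOpenMap_im
  rw [← mem_closure_iff_nhdsWithin_neBot]
  refine closure_mono (fun z hz ρ hρ => ?_) (h s)
  have him : (z - ρ).im ≠ 0 := by
    intro h0
    rw [Complex.sub_im, sub_eq_zero] at h0
    exact hz ⟨⟨ρ, hρ⟩, h0.symm⟩
  have h1 : z - ρ ∈ Complex.slitPlane := Or.inr him
  rw [Complex.mem_slitPlane_iff_arg] at h1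
  exact ⟨sub_ne_zero.1 h1.2, h1.1⟩

lemma continuous_L_mul_inv_eulerPart (hR : R.Monic) (hR1 : R ≠ 1) (hχ : IsPrimitive χ) (N : ℕ) :
    Continuous fun s => L χ s * (eulerPart N χ s)⁻¹ := by
  have hz : Continuous (zvar F) := by unfold zvar; fun_prop
  simp only [L_eq_sum hR hR1 hχ, eulerPart_eq, ← Complex.exp_neg]
  fun_prop

lemma tendsto_hadamardExp {u : ℝ → ℝ} {N : ℕ} (hN : 1 ≤ N) (hu : IsWeight (Nat.card F) N u)
    (hR : R.Monic) (hR1 : R ≠ 1) (hχ : IsPrimitive χ) (s : ℂ) :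
    Tendsto (hadamardExp u N χ) (𝓝[regularPoints χ] s) (𝓝 (L χ s * (eulerPart N χ s)⁻¹)) := by
  refine Tendsto.congr' ?_ ((continuous_L_mul_inv_eulerPart hR hR1 hχ N).tendsto s |>.mono_left
    nhdsWithin_le_nhds)
  filter_upwards [self_mem_nhdsWithin] with z hz
  exact (hadamardExp_eq hN hu hR hR1 hχ hz).symm

theorem hadamardPart_eq {u : ℝ → ℝ} {N : ℕ} (hN : 1 ≤ N) (hu : IsWeight (Nat.card F) N u)
    (hR : R.Monic) (hR1 : R ≠ 1) (hχ : IsPrimitive χ) (s : ℂ) :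
    hadamardPart u N χ s = L χ s * (eulerPart N χ s)⁻¹ := by
  rw [hadamardPart]
  split_ifs with h
  · exact hadamardExp_eq hN hu hR hR1 hχ h
  · have := neBot_nhdsWithin_regularPoints hR hR1 hχ s
    exact (tendsto_hadamardExp hN hu hR hR1 hχ s).limUnder_eq

end Zeros

lemma exp_neg_mul_le_one_sub {x c : ℝ} (hc : 0 < c) (hx : 0 ≤ x) (h : x ≤ 1 - 1 / c) :
    Real.exp (-(c * x)) ≤ 1 - x := by
  have h0 : 0 < 1 / c := by positivity
  have h1 : 0 < 1 - x := by linarith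
  rw [← Real.le_log_iff_exp_le h1]
  refine le_trans ?_ (Real.one_sub_inv_le_log_of_pos h1)
  have h2 : (1 - x)⁻¹ ≤ c := by
    rw [inv_le_comm₀ h1 hc, ← one_div]; linarith
  have h3 : (1 - x)⁻¹ * (1 - x) = 1 := inv_mul_cancel₀ h1.ne'
  nlinarith

lemma prod_inv_one_sub_pow_le {S : Finset F[X]} {w c : ℝ} (hc : 0 < c) (hw : 0 ≤ w)
    (h : ∀ P ∈ S, w ^ P.natDegree ≤ 1 - 1 / c) :
    ∏ P ∈ S, (1 - w ^ P.natDegree)⁻¹ ≤ Real.exp (c * ∑ P ∈ S, w ^ P.natDegree) := by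
  rw [Finset.mul_sum, Real.exp_sum]
  have h0 : 0 < 1 / c := by positivity
  refine Finset.prod_le_prod (fun P hP => inv_nonneg.2 ?_) fun P hP => ?_
  · linarith [h P hP]
  · rw [inv_le_comm₀ (by linarith [h P hP]) (Real.exp_pos _), ← Real.exp_neg]
    exact exp_neg_mul_le_one_sub hc (by positivity) (h P hP)

/-- The base `2 ^ (1 / (2 (X + 1)))` of the weights on smooth polynomials. -/
def th (X : ℕ) : ℝ := 2 ^ ((1 : ℝ) / (2 * (X + 1)))

lemma th_pos (X : ℕ) : 0 < th X := by unfold th; positivity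

lemma one_le_th (X : ℕ) : 1 ≤ th X := Real.one_le_rpow one_le_two (by positivity)

lemma th_pow (X : ℕ) : th X ^ (2 * (X + 1)) = 2 := by
  rw [th, ← Real.rpow_natCast, ← Real.rpow_mul zero_le_two]
  push_cast
  rw [one_div, inv_mul_cancel₀ (by positivity), Real.rpow_one]

lemma th_pow_le {X k : ℕ} (h : k ≤ 2 * (X + 1)) : th X ^ k ≤ 2 :=
  (pow_le_pow_right₀ (one_le_th X) h).trans_eq (th_pow X)

lemma th_sq_le {X : ℕ} (hX : 1 ≤ X) : th X ^ 2 ≤ 3 / 2 := by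
  by_contra! h
  have h1 := th_pow X
  rw [pow_mul] at h1
  have h2 : (3 / 2 : ℝ) ^ 2 ≤ (th X ^ 2) ^ (X + 1) :=
    (pow_le_pow_left₀ (by norm_num) h.le 2).trans
      (pow_le_pow_right₀ (by linarith) (by omega))
  rw [h1] at h2
  norm_num at h2

lemma rt_le_one : rt F ≤ 1 := by
  have h := rt_sq (F := F)
  have h2 := two_le_card (F := F)
  have h3 : (Nat.card F : ℝ)⁻¹ ≤ 1 := inv_le_one_of_one_le₀ (by linarith)
  have := rt_pos (F := F)
  nlinarith

lemma rt_sq_le : rt F ^ 2 ≤ 1 / 2 := by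
  rw [rt_sq, ← one_div]
  exact one_div_le_one_div_of_le (by norm_num) two_le_card

/-- The Euler product over the primes of degree at most `X` at `th ^ 2 / q`. -/
def smoothBound (F : Type*) [Field F] [Finite F] (X : ℕ) : ℝ :=
  ∏ P ∈ primeSet F X, (1 - (th X ^ 2 / Nat.card F) ^ P.natDegree)⁻¹

lemma one_le_of_mem_primeSet {X : ℕ} {P : F[X]} (hP : P ∈ primeSet F X) :
    1 ≤ P.natDegree ∧ P.natDegree ≤ X := by
  rw [mem_primeSet] at hP
  exact ⟨hP.1.natDegree_pos, hP.2⟩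

lemma th_sq_div_pow_le {X : ℕ} {P : F[X]} (hP : P ∈ primeSet F X) :
    (th X ^ 2 / Nat.card F) ^ P.natDegree ≤ 3 / 4 := by
  obtain ⟨h1, h2⟩ := one_le_of_mem_primeSet hP
  have hq := two_le_card (F := F)
  have h3 : th X ^ 2 / Nat.card F ≤ 3 / 4 := by
    rw [div_le_iff₀ (by linarith)]
    have := th_sq_le (h1.trans h2)
    linarith
  have h0 : 0 ≤ th X ^ 2 / Nat.card F := by positivity
  exact (pow_le_of_le_one h0 (by linarith) (by omega)).trans h3

lemma hasSum_smoothBound (X : ℕ) :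
    HasSum (fun n => cnt (FactorsIn (primeSet F X)) n * (th X ^ 2 / Nat.card F) ^ n)
      (smoothBound F X) := by
  refine hasSum_factorsIn (fun P hP => (mem_primeSet.1 hP).1) (by positivity) fun P hP => ?_
  linarith [th_sq_div_pow_le hP]

lemma smoothBound_le (X : ℕ) : smoothBound F X ≤ Real.exp 16 * ((X : ℝ) + 1) ^ 8 := by
  have h1 : smoothBound F X ≤ Real.exp (4 * ∑ P ∈ primeSet F X, (th X ^ 2 / Nat.card F) ^ P.natDegree) :=
    prod_inv_one_sub_pow_le (by norm_num) (by positivity) fun P hP =>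
      (th_sq_div_pow_le hP).trans (by norm_num)
  have h2 : ∑ P ∈ primeSet F X, (th X ^ 2 / Nat.card F) ^ P.natDegree ≤
      2 * ∑ P ∈ primeSet F X, 1 / (Nat.card F : ℝ) ^ P.natDegree := by
    rw [Finset.mul_sum]
    refine Finset.sum_le_sum fun P hP => ?_
    rw [div_pow, ← pow_mul, mul_one_div]
    refine div_le_div_of_nonneg_right (th_pow_le ?_) (card_pow_pos _).le
    have := (one_le_of_mem_primeSet hP).2
    omega
  have h3 := sum_one_div_primes_le (t := X + 1) (by omega)
    (fun P (hP : P ∈ primeSet F X) => (mem_primeSet.1 hP).1) (card_primeSet_le X)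
  refine h1.trans ?_
  calc _ ≤ Real.exp (8 * (Real.log ((X + 1 : ℕ) : ℝ) + 2)) := Real.exp_le_exp.2 (by linarith)
    _ = _ := by
      have : (0 : ℝ) < ((X + 1 : ℕ) : ℝ) := by positivity
      have e : 8 * Real.log ((X + 1 : ℕ) : ℝ) = Real.log (((X + 1 : ℕ) : ℝ) ^ 8) := by
        rw [Real.log_pow]; norm_num
      rw [mul_add, e, add_comm, Real.exp_add, Real.exp_log (by positivity)]
      push_cast
      norm_num

lemma one_le_smoothBound (X : ℕ) : 1 ≤ smoothBound F X := by
  refine Finset.prod_induction _ (fun x => 1 ≤ x) (fun a b ha hb => one_le_mul_of_one_le_of_one_le ha hb)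
    le_rfl fun P hP => ?_
  have h1 := th_sq_div_pow_le hP
  have h2 : 0 ≤ (th X ^ 2 / Nat.card F) ^ P.natDegree := by positivity
  exact (one_le_inv₀ (by linarith)).2 (by linarith)

/-- The Euler product over the primes of degree at most `X` at `th * q ^ (-1/2)`. -/
def halfBound (F : Type*) [Field F] [Finite F] (X : ℕ) : ℝ :=
  ∏ P ∈ primeSet F X, (1 - (th X * rt F) ^ P.natDegree)⁻¹

lemma th_mul_rt_pow_le {X : ℕ} {P : F[X]} (hP : P ∈ primeSet F X) :
    (th X * rt F) ^ P.natDegree ≤ 7 / 8 := by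
  obtain ⟨h1, h2⟩ := one_le_of_mem_primeSet hP
  have h0 : 0 ≤ th X * rt F := mul_nonneg (th_pos X).le rt_pos.le
  have h3 : th X * rt F ≤ 7 / 8 := by
    have h4 : (th X * rt F) ^ 2 ≤ 3 / 2 * (1 / 2) := by
      rw [mul_pow]
      exact mul_le_mul (th_sq_le (h1.trans h2)) rt_sq_le (sq_nonneg _) (by norm_num)
    nlinarith
  exact (pow_le_of_le_one h0 (by linarith) (by omega)).trans h3

lemma hasSum_halfBound (X : ℕ) :
    HasSum (fun n => cnt (FactorsIn (primeSet F X)) n * (th X * rt F) ^ n) (halfBound F X) := by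
  refine hasSum_factorsIn (fun P hP => (mem_primeSet.1 hP).1)
    (mul_nonneg (th_pos X).le rt_pos.le) fun P hP => ?_
  linarith [th_mul_rt_pow_le hP]

lemma halfBound_le (X : ℕ) : halfBound F X ≤ Real.exp (64 * (rt F)⁻¹ ^ X) := by
  have hr := rt_pos (F := F)
  have h1 : halfBound F X ≤ Real.exp (8 * ∑ P ∈ primeSet F X, (th X * rt F) ^ P.natDegree) :=
    prod_inv_one_sub_pow_le (by norm_num) (mul_nonneg (th_pos X).le rt_pos.le) fun P hP =>
      (th_mul_rt_pow_le hP).trans (by norm_num)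
  have h2 : ∑ P ∈ primeSet F X, (th X * rt F) ^ P.natDegree ≤
      2 * ∑ P ∈ primeSet F X, rt F ^ P.natDegree := by
    rw [Finset.mul_sum]
    refine Finset.sum_le_sum fun P hP => ?_
    rw [mul_pow]
    refine mul_le_mul_of_nonneg_right (th_pow_le ?_) (by positivity)
    have := (one_le_of_mem_primeSet hP).2
    omega
  have hq : (Nat.card F : ℝ) = (rt F)⁻¹ ^ 2 := by rw [inv_pow, rt_sq, inv_inv]
  have h3 : ∑ P ∈ primeSet F X, rt F ^ P.natDegree ≤ ∑ n ∈ Finset.range X, (rt F)⁻¹ ^ (n + 1) := by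
    refine (sum_primeSet_le (g := fun n => rt F ^ n) (fun n => by positivity) X).trans
      (Finset.sum_le_sum fun n _ => ?_)
    have e : (Nat.card F : ℝ) ^ (n + 1) * rt F ^ (n + 1) = (rt F)⁻¹ ^ (n + 1) := by
      rw [← mul_pow, hq]
      congr 1
      field_simp
    rw [div_mul_eq_mul_div, e]
    exact div_le_self (by positivity) (by linarith [(Nat.cast_nonneg n : (0 : ℝ) ≤ n)])
  have h4 : ∀ X : ℕ, ∑ n ∈ Finset.range X, (rt F)⁻¹ ^ (n + 1) ≤ 4 * (rt F)⁻¹ ^ X := by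
    have hs : 7 / 5 ≤ (rt F)⁻¹ := by
      have h5 := rt_sq_le (F := F)
      rw [le_inv_comm₀ (by norm_num) hr]
      nlinarith
    intro X
    induction X with
    | zero => simp
    | succ X ih =>
      rw [Finset.sum_range_succ]
      have : 0 < (rt F)⁻¹ ^ X := by positivity
      rw [pow_succ]
      nlinarith
  refine h1.trans (Real.exp_le_exp.2 ?_)
  linarith [h4 X]

/-- The weight of the smooth divisors. -/
def smoothWeight (X : ℕ) (D : F[X]) : ℝ :=
  open Classical in if FactorsIn (primeSet F X) D then th X ^ D.natDegree else 0

lemma smoothWeight_nonneg (X : ℕ) (D : F[X]) : 0 ≤ smoothWeight X D := by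
  have := th_pos X
  rw [smoothWeight]; split_ifs <;> positivity

lemma factorsIn_mul_iff {S : Finset F[X]} {A B : F[X]} :
    FactorsIn S (A * B) ↔ FactorsIn S A ∧ FactorsIn S B :=
  ⟨fun h => ⟨factorsIn_of_mul (A := B) (by rwa [mul_comm]), factorsIn_of_mul h⟩,
    fun h P hP hd => (hP.prime.dvd_or_dvd hd).elim (h.1 P hP) (h.2 P hP)⟩

lemma smoothWeight_mul (X : ℕ) {A B : F[X]} (hA : A.Monic) (hB : B.Monic) :
    smoothWeight X (A * B) = smoothWeight X A * smoothWeight X B := by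
  have h := factorsIn_mul_iff (S := primeSet F X) (A := A) (B := B)
  by_cases hA' : FactorsIn (primeSet F X) A <;> by_cases hB' : FactorsIn (primeSet F X) B <;>
    simp only [hA', hB', and_true, and_false, iff_true, iff_false] at h <;>
    simp [smoothWeight, hA', hB', h, hA.natDegree_mul hB, pow_add]

/-- The sum of the weights of the smooth divisors. -/
def divWeight (X : ℕ) (D : F[X]) : ℝ := conv (fun _ => 1) (smoothWeight X) D

lemma divWeight_eq (X : ℕ) (D : F[X]) : divWeight X D = ∑ p ∈ dpairs D, smoothWeight X p.2 := by
  simp only [divWeight, conv, one_mul]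

lemma divWeight_nonneg (X : ℕ) (D : F[X]) : 0 ≤ divWeight X D := by
  rw [divWeight_eq]
  exact Finset.sum_nonneg fun _ _ => smoothWeight_nonneg X _

lemma smoothWeight_one (X : ℕ) : smoothWeight X (1 : F[X]) = 1 := by
  rw [smoothWeight, if_pos, natDegree_one, pow_zero]
  intro P hP hd
  exact absurd (isUnit_of_dvd_one hd) hP.2.not_isUnit

lemma one_le_divWeight (X : ℕ) {D : F[X]} (hD : D.Monic) : 1 ≤ divWeight X D := by
  rw [divWeight_eq]
  have h : (D, (1 : F[X])) ∈ dpairs D := mem_dpairs.2 ⟨hD, monic_one, mul_one D⟩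
  refine le_trans ?_ (Finset.single_le_sum (f := fun p : F[X] × F[X] => smoothWeight X p.2)
    (fun p _ => smoothWeight_nonneg X _) h)
  simp [smoothWeight_one]

lemma exists_monic_mul_eq {K A B : F[X]} (hK : K.Monic) (h : K ∣ A * B) :
    ∃ a b : F[X], a.Monic ∧ b.Monic ∧ a ∣ A ∧ b ∣ B ∧ a * b = K := by
  classical
  obtain ⟨a, b, ha, hb, rfl⟩ := exists_dvd_and_dvd_of_dvd_mul h
  have h0 := hK.ne_zero
  refine ⟨normalize a, normalize b, monic_normalize (left_ne_zero_of_mul h0),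
    monic_normalize (right_ne_zero_of_mul h0), normalize_dvd_iff.2 ha, normalize_dvd_iff.2 hb, ?_⟩
  rw [← normalize_mul, hK.normalize_eq_self]

lemma divWeight_mul_le (X : ℕ) {A B : F[X]} (hA : A.Monic) (hB : B.Monic) :
    divWeight X (A * B) ≤ divWeight X A * divWeight X B := by
  classical
  have hmap : ∀ r ∈ dpairs A ×ˢ dpairs B, (r.1.1 * r.2.1, r.1.2 * r.2.2) ∈ dpairs (A * B) := by
    intro r hr
    rw [Finset.mem_product, mem_dpairs, mem_dpairs] at hr
    obtain ⟨⟨h1, h2, h3⟩, h4, h5, h6⟩ := hr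
    refine mem_dpairs.2 ⟨h1.mul h4, h2.mul h5, ?_⟩
    rw [← h3, ← h6]; ring
  rw [divWeight_eq, divWeight_eq, divWeight_eq, Finset.sum_mul_sum, ← Finset.sum_product',
    ← Finset.sum_fiberwise_of_maps_to hmap]
  refine Finset.sum_le_sum fun p hp => ?_
  obtain ⟨h1, h2, h3⟩ := mem_dpairs.1 hp
  obtain ⟨a, b, ha, hb, ⟨a', rfl⟩, ⟨b', rfl⟩, hab⟩ :=
    exists_monic_mul_eq (A := A) (B := B) h2 ⟨p.1, by rw [← h3, mul_comm]⟩
  have ha' := ha.of_mul_monic_left hA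
  have hb' := hb.of_mul_monic_left hB
  have hmem : ((a', a), (b', b)) ∈ (dpairs (a * a') ×ˢ dpairs (b * b')).filter
      fun r => (r.1.1 * r.2.1, r.1.2 * r.2.2) = p := by
    refine Finset.mem_filter.2 ⟨Finset.mem_product.2 ⟨mem_dpairs.2 ⟨ha', ha, mul_comm _ _⟩,
      mem_dpairs.2 ⟨hb', hb, mul_comm _ _⟩⟩, Prod.ext ?_ hab⟩
    refine mul_right_cancel₀ h2.ne_zero ?_
    rw [h3, ← hab]
    ring
  refine le_trans ?_ (Finset.single_le_sum
    (f := fun r : (F[X] × F[X]) × (F[X] × F[X]) => smoothWeight X r.1.2 * smoothWeight X r.2.2)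
    (fun r _ => mul_nonneg (smoothWeight_nonneg X _) (smoothWeight_nonneg X _)) hmem)
  rw [← hab, smoothWeight_mul X ha hb]

/-- The average of `f` over the monic polynomials of degree `n`. -/
def mavg (f : F[X] → ℝ) (n : ℕ) : ℝ := (∑ D ∈ monics F n, f D) / (Nat.card F : ℝ) ^ n

lemma mavg_nonneg {f : F[X] → ℝ} (hf : ∀ D, 0 ≤ f D) (n : ℕ) : 0 ≤ mavg f n :=
  div_nonneg (Finset.sum_nonneg fun _ _ => hf _) (card_pow_pos n).le

lemma mavg_mono {f g : F[X] → ℝ} {n : ℕ} (h : ∀ D : F[X], D.Monic → D.natDegree = n → f D ≤ g D) :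
    mavg f n ≤ mavg g n :=
  div_le_div_of_nonneg_right (Finset.sum_le_sum fun D hD => h D (mem_monics.1 hD).1
    (mem_monics.1 hD).2) (card_pow_pos n).le

lemma mavg_one (n : ℕ) : mavg (fun _ : F[X] => 1) n = 1 := by
  rw [mavg, Finset.sum_const, card_monics, nsmul_one, Nat.cast_pow, div_self (card_pow_pos n).ne']

lemma mavg_conv (f g : F[X] → ℝ) (n : ℕ) : mavg (conv f g) n =
    ∑ ij ∈ Finset.HasAntidiagonal.antidiagonal n, mavg f ij.1 * mavg g ij.2 := by
  simp only [mavg, conv]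
  rw [sum_monics_dpairs n (fun A B => f A * g B), Finset.sum_div]
  refine Finset.sum_congr rfl fun ij h => ?_
  rw [← Finset.sum_mul_sum, div_mul_div_comm, ← pow_add, Finset.HasAntidiagonal.mem_antidiagonal.1 h]

lemma sum_antidiagonal_mul_le {a b : ℕ → ℝ} {A B : ℝ} (ha : ∀ n, a n ≤ A)
    (hb : ∀ n, 0 ≤ b n) (hA : 0 ≤ A) (hB : ∀ n, ∑ j ∈ Finset.range n, b j ≤ B) (n : ℕ) :
    ∑ ij ∈ Finset.HasAntidiagonal.antidiagonal n, a ij.1 * b ij.2 ≤ A * B := by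
  calc _ ≤ ∑ ij ∈ Finset.HasAntidiagonal.antidiagonal n, A * b ij.2 :=
        Finset.sum_le_sum fun ij _ => mul_le_mul_of_nonneg_right (ha _) (hb _)
    _ = A * ∑ ij ∈ Finset.HasAntidiagonal.antidiagonal n, b ij.2 := by rw [Finset.mul_sum]
    _ = A * ∑ j ∈ Finset.range (n + 1), b j := by
        rw [← Finset.Nat.sum_antidiagonal_swap, Finset.Nat.sum_antidiagonal_eq_sum_range_succ_mk]
        rfl
    _ ≤ _ := mul_le_mul_of_nonneg_left (hB _) hA

section MeanSquare

variable (X : ℕ)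

/-- The terms of the series of `smoothBound`. -/
def smoothTerm (F : Type*) [Field F] [Finite F] (X n : ℕ) : ℝ :=
  cnt (FactorsIn (primeSet F X)) n * (th X ^ 2 / Nat.card F) ^ n

lemma smoothTerm_nonneg (n : ℕ) : 0 ≤ smoothTerm F X n :=
  mul_nonneg (cnt_nonneg _ _) (by have := th_pos X; positivity)

lemma mavg_smoothWeight_sq (n : ℕ) :
    mavg (fun D : F[X] => smoothWeight X D ^ 2) n = smoothTerm F X n := by
  classical
  rw [mavg, smoothTerm, cnt_eq_sum, div_pow, ← mul_div_assoc, Finset.sum_mul]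
  congr 1
  refine Finset.sum_congr rfl fun D hD => ?_
  rw [smoothWeight, (mem_monics.1 hD).2]
  by_cases h : FactorsIn (primeSet F X) D
  · simp only [h, if_true]; ring
  · simp [h]

lemma smoothWeight_le_sq (D : F[X]) : smoothWeight X D ≤ smoothWeight X D ^ 2 := by
  rw [smoothWeight]
  split_ifs
  · have := one_le_pow₀ (n := D.natDegree) (one_le_th X)
    nlinarith
  · norm_num

lemma mavg_smoothWeight_le (n : ℕ) : mavg (fun D : F[X] => smoothWeight X D) n ≤ smoothTerm F X n := by
  rw [← mavg_smoothWeight_sq]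
  exact mavg_mono fun D _ _ => smoothWeight_le_sq X D

lemma sum_smoothTerm_le (n : ℕ) : ∑ j ∈ Finset.range n, smoothTerm F X j ≤ smoothBound F X :=
  sum_le_hasSum _ (fun _ _ => smoothTerm_nonneg X _) (hasSum_smoothBound X)

lemma mavg_divWeight_le (n : ℕ) : mavg (fun D : F[X] => divWeight X D) n ≤ smoothBound F X := by
  have h : mavg (fun D : F[X] => divWeight X D) n = mavg (conv (fun _ => 1) (smoothWeight X)) n := rfl
  rw [h, mavg_conv, ← one_mul (smoothBound F X)]
  refine sum_antidiagonal_mul_le (fun n => (mavg_one n).le)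
    (fun n => mavg_nonneg (smoothWeight_nonneg X) n) zero_le_one (fun n => ?_) n
  exact (Finset.sum_le_sum fun j _ => mavg_smoothWeight_le X j).trans (sum_smoothTerm_le X n)

lemma sum_smoothTerm_conv_le (n : ℕ) :
    ∑ k ∈ Finset.range n, ∑ ij ∈ Finset.HasAntidiagonal.antidiagonal k,
      smoothTerm F X ij.1 * smoothTerm F X ij.2 ≤ smoothBound F X ^ 2 := by
  have hs : Summable fun n => ‖smoothTerm F X n‖ := (hasSum_smoothBound X).summable.norm
  have h := tsum_mul_tsum_eq_tsum_sum_antidiagonal_of_summable_norm hs hs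
  have h1 : ∑' n, smoothTerm F X n = smoothBound F X := (hasSum_smoothBound X).tsum_eq
  rw [h1] at h
  rw [sq, h]
  exact (summable_norm_sum_mul_antidiagonal_of_summable_norm hs hs).of_norm.sum_le_tsum _
    fun k _ => Finset.sum_nonneg fun ij _ => mul_nonneg (smoothTerm_nonneg X _) (smoothTerm_nonneg X _)

lemma smoothWeight_mul_divWeight {D : F[X]} :
    smoothWeight X D * divWeight X D =
      conv (smoothWeight X) (fun A => smoothWeight X A ^ 2) D := by
  rw [divWeight_eq, conv, Finset.mul_sum]
  refine Finset.sum_congr rfl fun p hp => ?_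
  obtain ⟨h1, h2, h3⟩ := mem_dpairs.1 hp
  rw [← h3, smoothWeight_mul X h1 h2]
  ring

lemma divWeight_sq_le {D : F[X]} :
    divWeight X D ^ 2 ≤ conv (divWeight X) (fun A => smoothWeight X A * divWeight X A) D := by
  rw [sq]
  nth_rw 1 [divWeight_eq]
  rw [conv, Finset.sum_mul]
  refine Finset.sum_le_sum fun p hp => ?_
  obtain ⟨h1, h2, h3⟩ := mem_dpairs.1 hp
  have h := divWeight_mul_le X h1 h2
  rw [← h3]
  have := mul_le_mul_of_nonneg_left h (smoothWeight_nonneg X p.2)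
  linarith

lemma mavg_divWeight_sq_le (n : ℕ) :
    mavg (fun D : F[X] => divWeight X D ^ 2) n ≤ smoothBound F X ^ 3 := by
  have hB : 0 ≤ smoothBound F X := zero_le_one.trans (one_le_smoothBound X)
  refine (mavg_mono (g := conv (divWeight X) (fun A => smoothWeight X A * divWeight X A))
    fun D hD _ => divWeight_sq_le X).trans ?_
  rw [mavg_conv, show smoothBound F X ^ 3 = smoothBound F X * smoothBound F X ^ 2 by ring]
  refine sum_antidiagonal_mul_le (mavg_divWeight_le X) (fun n => mavg_nonneg (fun D =>
    mul_nonneg (smoothWeight_nonneg X D) (divWeight_nonneg X D)) n) hB (fun n => ?_) n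
  refine le_trans (Finset.sum_le_sum fun k _ => ?_) (sum_smoothTerm_conv_le X n)
  simp only [smoothWeight_mul_divWeight]
  change mavg (conv (smoothWeight X) (fun A => smoothWeight X A ^ 2)) k ≤ _
  rw [mavg_conv]
  refine Finset.sum_le_sum fun ij _ => ?_
  rw [mavg_smoothWeight_sq]
  exact mul_le_mul_of_nonneg_right (mavg_smoothWeight_le X _) (smoothTerm_nonneg X _)

end MeanSquare

/-- `f` cut off at degree `M`. -/
def trunc (M : ℕ) (f : F[X] → ℝ) (D : F[X]) : ℝ := if D.natDegree < M then f D else 0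

lemma trunc_eq_zero {M : ℕ} (f : F[X] → ℝ) {D : F[X]} (h : M ≤ D.natDegree) : trunc M f D = 0 :=
  if_neg (by omega)

lemma trunc_of_lt {M : ℕ} (f : F[X] → ℝ) {D : F[X]} (h : D.natDegree < M) : trunc M f D = f D :=
  if_pos h

lemma abs_trunc_le {M : ℕ} {f : F[X] → ℝ} {D : F[X]} {C : ℝ} (h : |f D| ≤ C) : |trunc M f D| ≤ C := by
  rw [trunc]
  split_ifs
  · exact h
  · rw [abs_zero]; exact (abs_nonneg _).trans h

lemma abs_invCoeff_le_ite (X : ℕ) {D : F[X]} (hD : D.Monic) : |invCoeff X D| ≤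
    open Classical in if FactorsIn (primeSet F X) D then 1 else 0 := by
  classical
  split_ifs with h
  · exact (abs_invCoeff_le X hD).trans (eulerCoeff_le_one X hD)
  · refine (abs_invCoeff_le X hD).trans_eq ?_
    by_contra h0
    exact h (isSmooth_iff_factorsIn.1 (isSmooth_of_eulerCoeff_ne_zero hD h0))

lemma abs_invCoeff_le_one (X : ℕ) {D : F[X]} (hD : D.Monic) : |invCoeff X D| ≤ 1 :=
  (abs_invCoeff_le X hD).trans (eulerCoeff_le_one X hD)

lemma abs_invCoeff_le_smoothWeight (X : ℕ) {D : F[X]} (hD : D.Monic) :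
    |invCoeff X D| ≤ smoothWeight X D := by
  classical
  refine (abs_invCoeff_le_ite X hD).trans ?_
  rw [smoothWeight]
  by_cases h : FactorsIn (primeSet F X) D
  · simpa [h] using one_le_pow₀ (one_le_th X)
  · simp [h]

lemma abs_invCoeff_le_mul_smoothWeight (X : ℕ) {D : F[X]} (hD : D.Monic) {y : ℕ}
    (hy : y < D.natDegree) : |invCoeff X D| ≤ (th X ^ y)⁻¹ * smoothWeight X D := by
  classical
  refine (abs_invCoeff_le_ite X hD).trans ?_
  have h0 : 0 < th X ^ y := pow_pos (th_pos X) y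
  rw [smoothWeight]
  by_cases h : FactorsIn (primeSet F X) D
  · simp only [h, if_true]
    rw [← div_eq_inv_mul, one_le_div h0]
    exact pow_le_pow_right₀ (one_le_th X) hy.le
  · simp [h]

/-- The coefficients of the product of `g` cut off at `M` and of the truncation of `1 / P_X`. -/
def truncConv (X y M : ℕ) (g : F[X] → ℝ) : F[X] → ℝ :=
  conv (trunc M g) (trunc (y + 1) (invCoeff X))

lemma abs_truncConv_le_of {X y M : ℕ} {g : F[X] → ℝ} {C : ℝ} {D : F[X]}
    (hg : ∀ p ∈ dpairs D, p.1.natDegree < M → p.2.natDegree ≤ y → |g p.1| ≤ C) (hC : 0 ≤ C) :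
    |truncConv X y M g D| ≤ C * divWeight X D := by
  rw [truncConv, conv, divWeight_eq, Finset.mul_sum]
  refine (Finset.abs_sum_le_sum_abs _ _).trans (Finset.sum_le_sum fun p hp => ?_)
  obtain ⟨h1, h2, h3⟩ := mem_dpairs.1 hp
  rw [abs_mul]
  by_cases h : p.1.natDegree < M ∧ p.2.natDegree ≤ y
  · rw [trunc_of_lt g h.1, trunc_of_lt _ (by omega)]
    exact mul_le_mul (hg p hp h.1 h.2) (abs_invCoeff_le_smoothWeight X h2) (abs_nonneg _) hC
  · have h0 : |trunc M g p.1| * |trunc (y + 1) (invCoeff X) p.2| = 0 := by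
      rcases not_and_or.1 h with h | h
      · rw [trunc_eq_zero g (by omega)]; simp
      · rw [trunc_eq_zero (invCoeff X) (D := p.2) (by omega)]; simp
    rw [h0]
    exact mul_nonneg hC (smoothWeight_nonneg X _)

lemma sum_dpairs_le (y : ℕ) (D : F[X]) :
    (((dpairs D).filter fun p => p.2.natDegree ≤ y).card : ℝ) ≤ (Nat.card F : ℝ) ^ (y + 1) := by
  classical
  have h : ((dpairs D).filter fun p => p.2.natDegree ≤ y).card ≤ (monicsLE F y).card := by
    refine Finset.card_le_card_of_injOn (fun p => p.2) (fun p hp => ?_) fun p hp p' hp' e => ?_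
    · rw [Finset.mem_coe, Finset.mem_filter] at hp
      exact Finset.mem_coe.2 (mem_monicsLE.2 ⟨(mem_dpairs.1 hp.1).2.1, hp.2⟩)
    · rw [Finset.mem_coe, Finset.mem_filter] at hp hp'
      obtain ⟨h1, h2, h3⟩ := mem_dpairs.1 hp.1
      obtain ⟨h1', h2', h3'⟩ := mem_dpairs.1 hp'.1
      simp only at e
      refine Prod.ext (mul_right_cancel₀ h2.ne_zero ?_) e
      rw [h3, e, h3']
  refine (Nat.cast_le.2 h).trans ?_
  have h1 : ((monicsLE F y).card : ℝ) = ∑ m ∈ Finset.range (y + 1), (Nat.card F : ℝ) ^ m := by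
    have := sum_monicsLE (F := F) y (fun _ => (1 : ℝ))
    simp only [Finset.sum_const, card_monics, nsmul_one] at this
    rw [this]
    push_cast
    rfl
  rw [h1]
  have hq := two_le_card (F := F)
  generalize y + 1 = n
  induction n with
  | zero => simp
  | succ n ih =>
    rw [Finset.sum_range_succ, pow_succ]
    have := card_pow_pos (F := F) n
    nlinarith

lemma abs_truncConv_le_pow {X y M : ℕ} {g : F[X] → ℝ} {C : ℝ} {D : F[X]}
    (hg : ∀ A : F[X], A.Monic → A.natDegree < M → |g A| ≤ C) (hC : 0 ≤ C) :
    |truncConv X y M g D| ≤ C * (Nat.card F : ℝ) ^ (y + 1) := by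
  classical
  rw [truncConv, conv]
  refine (Finset.abs_sum_le_sum_abs _ _).trans ?_
  calc ∑ p ∈ dpairs D, |trunc M g p.1 * trunc (y + 1) (invCoeff X) p.2|
      ≤ ∑ p ∈ dpairs D, if p.2.natDegree ≤ y then C else 0 := by
        refine Finset.sum_le_sum fun p hp => ?_
        obtain ⟨h1, h2, h3⟩ := mem_dpairs.1 hp
        split_ifs with h
        · rw [abs_mul, ← mul_one C]
          refine mul_le_mul ?_ (abs_trunc_le (abs_invCoeff_le_one X h2)) (abs_nonneg _) hC
          rw [trunc]
          split_ifs with h'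
          · exact hg _ h1 h'
          · rwa [abs_zero]
        · rw [trunc_eq_zero (invCoeff X) (D := p.2) (by omega)]; simp
    _ = C * (((dpairs D).filter fun p => p.2.natDegree ≤ y).card : ℝ) := by
        rw [← Finset.sum_filter, Finset.sum_const, nsmul_eq_mul, mul_comm]
    _ ≤ _ := mul_le_mul_of_nonneg_left (sum_dpairs_le y D) hC

lemma abs_truncConv_sub_hadCoeff_le {X y M : ℕ} {D : F[X]} (hD : D.Monic) (hM : D.natDegree < M) :
    |truncConv X y M (fun _ => 1) D - hadCoeff X D| ≤ (th X ^ y)⁻¹ * divWeight X D := by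
  have h0 : 0 < th X ^ y := pow_pos (th_pos X) y
  rw [← conv_one_invCoeff X hD, truncConv, conv, conv, ← Finset.sum_sub_distrib, divWeight_eq,
    Finset.mul_sum]
  refine (Finset.abs_sum_le_sum_abs _ _).trans (Finset.sum_le_sum fun p hp => ?_)
  obtain ⟨h1, h2, h3⟩ := mem_dpairs.1 hp
  have hd := natDegree_of_mem_dpairs hp
  rw [trunc_of_lt _ (by omega), one_mul, one_mul]
  by_cases h : p.2.natDegree ≤ y
  · rw [trunc_of_lt _ (by omega), sub_self, abs_zero]
    exact mul_nonneg (inv_pos.2 h0).le (smoothWeight_nonneg X _)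
  · rw [trunc_eq_zero (invCoeff X) (D := p.2) (by omega), zero_sub, abs_neg]
    exact abs_invCoeff_le_mul_smoothWeight X h2 (by omega)

open Classical in
lemma diag_eq (R : F[X]) (f : F[X] → ℝ) (M : ℕ) : diag R f M =
    ∑ n ∈ Finset.range M, mavg (fun D => if IsCoprime D R then f D ^ 2 else 0) n := by
  rw [diag, sum_monicsLT]
  refine Finset.sum_congr rfl fun n _ => ?_
  rw [mavg, Finset.sum_div]
  refine Finset.sum_congr rfl fun D hD => ?_
  rw [(mem_monics.1 hD).2]
  by_cases h : IsCoprime D R <;> simp [h]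

open Classical in
lemma mavg_ite_le (R : F[X]) {f : F[X] → ℝ} {n X : ℕ} {C : ℝ}
    (h : ∀ D : F[X], D.Monic → D.natDegree = n → |f D| ≤ C * divWeight X D ^ 2) (hC : 0 ≤ C) :
    |mavg (fun D => if IsCoprime D R then f D else 0) n| ≤ C * smoothBound F X ^ 3 := by
  refine le_trans ?_ (mul_le_mul_of_nonneg_left (mavg_divWeight_sq_le X n) hC)
  rw [mavg, mavg, abs_div, abs_of_pos (card_pow_pos (F := F) n), ← mul_div_assoc, Finset.mul_sum]
  refine div_le_div_of_nonneg_right ((Finset.abs_sum_le_sum_abs _ _).trans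
    (Finset.sum_le_sum fun D hD => ?_)) (card_pow_pos n).le
  split_ifs
  · exact h D (mem_monics.1 hD).1 (mem_monics.1 hD).2
  · rw [abs_zero]; exact mul_nonneg hC (sq_nonneg _)

lemma diag_truncConv_sub_le (R : F[X]) (X y M : ℕ) :
    |diag R (truncConv X y M fun _ => 1) (M + (y + 1)) - diag R (hadCoeff X) M| ≤
      (2 * (th X ^ y)⁻¹ * M + (y + 1)) * smoothBound F X ^ 3 := by
  classical
  have ht : 0 < (th X ^ y)⁻¹ := inv_pos.2 (pow_pos (th_pos X) y)
  rw [diag_eq, diag_eq, Finset.sum_range_add, add_sub_right_comm, ← Finset.sum_sub_distrib, add_mul]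
  refine (abs_add_le _ _).trans (add_le_add ?_ ?_)
  · have h : ∀ n ∈ Finset.range M, |mavg (fun D => if IsCoprime D R then
        truncConv X y M (fun _ => 1) D ^ 2 else 0) n - mavg (fun D => if IsCoprime D R then
        hadCoeff X D ^ 2 else 0) n| ≤ 2 * (th X ^ y)⁻¹ * smoothBound F X ^ 3 := by
      intro n hn
      have e : mavg (fun D => if IsCoprime D R then
          truncConv X y M (fun _ => 1) D ^ 2 else 0) n - mavg (fun D => if IsCoprime D R then
          hadCoeff X D ^ 2 else 0) n = mavg (fun D => if IsCoprime D R then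
            truncConv X y M (fun _ => 1) D ^ 2 - hadCoeff X D ^ 2 else 0) n := by
        rw [mavg, mavg, mavg, ← sub_div, ← Finset.sum_sub_distrib]
        congr 1
        refine Finset.sum_congr rfl fun D _ => ?_
        split_ifs <;> simp
      rw [e]
      refine mavg_ite_le R (fun D hD hDn => ?_) (by positivity)
      have h1 := abs_truncConv_sub_hadCoeff_le (X := X) (y := y) hD
        (by rw [hDn]; exact Finset.mem_range.1 hn)
      have h2 : |truncConv X y M (fun _ => 1) D| ≤ 1 * divWeight X D :=
        abs_truncConv_le_of (fun _ _ _ _ => by rw [abs_one]) zero_le_one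
      have h3 := hadCoeff_nonneg X hD
      have h4 := hadCoeff_le_one X hD
      have h5 := one_le_divWeight X hD
      rw [sq_sub_sq, abs_mul]
      have h6 : |truncConv X y M (fun _ => 1) D + hadCoeff X D| ≤ 2 * divWeight X D := by
        refine (abs_add_le _ _).trans ?_
        rw [abs_of_nonneg h3]
        linarith
      calc _ ≤ 2 * divWeight X D * ((th X ^ y)⁻¹ * divWeight X D) :=
            mul_le_mul h6 h1 (abs_nonneg _) (by linarith)
        _ = _ := by ring
    refine (Finset.abs_sum_le_sum_abs _ _).trans ((Finset.sum_le_sum h).trans_eq ?_)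
    rw [Finset.sum_const, Finset.card_range, nsmul_eq_mul]
    ring
  · have h : ∀ n ∈ Finset.range (y + 1), |mavg (fun D => if IsCoprime D R then
        truncConv X y M (fun _ => 1) D ^ 2 else 0) (M + n)| ≤ 1 * smoothBound F X ^ 3 := by
      intro n _
      refine mavg_ite_le R (fun D hD _ => ?_) zero_le_one
      have h2 : |truncConv X y M (fun _ => 1) D| ≤ 1 * divWeight X D :=
        abs_truncConv_le_of (fun _ _ _ _ => by rw [abs_one]) zero_le_one
      rw [abs_pow]
      rw [one_mul] at h2 ⊢
      exact pow_le_pow_left₀ (abs_nonneg _) h2 2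
    refine (Finset.abs_sum_le_sum_abs _ _).trans ((Finset.sum_le_sum h).trans_eq ?_)
    rw [Finset.sum_const, Finset.card_range, nsmul_eq_mul]
    push_cast
    ring

/-- The difference of the coefficients of the partial sum and of the reflected partial sum. -/
def reflDiff (F : Type*) [Field F] (Y j : ℕ) : ℝ := ((rt F)⁻¹ + 1) * rt F ^ (Y - j)

lemma reflDiff_nonneg (Y j : ℕ) : 0 ≤ reflDiff F Y j := by
  have := rt_pos (F := F)
  unfold reflDiff; positivity

lemma reflDiff_le {Y j n : ℕ} (hj : j < Y) (hn : j ≤ n) :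
    reflDiff F Y j ≤ 2 * rt F ^ (Y - 1 - n) := by
  have h0 := rt_pos (F := F)
  have h1 := rt_le_one (F := F)
  have e : reflDiff F Y j = (1 + rt F) * rt F ^ (Y - 1 - j) := by
    rw [reflDiff, show Y - j = (Y - 1 - j) + 1 by omega, pow_succ]
    field_simp
  rw [e]
  refine mul_le_mul (by linarith) ?_ (by positivity) (by norm_num)
  exact pow_le_pow_of_le_one h0.le h1 (by omega)

lemma diag_truncConv_reflDiff_le (R : F[X]) (X y Y : ℕ) :
    diag R (truncConv X y Y fun A => reflDiff F Y A.natDegree) (Y + (y + 1)) ≤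
      (8 + 4 * (y + 1)) * smoothBound F X ^ 3 := by
  classical
  have hr := rt_pos (F := F)
  have hB : 0 ≤ smoothBound F X ^ 3 := pow_nonneg (zero_le_one.trans (one_le_smoothBound X)) 3
  have h : ∀ n : ℕ, mavg (fun D => if IsCoprime D R then
      truncConv X y Y (fun A => reflDiff F Y A.natDegree) D ^ 2 else 0) n ≤
      4 * (rt F ^ (Y - 1 - n)) ^ 2 * smoothBound F X ^ 3 := by
    intro n
    refine (le_abs_self _).trans (mavg_ite_le R (fun D hD hDn => ?_) (by positivity))
    have h2 : |truncConv X y Y (fun A => reflDiff F Y A.natDegree) D| ≤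
        2 * rt F ^ (Y - 1 - n) * divWeight X D :=
      abs_truncConv_le_of (fun p hp hp1 _ => by
        rw [abs_of_nonneg (reflDiff_nonneg _ _)]
        have := natDegree_of_mem_dpairs hp
        exact reflDiff_le hp1 (by omega)) (by positivity)
    rw [abs_pow]
    refine (pow_le_pow_left₀ (abs_nonneg _) h2 2).trans_eq (by ring)
  rw [diag_eq, Finset.sum_range_add, add_mul]
  refine add_le_add ?_ ?_
  · refine (Finset.sum_le_sum fun n _ => h n).trans ?_
    rw [← Finset.sum_mul]
    refine mul_le_mul_of_nonneg_right ?_ hB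
    rw [Finset.sum_range_reflect (fun n => 4 * (rt F ^ n) ^ 2) Y]
    have h1 : ∀ n ∈ Finset.range Y, 4 * (rt F ^ n) ^ 2 ≤ 4 * (1 / 2 : ℝ) ^ n := fun n _ => by
      rw [← pow_mul, mul_comm n, pow_mul]
      have := pow_le_pow_left₀ (sq_nonneg _) (rt_sq_le (F := F)) n
      linarith
    refine (Finset.sum_le_sum h1).trans ?_
    rw [← Finset.mul_sum]
    have := sum_geometric_two_le Y
    linarith
  · have h1 : ∀ n ∈ Finset.range (y + 1), mavg (fun D => if IsCoprime D R then
      truncConv X y Y (fun A => reflDiff F Y A.natDegree) D ^ 2 else 0) (Y + n) ≤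
      4 * smoothBound F X ^ 3 := fun n _ => by
      have := h (Y + n)
      rwa [show Y - 1 - (Y + n) = 0 by omega, pow_zero, one_pow, mul_one] at this
    refine (Finset.sum_le_sum h1).trans_eq ?_
    rw [Finset.sum_const, Finset.card_range, nsmul_eq_mul]
    push_cast
    ring

open Classical in
/-- The primes that divide `R` and those of degree at most `X`. -/
def badPrimes (X : ℕ) (R : F[X]) : Finset F[X] := primesOf R ∪ primeSet F X

lemma isPrimePoly_of_mem_badPrimes {X : ℕ} {R P : F[X]} (h : P ∈ badPrimes X R) :
    IsPrimePoly P := by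
  classical
  rw [badPrimes, Finset.mem_union] at h
  exact h.elim isPrime_of_mem_primesOf fun h => (mem_primeSet.1 h).1

lemma avoids_badPrimes_iff {X : ℕ} {R D : F[X]} :
    Avoids (badPrimes X R) D ↔ Avoids (primesOf R) D ∧ IsRough X D := by
  classical
  constructor
  · refine fun h => ⟨fun P hP => h P (Finset.mem_union_left _ hP), fun P hP hd => ?_⟩
    by_contra! hx
    exact h P (Finset.mem_union_right _ (mem_primeSet.2 ⟨hP, hx⟩)) hd
  · intro h P hP hd
    rw [badPrimes, Finset.mem_union] at hP
    rcases hP with hP | hP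
    · exact h.1 P hP hd
    · obtain ⟨h1, h2⟩ := mem_primeSet.1 hP
      have := h.2 P h1 hd
      omega

lemma sum_dens_le_diag {R : F[X]} (hR : R.Monic) (X M : ℕ) :
    ∑ n ∈ Finset.range M, dens (badPrimes X R) n ≤ diag R (hadCoeff X) M := by
  classical
  rw [diag_eq]
  refine Finset.sum_le_sum fun n _ => ?_
  rw [dens, cnt_eq_sum, mavg]
  refine div_le_div_of_nonneg_right (Finset.sum_le_sum fun D hD => ?_) (card_pow_pos n).le
  have hDm := (mem_monics.1 hD).1
  by_cases h : Avoids (badPrimes X R) D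
  · have h' := avoids_badPrimes_iff.1 h
    rw [if_pos h, if_pos ((isCoprime_iff_avoids hR).2 h'.1), hadCoeff_eq_one_of_isRough hDm h'.2,
      one_pow]
  · rw [if_neg h]
    split_ifs
    · exact sq_nonneg _
    · exact le_rfl

lemma diag_le_sum_dens {R : F[X]} (hR : R.Monic) (X M : ℕ) :
    diag R (hadCoeff X) M ≤ ∑ n ∈ Finset.range M, dens (badPrimes X R) n +
      highPowerSum F X * ∑ n ∈ Finset.range M, dens (primesOf R) n := by
  classical
  have hp := sum_cnt_highPower_le (p := Avoids (primesOf R))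
    (fun A B h P hP hd => h P hP (hd.mul_left A)) X M
  refine le_trans ?_ (add_le_add_right hp _)
  rw [diag_eq, ← Finset.sum_add_distrib]
  refine Finset.sum_le_sum fun n _ => ?_
  rw [dens, cnt_eq_sum, cnt_eq_sum, mavg, ← add_div, ← Finset.sum_add_distrib]
  refine div_le_div_of_nonneg_right (Finset.sum_le_sum fun D hD => ?_) (card_pow_pos n).le
  have hDm := (mem_monics.1 hD).1
  have h0 := hadCoeff_nonneg X hDm
  have h1 := hadCoeff_le_one X hDm
  by_cases hc : IsCoprime D R
  · have hc' := (isCoprime_iff_avoids hR).1 hc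
    by_cases hr : IsRough X D
    · rw [if_pos hc, if_pos (avoids_badPrimes_iff.2 ⟨hc', hr⟩)]
      refine (pow_le_one₀ h0 h1).trans (le_add_of_nonneg_right ?_)
      split_ifs <;> norm_num
    · rw [if_pos hc, if_neg fun h => hr (avoids_badPrimes_iff.1 h).2]
      by_cases hz : hadCoeff X D = 0
      · rw [hz]
        split_ifs <;> norm_num
      · rw [if_pos ⟨hc', hasHighPower_of_hadCoeff_ne_zero hDm hz hr⟩]
        nlinarith
  · rw [if_neg hc]
    split_ifs <;> norm_num

/-- The bound for the error in counting monic polynomials without prime factors in a set of at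
most `q ^ t` primes. -/
def sieveErr (t : ℕ) : ℝ := Real.exp 2 * t * (2 * t)

lemma sieveErr_nonneg (t : ℕ) : 0 ≤ sieveErr t := by unfold sieveErr; positivity

lemma abs_sum_dens_sub_le_sieveErr {t : ℕ} (ht : 1 ≤ t) {S : Finset F[X]}
    (hS : ∀ P ∈ S, IsPrimePoly P) (hc : (S.card : ℝ) ≤ (Nat.card F : ℝ) ^ t) (M : ℕ) :
    |∑ n ∈ Finset.range M, dens S n - M * kap S| ≤ sieveErr t :=
  (abs_sum_dens_sub_le hS M).trans (mul_le_mul (prod_one_add_le ht hS hc)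
    (sum_natDegree_div_le ht hS hc) (Finset.sum_nonneg fun P _ =>
      div_nonneg (Nat.cast_nonneg _) (card_pow_pos _).le) (by positivity))

lemma card_primesOf_le_badPrimes (X : ℕ) (R : F[X]) :
    ((primesOf R).card : ℝ) ≤ (badPrimes X R).card := by
  classical
  exact_mod_cast Finset.card_le_card Finset.subset_union_left

lemma abs_diag_hadCoeff_sub_le {R : F[X]} (hR : R.Monic) {X t : ℕ} (ht : 1 ≤ t)
    (hc : ((badPrimes X R).card : ℝ) ≤ (Nat.card F : ℝ) ^ t) (M : ℕ) :
    |diag R (hadCoeff X) M - M * kap (badPrimes X R)| ≤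
      sieveErr t + highPowerSum F X * (M * kap (primesOf R) + sieveErr t) := by
  have h1 := abs_le.1 (abs_sum_dens_sub_le_sieveErr ht
    (fun P (hP : P ∈ badPrimes X R) => isPrimePoly_of_mem_badPrimes hP) hc M)
  have h2 := abs_le.1 (abs_sum_dens_sub_le_sieveErr ht
    (fun P (hP : P ∈ primesOf R) => isPrime_of_mem_primesOf hP)
    ((card_primesOf_le_badPrimes X R).trans hc) M)
  have h3 := sum_dens_le_diag hR X M
  have h4 := diag_le_sum_dens hR X M
  have h5 := highPowerSum_nonneg (F := F) X
  have h6 : highPowerSum F X * ∑ n ∈ Finset.range M, dens (primesOf R) n ≤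
      highPowerSum F X * (M * kap (primesOf R) + sieveErr t) :=
    mul_le_mul_of_nonneg_left (by linarith [h2.2]) h5
  have h7 : 0 ≤ ∑ n ∈ Finset.range M, dens (primesOf R) n :=
    Finset.sum_nonneg fun n _ => dens_nonneg _ n
  have h8 := mul_nonneg h5 h7
  rw [abs_le]
  constructor <;> linarith [h1.1, h1.2]

/-- The truncation at degree `y` of the Dirichlet polynomial of `1 / P_X` at `1 / 2`. -/
def invPoly {R : F[X]} (X y : ℕ) (χ : DirChar R) : ℂ :=
  dpoly (trunc (y + 1) (invCoeff X)) (y + 1) χ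

lemma dpoly_trunc {R : F[X]} (f : F[X] → ℝ) (M : ℕ) (χ : DirChar R) :
    dpoly (trunc M f) M χ =
      ∑ n ∈ Finset.range M, (∑ D ∈ monics F n, (f D : ℂ) * χ.val D) * (rt F : ℂ) ^ n := by
  rw [dpoly_eq]
  refine Finset.sum_congr rfl fun n hn => ?_
  congr 1
  refine Finset.sum_congr rfl fun D hD => ?_
  rw [trunc_of_lt f (by rw [(mem_monics.1 hD).2]; exact Finset.mem_range.1 hn)]

lemma dpoly_trunc_natDegree {R : F[X]} (g : ℕ → ℝ) (M : ℕ) (χ : DirChar R) :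
    dpoly (trunc M fun A => g A.natDegree) M χ =
      ∑ n ∈ Finset.range M, (g n : ℂ) * csum χ n * (rt F : ℂ) ^ n := by
  rw [dpoly_trunc]
  refine Finset.sum_congr rfl fun n hn => ?_
  rw [csum, Finset.mul_sum]
  congr 1
  refine Finset.sum_congr rfl fun D hD => ?_
  rw [(mem_monics.1 hD).2]

lemma dpoly_trunc_one {R : F[X]} (M : ℕ) (χ : DirChar R) :
    dpoly (trunc M fun _ => 1) M χ = ∑ n ∈ Finset.range M, csum χ n * (rt F : ℂ) ^ n := by
  rw [dpoly_trunc_natDegree (fun _ => 1)]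
  simp

lemma dpoly_trunc_mul_invPoly {R : F[X]} (g : F[X] → ℝ) (X y M : ℕ) (χ : DirChar R) :
    dpoly (trunc M g) M χ * invPoly X y χ = dpoly (truncConv X y M g) (M + (y + 1)) χ :=
  dpoly_mul (fun _ h => trunc_eq_zero _ h) (fun _ h => trunc_eq_zero _ h) χ

/-- The bound for the contribution of the off-diagonal terms. -/
def offDiagErr (R : F[X]) (y Y : ℕ) : ℝ :=
  6 * 16 ^ (primesOf R).card * ((Nat.card F : ℝ) ^ (y + 1)) ^ 3 / (Nat.card F : ℝ) ^ Y

lemma offDiagErr_nonneg (R : F[X]) (y Y : ℕ) : 0 ≤ offDiagErr R y Y := by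
  unfold offDiagErr; positivity

lemma abs_sq_qmean_sub_diag_le {R : F[X]} (hR : R.Monic) (h : ∃ χ : DirChar R, IsPrimitive χ)
    {X y Y M : ℕ} (hM : M + Y ≤ R.natDegree) {g : F[X] → ℝ} {C : ℝ}
    (hg : ∀ A : F[X], A.Monic → A.natDegree < M → |g A| ≤ C) (hC : 0 ≤ C) :
    |qmean R (fun χ => dpoly (trunc M g) M χ * invPoly X y χ) ^ 2 -
      diag R (truncConv X y M g) (M + (y + 1))| ≤ C ^ 2 * offDiagErr R y Y := by
  rw [sq_qmean hR]
  simp only [dpoly_trunc_mul_invPoly]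
  refine (abs_primAvg_sub_diag_le hR h (C := C * (Nat.card F : ℝ) ^ (y + 1))
    fun D _ _ => abs_truncConv_le_pow hg hC).trans ?_
  have h1 : (Nat.card F : ℝ) ^ (M + (y + 1)) / (Nat.card F : ℝ) ^ R.natDegree ≤
      (Nat.card F : ℝ) ^ (y + 1) / (Nat.card F : ℝ) ^ Y := by
    rw [div_le_div_iff₀ (card_pow_pos _) (card_pow_pos _), ← pow_add, ← pow_add]
    exact pow_le_pow_right₀ (by linarith [two_le_card (F := F)]) (by omega)
  refine (mul_le_mul_of_nonneg_left h1 (by positivity)).trans_eq ?_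
  rw [offDiagErr]
  ring

/-- The bound for the error in the mean square of the partial sums. -/
def partialErr (R : F[X]) (X y t Y : ℕ) : ℝ :=
  (2 * (th X ^ y)⁻¹ * R.natDegree + (y + 1)) * smoothBound F X ^ 3 +
    (sieveErr t + highPowerSum F X * (R.natDegree * kap (primesOf R) + sieveErr t)) +
    offDiagErr R y Y

lemma abs_sq_qmean_partial_sub_le {R : F[X]} (hR : R.Monic) (h : ∃ χ : DirChar R, IsPrimitive χ)
    {X y Y M t : ℕ} (hM : M + Y ≤ R.natDegree) (ht : 1 ≤ t)
    (hc : ((badPrimes X R).card : ℝ) ≤ (Nat.card F : ℝ) ^ t) :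
    |qmean R (fun χ => dpoly (trunc M fun _ => 1) M χ * invPoly X y χ) ^ 2 -
      M * kap (badPrimes X R)| ≤ partialErr R X y t Y := by
  have h1 := abs_sq_qmean_sub_diag_le hR h (X := X) (y := y) hM (g := fun _ => 1) (C := 1)
    (fun _ _ _ => by rw [abs_one]) zero_le_one
  have h2 := diag_truncConv_sub_le R X y M
  have h3 := abs_diag_hadCoeff_sub_le hR ht hc M
  have hMd : (M : ℝ) ≤ R.natDegree := by exact_mod_cast (by omega : M ≤ R.natDegree)
  have hB : 0 ≤ smoothBound F X ^ 3 := pow_nonneg (zero_le_one.trans (one_le_smoothBound X)) 3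
  have ht' : 0 < (th X ^ y)⁻¹ := inv_pos.2 (pow_pos (th_pos X) y)
  have h4 : (2 * (th X ^ y)⁻¹ * M + (y + 1)) * smoothBound F X ^ 3 ≤
      (2 * (th X ^ y)⁻¹ * R.natDegree + (y + 1)) * smoothBound F X ^ 3 := by gcongr
  have hk := (kap_pos (fun P (hP : P ∈ primesOf R) => isPrime_of_mem_primesOf hP)).le
  have hp := highPowerSum_nonneg (F := F) X
  have h5 : highPowerSum F X * (M * kap (primesOf R) + sieveErr t) ≤
      highPowerSum F X * (R.natDegree * kap (primesOf R) + sieveErr t) := by gcongr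
  rw [partialErr]
  rw [abs_le] at *
  constructor <;> linarith [h1.1, h1.2, h2.1, h2.2, h3.1, h3.2]

/-- The bound for the mean square of the difference of the partial sum and the reflected one. -/
def reflErr (R : F[X]) (X y Y : ℕ) : ℝ :=
  (8 + 4 * (y + 1)) * smoothBound F X ^ 3 + 4 * offDiagErr R y Y

lemma sq_qmean_reflDiff_le {R : F[X]} (hR : R.Monic) (h : ∃ χ : DirChar R, IsPrimitive χ)
    {X y Y : ℕ} (hY : Y + Y ≤ R.natDegree) :
    qmean R (fun χ => dpoly (trunc Y fun A => reflDiff F Y A.natDegree) Y χ * invPoly X y χ) ^ 2 ≤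
      reflErr R X y Y := by
  have h1 := abs_sq_qmean_sub_diag_le hR h (X := X) (y := y) hY
    (g := fun A => reflDiff F Y A.natDegree) (C := 2)
    (fun A _ hA => by
      rw [abs_of_nonneg (reflDiff_nonneg _ _)]
      refine (reflDiff_le hA le_rfl).trans ?_
      have := pow_le_one₀ (n := Y - 1 - A.natDegree) (rt_pos (F := F)).le rt_le_one
      linarith) zero_le_two
  have h2 := diag_truncConv_reflDiff_le R X y Y
  rw [reflErr]
  have := (abs_le.1 h1).2
  linarith

lemma qmean_norm (R : F[X]) (f : DirChar R → ℂ) :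
    qmean R (fun χ => (‖f χ‖ : ℂ)) = qmean R f := by
  simp [qmean]

lemma norm_L_sub_partial_le {R : F[X]} (hR : R.Monic) (hR1 : R ≠ 1) {χ : DirChar R}
    (hχ : IsPrimitive χ) {N Y : ℕ} (hN : N + Y = R.natDegree) :
    ‖L χ (1 / 2) - dpoly (trunc N fun _ => 1) N χ‖ ≤ ‖dpoly (trunc Y fun _ => 1) Y χ‖ +
      ‖dpoly (trunc Y fun A => reflDiff F Y A.natDegree) Y χ‖ := by
  have h := norm_sum_csum_eq hR hR1 hχ (N := N) (by omega)
  rw [show R.natDegree - N = Y by omega] at h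
  have e : L χ (1 / 2) - dpoly (trunc N fun _ => 1) N χ =
      ∑ n ∈ Finset.Ico N R.natDegree, csum χ n * (rt F : ℂ) ^ n := by
    rw [L_eq_sum hR hR1 hχ, zvar_half, dpoly_trunc_one, Finset.sum_Ico_eq_sub _ (by omega)]
  have e2 : ∑ j ∈ Finset.range Y, (reflCoeff F Y j : ℂ) * csum χ j * (rt F : ℂ) ^ j =
      dpoly (trunc Y fun _ => 1) Y χ -
        dpoly (trunc Y fun A => reflDiff F Y A.natDegree) Y χ := by
    rw [dpoly_trunc_one, dpoly_trunc_natDegree, ← Finset.sum_sub_distrib]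
    refine Finset.sum_congr rfl fun j _ => ?_
    rw [reflCoeff, reflDiff]
    push_cast
    ring
  rw [e]
  rcases h with h | h
  · rw [h, ← dpoly_trunc_one]
    exact le_add_of_nonneg_right (norm_nonneg _)
  · rw [h, e2]
    exact norm_sub_le _ _

lemma abs_qmean_L_sub_le {R : F[X]} (hR : R.Monic) (hR1 : R ≠ 1) {N Y : ℕ}
    (hN : N + Y = R.natDegree) (X y : ℕ) :
    |qmean R (fun χ => L χ (1 / 2) * invPoly X y χ) -
      qmean R (fun χ => dpoly (trunc N fun _ => 1) N χ * invPoly X y χ)| ≤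
    qmean R (fun χ => dpoly (trunc Y fun _ => 1) Y χ * invPoly X y χ) +
      qmean R (fun χ => dpoly (trunc Y fun A => reflDiff F Y A.natDegree) Y χ * invPoly X y χ) := by
  refine (abs_qmean_sub_le hR _ _).trans ?_
  rw [← qmean_norm R (fun χ => dpoly (trunc Y fun _ => 1) Y χ * invPoly X y χ),
    ← qmean_norm R (fun χ => dpoly (trunc Y fun A => reflDiff F Y A.natDegree) Y χ * invPoly X y χ)]
  refine le_trans (qmean_mono hR fun χ hχ => ?_) (qmean_add_le hR _ _)
  rw [← sub_mul, norm_mul, ← Complex.ofReal_add, Complex.norm_real,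
    Real.norm_of_nonneg (by positivity), norm_mul, norm_mul, ← add_mul]
  exact mul_le_mul_of_nonneg_right (norm_L_sub_partial_le hR hR1 hχ hN) (norm_nonneg _)

/-- A Dirichlet polynomial with coefficients `expConv l`, where `|l| ≤ vmLE X`, is close to its
Dirichlet series. -/
lemma norm_exp_sub_dpoly_le {R : F[X]} (hR : R.Monic) {X : ℕ} {l : F[X] → ℝ}
    (hl : ∀ A : F[X], |l A| ≤ vmLE X A) (y : ℕ) (χ : DirChar R) :
    ‖Complex.exp (∑ m ∈ Finset.range (X + 1),
        (∑ A ∈ monics F m, (l A : ℂ) * χ.val A) * (rt F : ℂ) ^ m / m) -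
      dpoly (trunc (y + 1) (expConv l)) (y + 1) χ‖ ≤ (th X ^ y)⁻¹ * halfBound F X := by
  have hr := rt_pos (F := F)
  have hth := th_pos X
  have hl1 : l 1 = 0 := by
    have := hl 1
    rwa [vmLE_one, abs_nonpos_iff] at this
  have hlX : ∀ A : F[X], X < A.natDegree → l A = 0 := fun A hA => by
    have := hl A
    rwa [vmLE, if_neg (by omega), abs_nonpos_iff] at this
  have h := hasSum_expConv hl1 hlX (χ := χ.val) (val_mul χ) (val_one χ) (rt F : ℂ)
  rw [dpoly_trunc]
  have h1 := (hasSum_nat_add_iff' (y + 1)).2 h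
  have h2 := (hasSum_halfBound (F := F) X).mul_left (th X ^ y)⁻¹
  have h2' : ∀ n, 0 ≤ (th X ^ y)⁻¹ *
      (cnt (FactorsIn (primeSet F X)) n * (th X * rt F) ^ n) := fun n =>
    mul_nonneg (by positivity) (mul_nonneg (cnt_nonneg _ _) (by positivity))
  have h3 : Summable fun n => (th X ^ y)⁻¹ *
      (cnt (FactorsIn (primeSet F X)) (n + (y + 1)) * (th X * rt F) ^ (n + (y + 1))) :=
    (summable_nat_add_iff (y + 1)).2 h2.summable
  have h4 : ∑' n, (th X ^ y)⁻¹ *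
      (cnt (FactorsIn (primeSet F X)) (n + (y + 1)) * (th X * rt F) ^ (n + (y + 1))) ≤
      (th X ^ y)⁻¹ * halfBound F X := by
    rw [← h2.tsum_eq, ← h2.summable.sum_add_tsum_nat_add (y + 1)]
    exact le_add_of_nonneg_left (Finset.sum_nonneg fun n _ => h2' n)
  refine le_trans ?_ h4
  rw [← h1.tsum_eq]
  refine tsum_of_norm_bounded h3.hasSum fun n => ?_
  rw [norm_mul, norm_pow, Complex.norm_real, Real.norm_of_nonneg hr.le, mul_pow]
  have h5 : ‖∑ D ∈ monics F (n + (y + 1)), (expConv l D : ℂ) * χ.val D‖ ≤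
      cnt (FactorsIn (primeSet F X)) (n + (y + 1)) := by
    refine (norm_sum_le _ _).trans (le_trans (Finset.sum_le_sum fun D hD => ?_)
      (sum_eulerCoeff_le_cnt X _))
    rw [norm_mul, Complex.norm_real, Real.norm_eq_abs]
    have h6 := abs_expConv_le (vmLE_one X) hl (mem_monics.1 hD).1
    have h7 := norm_val_le hR χ D
    calc _ ≤ eulerCoeff X D * 1 := mul_le_mul h6 h7 (norm_nonneg _)
          (eulerCoeff_nonneg X (mem_monics.1 hD).1)
      _ = _ := mul_one _
  have h8 : 1 ≤ (th X ^ y)⁻¹ * th X ^ (n + (y + 1)) := by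
    rw [← div_eq_inv_mul, one_le_div (by positivity)]
    exact pow_le_pow_right₀ (one_le_th X) (by omega)
  have h9 : 0 ≤ cnt (FactorsIn (primeSet F X)) (n + (y + 1)) * rt F ^ (n + (y + 1)) :=
    mul_nonneg (cnt_nonneg _ _) (by positivity)
  calc _ ≤ cnt (FactorsIn (primeSet F X)) (n + (y + 1)) * rt F ^ (n + (y + 1)) :=
        mul_le_mul_of_nonneg_right h5 (by positivity)
    _ ≤ ((th X ^ y)⁻¹ * th X ^ (n + (y + 1))) *
        (cnt (FactorsIn (primeSet F X)) (n + (y + 1)) * rt F ^ (n + (y + 1))) :=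
        le_mul_of_one_le_left h9 h8
    _ = _ := by ring

lemma sum_vmLE_eq {R : F[X]} (X : ℕ) (χ : DirChar R) {m : ℕ} (hm : m ∈ Finset.range (X + 1)) :
    ∑ A ∈ monics F m, (vmLE X A : ℂ) * χ.val A = lamSum χ m := by
  refine Finset.sum_congr rfl fun A hA => ?_
  rw [vmLE, if_pos]
  rw [(mem_monics.1 hA).2]
  have := Finset.mem_range.1 hm
  omega

lemma norm_inv_eulerPart_sub_invPoly_le {R : F[X]} (hR : R.Monic) (X y : ℕ) (χ : DirChar R) :
    ‖(eulerPart X χ (1 / 2))⁻¹ - invPoly X y χ‖ ≤ (th X ^ y)⁻¹ * halfBound F X := by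
  have h := norm_exp_sub_dpoly_le hR (X := X) (l := fun A => -vmLE X A)
    (fun A => by rw [abs_neg, abs_of_nonneg (vmLE_nonneg X A)]) y χ
  have e : (eulerPart X χ (1 / 2))⁻¹ = Complex.exp (∑ m ∈ Finset.range (X + 1),
      (∑ A ∈ monics F m, ((-vmLE X A : ℝ) : ℂ) * χ.val A) * (rt F : ℂ) ^ m / m) := by
    rw [eulerPart_eq, ← Complex.exp_neg, zvar_half, ← Finset.sum_neg_distrib]
    congr 1
    refine Finset.sum_congr rfl fun m hm => ?_
    rw [← sum_vmLE_eq X χ hm]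
    simp only [Complex.ofReal_neg, neg_mul, Finset.sum_neg_distrib]
    ring
  rw [e]
  exact h

lemma norm_eulerPart_sub_dpoly_le {R : F[X]} (hR : R.Monic) (X y : ℕ) (χ : DirChar R) :
    ‖eulerPart X χ (1 / 2) - dpoly (trunc (y + 1) (eulerCoeff X)) (y + 1) χ‖ ≤
      (th X ^ y)⁻¹ * halfBound F X := by
  have h := norm_exp_sub_dpoly_le hR (X := X) (l := vmLE X)
    (fun A => by rw [abs_of_nonneg (vmLE_nonneg X A)]) y χ
  have e : eulerPart X χ (1 / 2) = Complex.exp (∑ m ∈ Finset.range (X + 1),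
      (∑ A ∈ monics F m, (vmLE X A : ℂ) * χ.val A) * (rt F : ℂ) ^ m / m) := by
    rw [eulerPart_eq, zvar_half]
    congr 1
    refine Finset.sum_congr rfl fun m hm => ?_
    rw [← sum_vmLE_eq X χ hm]
  rw [e]
  exact h

lemma abs_qmean_L_mul_inv_eulerPart_sub_le {R : F[X]} (hR : R.Monic) (X y : ℕ) :
    |qmean R (fun χ => L χ (1 / 2) * (eulerPart X χ (1 / 2))⁻¹) -
      qmean R (fun χ => L χ (1 / 2) * invPoly X y χ)| ≤
      (th X ^ y)⁻¹ * halfBound F X * qmean R (fun χ => L χ (1 / 2)) := by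
  refine (abs_qmean_sub_le hR _ _).trans ?_
  simp only [← mul_sub]
  refine qmean_mul_le hR ?_ fun χ _ => norm_inv_eulerPart_sub_invPoly_le hR X y χ
  exact (norm_nonneg _).trans (norm_inv_eulerPart_sub_invPoly_le hR X y 1)

/-- A number of size `log d`: at most `q ^ logSize` primes divide `R` or have degree at most `X`. -/
def logSize (F : Type*) [Field F] (d : ℕ) : ℕ := ⌈Real.logb (Nat.card F) d⌉₊ + 2

/-- A number of size `√d`. -/
def sqrtSize (d : ℕ) : ℕ := 200 * (Nat.sqrt d + 1)

/-- The degree at which the Dirichlet polynomials of `P_X` and `1 / P_X` are truncated. -/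
def cutoff (F : Type*) [Field F] (d : ℕ) : ℕ := 2 * logSize F d * sqrtSize d

/-- The length of the dual sum. -/
def dualLength (R : F[X]) : ℕ := 4 * (primesOf R).card + 3 * (cutoff F R.natDegree + 1)

lemma tendsto_logSize_pow_div (F : Type*) [Field F] [Finite F] (k : ℕ) :
    Tendsto (fun d : ℕ => (logSize F d : ℝ) ^ k / Real.sqrt d) atTop (𝓝 0) := by
  have hq := two_le_card (F := F)
  have hlog2 : (1 / 2 : ℝ) ≤ Real.log 2 := by linarith [Real.log_two_gt_d9]
  have h1 : ∀ᶠ d : ℕ in atTop, (logSize F d : ℝ) ≤ 5 * Real.log d := by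
    have h := Real.tendsto_log_atTop.comp (tendsto_natCast_atTop_atTop (R := ℝ))
    filter_upwards [h.eventually_ge_atTop 1, eventually_ge_atTop 1] with d hd hd1
    simp only [Function.comp] at hd
    have hl : Real.logb (Nat.card F) d ≤ 2 * Real.log d := by
      have h2 : Real.log 2 ≤ Real.log (Nat.card F) := Real.log_le_log (by norm_num) hq
      rw [Real.logb, div_le_iff₀ (by linarith)]
      nlinarith
    have h0 : 0 ≤ Real.logb (Nat.card F) d :=
      Real.logb_nonneg (by linarith) (by exact_mod_cast hd1)
    have h3 := Nat.ceil_lt_add_one h0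
    rw [logSize]
    push_cast
    linarith
  have h2 : Tendsto (fun d : ℕ => (5 : ℝ) ^ k * (Real.log d ^ k / Real.sqrt d)) atTop (𝓝 0) := by
    rw [← mul_zero ((5 : ℝ) ^ k)]
    refine Tendsto.const_mul _ ?_
    have h := (Real.isLittleO_pow_log_id_atTop (n := 2 * k)).tendsto_div_nhds_zero.comp
      (tendsto_natCast_atTop_atTop (R := ℝ))
    have h' := (Real.continuous_sqrt.tendsto 0).comp h
    rw [Real.sqrt_zero] at h'
    refine h'.congr' ?_
    filter_upwards [eventually_ge_atTop 1] with d hd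
    simp only [Function.comp, id]
    have : 0 ≤ Real.log d := Real.log_natCast_nonneg d
    rw [Real.sqrt_div (by positivity), mul_comm 2 k, pow_mul, Real.sqrt_sq (by positivity)]
  refine squeeze_zero' (Eventually.of_forall fun d => by positivity) ?_ h2
  filter_upwards [h1] with d hd
  rw [← mul_div_assoc, ← mul_pow]
  gcongr

lemma sqrt_le_natSqrt_succ (d : ℕ) : Real.sqrt d ≤ Nat.sqrt d + 1 := by
  rw [Real.sqrt_le_left (by positivity)]
  exact_mod_cast (Nat.lt_succ_sqrt' d).le

lemma natSqrt_le_sqrt (d : ℕ) : (Nat.sqrt d : ℝ) ≤ Real.sqrt d := Real.nat_sqrt_le_real_sqrt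

lemma sqrtSize_le {d : ℕ} (hd : 1 ≤ d) : (sqrtSize d : ℝ) ≤ 400 * Real.sqrt d := by
  have h1 : 1 ≤ Real.sqrt d := Real.one_le_sqrt.2 (by exact_mod_cast hd)
  have h2 := natSqrt_le_sqrt d
  rw [sqrtSize]
  push_cast
  linarith

section Bounds

variable {X : ℕ} {R : F[X]} (hR : R.Monic) (hd : 1 ≤ R.natDegree)
  (hX : (X : ℝ) ≤ Real.logb (Nat.card F) R.natDegree)

include hd in
lemma natDegree_le_pow : (R.natDegree : ℝ) ≤ (Nat.card F : ℝ) ^ ⌈Real.logb (Nat.card F) R.natDegree⌉₊ := by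
  have hq := two_le_card (F := F)
  have hd' : (0 : ℝ) < R.natDegree := by exact_mod_cast hd
  rw [← Real.rpow_natCast, ← Real.logb_le_iff_le_rpow (by linarith) hd']
  exact Nat.le_ceil _

include hX in
lemma le_ceil_logb : X ≤ ⌈Real.logb (Nat.card F) R.natDegree⌉₊ := by
  exact_mod_cast hX.trans (Nat.le_ceil _)

include hX in
lemma succ_le_logSize : X + 1 ≤ logSize F R.natDegree := by
  have := le_ceil_logb hX
  rw [logSize]; omega

lemma one_le_logSize (d : ℕ) : 1 ≤ logSize F d := by rw [logSize]; omega

include hR in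
lemma card_primesOf_le : (primesOf R).card ≤ R.natDegree := by
  refine le_trans ?_ (sum_natDegree_primesOf_le hR)
  rw [Finset.card_eq_sum_ones]
  exact Finset.sum_le_sum fun P hP => (isPrime_of_mem_primesOf hP).natDegree_pos

include hR hd hX in
lemma card_badPrimes_le :
    ((badPrimes X R).card : ℝ) ≤ (Nat.card F : ℝ) ^ logSize F R.natDegree := by
  classical
  have hq := two_le_card (F := F)
  have h1 : ((badPrimes X R).card : ℝ) ≤ (primesOf R).card + (primeSet F X).card := by
    rw [badPrimes]
    exact_mod_cast Finset.card_union_le _ _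
  have h2 : ((primesOf R).card : ℝ) ≤ R.natDegree := by exact_mod_cast card_primesOf_le hR
  have h3 := natDegree_le_pow hd
  have h4 := card_primeSet_le (F := F) X
  have h5 : (Nat.card F : ℝ) ^ (X + 1) ≤
      (Nat.card F : ℝ) ^ (⌈Real.logb (Nat.card F) R.natDegree⌉₊ + 1) :=
    pow_le_pow_right₀ (by linarith) (by have := le_ceil_logb hX; omega)
  rw [logSize, pow_add]
  rw [pow_succ _ ⌈_⌉₊] at h5
  have h6 := card_pow_pos (F := F) ⌈Real.logb (Nat.card F) R.natDegree⌉₊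
  have h7 : (0 : ℝ) ≤ (Nat.card F : ℝ) ^ 2 - Nat.card F - 1 := by nlinarith
  have h8 := mul_nonneg h6.le h7
  nlinarith

include hR hd hX in
lemma le_kap_badPrimes : Real.exp (-4) / (logSize F R.natDegree : ℝ) ^ 2 ≤ kap (badPrimes X R) :=
  le_kap (one_le_logSize _) (fun P hP => isPrimePoly_of_mem_badPrimes hP)
    (card_badPrimes_le hR hd hX)

lemma kap_badPrimes_pos : 0 < kap (badPrimes X R) :=
  kap_pos fun P hP => isPrimePoly_of_mem_badPrimes hP

include hR hd hX in
/-- Quantities that are small in comparison with `d * kap (badPrimes X R)`. -/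
lemma div_main_le {x c : ℝ} (hc : 0 ≤ c)
    (h : x ≤ c * (logSize F R.natDegree : ℝ) ^ 26 * Real.sqrt R.natDegree) :
    x / (R.natDegree * kap (badPrimes X R)) ≤
      c * Real.exp 4 * ((logSize F R.natDegree : ℝ) ^ 28 / Real.sqrt R.natDegree) := by
  have hd' : (0 : ℝ) < R.natDegree := by exact_mod_cast hd
  have hs := Real.sqrt_pos.2 hd'
  have ht : (0 : ℝ) < logSize F R.natDegree := by exact_mod_cast one_le_logSize (F := F) R.natDegree
  have hk := le_kap_badPrimes hR hd hX
  have hk0 := kap_badPrimes_pos (X := X) (R := R)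
  rw [div_le_iff₀ (by positivity)]
  refine h.trans ?_
  have e1 : c * (logSize F R.natDegree : ℝ) ^ 26 * Real.sqrt R.natDegree =
      c * Real.exp 4 * ((logSize F R.natDegree : ℝ) ^ 28 / Real.sqrt R.natDegree) *
        (R.natDegree * (Real.exp (-4) / (logSize F R.natDegree : ℝ) ^ 2)) := by
    rw [Real.exp_neg]
    have e2 := Real.mul_self_sqrt hd'.le
    generalize Real.sqrt R.natDegree = s at *
    rw [← e2]
    field_simp
  rw [e1]
  gcongr

include hX in
lemma two_pow_le_th_pow : (2 : ℝ) ^ sqrtSize R.natDegree ≤ th X ^ cutoff F R.natDegree := by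
  rw [← th_pow X, ← pow_mul]
  refine pow_le_pow_right₀ (one_le_th X) ?_
  rw [cutoff]
  exact Nat.mul_le_mul_right _ (Nat.mul_le_mul_left _ (succ_le_logSize hX))

include hd hX in
lemma th_pow_inv_mul_exp_le :
    (th X ^ cutoff F R.natDegree)⁻¹ * Real.exp (64 * Real.sqrt R.natDegree) ≤
      1 / Real.sqrt R.natDegree := by
  have hd' : (0 : ℝ) < R.natDegree := by exact_mod_cast hd
  have hs := Real.sqrt_pos.2 hd'
  have h1 := two_pow_le_th_pow hX
  have h2 := sqrt_le_natSqrt_succ R.natDegree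
  set m := Nat.sqrt R.natDegree + 1 with hm
  have h2' : Real.sqrt R.natDegree ≤ (m : ℝ) := by rw [hm]; push_cast; exact h2
  have h3 : Real.exp (64 * Real.sqrt R.natDegree) ≤ (2 : ℝ) ^ (128 * m) := by
    have e : Real.exp 1 ≤ 2 ^ 2 := by linarith [Real.exp_one_lt_d9]
    calc Real.exp (64 * Real.sqrt R.natDegree) ≤ Real.exp ((64 * m : ℕ) * 1) := by
          refine Real.exp_le_exp.2 ?_
          push_cast
          linarith
      _ = Real.exp 1 ^ (64 * m) := Real.exp_nat_mul _ _
      _ ≤ (2 ^ 2) ^ (64 * m) := pow_le_pow_left₀ (Real.exp_pos _).le e _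
      _ = _ := by rw [← pow_mul]; congr 1; ring
  have h4 : Real.sqrt R.natDegree * (2 : ℝ) ^ (128 * m) ≤ (2 : ℝ) ^ sqrtSize R.natDegree := by
    have h5 : Real.sqrt R.natDegree ≤ (2 : ℝ) ^ (72 * m) := by
      refine h2'.trans ?_
      have h6 : (m : ℝ) ≤ 2 ^ m := by exact_mod_cast Nat.lt_two_pow_self.le
      exact h6.trans (pow_le_pow_right₀ one_le_two (by omega))
    calc _ ≤ (2 : ℝ) ^ (72 * m) * (2 : ℝ) ^ (128 * m) := by gcongr
      _ = _ := by rw [← pow_add, sqrtSize]; congr 1; omega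
  rw [← div_eq_inv_mul, div_le_div_iff₀ (pow_pos (th_pos X) _) hs, one_mul]
  calc _ ≤ (2 : ℝ) ^ (128 * m) * Real.sqrt R.natDegree := by gcongr
    _ ≤ _ := by rw [mul_comm]; exact h4.trans h1

include hd hX in
lemma th_pow_inv_le : (th X ^ cutoff F R.natDegree)⁻¹ ≤ 1 / Real.sqrt R.natDegree := by
  refine le_trans ?_ (th_pow_inv_mul_exp_le hd hX)
  have := th_pos X
  exact le_mul_of_one_le_right (by positivity) (Real.one_le_exp (by positivity))

include hd hX in
lemma th_pow_inv_mul_halfBound_le :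
    (th X ^ cutoff F R.natDegree)⁻¹ * halfBound F X ≤ 1 / Real.sqrt R.natDegree := by
  refine le_trans ?_ (th_pow_inv_mul_exp_le hd hX)
  have hth := th_pos X
  have hr := rt_pos (F := F)
  have hq := two_le_card (F := F)
  have hd' : (0 : ℝ) < R.natDegree := by exact_mod_cast hd
  refine mul_le_mul_of_nonneg_left ((halfBound_le X).trans (Real.exp_le_exp.2 ?_)) (by positivity)
  refine mul_le_mul_of_nonneg_left ?_ (by norm_num)
  refine Real.le_sqrt_of_sq_le ?_
  rw [← pow_mul, mul_comm X 2, pow_mul, inv_pow, rt_sq, inv_inv, ← Real.rpow_natCast]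
  exact (Real.le_logb_iff_rpow_le (by linarith) hd').1 hX

include hX in
lemma smoothBound_le_logSize :
    smoothBound F X ≤ Real.exp 16 * (logSize F R.natDegree : ℝ) ^ 8 := by
  refine (smoothBound_le X).trans ?_
  have : (X : ℝ) + 1 ≤ logSize F R.natDegree := by exact_mod_cast succ_le_logSize hX
  gcongr

include hX in
lemma smoothBound_cube_le :
    smoothBound F X ^ 3 ≤ Real.exp 48 * (logSize F R.natDegree : ℝ) ^ 24 := by
  have h0 : 0 ≤ smoothBound F X := zero_le_one.trans (one_le_smoothBound X)
  refine (pow_le_pow_left₀ h0 (smoothBound_le_logSize hX) 3).trans_eq ?_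
  rw [mul_pow, ← pow_mul, ← Real.exp_nat_mul]
  norm_num

lemma cutoff_succ_le {d : ℕ} (hd : 1 ≤ d) :
    (cutoff F d : ℝ) + 1 ≤ 801 * logSize F d * Real.sqrt d := by
  have h1 : 1 ≤ Real.sqrt d := Real.one_le_sqrt.2 (by exact_mod_cast hd)
  have h2 := sqrtSize_le hd
  have ht : (1 : ℝ) ≤ logSize F d := by exact_mod_cast one_le_logSize (F := F) d
  rw [cutoff]
  push_cast
  have h3 := mul_le_mul_of_nonneg_left h2 (by linarith : (0 : ℝ) ≤ 2 * logSize F d)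
  have h4 := one_le_mul_of_one_le_of_one_le ht h1
  linarith

lemma offDiagErr_le : offDiagErr R (cutoff F R.natDegree) (dualLength R) ≤ 6 := by
  have hq := two_le_card (F := F)
  have e : (Nat.card F : ℝ) ^ dualLength R = ((Nat.card F : ℝ) ^ 4) ^ (primesOf R).card *
      ((Nat.card F : ℝ) ^ (cutoff F R.natDegree + 1)) ^ 3 := by
    rw [← pow_mul, ← pow_mul, ← pow_add, dualLength]
    congr 1
    ring
  have h16 : (16 : ℝ) ≤ (Nat.card F : ℝ) ^ 4 :=
    le_trans (by norm_num) (pow_le_pow_left₀ zero_le_two hq 4)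
  rw [offDiagErr, div_le_iff₀ (card_pow_pos _), e, ← mul_assoc]
  gcongr

include hd hX in
lemma cutoff_mul_smoothBound_le :
    (cutoff F R.natDegree + 1) * smoothBound F X ^ 3 ≤
      801 * Real.exp 48 * (logSize F R.natDegree : ℝ) ^ 26 * Real.sqrt R.natDegree := by
  have h0 : 0 ≤ smoothBound F X := zero_le_one.trans (one_le_smoothBound X)
  have ht : (1 : ℝ) ≤ logSize F R.natDegree := by exact_mod_cast one_le_logSize (F := F) R.natDegree
  calc _ ≤ (801 * logSize F R.natDegree * Real.sqrt R.natDegree) *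
        (Real.exp 48 * (logSize F R.natDegree : ℝ) ^ 24) :=
        mul_le_mul (cutoff_succ_le hd) (smoothBound_cube_le hX) (by positivity) (by positivity)
    _ = 801 * Real.exp 48 * (logSize F R.natDegree : ℝ) ^ 25 * Real.sqrt R.natDegree := by ring
    _ ≤ _ := by
        gcongr
        · norm_num

lemma one_le_logSize_mul {d : ℕ} (hd : 1 ≤ d) (k : ℕ) :
    1 ≤ (logSize F d : ℝ) ^ k * Real.sqrt d := by
  have h1 : 1 ≤ Real.sqrt d := Real.one_le_sqrt.2 (by exact_mod_cast hd)
  have ht : (1 : ℝ) ≤ logSize F d := by exact_mod_cast one_le_logSize (F := F) d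
  exact one_le_mul_of_one_le_of_one_le (one_le_pow₀ ht) h1

include hd in
lemma sieveErr_le : sieveErr (logSize F R.natDegree) ≤
    2 * Real.exp 2 * (logSize F R.natDegree : ℝ) ^ 26 * Real.sqrt R.natDegree := by
  have h1 : 1 ≤ Real.sqrt R.natDegree := Real.one_le_sqrt.2 (by exact_mod_cast hd)
  have ht : (1 : ℝ) ≤ logSize F R.natDegree := by exact_mod_cast one_le_logSize (F := F) R.natDegree
  have h2 : (logSize F R.natDegree : ℝ) ^ 2 ≤ (logSize F R.natDegree : ℝ) ^ 26 :=
    pow_le_pow_right₀ ht (by norm_num)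
  calc sieveErr (logSize F R.natDegree) = 2 * Real.exp 2 * (logSize F R.natDegree : ℝ) ^ 2 := by
        rw [sieveErr]; ring
    _ ≤ 2 * Real.exp 2 * (logSize F R.natDegree : ℝ) ^ 26 := by gcongr
    _ ≤ _ := le_mul_of_one_le_right (by positivity) h1

include hR hd hX in
lemma reflErr_div_le :
    reflErr R X (cutoff F R.natDegree) (dualLength R) / (R.natDegree * kap (badPrimes X R)) ≤
      (9612 * Real.exp 48 + 24) * Real.exp 4 *
        ((logSize F R.natDegree : ℝ) ^ 28 / Real.sqrt R.natDegree) := by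
  refine div_main_le hR hd hX (by positivity) ?_
  have h1 := cutoff_mul_smoothBound_le hd hX
  have h2 := offDiagErr_le (R := R)
  have h3 := one_le_logSize_mul (F := F) hd 26
  have h4 : 0 ≤ smoothBound F X ^ 3 := pow_nonneg (zero_le_one.trans (one_le_smoothBound X)) 3
  have h5 : smoothBound F X ^ 3 ≤ (cutoff F R.natDegree + 1) * smoothBound F X ^ 3 :=
    le_mul_of_one_le_left h4 (by linarith [(Nat.cast_nonneg (cutoff F R.natDegree) : (0 : ℝ) ≤ _)])
  rw [reflErr]
  linarith

open Classical in
lemma kap_primesOf_mul_le : kap (primesOf R) * kap (primeSet F X) ≤ kap (badPrimes X R) := by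
  have hp1 : ∀ P ∈ primesOf R, IsPrimePoly P := fun P hP => isPrime_of_mem_primesOf hP
  have hp2 : ∀ P ∈ primeSet F X, IsPrimePoly P := fun P hP => (mem_primeSet.1 hP).1
  have e : kap (badPrimes X R) = kap (primesOf R) * kap (primeSet F X \ primesOf R) := by
    rw [badPrimes, ← Finset.union_sdiff_self_eq_union, kap, Finset.prod_union Finset.disjoint_sdiff]
    rfl
  have e2 : kap (primeSet F X) = kap (primeSet F X \ primesOf R) * kap (primeSet F X ∩ primesOf R) := by
    conv_lhs => rw [← Finset.sdiff_union_inter (primeSet F X) (primesOf R)]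
    rw [kap, Finset.prod_union (Finset.disjoint_sdiff_inter _ _)]
    rfl
  have h1 := kap_pos hp1
  have h2 := kap_pos (S := primeSet F X \ primesOf R) fun P hP => hp2 P (Finset.mem_sdiff.1 hP).1
  have h3 := kap_le_one (S := primeSet F X ∩ primesOf R) fun P hP => hp2 P (Finset.mem_inter.1 hP).1
  rw [e, e2]
  exact mul_le_mul_of_nonneg_left (mul_le_of_le_one_right h2.le h3) h1.le

include hR hd hX in
lemma partialErr_div_le :
    partialErr R X (cutoff F R.natDegree) (logSize F R.natDegree) (dualLength R) /
        (R.natDegree * kap (badPrimes X R)) ≤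
      1000 * Real.exp 52 * ((logSize F R.natDegree : ℝ) ^ 28 / Real.sqrt R.natDegree) +
        highPowerSum F X / kap (primeSet F X) * (1 + 1000 * Real.exp 52 *
          ((logSize F R.natDegree : ℝ) ^ 28 / Real.sqrt R.natDegree)) := by
  have hd' : (0 : ℝ) < R.natDegree := by exact_mod_cast hd
  have hs := Real.sqrt_pos.2 hd'
  have ht : (1 : ℝ) ≤ logSize F R.natDegree := by exact_mod_cast one_le_logSize (F := F) R.natDegree
  have hk0 := kap_badPrimes_pos (X := X) (R := R)
  have hkX := kap_pos (S := primeSet F X) fun P hP => (mem_primeSet.1 hP).1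
  have hkX1 := kap_le_one (S := primeSet F X) fun P hP => (mem_primeSet.1 hP).1
  have hkR := kap_pos (S := primesOf R) fun P hP => isPrime_of_mem_primesOf hP
  have hh := highPowerSum_nonneg (F := F) X
  set W := (logSize F R.natDegree : ℝ) ^ 28 / Real.sqrt R.natDegree with hW
  have hW0 : 0 ≤ W := by positivity
  have hexp : Real.exp 52 = Real.exp 48 * Real.exp 4 := by rw [← Real.exp_add]; norm_num
  have hexp2 : Real.exp 2 ≤ Real.exp 48 := Real.exp_le_exp.2 (by norm_num)
  have hexp3 : 1 ≤ Real.exp 48 := Real.one_le_exp (by norm_num)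
  have hsieve := sieveErr_le (R := R) hd
  have hLS : 0 ≤ (logSize F R.natDegree : ℝ) ^ 26 * Real.sqrt R.natDegree := by positivity
  have h1 : ((2 * (th X ^ cutoff F R.natDegree)⁻¹ * R.natDegree + (cutoff F R.natDegree + 1)) *
      smoothBound F X ^ 3 + sieveErr (logSize F R.natDegree) +
      offDiagErr R (cutoff F R.natDegree) (dualLength R)) / (R.natDegree * kap (badPrimes X R)) ≤
      1000 * Real.exp 48 * Real.exp 4 * W := by
    refine div_main_le hR hd hX (by positivity) ?_
    have a1 := cutoff_mul_smoothBound_le hd hX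
    have a2 := offDiagErr_le (R := R)
    have a3 := one_le_logSize_mul (F := F) hd 26
    have a4 : 2 * (th X ^ cutoff F R.natDegree)⁻¹ * R.natDegree * smoothBound F X ^ 3 ≤
        2 * Real.exp 48 * ((logSize F R.natDegree : ℝ) ^ 26 * Real.sqrt R.natDegree) := by
      have b1 := th_pow_inv_le hd hX
      have b2 : (th X ^ cutoff F R.natDegree)⁻¹ * R.natDegree ≤ Real.sqrt R.natDegree := by
        calc _ ≤ 1 / Real.sqrt R.natDegree * R.natDegree := by gcongr
          _ = Real.sqrt R.natDegree := by
            rw [one_div_mul_eq_div, Real.div_sqrt]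
      have b3 : smoothBound F X ^ 3 ≤ Real.exp 48 * (logSize F R.natDegree : ℝ) ^ 26 :=
        (smoothBound_cube_le hX).trans (by gcongr; norm_num)
      have b4 : 0 ≤ smoothBound F X ^ 3 := pow_nonneg (zero_le_one.trans (one_le_smoothBound X)) 3
      calc _ = 2 * ((th X ^ cutoff F R.natDegree)⁻¹ * R.natDegree * smoothBound F X ^ 3) := by ring
        _ ≤ 2 * (Real.sqrt R.natDegree * (Real.exp 48 * (logSize F R.natDegree : ℝ) ^ 26)) := by
            gcongr
        _ = _ := by ring
    rw [mul_assoc (801 * Real.exp 48)] at a1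
    rw [mul_assoc (2 * Real.exp 2)] at hsieve
    rw [mul_assoc (1000 * Real.exp 48), add_mul]
    have a5 := mul_le_mul_of_nonneg_right hexp2 hLS
    have a6 := mul_le_mul_of_nonneg_right hexp3 hLS
    linarith
  have h2 : sieveErr (logSize F R.natDegree) / (R.natDegree * kap (badPrimes X R)) ≤
      1000 * Real.exp 48 * Real.exp 4 * W := by
    refine div_main_le hR hd hX (by positivity) (hsieve.trans ?_)
    rw [mul_assoc (2 * Real.exp 2), mul_assoc (1000 * Real.exp 48)]
    exact mul_le_mul_of_nonneg_right (by linarith) hLS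
  have h3 : highPowerSum F X * (R.natDegree * kap (primesOf R)) / (R.natDegree * kap (badPrimes X R)) ≤
      highPowerSum F X / kap (primeSet F X) := by
    rw [div_le_div_iff₀ (by positivity) hkX]
    have := mul_le_mul_of_nonneg_left (kap_primesOf_mul_le (X := X) (R := R))
      (mul_nonneg hh hd'.le)
    linarith
  have h4 : highPowerSum F X ≤ highPowerSum F X / kap (primeSet F X) :=
    le_div_self hh hkX hkX1
  have h5 : highPowerSum F X * (sieveErr (logSize F R.natDegree) / (R.natDegree * kap (badPrimes X R))) ≤
      highPowerSum F X / kap (primeSet F X) * (1000 * Real.exp 48 * Real.exp 4 * W) :=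
    mul_le_mul h4 h2 (div_nonneg (sieveErr_nonneg _) (by positivity)) (by positivity)
  rw [hexp]
  calc _ = ((2 * (th X ^ cutoff F R.natDegree)⁻¹ * R.natDegree + (cutoff F R.natDegree + 1)) *
      smoothBound F X ^ 3 + sieveErr (logSize F R.natDegree) +
      offDiagErr R (cutoff F R.natDegree) (dualLength R)) / (R.natDegree * kap (badPrimes X R)) +
      (highPowerSum F X * (R.natDegree * kap (primesOf R)) / (R.natDegree * kap (badPrimes X R)) +
      highPowerSum F X * (sieveErr (logSize F R.natDegree) / (R.natDegree * kap (badPrimes X R)))) := by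
        rw [partialErr]; ring
    _ ≤ _ := by rw [mul_add, mul_one]; linarith

end Bounds

lemma tendsto_zero_of_sq_le {ι : Type*} {l : Filter ι} {x f : ι → ℝ} (h : ∀ᶠ i in l, x i ^ 2 ≤ f i)
    (hf : Tendsto f l (𝓝 0)) : Tendsto x l (𝓝 0) := by
  have hs : Tendsto (fun i => Real.sqrt (f i)) l (𝓝 0) := by
    have := (Real.continuous_sqrt.tendsto 0).comp hf
    rwa [Real.sqrt_zero] at this
  refine squeeze_zero_norm' ?_ hs
  filter_upwards [h] with i hi
  exact Real.abs_le_sqrt hi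

lemma tendsto_one_of_sq {ι : Type*} {l : Filter ι} {x : ι → ℝ} (h0 : ∀ᶠ i in l, 0 ≤ x i)
    (h : Tendsto (fun i => x i ^ 2) l (𝓝 1)) : Tendsto x l (𝓝 1) := by
  have := (Real.continuous_sqrt.tendsto 1).comp h
  rw [Real.sqrt_one] at this
  refine this.congr' ?_
  filter_upwards [h0] with i hi
  exact Real.sqrt_sq hi

lemma tendsto_of_abs_sub_le {ι : Type*} {l : Filter ι} {x y f : ι → ℝ} {c : ℝ}
    (h : ∀ᶠ i in l, |y i - x i| ≤ f i) (hf : Tendsto f l (𝓝 0)) (hx : Tendsto x l (𝓝 c)) :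
    Tendsto y l (𝓝 c) := by
  have h1 : Tendsto (fun i => y i - x i) l (𝓝 0) := squeeze_zero_norm' h hf
  simpa using h1.add hx

/-- The size of the mean square of `L / P_X`. -/
def mainSize (X : ℕ) (R : F[X]) : ℝ := R.natDegree * kap (badPrimes X R)

/-- A family of pairs `(X, R)` in which `deg R → ∞`. -/
structure IsAdmissible {ι : Type*} (l : Filter ι) (X : ι → ℕ) (R : ι → F[X]) : Prop where
  natDegree : Tendsto (fun i => (R i).natDegree) l atTop
  eventually : ∀ᶠ i in l, (R i).Monic ∧
    (X i : ℝ) ≤ Real.logb (Nat.card F) (R i).natDegree ∧ ∃ χ : DirChar (R i), IsPrimitive χ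
  highPower : Tendsto (fun i => highPowerSum F (X i) / kap (primeSet F (X i))) l (𝓝 0)

namespace IsAdmissible

variable {ι : Type*} {l : Filter ι} {X : ι → ℕ} {R : ι → F[X]}

lemma eventually' (h : IsAdmissible l X R) : ∀ᶠ i in l, (R i).Monic ∧ 1 ≤ (R i).natDegree ∧
    (X i : ℝ) ≤ Real.logb (Nat.card F) (R i).natDegree ∧ (∃ χ : DirChar (R i), IsPrimitive χ) ∧
    R i ≠ 1 := by
  filter_upwards [h.eventually, h.natDegree.eventually_ge_atTop 1] with i hi hd
  refine ⟨hi.1, hd, hi.2.1, hi.2.2, fun h1 => ?_⟩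
  rw [h1, natDegree_one] at hd
  omega

lemma tendsto_pow_div (h : IsAdmissible l X R) (k : ℕ) :
    Tendsto (fun i => (logSize F (R i).natDegree : ℝ) ^ k / Real.sqrt (R i).natDegree) l (𝓝 0) :=
  (tendsto_logSize_pow_div F k).comp h.natDegree

lemma tendsto_div_natDegree (h : IsAdmissible l X R) (c : ℝ) :
    Tendsto (fun i => c / ((R i).natDegree : ℝ)) l (𝓝 0) :=
  (tendsto_const_div_atTop_nhds_zero_nat c).comp h.natDegree

lemma tendsto_card_primesOf_div (h : IsAdmissible l X R) :
    Tendsto (fun i => ((primesOf (R i)).card : ℝ) / (R i).natDegree) l (𝓝 0) := by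
  rw [Metric.tendsto_nhds]
  intro ε hε
  obtain ⟨w, hw⟩ := exists_nat_one_div_lt (half_pos hε)
  have h1 := (h.tendsto_div_natDegree ((Nat.card F : ℝ) ^ (w + 1))).eventually
    (gt_mem_nhds (half_pos hε))
  filter_upwards [h.eventually', h1] with i hi h2
  have hd : (0 : ℝ) < (R i).natDegree := by exact_mod_cast hi.2.1
  have h3 := card_primes_le (fun P (hP : P ∈ primesOf (R i)) => isPrime_of_mem_primesOf hP)
    (sum_natDegree_primesOf_le hi.1) w
  rw [Real.dist_eq, sub_zero, abs_of_nonneg (by positivity)]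
  have h4 := div_le_div_of_nonneg_right h3 hd.le
  rw [add_div, div_div, mul_comm, ← div_div, div_self hd.ne'] at h4
  linarith

lemma tendsto_cutoff_div (h : IsAdmissible l X R) :
    Tendsto (fun i => ((cutoff F (R i).natDegree : ℝ) + 1) / (R i).natDegree) l (𝓝 0) := by
  have h1 := (h.tendsto_pow_div 1).const_mul 801
  rw [mul_zero] at h1
  refine squeeze_zero' (Eventually.of_forall fun i => by positivity) ?_ h1
  filter_upwards [h.eventually'] with i hi
  have hd : (0 : ℝ) < (R i).natDegree := by exact_mod_cast hi.2.1
  have hs := Real.sqrt_pos.2 hd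
  rw [div_le_iff₀ hd]
  refine (cutoff_succ_le (F := F) hi.2.1).trans_eq ?_
  have e2 := Real.mul_self_sqrt hd.le
  generalize Real.sqrt (R i).natDegree = s at *
  rw [← e2]
  field_simp

lemma tendsto_dualLength_div (h : IsAdmissible l X R) :
    Tendsto (fun i => (dualLength (R i) : ℝ) / (R i).natDegree) l (𝓝 0) := by
  have h1 := (h.tendsto_card_primesOf_div.const_mul 4).add (h.tendsto_cutoff_div.const_mul 3)
  rw [mul_zero, mul_zero, add_zero] at h1
  refine h1.congr fun i => ?_
  rw [dualLength]
  push_cast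
  ring

lemma eventually_dualLength (h : IsAdmissible l X R) :
    ∀ᶠ i in l, dualLength (R i) + dualLength (R i) ≤ (R i).natDegree := by
  filter_upwards [h.eventually', h.tendsto_dualLength_div.eventually
    (gt_mem_nhds (by norm_num : (0 : ℝ) < 1 / 2))] with i hi h1
  have hd : (0 : ℝ) < (R i).natDegree := by exact_mod_cast hi.2.1
  rw [div_lt_iff₀ hd] at h1
  have : ((dualLength (R i) + dualLength (R i) : ℕ) : ℝ) ≤ (R i).natDegree := by
    push_cast; linarith
  exact_mod_cast this

lemma eventually_mainSize_pos (h : IsAdmissible l X R) : ∀ᶠ i in l, 0 < mainSize (X i) (R i) := by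
  filter_upwards [h.eventually'] with i hi
  have hd : (0 : ℝ) < (R i).natDegree := by exact_mod_cast hi.2.1
  exact mul_pos hd kap_badPrimes_pos

lemma tendsto_reflErr_div (h : IsAdmissible l X R) :
    Tendsto (fun i => reflErr (R i) (X i) (cutoff F (R i).natDegree) (dualLength (R i)) /
      mainSize (X i) (R i)) l (𝓝 0) := by
  have h1 := (h.tendsto_pow_div 28).const_mul ((9612 * Real.exp 48 + 24) * Real.exp 4)
  rw [mul_zero] at h1
  refine squeeze_zero' ?_ ?_ h1
  · filter_upwards [h.eventually_mainSize_pos] with i hi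
    refine div_nonneg ?_ hi.le
    have h2 := offDiagErr_nonneg (R i) (cutoff F (R i).natDegree) (dualLength (R i))
    have h3 : 0 ≤ smoothBound F (X i) ^ 3 :=
      pow_nonneg (zero_le_one.trans (one_le_smoothBound (X i))) 3
    rw [reflErr]
    positivity
  · filter_upwards [h.eventually'] with i hi
    exact reflErr_div_le hi.1 hi.2.1 hi.2.2.1

lemma partialErr_nonneg (R : F[X]) (X y t Y : ℕ) : 0 ≤ partialErr R X y t Y := by
  have h2 := offDiagErr_nonneg R y Y
  have h3 : 0 ≤ smoothBound F X ^ 3 := pow_nonneg (zero_le_one.trans (one_le_smoothBound X)) 3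
  have h4 := sieveErr_nonneg t
  have h5 := highPowerSum_nonneg (F := F) X
  have h6 := kap_pos (S := primesOf R) fun P hP => isPrime_of_mem_primesOf hP
  have h7 := th_pos X
  rw [partialErr]
  positivity

lemma tendsto_partialErr_div (h : IsAdmissible l X R) :
    Tendsto (fun i => partialErr (R i) (X i) (cutoff F (R i).natDegree) (logSize F (R i).natDegree)
      (dualLength (R i)) / mainSize (X i) (R i)) l (𝓝 0) := by
  have h1 := (h.tendsto_pow_div 28).const_mul (1000 * Real.exp 52)
  have h2 := h1.add (h.highPower.mul (h1.const_add 1))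
  rw [mul_zero, zero_mul, add_zero] at h2
  refine squeeze_zero' ?_ ?_ h2
  · filter_upwards [h.eventually_mainSize_pos] with i hi
    exact div_nonneg (partialErr_nonneg _ _ _ _ _) hi.le
  · filter_upwards [h.eventually'] with i hi
    exact partialErr_div_le hi.1 hi.2.1 hi.2.2.1

lemma tendsto_qmean_L_mul_invPoly (h : IsAdmissible l X R) :
    Tendsto (fun i => qmean (R i) (fun χ => L χ (1 / 2) *
      invPoly (X i) (cutoff F (R i).natDegree) χ) / Real.sqrt (mainSize (X i) (R i))) l (𝓝 1) := by
  set Y : ι → ℕ := fun i => dualLength (R i) with hY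
  set y : ι → ℕ := fun i => cutoff F (R i).natDegree with hy
  set p : ι → ℝ := fun i => partialErr (R i) (X i) (y i) (logSize F (R i).natDegree) (Y i) /
    mainSize (X i) (R i) with hp
  have hp0 : Tendsto p l (𝓝 0) := h.tendsto_partialErr_div
  have hY0 : Tendsto (fun i => (Y i : ℝ) / (R i).natDegree) l (𝓝 0) := h.tendsto_dualLength_div
  have key : ∀ᶠ i in l, ∀ M : ℕ, M + Y i ≤ (R i).natDegree →
      |(qmean (R i) (fun χ => dpoly (trunc M fun _ => 1) M χ * invPoly (X i) (y i) χ) /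
        Real.sqrt (mainSize (X i) (R i))) ^ 2 - M / (R i).natDegree| ≤ p i := by
    filter_upwards [h.eventually', h.eventually_mainSize_pos] with i hi hm M hM
    have hd : (0 : ℝ) < (R i).natDegree := by exact_mod_cast hi.2.1
    have h1 := abs_sq_qmean_partial_sub_le hi.1 hi.2.2.2.1 (X := X i) (y := y i) hM
      (one_le_logSize (F := F) (R i).natDegree) (card_badPrimes_le hi.1 hi.2.1 hi.2.2.1)
    have hk : 0 < kap (badPrimes (X i) (R i)) := kap_badPrimes_pos
    have e : (M : ℝ) / (R i).natDegree =
        M * kap (badPrimes (X i) (R i)) / mainSize (X i) (R i) := by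
      rw [mainSize, mul_div_mul_right _ _ hk.ne']
    rw [div_pow, Real.sq_sqrt hm.le, e, ← sub_div, abs_div, abs_of_pos hm]
    exact div_le_div_of_nonneg_right h1 hm.le
  set a : ι → ℝ := fun i => qmean (R i) (fun χ => dpoly (trunc ((R i).natDegree - Y i) fun _ => 1)
    ((R i).natDegree - Y i) χ * invPoly (X i) (y i) χ) / Real.sqrt (mainSize (X i) (R i)) with ha
  set s : ι → ℝ := fun i => qmean (R i) (fun χ => dpoly (trunc (Y i) fun _ => 1)
    (Y i) χ * invPoly (X i) (y i) χ) / Real.sqrt (mainSize (X i) (R i)) with hs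
  set g : ι → ℝ := fun i => qmean (R i) (fun χ => dpoly (trunc (Y i)
    fun A => reflDiff F (Y i) A.natDegree)
    (Y i) χ * invPoly (X i) (y i) χ) / Real.sqrt (mainSize (X i) (R i)) with hg
  have ha1 : Tendsto a l (𝓝 1) := by
    refine tendsto_one_of_sq (Eventually.of_forall fun i =>
      div_nonneg (qmean_nonneg _ _) (Real.sqrt_nonneg _)) ?_
    refine tendsto_of_abs_sub_le (x := fun i => 1 - (Y i : ℝ) / (R i).natDegree) (f := p) ?_ hp0 ?_
    · filter_upwards [key, h.eventually_dualLength, h.eventually'] with i hi h1 h2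
      have hd : (0 : ℝ) < (R i).natDegree := by exact_mod_cast h2.2.1
      change Y i + Y i ≤ _ at h1
      have h3 := hi ((R i).natDegree - Y i) (by omega)
      rwa [Nat.cast_sub (by omega), sub_div, div_self hd.ne'] at h3
    · simpa using hY0.const_sub 1
  have hs0 : Tendsto s l (𝓝 0) := by
    have h1 := hY0.add hp0
    rw [add_zero] at h1
    refine tendsto_zero_of_sq_le ?_ h1
    filter_upwards [key, h.eventually_dualLength] with i hi h1
    have := (abs_le.1 (hi (Y i) h1)).2
    simp only [hs]
    linarith
  have hg0 : Tendsto g l (𝓝 0) := by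
    refine tendsto_zero_of_sq_le ?_ h.tendsto_reflErr_div
    filter_upwards [h.eventually_dualLength, h.eventually', h.eventually_mainSize_pos] with i h1 h2 hm
    simp only [hg]
    rw [div_pow, Real.sq_sqrt hm.le]
    exact div_le_div_of_nonneg_right (sq_qmean_reflDiff_le h2.1 h2.2.2.2.1 h1) hm.le
  have hsg := hs0.add hg0
  rw [add_zero] at hsg
  refine tendsto_of_abs_sub_le ?_ hsg ha1
  filter_upwards [h.eventually_dualLength, h.eventually'] with i h1 h2
  change Y i + Y i ≤ _ at h1
  have h3 := abs_qmean_L_sub_le h2.1 h2.2.2.2.2 (N := (R i).natDegree - Y i) (Y := Y i)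
    (by omega) (X i) (y i)
  simp only [ha, hs, hg]
  rw [← sub_div, abs_div, abs_of_nonneg (Real.sqrt_nonneg _), ← add_div]
  exact div_le_div_of_nonneg_right h3 (Real.sqrt_nonneg _)

end IsAdmissible

lemma primeSet_zero : primeSet F 0 = ∅ := by
  refine Finset.eq_empty_of_forall_notMem fun P hP => ?_
  obtain ⟨h1, h2⟩ := mem_primeSet.1 hP
  have := h1.natDegree_pos
  omega

lemma badPrimes_zero (R : F[X]) : badPrimes 0 R = primesOf R := by
  classical
  rw [badPrimes, primeSet_zero, Finset.union_empty]

lemma highPowerSum_zero : highPowerSum F 0 = 0 := by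
  rw [highPowerSum, primeSet_zero, Finset.sum_empty]

lemma invCoeff_zero {D : F[X]} (hD : D.Monic) (h : D.natDegree ≠ 0) : invCoeff 0 D = 0 := by
  by_contra h0
  have h1 : eulerCoeff 0 D ≠ 0 := fun h2 => h0 (abs_nonpos_iff.1 (h2 ▸ abs_invCoeff_le 0 hD))
  obtain ⟨P, hP, hd⟩ := exists_isPrimePoly_dvd hD (fun h1 => h (by rw [h1, natDegree_one]))
  have h2 := isSmooth_of_eulerCoeff_ne_zero hD h1 P hP hd
  have := hP.natDegree_pos
  omega

lemma invPoly_zero {R : F[X]} (y : ℕ) (χ : DirChar R) : invPoly 0 y χ = 1 := by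
  rw [invPoly, dpoly_trunc, Finset.sum_range_succ', Finset.sum_eq_zero, monics_zero,
    Finset.sum_singleton, val_one]
  · simp [invCoeff, expConv_one]
  · intro n _
    rw [Finset.sum_eq_zero, zero_mul]
    intro D hD
    rw [invCoeff_zero (mem_monics.1 hD).1 (by rw [(mem_monics.1 hD).2]; omega)]
    simp

namespace IsAdmissible

variable {ι : Type*} {l : Filter ι} {X : ι → ℕ} {R : ι → F[X]}

lemma zero (h : IsAdmissible l X R) : IsAdmissible l (fun _ => 0) R where
  natDegree := h.natDegree
  eventually := by
    filter_upwards [h.eventually'] with i hi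
    have hq := two_le_card (F := F)
    refine ⟨hi.1, ?_, hi.2.2.2.1⟩
    rw [Nat.cast_zero]
    exact Real.logb_nonneg (by linarith) (by exact_mod_cast hi.2.1)
  highPower := by simpa only [highPowerSum_zero, zero_div] using tendsto_const_nhds

/-- The second moment of `L`. -/
lemma tendsto_qmean_L (h : IsAdmissible l X R) :
    Tendsto (fun i => qmean (R i) (fun χ => L χ (1 / 2)) / Real.sqrt (mainSize 0 (R i))) l (𝓝 1) := by
  have h1 := h.zero.tendsto_qmean_L_mul_invPoly
  simpa only [invPoly_zero, mul_one] using h1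

/-- The second moment of `L / P_X`. -/
lemma tendsto_qmean_L_mul_inv_eulerPart (h : IsAdmissible l X R) :
    Tendsto (fun i => qmean (R i) (fun χ => L χ (1 / 2) * (eulerPart (X i) χ (1 / 2))⁻¹) /
      Real.sqrt (mainSize (X i) (R i))) l (𝓝 1) := by
  have h1 := ((h.tendsto_pow_div 1).const_mul (Real.exp 2)).mul h.tendsto_qmean_L
  rw [mul_zero, zero_mul] at h1
  refine tendsto_of_abs_sub_le ?_ h1 h.tendsto_qmean_L_mul_invPoly
  filter_upwards [h.eventually', h.eventually_mainSize_pos, h.zero.eventually_mainSize_pos]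
    with i hi hm hm0
  have hd : (0 : ℝ) < (R i).natDegree := by exact_mod_cast hi.2.1
  have hs := Real.sqrt_pos.2 hd
  have hk0 : 0 < kap (badPrimes (X i) (R i)) := kap_badPrimes_pos
  have hkR : kap (badPrimes 0 (R i)) ≤ 1 := kap_le_one fun P hP => isPrimePoly_of_mem_badPrimes hP
  have ht : (0 : ℝ) < logSize F (R i).natDegree := by
    exact_mod_cast one_le_logSize (F := F) (R i).natDegree
  have h2 := abs_qmean_L_mul_inv_eulerPart_sub_le hi.1 (X i) (cutoff F (R i).natDegree)
  have h3 := th_pow_inv_mul_halfBound_le hi.2.1 hi.2.2.1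
  have h4 : Real.sqrt (mainSize 0 (R i)) ≤
      Real.exp 2 * logSize F (R i).natDegree * Real.sqrt (mainSize (X i) (R i)) := by
    rw [Real.sqrt_le_left (by positivity), mul_pow, mul_pow, Real.sq_sqrt hm.le]
    have h5 := le_kap_badPrimes hi.1 hi.2.1 hi.2.2.1
    rw [mainSize, mainSize]
    calc _ ≤ ((R i).natDegree : ℝ) * 1 := by gcongr
      _ = Real.exp 2 ^ 2 * (logSize F (R i).natDegree : ℝ) ^ 2 * ((R i).natDegree *
          (Real.exp (-4) / (logSize F (R i).natDegree : ℝ) ^ 2)) := by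
          have e : Real.exp 2 ^ 2 * Real.exp (-4) = 1 := by
            rw [← Real.exp_nat_mul, ← Real.exp_add]; norm_num
          field_simp
          linarith
      _ ≤ _ := by gcongr
  rw [← sub_div, abs_div, abs_of_nonneg (Real.sqrt_nonneg _)]
  have hsm := Real.sqrt_pos.2 hm
  have hsm0 := Real.sqrt_pos.2 hm0
  have hq0 := qmean_nonneg (R i) (fun χ => L χ (1 / 2))
  rw [div_le_iff₀ hsm]
  refine h2.trans ((mul_le_mul_of_nonneg_right h3 hq0).trans ?_)
  rw [pow_one]
  calc 1 / Real.sqrt (R i).natDegree * qmean (R i) (fun χ => L χ (1 / 2))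
      = 1 / Real.sqrt (R i).natDegree * (qmean (R i) (fun χ => L χ (1 / 2)) /
        Real.sqrt (mainSize 0 (R i))) * Real.sqrt (mainSize 0 (R i)) := by
        field_simp
    _ ≤ 1 / Real.sqrt (R i).natDegree * (qmean (R i) (fun χ => L χ (1 / 2)) /
        Real.sqrt (mainSize 0 (R i))) *
        (Real.exp 2 * logSize F (R i).natDegree * Real.sqrt (mainSize (X i) (R i))) := by
        gcongr
    _ = _ := by ring

end IsAdmissible

open Classical in
/-- The primes of degree at most `X` that do not divide `R`. -/
def smallPrimes (X : ℕ) (R : F[X]) : Finset F[X] := primeSet F X \ primesOf R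

lemma isPrimePoly_of_mem_smallPrimes {X : ℕ} {R P : F[X]} (h : P ∈ smallPrimes X R) :
    IsPrimePoly P := by
  classical
  exact (mem_primeSet.1 (Finset.mem_sdiff.1 h).1).1

lemma kap_smallPrimes_pos {X : ℕ} {R : F[X]} : 0 < kap (smallPrimes X R) :=
  kap_pos fun _ hP => isPrimePoly_of_mem_smallPrimes hP

lemma kap_smallPrimes_le_one {X : ℕ} {R : F[X]} : kap (smallPrimes X R) ≤ 1 :=
  kap_le_one fun _ hP => isPrimePoly_of_mem_smallPrimes hP

lemma kap_badPrimes_eq (X : ℕ) (R : F[X]) :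
    kap (badPrimes X R) = kap (primesOf R) * kap (smallPrimes X R) := by
  classical
  rw [badPrimes, ← Finset.union_sdiff_self_eq_union, kap, Finset.prod_union Finset.disjoint_sdiff]
  rfl

lemma mainSize_eq (X : ℕ) (R : F[X]) : mainSize X R = mainSize 0 R * kap (smallPrimes X R) := by
  rw [mainSize, mainSize, badPrimes_zero, kap_badPrimes_eq]; ring

lemma factorsIn_smallPrimes_iff {X : ℕ} {R D : F[X]} (hR : R.Monic) :
    FactorsIn (smallPrimes X R) D ↔ FactorsIn (primeSet F X) D ∧ IsCoprime D R := by
  classical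
  rw [isCoprime_iff_avoids hR]
  constructor
  · exact fun h => ⟨fun P hP hd => (Finset.mem_sdiff.1 (h P hP hd)).1,
      fun P hP hd => (Finset.mem_sdiff.1 (h P (isPrime_of_mem_primesOf hP) hd)).2 hP⟩
  · exact fun h P hP hd => Finset.mem_sdiff.2 ⟨h.1 P hP hd, fun hP' => h.2 P hP' hd⟩

lemma diag_eulerCoeff_le {R : F[X]} (hR : R.Monic) (X M : ℕ) :
    diag R (eulerCoeff X) M ≤ (kap (smallPrimes X R))⁻¹ := by
  classical
  refine le_trans ?_ (sum_le_hasSum (Finset.range M)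
    (fun n _ => div_nonneg (cnt_nonneg _ n) (card_pow_pos n).le) (hasSum_factorsIn_inv
      fun P (hP : P ∈ smallPrimes X R) => isPrimePoly_of_mem_smallPrimes hP))
  rw [diag_eq]
  refine Finset.sum_le_sum fun n _ => ?_
  rw [cnt_eq_sum, mavg]
  refine div_le_div_of_nonneg_right (Finset.sum_le_sum fun D hD => ?_) (card_pow_pos n).le
  have hDm := (mem_monics.1 hD).1
  have h0 := eulerCoeff_nonneg X hDm
  have h1 := eulerCoeff_le_one X hDm
  by_cases h : FactorsIn (smallPrimes X R) D
  · rw [if_pos h, if_pos ((factorsIn_smallPrimes_iff hR).1 h).2]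
    exact pow_le_one₀ h0 h1
  · rw [if_neg h]
    by_cases hc : IsCoprime D R
    · have hz : eulerCoeff X D = 0 := by
        by_contra hz
        exact h ((factorsIn_smallPrimes_iff hR).2
          ⟨isSmooth_iff_factorsIn.1 (isSmooth_of_eulerCoeff_ne_zero hDm hz), hc⟩)
      rw [if_pos hc, hz]; norm_num
    · rw [if_neg hc]

lemma sub_sum_range_le_of_hasSum {f g : ℕ → ℝ} {a b : ℝ} (hf : HasSum f a) (hg : HasSum g b)
    (m : ℕ) (h : ∀ n, m ≤ n → f n ≤ g n) (hg0 : ∀ n, 0 ≤ g n) :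
    a - ∑ n ∈ Finset.range m, f n ≤ b := by
  have e1 := hf.summable.sum_add_tsum_nat_add m
  have e2 := hg.summable.sum_add_tsum_nat_add m
  rw [hf.tsum_eq] at e1
  rw [hg.tsum_eq] at e2
  have h0 : 0 ≤ ∑ n ∈ Finset.range m, g n := Finset.sum_nonneg fun n _ => hg0 n
  have h7 : ∑' n, f (n + m) ≤ ∑' n, g (n + m) :=
    Summable.tsum_le_tsum (fun n => h (n + m) (by omega))
      ((summable_nat_add_iff m).2 hf.summable) ((summable_nat_add_iff m).2 hg.summable)
  linarith

lemma tail_factorsIn_le {R : F[X]} (X y : ℕ) :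
    (kap (smallPrimes X R))⁻¹ - ∑ n ∈ Finset.range (y + 1),
      cnt (FactorsIn (smallPrimes X R)) n / (Nat.card F : ℝ) ^ n ≤
      (th X ^ y)⁻¹ * smoothBound F X := by
  classical
  have hth := th_pos X
  refine sub_sum_range_le_of_hasSum (hasSum_factorsIn_inv
    fun P (hP : P ∈ smallPrimes X R) => isPrimePoly_of_mem_smallPrimes hP)
    ((hasSum_smoothBound (F := F) X).mul_left (th X ^ y)⁻¹) (y + 1) (fun n hn => ?_) fun n =>
      mul_nonneg (by positivity) (mul_nonneg (cnt_nonneg _ _) (by positivity))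
  have h3 : cnt (FactorsIn (smallPrimes X R)) n ≤ cnt (FactorsIn (primeSet F X)) n :=
    cnt_mono fun D _ hD P hP hd => (Finset.mem_sdiff.1 (hD P hP hd)).1
  have h4 : 1 ≤ (th X ^ y)⁻¹ * (th X ^ 2) ^ n := by
    rw [← div_eq_inv_mul, one_le_div (by positivity), ← pow_mul]
    exact pow_le_pow_right₀ (one_le_th X) (by omega)
  have h5 := card_pow_pos (F := F) n
  have h6 : 0 ≤ cnt (FactorsIn (primeSet F X)) n / (Nat.card F : ℝ) ^ n :=
    div_nonneg (cnt_nonneg _ _) h5.le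
  refine (div_le_div_of_nonneg_right h3 h5.le).trans
    ((le_mul_of_one_le_left h6 h4).trans_eq ?_)
  rw [div_pow]
  ring

lemma le_diag_eulerCoeff {R : F[X]} (hR : R.Monic) (X y : ℕ) :
    (kap (smallPrimes X R))⁻¹ - (th X ^ y)⁻¹ * smoothBound F X -
      highPowerSum F X * (kap (smallPrimes X R))⁻¹ ≤ diag R (eulerCoeff X) (y + 1) := by
  classical
  have h1 := tail_factorsIn_le (R := R) X y
  have h2 := sum_cnt_highPower_le (p := FactorsIn (smallPrimes X R))
    (fun A B h => factorsIn_of_mul h) X (y + 1)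
  have h3 := mul_le_mul_of_nonneg_left (sum_le_hasSum (Finset.range (y + 1))
    (fun n _ => div_nonneg (cnt_nonneg _ n) (card_pow_pos n).le) (hasSum_factorsIn_inv
      fun P (hP : P ∈ smallPrimes X R) => isPrimePoly_of_mem_smallPrimes hP))
    (highPowerSum_nonneg (F := F) X)
  have h4 : ∑ n ∈ Finset.range (y + 1), cnt (FactorsIn (smallPrimes X R)) n / (Nat.card F : ℝ) ^ n -
      ∑ n ∈ Finset.range (y + 1), cnt (fun D => FactorsIn (smallPrimes X R) D ∧ HasHighPower X D) n /
        (Nat.card F : ℝ) ^ n ≤ diag R (eulerCoeff X) (y + 1) := by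
    rw [diag_eq, ← Finset.sum_sub_distrib]
    refine Finset.sum_le_sum fun n _ => ?_
    rw [cnt_eq_sum, cnt_eq_sum, mavg, ← sub_div, ← Finset.sum_sub_distrib]
    refine div_le_div_of_nonneg_right (Finset.sum_le_sum fun D hD => ?_) (card_pow_pos n).le
    have hDm := (mem_monics.1 hD).1
    have hpos : (0 : ℝ) ≤ if IsCoprime D R then eulerCoeff X D ^ 2 else 0 := by
      split_ifs
      · exact sq_nonneg _
      · exact le_rfl
    by_cases h : FactorsIn (smallPrimes X R) D
    · by_cases hh : HasHighPower X D
      · rw [if_pos h, if_pos ⟨h, hh⟩, sub_self]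
        exact hpos
      · have h' := (factorsIn_smallPrimes_iff hR).1 h
        rw [if_pos h, if_neg fun h'' => hh h''.2, if_pos h'.2,
          eulerCoeff_eq_one hDm (isSmooth_iff_factorsIn.2 h'.1) hh]
        norm_num
    · rw [if_neg h, if_neg fun h'' => h h''.1, sub_self]
      exact hpos
  linarith

lemma qmean_one_le {R : F[X]} (hR : R.Monic) : qmean R (fun _ => 1) ≤ 1 := by
  refine Real.sqrt_le_one.2 ?_
  rw [primAvg_eq hR]
  simp only [norm_one, one_pow, Finset.sum_const, nsmul_one]
  rw [one_div_mul_eq_div]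
  exact div_self_le_one _

/-- The truncation at degree `y` of the Dirichlet polynomial of `P_X` at `1 / 2`. -/
def eulerPoly {R : F[X]} (X y : ℕ) (χ : DirChar R) : ℂ :=
  dpoly (trunc (y + 1) (eulerCoeff X)) (y + 1) χ

lemma abs_qmean_eulerPart_sub_le {R : F[X]} (hR : R.Monic) (X y : ℕ) :
    |qmean R (fun χ => eulerPart X χ (1 / 2)) - qmean R (fun χ => eulerPoly X y χ)| ≤
      (th X ^ y)⁻¹ * halfBound F X := by
  refine (abs_qmean_sub_le hR _ _).trans ?_
  have h0 : 0 ≤ (th X ^ y)⁻¹ * halfBound F X :=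
    (norm_nonneg _).trans (norm_eulerPart_sub_dpoly_le hR X y 1)
  have h := qmean_mul_le hR (f := fun _ => 1)
    (g := fun χ => eulerPart X χ (1 / 2) - eulerPoly X y χ) h0
    fun χ _ => norm_eulerPart_sub_dpoly_le hR X y χ
  simp only [one_mul] at h
  exact h.trans (mul_le_of_le_one_right h0 (qmean_one_le hR))

lemma abs_sq_qmean_eulerPoly_sub_le {R : F[X]} (hR : R.Monic)
    (h : ∃ χ : DirChar R, IsPrimitive χ) (X y : ℕ) :
    |qmean R (fun χ => eulerPoly X y χ) ^ 2 - diag R (eulerCoeff X) (y + 1)| ≤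
      6 * 16 ^ (primesOf R).card * ((Nat.card F : ℝ) ^ (y + 1) / (Nat.card F : ℝ) ^ R.natDegree) := by
  have h1 := abs_primAvg_sub_diag_le hR h (f := trunc (y + 1) (eulerCoeff X)) (C := 1) (M := y + 1)
    fun D hD _ => abs_trunc_le (by
      rw [abs_of_nonneg (eulerCoeff_nonneg X hD)]
      exact eulerCoeff_le_one X hD)
  have e : diag R (trunc (y + 1) (eulerCoeff X)) (y + 1) = diag R (eulerCoeff X) (y + 1) := by
    classical
    rw [diag, diag]
    refine Finset.sum_congr rfl fun D hD => ?_
    rw [trunc_of_lt _ (mem_monicsLT.1 hD).2]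
  rw [e, one_pow, mul_one] at h1
  rw [sq_qmean hR]
  exact h1

namespace IsAdmissible

variable {ι : Type*} {l : Filter ι} {X : ι → ℕ} {R : ι → F[X]}

lemma eventually_eulerPoly_offDiag_le (h : IsAdmissible l X R) : ∀ᶠ i in l,
    6 * 16 ^ (primesOf (R i)).card * ((Nat.card F : ℝ) ^ (cutoff F (R i).natDegree + 1) /
      (Nat.card F : ℝ) ^ (R i).natDegree) ≤ 12 / (R i).natDegree := by
  have hq := two_le_card (F := F)
  filter_upwards [h.eventually_dualLength, h.eventually'] with i h1 h2
  have hd : (0 : ℝ) < (R i).natDegree := by exact_mod_cast h2.2.1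
  have h16 : (16 : ℝ) ^ (primesOf (R i)).card ≤ (Nat.card F : ℝ) ^ (4 * (primesOf (R i)).card) := by
    rw [pow_mul]
    exact pow_le_pow_left₀ (by norm_num) (le_trans (by norm_num) (pow_le_pow_left₀ zero_le_two hq 4)) _
  have h3 : (16 : ℝ) ^ (primesOf (R i)).card * (Nat.card F : ℝ) ^ (cutoff F (R i).natDegree + 1) ≤
      (Nat.card F : ℝ) ^ dualLength (R i) := by
    calc _ ≤ (Nat.card F : ℝ) ^ (4 * (primesOf (R i)).card) *
          (Nat.card F : ℝ) ^ (cutoff F (R i).natDegree + 1) := by gcongr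
      _ ≤ _ := by
        rw [← pow_add]
        exact pow_le_pow_right₀ (by linarith) (by rw [dualLength]; omega)
  have h4 : ((R i).natDegree : ℝ) * (Nat.card F : ℝ) ^ dualLength (R i) ≤
      2 * (Nat.card F : ℝ) ^ (R i).natDegree := by
    set k := (R i).natDegree - dualLength (R i) with hk
    have e : (R i).natDegree = k + dualLength (R i) := by omega
    have h5 : ((R i).natDegree : ℝ) ≤ 2 * k := by exact_mod_cast (by omega : (R i).natDegree ≤ 2 * k)
    have h6 : (k : ℝ) ≤ (Nat.card F : ℝ) ^ k := by
      have : (k : ℝ) ≤ 2 ^ k := by exact_mod_cast Nat.lt_two_pow_self.le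
      exact this.trans (pow_le_pow_left₀ zero_le_two hq k)
    calc _ ≤ (2 * (Nat.card F : ℝ) ^ k) * (Nat.card F : ℝ) ^ dualLength (R i) := by
          refine mul_le_mul_of_nonneg_right (by linarith) (card_pow_pos _).le
      _ = 2 * (Nat.card F : ℝ) ^ (k + dualLength (R i)) := by rw [pow_add]; ring
      _ = _ := by rw [← e]
  rw [← mul_div_assoc, div_le_div_iff₀ (card_pow_pos _) hd]
  calc _ = 6 * ((R i).natDegree * ((16 : ℝ) ^ (primesOf (R i)).card *
        (Nat.card F : ℝ) ^ (cutoff F (R i).natDegree + 1))) := by ring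
    _ ≤ 6 * ((R i).natDegree * (Nat.card F : ℝ) ^ dualLength (R i)) := by gcongr
    _ ≤ _ := by linarith

/-- The second moment of `P_X`. -/
lemma tendsto_qmean_eulerPart (h : IsAdmissible l X R) :
    Tendsto (fun i => qmean (R i) (fun χ => eulerPart (X i) χ (1 / 2)) *
      Real.sqrt (kap (smallPrimes (X i) (R i)))) l (𝓝 1) := by
  have hpoly : Tendsto (fun i => qmean (R i) (fun χ => eulerPoly (X i) (cutoff F (R i).natDegree) χ) *
      Real.sqrt (kap (smallPrimes (X i) (R i)))) l (𝓝 1) := by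
    refine tendsto_one_of_sq (Eventually.of_forall fun i =>
      mul_nonneg (qmean_nonneg _ _) (Real.sqrt_nonneg _)) ?_
    have h1 := ((h.tendsto_div_natDegree 12).add
      ((h.tendsto_pow_div 8).const_mul (Real.exp 16))).add h.highPower
    rw [mul_zero, add_zero, add_zero] at h1
    refine tendsto_of_abs_sub_le (x := fun _ => 1) ?_ h1 tendsto_const_nhds
    filter_upwards [h.eventually', h.eventually_eulerPoly_offDiag_le] with i hi h2
    have hk := kap_smallPrimes_pos (X := X i) (R := R i)
    have hk1 := kap_smallPrimes_le_one (X := X i) (R := R i)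
    set k := kap (smallPrimes (X i) (R i)) with hkdef
    have h3 := abs_sq_qmean_eulerPoly_sub_le hi.1 hi.2.2.2.1 (X i) (cutoff F (R i).natDegree)
    have h4 := diag_eulerCoeff_le hi.1 (X i) (cutoff F (R i).natDegree + 1)
    have h5 := le_diag_eulerCoeff hi.1 (X i) (cutoff F (R i).natDegree)
    rw [← hkdef] at h4 h5
    have h6 : (th (X i) ^ cutoff F (R i).natDegree)⁻¹ * smoothBound F (X i) ≤
        Real.exp 16 * ((logSize F (R i).natDegree : ℝ) ^ 8 / Real.sqrt (R i).natDegree) := by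
      have b1 := th_pow_inv_le hi.2.1 hi.2.2.1
      have b2 := smoothBound_le_logSize hi.2.2.1
      have b3 : 0 ≤ smoothBound F (X i) := zero_le_one.trans (one_le_smoothBound _)
      calc _ ≤ 1 / Real.sqrt (R i).natDegree *
            (Real.exp 16 * (logSize F (R i).natDegree : ℝ) ^ 8) := by gcongr
        _ = _ := by ring
    have hkX := kap_pos (S := primeSet F (X i)) fun P hP => (mem_primeSet.1 hP).1
    have hkX1 := kap_le_one (S := primeSet F (X i)) fun P hP => (mem_primeSet.1 hP).1
    have h7 : highPowerSum F (X i) ≤ highPowerSum F (X i) / kap (primeSet F (X i)) :=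
      le_div_self (highPowerSum_nonneg _) hkX hkX1
    have h8 := (abs_le.1 (h3.trans h2))
    have hh := highPowerSum_nonneg (F := F) (X i)
    have e0 : k * k⁻¹ = 1 := mul_inv_cancel₀ hk.ne'
    rw [mul_pow, Real.sq_sqrt hk.le]
    set Q := qmean (R i) (fun χ => eulerPoly (X i) (cutoff F (R i).natDegree) χ) ^ 2 with hQ
    set A := 12 / ((R i).natDegree : ℝ) with hA
    set B := Real.exp 16 * ((logSize F (R i).natDegree : ℝ) ^ 8 / Real.sqrt (R i).natDegree) with hB
    have hA0 : 0 ≤ A := by positivity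
    have hB0 : 0 ≤ B := by positivity
    have u1 : Q ≤ k⁻¹ + A := by linarith [h8.2]
    have u2 : k⁻¹ - B - highPowerSum F (X i) * k⁻¹ - A ≤ Q := by linarith [h8.1]
    have v1 := mul_le_mul_of_nonneg_left u1 hk.le
    have v2 := mul_le_mul_of_nonneg_left u2 hk.le
    have w1 : k * A ≤ A := mul_le_of_le_one_left hA0 hk1
    have w2 : k * B ≤ B := mul_le_of_le_one_left hB0 hk1
    have w3 : k * (highPowerSum F (X i) * k⁻¹) = highPowerSum F (X i) := by
      rw [mul_left_comm, e0, mul_one]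
    rw [abs_le]
    constructor <;> nlinarith
  have h1 := h.tendsto_pow_div 0
  simp only [pow_zero] at h1
  refine tendsto_of_abs_sub_le ?_ h1 hpoly
  filter_upwards [h.eventually'] with i hi
  have h2 := (abs_qmean_eulerPart_sub_le hi.1 (X i) (cutoff F (R i).natDegree)).trans
    (th_pow_inv_mul_halfBound_le hi.2.1 hi.2.2.1)
  rw [← sub_mul, abs_mul, abs_of_nonneg (Real.sqrt_nonneg _)]
  refine (mul_le_of_le_one_right (abs_nonneg _) ?_).trans h2
  exact Real.sqrt_le_one.2 kap_smallPrimes_le_one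

end IsAdmissible

lemma largePrimeFactors_eq {R : F[X]} (hR : R.Monic) (X : ℕ) :
    largePrimeFactors X R = open Classical in primesOf R \ primeSet F X := by
  classical
  ext P
  rw [largePrimeFactors, Finset.mem_filter, Finset.mem_sdiff, mem_primesOf hR, mem_primeSet,
    mem_monicsLE]
  constructor
  · rintro ⟨_, h1, h2, h3⟩
    exact ⟨⟨h1, h2⟩, fun h => by omega⟩
  · rintro ⟨⟨h1, h2⟩, h3⟩
    refine ⟨⟨h1.1, natDegree_le_of_dvd h2 hR.ne_zero⟩, h1, h2, ?_⟩
    by_contra! h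
    exact h3 ⟨h1, h⟩

lemma mainTerm_eq {R : F[X]} (hR : R.Monic) (X : ℕ) :
    mainTerm X R * kap (primeSet F X) = mainSize X R / (Real.exp Real.eulerMascheroniConstant * X) := by
  classical
  have e : ∏ P ∈ largePrimeFactors X R, (1 - 1 / absVal P) = kap (primesOf R \ primeSet F X) := by
    rw [largePrimeFactors_eq hR, kap]
    refine Finset.prod_congr (by congr!) fun P hP => ?_
    rw [absVal_monic (isPrime_of_mem_primesOf (Finset.mem_sdiff.1 hP).1).1]
  have e2 : kap (badPrimes X R) = kap (primeSet F X) * kap (primesOf R \ primeSet F X) := by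
    rw [badPrimes, Finset.union_comm, ← Finset.union_sdiff_self_eq_union, kap,
      Finset.prod_union Finset.disjoint_sdiff]
    rfl
  rw [mainTerm, e, mainSize, e2]
  ring

lemma isAdmissible_regime (F : Type*) [Field F] [Finite F] :
    IsAdmissible (regime F) (fun p => p.1) (fun p => p.2) where
  natDegree := tendsto_comap.mono_left (inf_le_left.trans inf_le_right)
  eventually := (eventually_principal.2 fun _ h => h).filter_mono inf_le_right
  highPower := by
    have h := (tendsto_mul_highPowerSum (F := F)).const_mul (Real.exp Real.eulerMascheroniConstant)
    have h2 := h.div (tendsto_kap_primeSet (F := F)) one_ne_zero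
    rw [mul_zero, zero_div] at h2
    have h3 : Tendsto (fun X : ℕ => highPowerSum F X / kap (primeSet F X)) atTop (𝓝 0) := by
      refine h2.congr' ?_
      filter_upwards [eventually_ge_atTop 1] with X hX
      have hX' : (0 : ℝ) < X := by exact_mod_cast hX
      have hk := kap_pos (S := primeSet F X) fun P hP => (mem_primeSet.1 hP).1
      simp only [Pi.div_apply]
      field_simp
    exact h3.comp (tendsto_comap.mono_left (inf_le_left.trans inf_le_left))

lemma tendsto_mainTerm_div (F : Type*) [Field F] [Finite F] :
    Tendsto (fun p : ℕ × F[X] => mainTerm p.1 p.2 / mainSize p.1 p.2) (regime F) (𝓝 1) := by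
  have hX : Tendsto (fun p : ℕ × F[X] => p.1) (regime F) atTop :=
    tendsto_comap.mono_left (inf_le_left.trans inf_le_left)
  have h := ((tendsto_kap_primeSet (F := F)).inv₀ one_ne_zero).comp hX
  rw [inv_one] at h
  refine h.congr' ?_
  filter_upwards [(isAdmissible_regime F).eventually', hX.eventually_ge_atTop 1,
    (isAdmissible_regime F).eventually_mainSize_pos] with p hp hp1 hm
  have hX' : (0 : ℝ) < p.1 := by exact_mod_cast hp1
  have hk := kap_pos (S := primeSet F p.1) fun P hP => (mem_primeSet.1 hP).1
  have e := mainTerm_eq hp.1 p.1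
  have he := Real.exp_pos Real.eulerMascheroniConstant
  rw [Function.comp, eq_div_iff hm.ne', eq_comm, ← mul_right_cancel_iff_of_pos hk, e]
  field_simp

lemma isEquivalent_of_tendsto_div {ι : Type*} {l : Filter ι} {f g m : ι → ℝ}
    (hm : ∀ᶠ i in l, 0 < m i) (hf : Tendsto (fun i => f i / m i) l (𝓝 1))
    (hg : Tendsto (fun i => g i / m i) l (𝓝 1)) : f ~[l] g := by
  have h : ∀ {f : ι → ℝ}, Tendsto (fun i => f i / m i) l (𝓝 1) → f ~[l] m := fun {f} hf =>
    (isEquivalent_iff_tendsto_one (hm.mono fun _ h => h.ne')).2 hf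
  exact (h hf).trans (h hg).symm

theorem isEquivalent_mean_square (F : Type*) [Field F] [Finite F] :
    (fun p : ℕ × F[X] => primAvg p.2 fun χ => ‖L χ (1 / 2) * (eulerPart p.1 χ (1 / 2))⁻¹‖ ^ 2)
      ~[regime F] fun p => mainTerm p.1 p.2 := by
  have h := isAdmissible_regime F
  refine isEquivalent_of_tendsto_div h.eventually_mainSize_pos ?_ (tendsto_mainTerm_div F)
  have h1 := h.tendsto_qmean_L_mul_inv_eulerPart.pow 2
  rw [one_pow] at h1
  refine h1.congr' ?_
  filter_upwards [h.eventually', h.eventually_mainSize_pos] with p hp hm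
  rw [div_pow, Real.sq_sqrt hm.le, sq_qmean hp.1]

theorem isEquivalent_splitting (F : Type*) [Field F] [Finite F] :
    (fun p : ℕ × F[X] => primAvg p.2 fun χ => ‖L χ (1 / 2)‖ ^ 2)
      ~[regime F] fun p => primAvg p.2 (fun χ => ‖eulerPart p.1 χ (1 / 2)‖ ^ 2) *
        primAvg p.2 fun χ => ‖L χ (1 / 2) * (eulerPart p.1 χ (1 / 2))⁻¹‖ ^ 2 := by
  have h := isAdmissible_regime F
  refine isEquivalent_of_tendsto_div h.zero.eventually_mainSize_pos ?_ ?_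
  · have h1 := h.tendsto_qmean_L.pow 2
    rw [one_pow] at h1
    refine h1.congr' ?_
    filter_upwards [h.eventually', h.zero.eventually_mainSize_pos] with p hp hm
    rw [div_pow, Real.sq_sqrt hm.le, sq_qmean hp.1]
  · have h1 := (h.tendsto_qmean_eulerPart.mul h.tendsto_qmean_L_mul_inv_eulerPart).pow 2
    rw [one_mul, one_pow] at h1
    refine h1.congr' ?_
    filter_upwards [h.eventually', h.eventually_mainSize_pos] with p hp hm
    have hk := kap_smallPrimes_pos (X := p.1) (R := p.2)
    rw [mul_pow, mul_pow, div_pow, Real.sq_sqrt hm.le, Real.sq_sqrt hk.le, sq_qmean hp.1,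
      sq_qmean hp.1, mainSize_eq p.1 p.2]
    have hm0 : mainSize 0 p.2 ≠ 0 := by
      intro h0
      rw [mainSize_eq, h0, zero_mul] at hm
      exact lt_irrefl _ hm
    field_simp

end FqT

end

theorem theorem3 (F : Type*) [Field F] [Finite F]
    (u : ℕ → ℝ → ℝ) (hu : ∀ X : ℕ, 1 ≤ X → FqT.IsWeight (Nat.card F) X (u X)) :
    -- the Hadamard product part is well defined
    (∀ (X : ℕ) (R : F[X]), 1 ≤ X → R.Monic → R ≠ 1 →
      ∀ χ : FqT.DirChar R, FqT.IsPrimitive χ → ∀ s : ℂ,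
        (s ∈ FqT.regularPoints χ →
          Summable fun ρ : {ρ : ℂ // FqT.L χ ρ = 0} => FqT.zeroTerm (u X) X χ s ρ) ∧
        (𝓝[FqT.regularPoints χ] s).NeBot ∧
        Tendsto (FqT.hadamardExp (u X) X χ) (𝓝[FqT.regularPoints χ] s)
          (𝓝 (FqT.hadamardPart (u X) X χ s))) ∧
    -- the two averages are equal
    (∀ (X : ℕ) (R : F[X]), 1 ≤ X → R.Monic → R ≠ 1 →
      FqT.primAvg R (fun χ => ‖FqT.hadamardPart (u X) X χ (1 / 2)‖ ^ 2) =
        FqT.primAvg R (fun χ => ‖FqT.L χ (1 / 2) * (FqT.eulerPart X χ (1 / 2))⁻¹‖ ^ 2)) ∧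
    -- the asymptotic formula
    ((fun p : ℕ × F[X] =>
        FqT.primAvg p.2 (fun χ => ‖FqT.hadamardPart (u p.1) p.1 χ (1 / 2)‖ ^ 2))
      ~[FqT.regime F] fun p => FqT.mainTerm p.1 p.2) ∧
    ((fun p : ℕ × F[X] =>
        FqT.primAvg p.2 (fun χ => ‖FqT.L χ (1 / 2) * (FqT.eulerPart p.1 χ (1 / 2))⁻¹‖ ^ 2))
      ~[FqT.regime F] fun p => FqT.mainTerm p.1 p.2) ∧
    -- the splitting of the second moment
    ((fun p : ℕ × F[X] => FqT.primAvg p.2 (fun χ => ‖FqT.L χ (1 / 2)‖ ^ 2))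
      ~[FqT.regime F] fun p =>
        FqT.primAvg p.2 (fun χ => ‖FqT.eulerPart p.1 χ (1 / 2)‖ ^ 2) *
        FqT.primAvg p.2 (fun χ => ‖FqT.hadamardPart (u p.1) p.1 χ (1 / 2)‖ ^ 2)) := by
  have heq : ∀ (X : ℕ) (R : F[X]), 1 ≤ X → R.Monic → R ≠ 1 →
      FqT.primAvg R (fun χ => ‖FqT.hadamardPart (u X) X χ (1 / 2)‖ ^ 2) =
        FqT.primAvg R (fun χ => ‖FqT.L χ (1 / 2) * (FqT.eulerPart X χ (1 / 2))⁻¹‖ ^ 2) :=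
    fun X R hX hR hR1 => FqT.primAvg_congr hR fun χ hχ => by
      rw [FqT.hadamardPart_eq hX (hu X hX) hR hR1 hχ]
  have hX : Tendsto (fun p : ℕ × F[X] => p.1) (FqT.regime F) atTop :=
    tendsto_comap.mono_left (inf_le_left.trans inf_le_left)
  have hev : (fun p : ℕ × F[X] =>
      FqT.primAvg p.2 (fun χ => ‖FqT.hadamardPart (u p.1) p.1 χ (1 / 2)‖ ^ 2)) =ᶠ[FqT.regime F]
      fun p => FqT.primAvg p.2
        (fun χ => ‖FqT.L χ (1 / 2) * (FqT.eulerPart p.1 χ (1 / 2))⁻¹‖ ^ 2) := by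
    filter_upwards [(FqT.isAdmissible_regime F).eventually', hX.eventually_ge_atTop 1] with p hp h1
    exact heq p.1 p.2 h1 hp.1 hp.2.2.2.2
  refine ⟨fun X R hX hR hR1 χ hχ s => ⟨fun hs =>
      (FqT.hasSum_zeroTerm hX (hu X hX) hR hR1 hχ hs).summable,
    FqT.neBot_nhdsWithin_regularPoints hR hR1 hχ s, ?_⟩, heq,
    (FqT.isEquivalent_mean_square F).congr_left hev.symm, FqT.isEquivalent_mean_square F,
    (FqT.isEquivalent_splitting F).congr_right ?_⟩
  · rw [FqT.hadamardPart_eq hX (hu X hX) hR hR1 hχ]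
    exact FqT.tendsto_hadamardExp hX (hu X hX) hR hR1 hχ s
  · filter_upwards [hev] with p hp
    rw [hp]
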